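/- **Setting.** Let $\mathcal G=(V_{\mathcal G},E_{\mathcal G})$ be a connected, locally finite planar graph embedded in $\mathbb R^2$ (finite degrees, finitely many vertices in every bounded set) whose edges are straight segments, distinct edges meeting at common end-points only. Assume that $\mathcal G$ is invariant under the translations by $(1,0)$ and $(0,1)$, the rotation by $\pi/2$ around $0$, and the reflection in the line $\{(0,y):y\in\mathbb R\}$. Fix $q\ge 1$. For a finite set of edges $E_G\subset E_{\mathcal G}$ let $G$ be the graph with edge set $E_G$ and vertex set $V_G$ the end-points of $E_G$, and let $\partial G$ be the set of vertices of $G$ incident to an edge of $E_{\mathcal G}\setminus E_G$. For $p\in[0,1]$ and a partition $\xi$ of $\partial G$, let $\phi^{\xi}_{p,q,G}$ be the probability measure on $\{0,1\}^{E_G}$ with $$\phi^{\xi}_{p,q,G}(\omega)=\frac{p^{o(\omega)}(1-p)^{c(\omega)}q^{k(\omega^\xi)}}{Z^\xi(p,q,G)},$$ where $o(\omega)$, $c(\omega)$ are the numbers of open ($\omega(e)=1$) and closed ($\omega(e)=0$) edges, $k(\omega^\xi)$ is the number of connected components of the graph $(V_G,\{e:\omega(e)=1\})$ after identification of the vertices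 in the same class of $\xi$, and $Z^\xi(p,q,G)$ is the normalizing constant. An *infinite-volume random-cluster measure* with parameters $p,q$ is a probability measure $\phi$ on $\{0,1\}^{E_{\mathcal G}}$ such that for every finite $G$ as above and every partition $\xi$ of $\partial G$ with $\phi(\chi_G(\omega)=\xi)>0$, $$\phi\big(\omega_{|G}=\cdot\,\big|\,\chi_G(\omega)=\xi\big)=\phi^\xi_{p,q,G}(\cdot),$$ where $\chi_G(\omega)$ is the partition of $\partial G$ in which two vertices are in the same class if and only if they are connected by a path of open edges of $E_{\mathcal G}\setminus E_G$. For $n\in\mathbb N$, let $\mathcal C_h(2n,n)$ (respectively $\mathcal C_v(2n,n)$) be the event that in the subgraph of $\mathcal G$ induced by the vertices in $[0,2n]\times[0,n]$ there is an open path from a vertex of $\{0\}\times[0,n]$ to a vertex of $\{2n\}\times[0,n]$ (respectively from a vertex of $[0,2n]\times\{0\}$ to a vertex of $[0,2n]\times\{n\}$). **Proposition.** Let $p\in(0,1)$ be such that there exists an infinite-volume random-cluster measure $\phi_p$ with parameters $p,q$ and $$\liminf_{n\to\infty}\phi_p\big(\mathcal C_v(2n,n)\big)>0 .$$ Then for every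 $p_0\in(p,1]$ and every infinite-volume random-cluster measure $\phi_{p_0}$ with parameters $p_0,q$, $$\liminf_{n\to\infty}\phi_{p_0}\big(\mathcal C_h(2n,n)\big)>0 .$$ -/

import Mathlib

open MeasureTheory

noncomputable section

namespace RandomCluster

/-! ### The lattice -/

/-- The plane map `f` induces an automorphism of the embedded graph `G`. -/
def InducesAut {V : Set (ℝ × ℝ)} (G : SimpleGraph V) (f : ℝ × ℝ → ℝ × ℝ) : Prop :=
  ∃ σ : G ≃g G, ∀ v : V, ((σ v : V) : ℝ × ℝ) = f v

/-- `G`, a graph whose vertices are points of the plane and whose edges are drawn as straight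
segments, is a connected locally finite planar graph which is invariant under the translations
by `(1,0)` and `(0,1)`, the rotation by `π/2` around the origin, and the reflection in the
vertical axis. -/
structure IsLattice {V : Set (ℝ × ℝ)} (G : SimpleGraph V) : Prop where
  connected : G.Connected
  finite_neighbors : ∀ v : V, (G.neighborSet v).Finite
  finite_of_bounded : ∀ B : Set (ℝ × ℝ), Bornology.IsBounded B → (V ∩ B).Finite
  /-- Distinct edges meet at common end-points only. -/
  planar : ∀ x y x' y' : V, G.Adj x y → G.Adj x' y' → s(x, y) ≠ s(x', y') →
    segment ℝ (x : ℝ × ℝ) y ∩ segment ℝ (x' : ℝ × ℝ) y' ⊆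
      ({(x : ℝ × ℝ), (y : ℝ × ℝ)} ∩ {(x' : ℝ × ℝ), (y' : ℝ × ℝ)} : Set (ℝ × ℝ))
  translation_fst : InducesAut G (fun z => (z.1 + 1, z.2))
  translation_snd : InducesAut G (fun z => (z.1, z.2 + 1))
  rotation : InducesAut G (fun z => (-z.2, z.1))
  reflection : InducesAut G (fun z => (-z.1, z.2))

/-! ### Configurations -/

/-- Configurations `{0,1}^E`, with `true` meaning open; the σ-algebra is the product one. -/
abbrev Config {V : Set (ℝ × ℝ)} (G : SimpleGraph V) : Type := G.edgeSet → Bool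

/-- The graph on the vertex set of `G` formed by the open edges of `ω` lying in `F`. -/
def openGraph {V : Set (ℝ × ℝ)} {G : SimpleGraph V} (ω : Config G) (F : Set G.edgeSet) :
    SimpleGraph V :=
  SimpleGraph.fromRel fun x y => ∃ e : G.edgeSet, e ∈ F ∧ ω e = true ∧ (e : Sym2 V) = s(x, y)

/-! ### Finite-volume measures

A finite subgraph is given by its finite edge set `E`; its vertices are the end-points of `E`. -/

section FiniteVolume

variable {V : Set (ℝ × ℝ)} {G : SimpleGraph V}

/-- The vertex set of the finite subgraph with edge set `E`. -/
def verts (E : Finset G.edgeSet) : Set V := {x | ∃ e ∈ E, x ∈ (e : Sym2 V)}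

/-- The boundary of the finite subgraph with edge set `E`: its vertices that are
incident to an edge of the lattice outside `E`. -/
def bdry (E : Finset G.edgeSet) : Set V :=
  {x | x ∈ verts E ∧ ∃ e : G.edgeSet, e ∉ E ∧ x ∈ (e : Sym2 V)}

/-- The graph on `verts E` with the open edges of `η`, in which moreover the boundary vertices in
the same class of `ξ` are joined. Its connected components are the clusters of `η^ξ`. -/
def wiredGraph (E : Finset G.edgeSet) (ξ : Setoid (bdry E)) (η : E → Bool) :
    SimpleGraph (verts E) :=
  SimpleGraph.fromRel fun x y =>
    (∃ e : E, η e = true ∧ (e.1 : Sym2 V) = s(x.1, y.1)) ∨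
      ∃ (hx : x.1 ∈ bdry E) (hy : y.1 ∈ bdry E), ξ ⟨x.1, hx⟩ ⟨y.1, hy⟩

/-- The number of clusters `k(η^ξ)`. -/
def numClusters (E : Finset G.edgeSet) (ξ : Setoid (bdry E)) (η : E → Bool) : ℕ :=
  Nat.card (wiredGraph E ξ η).ConnectedComponent

/-- The weight `p^{o(η)} (1-p)^{c(η)} q^{k(η^ξ)}`. -/
def weight (p q : ℝ) (E : Finset G.edgeSet) (ξ : Setoid (bdry E)) (η : E → Bool) : ℝ :=
  p ^ (Finset.univ.filter fun e : E => η e = true).card *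
    (1 - p) ^ (Finset.univ.filter fun e : E => η e = false).card *
    q ^ numClusters E ξ η

open Classical in
/-- The probability of the configuration `η` under the random-cluster measure on the finite
subgraph with edge set `E`, edge-weight `p`, cluster-weight `q`, boundary condition `ξ`. -/
def finiteVolumeProb (p q : ℝ) (E : Finset G.edgeSet) (ξ : Setoid (bdry E)) (η : E → Bool) : ℝ :=
  weight p q E ξ η / ∑ η' : E → Bool, weight p q E ξ η'

/-! ### Infinite-volume measures -/

/-- The boundary condition on `E` induced by `ω`: two boundary vertices are wired if and only if
they are connected by open edges of `ω` outside `E`. -/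
def inducedBC (E : Finset G.edgeSet) (ω : Config G) : Setoid (bdry E) :=
  (openGraph ω {e | e ∉ E}).reachableSetoid.comap Subtype.val

/-- `φ` is an infinite-volume random-cluster measure with edge-weight `p` and cluster-weight `q`:
for every finite subgraph and every boundary condition `ξ` that is induced with positive
probability, the conditional law of the restriction of `ω` to the subgraph, given that the
induced boundary condition is `ξ`, is the finite-volume measure. -/
structure IsInfiniteVolume (p q : ℝ) (φ : Measure (Config G)) : Prop where
  isProbabilityMeasure : IsProbabilityMeasure φ
  cond_eq : ∀ (E : Finset G.edgeSet) (ξ : Setoid (bdry E)),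
    φ {ω | inducedBC E ω = ξ} ≠ 0 → ∀ η : E → Bool,
      ProbabilityTheory.cond φ {ω | inducedBC E ω = ξ} {ω | ∀ e : E, ω e.1 = η e} =
        ENNReal.ofReal (finiteVolumeProb p q E ξ η)

/-! ### Crossings -/

/-- The edges of the subgraph of `G` induced by the vertices in `R`. -/
def edgesIn (G : SimpleGraph V) (R : Set (ℝ × ℝ)) : Set G.edgeSet :=
  {e | ∀ x : V, x ∈ (e : Sym2 V) → (x : ℝ × ℝ) ∈ R}

/-- `[a,b] × [c,d]` is crossed horizontally: an open path of the subgraph induced by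
the vertices in the rectangle joins a vertex of `{a} × [c,d]` to a vertex of `{b} × [c,d]`. -/
def crossH (G : SimpleGraph V) (a b c d : ℝ) : Set (Config G) :=
  {ω | ∃ x y : V, (x : ℝ × ℝ) ∈ ({a} : Set ℝ) ×ˢ Set.Icc c d ∧
    (y : ℝ × ℝ) ∈ ({b} : Set ℝ) ×ˢ Set.Icc c d ∧
    (openGraph ω (edgesIn G (Set.Icc a b ×ˢ Set.Icc c d))).Reachable x y}

/-- `[a,b] × [c,d]` is crossed vertically: an open path of the subgraph induced by
the vertices in the rectangle joins a vertex of `[a,b] × {c}` to a vertex of `[a,b] × {d}`. -/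
def crossV (G : SimpleGraph V) (a b c d : ℝ) : Set (Config G) :=
  {ω | ∃ x y : V, (x : ℝ × ℝ) ∈ Set.Icc a b ×ˢ ({c} : Set ℝ) ∧
    (y : ℝ × ℝ) ∈ Set.Icc a b ×ˢ ({d} : Set ℝ) ∧
    (openGraph ω (edgesIn G (Set.Icc a b ×ˢ Set.Icc c d))).Reachable x y}

end FiniteVolume

end RandomCluster

end

/-! Put x = p / (1 - p). Wired finite-volume probabilities of an increasing event decrease with the
volume, and `mu q x` is their limit. It is positively associated, invariant under the lattice
symmetries, and increasing in x. Only increasing events are ever evaluated, so no limit measure is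
constructed. Every infinite-volume measure at p lies below `mu q x` on increasing local events. The
proof works with parameters x < x₁ < x₂ < y, where y ≤ p₀ / (1 - p₀) if p₀ < 1, and each gap pays
for one step.

From x to x₁: sharpness. A vertical crossing produces an arm of length n from one of O(n) vertices,
so the one-arm probability θ_n is at least c' / n at x. The OSSS inequality, valid for all weights
with the FKG lattice condition (`DTree.wcov_eval_le`), is applied to the exploration of the clusters
of a shell and averaged over the shells (`arm_variance_le`). It bounds the logarithmic derivative of
a finite-volume arm probability below by a constant times n / (θ_0 + ... + θ_n). If θ_n(x₁) tended
to 0, repeated integration would make n θ_n(x) arbitrarily small along some scales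
(`exists_pos_le_of_exp_step`). Hence θ_n(x₁) is bounded below.

From x₁ to x₂: links. A symmetric finite piece of the lattice, the core, reaches the right side of
the box of size t with probability bounded below. Let H be the typical height of the landing point.
If H is bounded, the next translate of the core absorbs the landing point. If H is comparable to its
value at a smaller scale, two feet of a translated core enclose the landing point, and planarity
forces a connection. If neither holds over a range of scales, H grows so fast that at the start of
the range it is tiny compared with the scale; then the path and its mirror image both cross many
annuli around the middle point, and open circuits in one of them join the two. The probability that
one of many disjoint annuli occurs is raised to 1/2 by a small increase of the parameter
(`mu_biUnion_ge_of_disjoint`), which keeps the constants from deteriorating. The outcome,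
`IsCore.exists_good`, links the core to a translate at a scale comparable to any given one.

Links chain to crossings of long rectangles, in the sense of plane sets. Since the required
crossings must end at vertices on the sides, they are glued to rotated copies of the assumed
vertical crossings, which do end at vertices.

From x₂ to y: free against wired. In a box the two weights differ by a factor exponential in the
boundary, while the number of disjoint translates of a local event is of the order of the volume. So
for some translate the free probability at y nearly exceeds the wired one at x₂
(`IsLattice.exists_freeExp_ge`), and every infinite-volume measure at p₀ dominates the free measure.

Cluster counts are treated as dimensions of spaces of functions constant on clusters, so their
supermodularity is the dimension formula; planar topology enters through the Poincaré-Miranda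
theorem. -/

open MeasureTheory

noncomputable section

namespace RandomCluster

section

open Filter Topology
open scoped FinsetFamily

set_option linter.unusedSectionVars false

/-! ### Holley, FKG and exponential tilting for weights on finite sets -/

section Weighted

variable {α : Type*} [DecidableEq α]

/-- The unnormalised expectation of `f` for the weight `w` on the subsets of `E`. -/
def wsum (E : Finset α) (w f : Finset α → ℝ) : ℝ := ∑ S ∈ E.powerset, w S * f S

/-- The expectation of `f` for the probability on subsets of `E` proportional to `w`. -/
def wexp (E : Finset α) (w f : Finset α → ℝ) : ℝ := wsum E w f / wsum E w 1

/-- Cross-multiplied Holley inequality. -/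
theorem wsum_holley (E : Finset α) {w₁ w₂ f : Finset α → ℝ} (h₁ : 0 ≤ w₁) (h₂ : 0 ≤ w₂)
    (h : ∀ a ⊆ E, ∀ b ⊆ E, w₁ a * w₂ b ≤ w₁ (a ∩ b) * w₂ (a ∪ b)) (hf : Monotone f) :
    wsum E w₁ f * wsum E w₂ 1 ≤ wsum E w₁ 1 * wsum E w₂ f := by
  have hf0 : ∀ S, 0 ≤ f S - f ∅ := fun S => sub_nonneg.2 (hf (Finset.empty_subset S))
  -- The four functions theorem needs nonnegative functions, hence the subtraction of `f ∅`; the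
  -- constant cancels from both sides once everything is expanded.
  have key := Finset.four_functions_theorem (f₁ := fun S => w₁ S * (f S - f ∅)) (f₂ := w₂)
    (f₃ := w₁) (f₄ := fun S => w₂ S * (f S - f ∅)) E (fun S => mul_nonneg (h₁ S) (hf0 S)) h₂ h₁
    (fun S => mul_nonneg (h₂ S) (hf0 S)) (by
      intro a ha b hb
      have e1 := h a ha b hb
      have e2 : f a - f ∅ ≤ f (a ∪ b) - f ∅ := sub_le_sub_right (hf Finset.subset_union_left) _
      calc w₁ a * (f a - f ∅) * w₂ b = (w₁ a * w₂ b) * (f a - f ∅) := by ring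
        _ ≤ (w₁ (a ∩ b) * w₂ (a ∪ b)) * (f (a ∪ b) - f ∅) :=
          mul_le_mul e1 e2 (hf0 a) (mul_nonneg (h₁ _) (h₂ _))
        _ = _ := by ring) (subset_refl E.powerset) (subset_refl E.powerset)
  have hinf : Finset.powerset E ⊼ Finset.powerset E = Finset.powerset E := by
    apply Finset.Subset.antisymm
    · intro S hS
      obtain ⟨a, ha, b, hb, rfl⟩ := Finset.mem_infs.1 hS
      exact Finset.mem_powerset.2 (Finset.inter_subset_left.trans (Finset.mem_powerset.1 ha))
    · intro S hS
      exact Finset.mem_infs.2 ⟨S, hS, S, hS, inf_idem _⟩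
  have hsup : Finset.powerset E ⊻ Finset.powerset E = Finset.powerset E := by
    apply Finset.Subset.antisymm
    · intro S hS
      obtain ⟨a, ha, b, hb, rfl⟩ := Finset.mem_sups.1 hS
      exact Finset.mem_powerset.2
        (Finset.union_subset (Finset.mem_powerset.1 ha) (Finset.mem_powerset.1 hb))
    · intro S hS
      exact Finset.mem_sups.2 ⟨S, hS, S, hS, sup_idem _⟩
  rw [hinf, hsup] at key
  simp only [mul_sub, Finset.sum_sub_distrib] at key
  simp only [← Finset.sum_mul] at key
  simp only [wsum, Pi.one_apply, mul_one]
  nlinarith [key]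

theorem wsum_congr {E : Finset α} {w w' f f' : Finset α → ℝ}
    (h : ∀ S ⊆ E, w S * f S = w' S * f' S) : wsum E w f = wsum E w' f' :=
  Finset.sum_congr rfl fun S hS => h S (Finset.mem_powerset.1 hS)

theorem wsum_add (E : Finset α) (w f g : Finset α → ℝ) :
    wsum E w (fun S => f S + g S) = wsum E w f + wsum E w g := by
  simp [wsum, mul_add, Finset.sum_add_distrib]

theorem wsum_const_mul (E : Finset α) (w f : Finset α → ℝ) (c : ℝ) :
    wsum E w (fun S => c * f S) = c * wsum E w f := by
  simp only [wsum, Finset.mul_sum]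
  exact Finset.sum_congr rfl fun S _ => by ring

theorem wsum_mono {E : Finset α} {w f g : Finset α → ℝ} (hw : 0 ≤ w) (h : ∀ S ⊆ E, f S ≤ g S) :
    wsum E w f ≤ wsum E w g :=
  Finset.sum_le_sum fun S hS => mul_le_mul_of_nonneg_left (h S (Finset.mem_powerset.1 hS)) (hw S)

theorem wsum_one_pos (E : Finset α) {w : Finset α → ℝ} (hw : ∀ S, 0 < w S) : 0 < wsum E w 1 := by
  simp only [wsum, Pi.one_apply, mul_one]
  exact Finset.sum_pos (fun S _ => hw S) ⟨∅, Finset.empty_mem_powerset E⟩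

theorem wexp_congr {E : Finset α} {w f g : Finset α → ℝ} (h : ∀ S ⊆ E, f S = g S) :
    wexp E w f = wexp E w g := by
  rw [wexp, wexp, wsum_congr fun S hS => by rw [h S hS]]

theorem wexp_add (E : Finset α) (w f g : Finset α → ℝ) :
    wexp E w (fun S => f S + g S) = wexp E w f + wexp E w g := by
  rw [wexp, wsum_add, add_div]; rfl

theorem wexp_const_mul (E : Finset α) (w f : Finset α → ℝ) (c : ℝ) :
    wexp E w (fun S => c * f S) = c * wexp E w f := by
  rw [wexp, wsum_const_mul, mul_div_assoc]; rfl

theorem wexp_sub (E : Finset α) (w f g : Finset α → ℝ) :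
    wexp E w (fun S => f S - g S) = wexp E w f - wexp E w g := by
  have h1 := wexp_add E w (fun S => f S - g S) g
  simp only [sub_add_cancel] at h1
  change wexp E w f = _ at h1
  linarith

theorem wexp_sum {ι : Type*} (E : Finset α) (w : Finset α → ℝ) (s : Finset ι)
    (f : ι → Finset α → ℝ) :
    wexp E w (fun S => ∑ i ∈ s, f i S) = ∑ i ∈ s, wexp E w (f i) := by
  simp only [wexp, wsum, Finset.mul_sum, ← Finset.sum_div]
  rw [Finset.sum_comm]

theorem wexp_const (E : Finset α) {w : Finset α → ℝ} (hw : ∀ S, 0 < w S) (c : ℝ) :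
    wexp E w (fun _ => c) = c := by
  have h := wexp_const_mul E w 1 c
  simp only [Pi.one_apply, mul_one] at h
  rw [h, wexp, div_self (wsum_one_pos E hw).ne', mul_one]

theorem wexp_mono {E : Finset α} {w f g : Finset α → ℝ} (hw : ∀ S, 0 < w S)
    (h : ∀ S ⊆ E, f S ≤ g S) : wexp E w f ≤ wexp E w g :=
  div_le_div_of_nonneg_right (wsum_mono (fun S => (hw S).le) h) (wsum_one_pos E hw).le

theorem wexp_nonneg {E : Finset α} {w f : Finset α → ℝ} (hw : ∀ S, 0 < w S)
    (h : ∀ S ⊆ E, 0 ≤ f S) : 0 ≤ wexp E w f := by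
  simpa [wexp_const E hw] using wexp_mono (E := E) (f := fun _ => 0) hw h

theorem wexp_le_one {E : Finset α} {w f : Finset α → ℝ} (hw : ∀ S, 0 < w S)
    (h : ∀ S ⊆ E, f S ≤ 1) : wexp E w f ≤ 1 := by
  simpa [wexp_const E hw] using wexp_mono (E := E) (g := fun _ => 1) hw h

theorem wexp_pos {E : Finset α} {w f : Finset α → ℝ} (hw : ∀ S, 0 < w S)
    (h : ∀ S ⊆ E, 0 < f S) : 0 < wexp E w f :=
  div_pos (Finset.sum_pos (fun S hS => mul_pos (hw S) (h S (Finset.mem_powerset.1 hS)))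
    ⟨∅, Finset.empty_mem_powerset E⟩) (wsum_one_pos E hw)

/-- A positive weight satisfying the FKG lattice condition on the subsets of `E`. -/
structure IsFKG (E : Finset α) (w : Finset α → ℝ) : Prop where
  pos : ∀ S, 0 < w S
  lattice : ∀ a ⊆ E, ∀ b ⊆ E, w a * w b ≤ w (a ∩ b) * w (a ∪ b)

theorem wexp_holley {E : Finset α} {w₁ w₂ f : Finset α → ℝ} (h₁ : ∀ S, 0 < w₁ S)
    (h₂ : ∀ S, 0 < w₂ S)
    (h : ∀ a ⊆ E, ∀ b ⊆ E, w₁ a * w₂ b ≤ w₁ (a ∩ b) * w₂ (a ∪ b)) (hf : Monotone f) :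
    wexp E w₁ f ≤ wexp E w₂ f := by
  rw [wexp, wexp, div_le_div_iff₀ (wsum_one_pos E h₁) (wsum_one_pos E h₂)]
  have := wsum_holley E (fun S => (h₁ S).le) (fun S => (h₂ S).le) h hf
  linarith

/-- Positive association is Holley's inequality between `w` and `w` reweighted by the nonnegative
increasing function `g - g ∅`. -/
theorem IsFKG.wsum_mul_le {E : Finset α} {w f g : Finset α → ℝ} (hw : IsFKG E w) (hf : Monotone f)
    (hg : Monotone g) : wsum E w f * wsum E w g ≤ wsum E w 1 * wsum E w (fun S => f S * g S) := by
  have hg0 : ∀ S, 0 ≤ g S - g ∅ := fun S => sub_nonneg.2 (hg (Finset.empty_subset S))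
  have key := wsum_holley E (w₁ := w) (w₂ := fun S => w S * (g S - g ∅)) (fun S => (hw.pos S).le)
    (fun S => mul_nonneg (hw.pos S).le (hg0 S)) (by
      intro a ha b hb
      calc w a * (w b * (g b - g ∅)) = (w a * w b) * (g b - g ∅) := by ring
        _ ≤ (w (a ∩ b) * w (a ∪ b)) * (g (a ∪ b) - g ∅) :=
          mul_le_mul (hw.lattice a ha b hb) (sub_le_sub_right (hg Finset.subset_union_right) _)
            (hg0 b) (mul_nonneg (hw.pos _).le (hw.pos _).le)
        _ = _ := by ring) hf
  have e1 : wsum E (fun S => w S * (g S - g ∅)) 1 = wsum E w g - g ∅ * wsum E w 1 := by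
    simp only [wsum, Finset.mul_sum, ← Finset.sum_sub_distrib]
    exact Finset.sum_congr rfl fun S _ => by simp; ring
  have e2 : wsum E (fun S => w S * (g S - g ∅)) f =
      wsum E w (fun S => f S * g S) - g ∅ * wsum E w f := by
    simp only [wsum, Finset.mul_sum, ← Finset.sum_sub_distrib]
    exact Finset.sum_congr rfl fun S _ => by ring
  rw [e1, e2] at key
  linarith

theorem IsFKG.wexp_mul_le {E : Finset α} {w f g : Finset α → ℝ} (hw : IsFKG E w) (hf : Monotone f)
    (hg : Monotone g) : wexp E w f * wexp E w g ≤ wexp E w (fun S => f S * g S) := by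
  have hz := wsum_one_pos E hw.pos
  rw [wexp, wexp, wexp, div_mul_div_comm, div_le_div_iff₀ (mul_pos hz hz) hz]
  nlinarith [hw.wsum_mul_le hf hg]

/-- Tilting the weight by `l ^ |S|` and conditioning: if `N` and `|S| - N` are increasing, then the
tilted probability of `N = 0` is at most the inverse of the exponential moment of `N`. -/
theorem wexp_tilt_zero_le {E : Finset α} {w : Finset α → ℝ} (hw : IsFKG E w) {l : ℝ} (hl : 1 ≤ l)
    {N : Finset α → ℕ} (hN : Monotone N) (hle : ∀ S, N S ≤ S.card)
    (hNc : Monotone fun S => S.card - N S) :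
    wexp E (fun S => l ^ S.card * w S) (fun S => if N S = 0 then 1 else 0) ≤
      1 / (1 + (l - 1) * wexp E w (fun S => (N S : ℝ))) := by
  have hl0 : 0 < l := by linarith
  have hpow : Monotone fun n : ℕ => l ^ n := pow_right_mono₀ hl
  have hw' : ∀ S : Finset α, 0 < l ^ S.card * w S := fun S => mul_pos (pow_pos hl0 _) (hw.pos S)
  have hz := wsum_one_pos E hw.pos
  have hz' := wsum_one_pos E hw'
  -- Positive association under the untilted weight, for the two factors of the tilt `l ^ |S|`.
  have h1 := hw.wsum_mul_le (f := fun S => l ^ (S.card - N S)) (g := fun S => l ^ N S)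
    (hpow.comp hNc) (hpow.comp hN)
  have e1 : wsum E w (fun S => l ^ (S.card - N S) * l ^ N S) =
      wsum E (fun S => l ^ S.card * w S) 1 := by
    refine wsum_congr fun S _ => ?_
    simp only [Pi.one_apply, mul_one]
    rw [← pow_add, Nat.sub_add_cancel (hle S), mul_comm]
  have e2 : wsum E (fun S => l ^ S.card * w S) (fun S => if N S = 0 then 1 else 0) ≤
      wsum E w (fun S => l ^ (S.card - N S)) := by
    refine Finset.sum_le_sum fun S _ => ?_
    have h3 : 0 < w S * l ^ (S.card - N S) := mul_pos (hw.pos S) (pow_pos hl0 _)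
    beta_reduce
    split_ifs with h
    · simp [h, mul_comm]
    · simpa using h3.le
  -- Bernoulli's inequality turns the exponential moment of `N` into its mean.
  have e3 : wsum E w 1 + (l - 1) * wsum E w (fun S => (N S : ℝ)) ≤ wsum E w (fun S => l ^ N S) := by
    rw [← wsum_const_mul, ← wsum_add]
    refine wsum_mono (fun S => (hw.pos S).le) fun S _ => ?_
    have := one_add_mul_le_pow (a := l - 1) (by linarith) (N S)
    simp only [Pi.one_apply]
    rw [add_sub_cancel] at this
    linarith
  have hN0 : 0 ≤ wsum E w (fun S => (N S : ℝ)) :=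
    Finset.sum_nonneg fun S _ => mul_nonneg (hw.pos S).le (Nat.cast_nonneg _)
  rw [e1] at h1
  have hA : 0 ≤ wsum E w (fun S => l ^ (S.card - N S)) :=
    Finset.sum_nonneg fun S _ => mul_nonneg (hw.pos S).le (pow_nonneg hl0.le _)
  rw [wexp, wexp, div_le_div_iff₀ hz' ?_]
  swap
  · have := mul_nonneg (sub_nonneg.2 hl) (div_nonneg hN0 hz.le)
    linarith
  have h4 : 1 + (l - 1) * (wsum E w (fun S => (N S : ℝ)) / wsum E w 1) =
      (wsum E w 1 + (l - 1) * wsum E w (fun S => (N S : ℝ))) / wsum E w 1 := by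
    field_simp
  rw [h4, ← mul_div_assoc, div_le_iff₀ hz]
  have h5 : 0 ≤ wsum E w 1 + (l - 1) * wsum E w (fun S => (N S : ℝ)) :=
    add_nonneg hz.le (mul_nonneg (sub_nonneg.2 hl) hN0)
  calc _ ≤ wsum E w (fun S => l ^ (S.card - N S)) *
        (wsum E w 1 + (l - 1) * wsum E w (fun S => (N S : ℝ))) := mul_le_mul_of_nonneg_right e2 h5
    _ ≤ wsum E w (fun S => l ^ (S.card - N S)) * wsum E w (fun S => l ^ N S) :=
      mul_le_mul_of_nonneg_left e3 hA
    _ ≤ _ := h1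
    _ = _ := by ring

end Weighted

end

section

open Filter Topology

/-! ### Cluster counts as dimensions, and comparison of boundary conditions -/

section Ranks

variable {V : Set (ℝ × ℝ)} {G : SimpleGraph V}

/-- Real functions on the vertices, vanishing off `Z` and constant along the relation `R`. -/
def flat (Z : Set V) (R : V → V → Prop) : Submodule ℝ (V → ℝ) where
  carrier := {f | (∀ v, v ∉ Z → f v = 0) ∧ ∀ x y, R x y → f x = f y}
  add_mem' := fun {f g} hf hg => ⟨fun v hv => by simp [hf.1 v hv, hg.1 v hv],
    fun x y h => by simp [hf.2 x y h, hg.2 x y h]⟩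
  zero_mem' := ⟨fun _ _ => rfl, fun _ _ _ => rfl⟩
  smul_mem' := fun c f hf => ⟨fun v hv => by simp [hf.1 v hv], fun x y h => by simp [hf.2 x y h]⟩

theorem finiteDimensional_flat {Z : Set V} (hZ : Z.Finite) (R : V → V → Prop) :
    FiniteDimensional ℝ (flat Z R) := by
  have := hZ.to_subtype
  let L : flat Z R →ₗ[ℝ] (Z → ℝ) :=
    { toFun := fun f z => f.1 z, map_add' := fun _ _ => rfl, map_smul' := fun _ _ => rfl }
  refine FiniteDimensional.of_injective L fun f g h => ?_
  ext v
  by_cases hv : v ∈ Z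
  · exact congrFun h ⟨v, hv⟩
  · rw [f.2.1 v hv, g.2.1 v hv]

/-- The dimension formula for a sum and an intersection. Applied to spaces of functions constant on
clusters, it yields every Holley condition used for random-cluster weights. -/
theorem finrank_add_le_of_inf_le {W : Type*} [AddCommGroup W] [Module ℝ W]
    {A B C D : Submodule ℝ W} [FiniteDimensional ℝ C] [FiniteDimensional ℝ D] (hA : A ≤ C)
    (hB : B ≤ C) (hD : A ⊓ B ≤ D) :
    Module.finrank ℝ A + Module.finrank ℝ B ≤ Module.finrank ℝ C + Module.finrank ℝ D := by
  have := Submodule.finiteDimensional_of_le hA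
  have := Submodule.finiteDimensional_of_le hB
  rw [← Submodule.finrank_sup_add_finrank_inf_eq]
  exact add_le_add (Submodule.finrank_mono (sup_le hA hB)) (Submodule.finrank_mono hD)

/-- The two vertices are end-points of the same edge of `S`. -/
def edgeRel (S : Set G.edgeSet) (x y : V) : Prop :=
  ∃ e ∈ S, x ∈ (e : Sym2 V) ∧ y ∈ (e : Sym2 V)

theorem verts_finite (E : Finset G.edgeSet) : (verts E).Finite := by
  have : verts E = ⋃ e ∈ E, {x | x ∈ (e : Sym2 V)} := by
    ext x; simp [verts]
  rw [this]
  refine E.finite_toSet.biUnion fun e _ => ?_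
  induction (e : Sym2 V) with
  | _ a b => exact (Set.toFinite {a, b}).subset fun x hx => by simpa using hx

/-- The vertices of `E` that are not on the boundary. -/
def inner (E : Finset G.edgeSet) : Set V := verts E \ bdry E

theorem inner_finite (E : Finset G.edgeSet) : (inner E).Finite := (verts_finite E).sdiff

theorem verts_mono {E F : Finset G.edgeSet} (h : E ⊆ F) : verts E ⊆ verts F :=
  fun _ ⟨e, he, hx⟩ => ⟨e, h he, hx⟩

theorem inner_mono {E F : Finset G.edgeSet} (h : E ⊆ F) : inner E ⊆ inner F :=
  fun _ hx => ⟨verts_mono h hx.1, fun ⟨_, e, he, hxe⟩ => hx.2 ⟨hx.1, e, fun h' => he (h h'), hxe⟩⟩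

/-- Functions supported on `inner E` therefore vanish at both ends of every edge outside `E`, so the
states of such edges impose no condition on them. -/
theorem notMem_inner {E : Finset G.edgeSet} {e : G.edgeSet} (he : e ∉ E) {x : V}
    (hx : x ∈ (e : Sym2 V)) : x ∉ inner E :=
  fun h => h.2 ⟨h.1, e, he, hx⟩

/-- One less than the number of clusters of `S` in `E` with wired boundary. -/
def wiredRank (E : Finset G.edgeSet) (S : Finset G.edgeSet) : ℕ :=
  Module.finrank ℝ (flat (inner E) (edgeRel (S : Set G.edgeSet)))

/-- The number of clusters of `S` in `E` when vertices are moreover identified along `R`. -/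
def relRank (E : Finset G.edgeSet) (R : V → V → Prop) (S : Finset G.edgeSet) : ℕ :=
  Module.finrank ℝ (flat (verts E) fun x y => edgeRel (S : Set G.edgeSet) x y ∨ R x y)

/-- The random-cluster weight with wired boundary. -/
def wiredWeight (q x : ℝ) (E : Finset G.edgeSet) (S : Finset G.edgeSet) : ℝ :=
  x ^ S.card * q ^ wiredRank E S

/-- The random-cluster weight with boundary identifications `R`. -/
def relWeight (q x : ℝ) (E : Finset G.edgeSet) (R : V → V → Prop) (S : Finset G.edgeSet) : ℝ :=
  x ^ S.card * q ^ relRank E R S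

theorem wiredWeight_pos {q x : ℝ} (hq : 1 ≤ q) (hx : 0 < x) (E S : Finset G.edgeSet) :
    0 < wiredWeight q x E S := mul_pos (pow_pos hx _) (pow_pos (by linarith) _)

theorem relWeight_pos {q x : ℝ} (hq : 1 ≤ q) (hx : 0 < x) (E : Finset G.edgeSet)
    (R : V → V → Prop) (S : Finset G.edgeSet) :
    0 < relWeight q x E R S := mul_pos (pow_pos hx _) (pow_pos (by linarith) _)

open Classical

/-- The edges of `a \ b` move from the factor `x` to the larger factor `y`; all the others keep
theirs. -/
theorem pow_mul_pow_le_of_card {α : Type*} [DecidableEq α] {x y : ℝ} (hx : 0 ≤ x) (hxy : x ≤ y) (a b : Finset α) :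
    x ^ a.card * y ^ b.card ≤ x ^ (a ∩ b).card * y ^ (a ∪ b).card := by
  have h1 := Finset.card_sdiff_add_card_inter a b
  have h2 : (a ∪ b).card = (a \ b).card + b.card := by
    have := Finset.card_union_add_card_inter a b
    omega
  rw [← h1, h2, pow_add, pow_add]
  have h3 : x ^ (a \ b).card ≤ y ^ (a \ b).card := pow_le_pow_left₀ hx hxy _
  have h4 : 0 ≤ x ^ (a ∩ b).card * y ^ b.card :=
    mul_nonneg (pow_nonneg hx _) (pow_nonneg (hx.trans hxy) _)
  nlinarith

theorem weight_mul_le {q : ℝ} (hq : 1 ≤ q) {A B C D : ℝ} {i j k l : ℕ} (hC : 0 ≤ C) (hD : 0 ≤ D)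
    (h : A * B ≤ C * D) (hk : i + j ≤ k + l) :
    (A * q ^ i) * (B * q ^ j) ≤ (C * q ^ k) * (D * q ^ l) := by
  have h1 : q ^ i * q ^ j ≤ q ^ k * q ^ l := by
    rw [← pow_add, ← pow_add]; exact pow_le_pow_right₀ hq hk
  have h2 : 0 ≤ q ^ i * q ^ j := by positivity
  calc _ = (A * B) * (q ^ i * q ^ j) := by ring
    _ ≤ (C * D) * (q ^ k * q ^ l) := mul_le_mul h h1 h2 (mul_nonneg hC hD)
    _ = _ := by ring

/-- Extension by zero embeds the wired space of `E` into that of `F`: edges outside `E` only see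
zero values. A function in both spaces is constant along the edges of `a` and along those of `b` in
`E`, and the dimension formula concludes. This one inequality gives the FKG condition and the
monotonicity in the volume. -/
theorem wiredRank_add_le {E F : Finset G.edgeSet} (hEF : E ⊆ F) (a b : Finset G.edgeSet) :
    wiredRank F a + wiredRank E (b ∩ E) ≤ wiredRank F (a ∩ b) + wiredRank E ((a ∪ b) ∩ E) := by
  have := finiteDimensional_flat (inner_finite F) (edgeRel ((a ∩ b : Finset _) : Set G.edgeSet))
  have := finiteDimensional_flat (inner_finite E)
    (edgeRel (((a ∪ b) ∩ E : Finset _) : Set G.edgeSet))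
  have zero : ∀ f : V → ℝ, (∀ v, v ∉ inner E → f v = 0) → ∀ e : G.edgeSet, e ∉ E →
      ∀ x ∈ (e : Sym2 V), f x = 0 := fun f hf e he x hx => hf x (notMem_inner he hx)
  refine finrank_add_le_of_inf_le ?_ ?_ ?_
  · rintro f ⟨h1, h2⟩
    refine ⟨h1, fun x y ⟨e, he, hx, hy⟩ => h2 x y ⟨e, ?_, hx, hy⟩⟩
    exact_mod_cast Finset.mem_of_mem_inter_left (by exact_mod_cast he)
  · rintro f ⟨h1, h2⟩
    refine ⟨fun v hv => h1 v fun h => hv (inner_mono hEF h), fun x y ⟨e, he, hx, hy⟩ => ?_⟩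
    by_cases heE : e ∈ E
    · refine h2 x y ⟨e, ?_, hx, hy⟩
      simp only [Finset.coe_inter, Set.mem_inter_iff, Finset.mem_coe] at he ⊢
      exact ⟨he.2, heE⟩
    · rw [zero f h1 e heE x hx, zero f h1 e heE y hy]
  · rintro f ⟨⟨_, h2⟩, h3, h4⟩
    refine ⟨h3, fun x y ⟨e, he, hx, hy⟩ => ?_⟩
    simp only [Finset.coe_inter, Set.mem_inter_iff, Finset.mem_coe, Finset.mem_union] at he
    rcases he.1 with h | h
    · exact h2 x y ⟨e, h, hx, hy⟩
    · exact h4 x y ⟨e, by simp [h, he.2], hx, hy⟩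

theorem isFKG_wiredWeight {q x : ℝ} (hq : 1 ≤ q) (hx : 0 < x) (E : Finset G.edgeSet) :
    IsFKG E (wiredWeight q x E) where
  pos := wiredWeight_pos hq hx E
  lattice := fun a ha b hb => by
    refine weight_mul_le hq (by positivity) (by positivity) (pow_mul_pow_le_of_card hx.le le_rfl a b)
      ?_
    have := wiredRank_add_le (subset_refl E) a b
    rwa [Finset.inter_eq_left.2 hb, Finset.inter_eq_left.2 (Finset.union_subset ha hb)] at this

theorem relRank_add_le {E : Finset G.edgeSet} {R R' : V → V → Prop} (hR : ∀ x y, R x y → R' x y)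
    (a b : Finset G.edgeSet) :
    relRank E R a + relRank E R' b ≤ relRank E R (a ∩ b) + relRank E R' (a ∪ b) := by
  have := finiteDimensional_flat (verts_finite E)
    fun x y => edgeRel ((a ∩ b : Finset _) : Set G.edgeSet) x y ∨ R x y
  have := finiteDimensional_flat (verts_finite E)
    fun x y => edgeRel ((a ∪ b : Finset _) : Set G.edgeSet) x y ∨ R' x y
  refine finrank_add_le_of_inf_le ?_ ?_ ?_
  · rintro f ⟨h1, h2⟩
    refine ⟨h1, fun x y h => h2 x y (h.imp_left ?_)⟩
    rintro ⟨e, he, hx, hy⟩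
    exact ⟨e, by simp only [Finset.coe_inter, Set.mem_inter_iff] at he; exact he.1, hx, hy⟩
  · rintro f ⟨h1, h2⟩
    refine ⟨h1, fun x y h => h2 x y (h.imp ?_ (hR x y))⟩
    rintro ⟨e, he, hx, hy⟩
    exact ⟨e, by simp only [Finset.coe_inter, Set.mem_inter_iff] at he; exact he.2, hx, hy⟩
  · rintro f ⟨⟨h1, h2⟩, _, h4⟩
    refine ⟨h1, fun x y h => ?_⟩
    rcases h with ⟨e, he, hx, hy⟩ | h
    · simp only [Finset.coe_union, Set.mem_union] at he
      rcases he with he | he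
      · exact h2 x y (Or.inl ⟨e, he, hx, hy⟩)
      · exact h4 x y (Or.inl ⟨e, he, hx, hy⟩)
    · exact h4 x y (Or.inr h)

/-- Functions vanishing on the boundary respect any identification of boundary vertices. This is why
the wired measure dominates all boundary conditions. -/
theorem relRank_add_wiredRank_le {E : Finset G.edgeSet} {R : V → V → Prop}
    (hR : ∀ x y, R x y → x ∈ bdry E ∧ y ∈ bdry E) (a b : Finset G.edgeSet) :
    relRank E R a + wiredRank E b ≤ relRank E R (a ∩ b) + wiredRank E (a ∪ b) := by
  have := finiteDimensional_flat (verts_finite E)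
    fun x y => edgeRel ((a ∩ b : Finset _) : Set G.edgeSet) x y ∨ R x y
  have := finiteDimensional_flat (inner_finite E)
    (edgeRel ((a ∪ b : Finset _) : Set G.edgeSet))
  refine finrank_add_le_of_inf_le ?_ ?_ ?_
  · rintro f ⟨h1, h2⟩
    refine ⟨h1, fun x y h => h2 x y (h.imp_left ?_)⟩
    rintro ⟨e, he, hx, hy⟩
    exact ⟨e, by simp only [Finset.coe_inter, Set.mem_inter_iff] at he; exact he.1, hx, hy⟩
  · rintro f ⟨h1, h2⟩
    refine ⟨fun v hv => h1 v fun h => hv h.1, fun x y h => ?_⟩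
    rcases h with ⟨e, he, hx, hy⟩ | h
    · exact h2 x y ⟨e, by simp only [Finset.coe_inter, Set.mem_inter_iff] at he; exact he.2, hx, hy⟩
    · rw [h1 x fun h' => h'.2 (hR x y h).1, h1 y fun h' => h'.2 (hR x y h).2]
  · rintro f ⟨⟨_, h2⟩, h3, h4⟩
    refine ⟨h3, ?_⟩
    rintro x y ⟨e, he, hx, hy⟩
    simp only [Finset.coe_union, Set.mem_union] at he
    rcases he with he | he
    · exact h2 x y (Or.inl ⟨e, he, hx, hy⟩)
    · exact h4 x y ⟨e, he, hx, hy⟩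

theorem wiredRank_le_relRank (E S : Finset G.edgeSet) :
    wiredRank E S ≤ relRank E (fun _ _ => False) S := by
  have h2 := finiteDimensional_flat (verts_finite E)
    fun x y => edgeRel (S : Set G.edgeSet) x y ∨ (fun _ _ => False) x y
  refine Submodule.finrank_mono ?_
  rintro f ⟨h1, h2⟩
  exact ⟨fun v hv => h1 v fun h => hv h.1, fun x y h => h2 x y (h.resolve_right id)⟩

/-- Imposing `card ι` linear equations lowers the dimension by at most `card ι`. -/
theorem finrank_le_ker_add {W : Type*} [AddCommGroup W] [Module ℝ W] {ι : Type*} [Fintype ι]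
    {A B : Submodule ℝ W} [FiniteDimensional ℝ A] [FiniteDimensional ℝ B] (L : W →ₗ[ℝ] (ι → ℝ))
    (h : ∀ f ∈ A, L f = 0 → f ∈ B) :
    Module.finrank ℝ A ≤ Module.finrank ℝ B + Fintype.card ι := by
  have h1 := (L.domRestrict A).finrank_range_add_finrank_ker
  have h2 : Module.finrank ℝ (LinearMap.range (L.domRestrict A)) ≤ Fintype.card ι := by
    simpa using (LinearMap.range (L.domRestrict A)).finrank_le
  have h3 : Module.finrank ℝ (LinearMap.ker (L.domRestrict A)) ≤ Module.finrank ℝ B := by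
    refine LinearMap.finrank_le_finrank_of_injective
      (f := (A.subtype.comp (LinearMap.ker (L.domRestrict A)).subtype).codRestrict B
        fun f => h _ f.1.2 f.2) ?_
    intro f g hfg
    have := congrArg Subtype.val hfg
    exact Subtype.ext (Subtype.ext this)
  omega

/-- The equations are the vanishing at each boundary vertex. Free and wired weights thus differ by a
factor at most `q ^ |∂E|`, a surface-order quantity. -/
theorem relRank_le_wiredRank_add (E S : Finset G.edgeSet) :
    relRank E (fun _ _ => False) S ≤ wiredRank E S + (bdry E).ncard := by
  have hb : (bdry E).Finite := (verts_finite E).subset fun x hx => hx.1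
  have := hb.fintype
  have := finiteDimensional_flat (verts_finite E)
    fun x y => edgeRel (S : Set G.edgeSet) x y ∨ (fun _ _ => False) x y
  have := finiteDimensional_flat (inner_finite E) (edgeRel (S : Set G.edgeSet))
  let L : (V → ℝ) →ₗ[ℝ] (bdry E → ℝ) :=
    { toFun := fun f z => f z, map_add' := fun _ _ => rfl, map_smul' := fun _ _ => rfl }
  have key := finrank_le_ker_add (A := flat (verts E)
    fun x y => edgeRel (S : Set G.edgeSet) x y ∨ (fun _ _ => False) x y)
    (B := flat (inner E) (edgeRel (S : Set G.edgeSet))) L ?_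
  · rwa [← Nat.card_eq_fintype_card, Nat.card_coe_set_eq] at key
  · rintro f ⟨h1, h2⟩ h3
    refine ⟨fun v hv => ?_, fun x y h => h2 x y (Or.inl h)⟩
    by_cases hvE : v ∈ verts E
    · have : v ∈ bdry E := by by_contra h; exact hv ⟨hvE, h⟩
      exact congrFun h3 ⟨v, this⟩
    · exact h1 v hvE

/-- Opening an edge imposes one more equation, the equality of the values at its two ends. -/
theorem wiredRank_le_insert (E S : Finset G.edgeSet) (e : G.edgeSet) :
    wiredRank E S ≤ wiredRank E (insert e S) + 1 := by
  have := finiteDimensional_flat (inner_finite E) (edgeRel (S : Set G.edgeSet))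
  have := finiteDimensional_flat (inner_finite E) (edgeRel ((insert e S : Finset _) : Set G.edgeSet))
  obtain ⟨a, b, hab⟩ : ∃ a b : V, (e : Sym2 V) = s(a, b) := by
    induction h : (e : Sym2 V) with
    | _ a b => exact ⟨a, b, rfl⟩
  let L : (V → ℝ) →ₗ[ℝ] (Unit → ℝ) :=
    { toFun := fun f _ => f a - f b, map_add' := fun f g => by ext; simp; ring,
      map_smul' := fun c f => by ext; simp; ring }
  have key := finrank_le_ker_add (A := flat (inner E) (edgeRel (S : Set G.edgeSet)))
    (B := flat (inner E) (edgeRel ((insert e S : Finset _) : Set G.edgeSet))) L ?_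
  · simp only [Fintype.card_unit] at key
    exact key
  · rintro f ⟨h1, h2⟩ h3
    refine ⟨h1, ?_⟩
    rintro x y ⟨e', he', hx, hy⟩
    simp only [Finset.coe_insert, Set.mem_insert_iff] at he'
    rcases he' with rfl | he'
    · have h4 : f a = f b := sub_eq_zero.1 (congrFun h3 ())
      rw [hab, Sym2.mem_iff] at hx hy
      rcases hx with rfl | rfl <;> rcases hy with rfl | rfl <;> simp [h4]
    · exact h2 x y ⟨e', he', hx, hy⟩

end Ranks

end

section

open Filter Topology

/-! ### Wired measures, their infinite-volume limit, and sprinkling -/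

section Wired

variable {V : Set (ℝ × ℝ)} {G : SimpleGraph V}

open Classical

/-- The expectation of `f` under the wired random-cluster measure on `E`, all the edges outside `E`
being declared open. -/
def wiredExp (q x : ℝ) (E : Finset G.edgeSet) (f : Set G.edgeSet → ℝ) : ℝ :=
  wexp E (wiredWeight q x E) fun S => f (↑S ∪ (↑E)ᶜ)

theorem sum_powerset_superset {α : Type*} [DecidableEq α] {E F : Finset α} (h : E ⊆ F)
    (g : Finset α → ℝ) :
    ∑ S ∈ F.powerset, (if F \ E ⊆ S then g S else 0) = ∑ S ∈ E.powerset, g (S ∪ (F \ E)) := by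
  rw [← Finset.sum_filter]
  refine Finset.sum_bij' (fun S _ => S ∩ E) (fun S _ => S ∪ (F \ E)) ?_ ?_ ?_ ?_ ?_
  · intro S _; simp
  · intro S hS
    simp only [Finset.mem_filter, Finset.mem_powerset] at hS ⊢
    exact ⟨Finset.union_subset (hS.trans h) Finset.sdiff_subset, Finset.subset_union_right⟩
  · intro S hS
    simp only [Finset.mem_filter, Finset.mem_powerset] at hS
    ext e
    have h1 := @hS.1 e
    have h2 := @hS.2 e
    simp only [Finset.mem_sdiff] at h2
    simp only [Finset.mem_union, Finset.mem_inter, Finset.mem_sdiff]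
    tauto
  · intro S hS
    simp only [Finset.mem_powerset] at hS
    ext e
    have h1 := @hS e
    simp only [Finset.mem_union, Finset.mem_inter, Finset.mem_sdiff]
    tauto
  · intro S hS
    simp only [Finset.mem_filter, Finset.mem_powerset] at hS
    congr 1
    ext e
    have h1 := @hS.1 e
    have h2 := @hS.2 e
    simp only [Finset.mem_sdiff] at h2
    simp only [Finset.mem_union, Finset.mem_inter, Finset.mem_sdiff]
    tauto

theorem wiredExp_le_of_subset {q x y : ℝ} (hq : 1 ≤ q) (hx : 0 < x) (hxy : x ≤ y)
    {E F : Finset G.edgeSet} (hEF : E ⊆ F) {f : Set G.edgeSet → ℝ} (hf : Monotone f) :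
    wiredExp q x F f ≤ wiredExp q y E f := by
  have hy : 0 < y := hx.trans_le hxy
  -- The wired measure on `E`, seen on subsets of `F` by opening all of `F \ E`. This weight
  -- vanishes at some sets, so the cross-multiplied form of Holley's inequality is needed.
  set w₂ : Finset G.edgeSet → ℝ := fun S => if F \ E ⊆ S then wiredWeight q y E (S ∩ E) else 0
    with hw₂
  have h2 : 0 ≤ w₂ := by
    intro S
    simp only [hw₂, Pi.zero_apply]
    split_ifs
    exacts [(wiredWeight_pos hq hy _ _).le, le_rfl]
  have hmono : Monotone fun S : Finset G.edgeSet => f (↑S ∪ (↑F)ᶜ) :=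
    fun S T h => hf (Set.union_subset_union_left _ (by exact_mod_cast h))
  have key := wsum_holley F (fun S => (wiredWeight_pos hq hx F S).le) h2 (by
    intro a ha b hb
    simp only [hw₂]
    by_cases h : F \ E ⊆ b
    · rw [if_pos h, if_pos (h.trans Finset.subset_union_right)]
      refine weight_mul_le hq (by positivity) (by positivity) ?_ (wiredRank_add_le hEF a b)
      have h1 := pow_mul_pow_le_of_card hx.le hxy (a ∩ E) (b ∩ E)
      have e1 : (a \ E).card + (a ∩ E).card = a.card := Finset.card_sdiff_add_card_inter a E
      have e2 : (a ∩ b).card = (a \ E).card + (a ∩ E ∩ (b ∩ E)).card := by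
        rw [← Finset.card_sdiff_add_card_inter (a ∩ b) E]
        congr 2
        · ext e
          have h1 := @h e
          have h2 := @ha e
          simp only [Finset.mem_inter, Finset.mem_sdiff] at h1 ⊢
          tauto
        · ext e
          simp only [Finset.mem_inter]
          tauto
      have e3 : (a ∪ b) ∩ E = (a ∩ E) ∪ (b ∩ E) := Finset.union_inter_distrib_right a b E
      rw [← e1, e2, e3, pow_add, pow_add]
      have : 0 ≤ x ^ (a \ E).card := by positivity
      nlinarith
    · rw [if_neg h, mul_zero]
      exact mul_nonneg (wiredWeight_pos hq hx _ _).le (h2 _)) hmono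
  have conv : ∀ g : Finset G.edgeSet → ℝ, wsum F w₂ g =
      wsum E (wiredWeight q y E) fun S => g (S ∪ (F \ E)) := by
    intro g
    have := sum_powerset_superset hEF (fun S => wiredWeight q y E (S ∩ E) * g S)
    rw [wsum, wsum]
    simp only [hw₂, ite_mul, zero_mul]
    rw [this]
    refine Finset.sum_congr rfl fun S hS => ?_
    congr 2
    ext e
    have h1 := Finset.mem_powerset.1 hS
    have h1 := @h1 e
    simp only [Finset.mem_union, Finset.mem_inter, Finset.mem_sdiff]
    tauto
  rw [conv, conv] at key
  have e4 : (wsum E (wiredWeight q y E) fun S => f (↑(S ∪ (F \ E)) ∪ (↑F)ᶜ)) =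
      wsum E (wiredWeight q y E) fun S => f (↑S ∪ (↑E)ᶜ) := by
    refine wsum_congr fun S _ => ?_
    congr 2
    ext e
    have h1 := @hEF e
    simp only [Finset.coe_union, Finset.coe_sdiff, Set.mem_union, Set.mem_sdiff, Finset.mem_coe,
      Set.mem_compl_iff]
    tauto
  rw [e4] at key
  rw [wiredExp, wiredExp, wexp, wexp, div_le_div_iff₀ (wsum_one_pos F (wiredWeight_pos hq hx F))
    (wsum_one_pos E (wiredWeight_pos hq hy E))]
  refine key.trans (le_of_eq (mul_comm _ _))

/-- The indicator function of an event. -/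
def ind (A : Set (Set G.edgeSet)) : Set G.edgeSet → ℝ := A.indicator 1

theorem ind_mono {A : Set (Set G.edgeSet)} (hA : IsUpperSet A) : Monotone (ind A) := by
  intro S T h
  unfold ind
  by_cases hS : S ∈ A
  · simp [hS, hA h hS]
  · simp only [hS, not_false_eq_true, Set.indicator_of_notMem]
    exact Set.indicator_nonneg (fun _ _ => zero_le_one) _

theorem ind_nonneg (A : Set (Set G.edgeSet)) (S : Set G.edgeSet) : 0 ≤ ind A S :=
  Set.indicator_nonneg (fun _ _ => zero_le_one) _

theorem ind_le_one (A : Set (Set G.edgeSet)) (S : Set G.edgeSet) : ind A S ≤ 1 :=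
  Set.indicator_le_self' (fun _ _ => zero_le_one) S

theorem ind_of_mem {A : Set (Set G.edgeSet)} {S : Set G.edgeSet} (h : S ∈ A) : ind A S = 1 := by
  simp [ind, h]

theorem ind_of_notMem {A : Set (Set G.edgeSet)} {S : Set G.edgeSet} (h : S ∉ A) : ind A S = 0 := by
  simp [ind, h]

/-- The infinite-volume limit of the wired probabilities of the increasing event `A`. -/
def mu (q x : ℝ) (A : Set (Set G.edgeSet)) : ℝ := ⨅ E : Finset G.edgeSet, wiredExp q x E (ind A)

variable {q x y : ℝ} {A B : Set (Set G.edgeSet)}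

theorem wiredExp_ind_nonneg (hq : 1 ≤ q) (hx : 0 < x) (E : Finset G.edgeSet) :
    0 ≤ wiredExp q x E (ind A) :=
  wexp_nonneg (wiredWeight_pos hq hx E) fun _ _ => ind_nonneg _ _

theorem wiredExp_ind_le_one (hq : 1 ≤ q) (hx : 0 < x) (E : Finset G.edgeSet) :
    wiredExp q x E (ind A) ≤ 1 :=
  wexp_le_one (wiredWeight_pos hq hx E) fun _ _ => ind_le_one _ _

theorem bddBelow_wiredExp (hq : 1 ≤ q) (hx : 0 < x) :
    BddBelow (Set.range fun E : Finset G.edgeSet => wiredExp q x E (ind A)) :=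
  ⟨0, by rintro _ ⟨E, rfl⟩; exact wiredExp_ind_nonneg hq hx E⟩

theorem mu_le_wiredExp (hq : 1 ≤ q) (hx : 0 < x) (E : Finset G.edgeSet) :
    mu q x A ≤ wiredExp q x E (ind A) := ciInf_le (bddBelow_wiredExp hq hx) E

theorem mu_nonneg (hq : 1 ≤ q) (hx : 0 < x) (A : Set (Set G.edgeSet)) : 0 ≤ mu q x A :=
  le_ciInf fun E => wiredExp_ind_nonneg hq hx E

theorem mu_le_one (hq : 1 ≤ q) (hx : 0 < x) (A : Set (Set G.edgeSet)) : mu q x A ≤ 1 :=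
  (mu_le_wiredExp hq hx ∅).trans (wiredExp_ind_le_one hq hx ∅)

/-- Monotonicity in the volume makes the infimum a limit for increasing events; positive association
and union bounds are inherited from finite volume through it. -/
theorem tendsto_mu (hq : 1 ≤ q) (hx : 0 < x) (hA : IsUpperSet A) :
    Tendsto (fun E : Finset G.edgeSet => wiredExp q x E (ind A)) atTop (𝓝 (mu q x A)) :=
  tendsto_atTop_ciInf (fun _ _ h => wiredExp_le_of_subset hq hx le_rfl h (ind_mono hA))
    (bddBelow_wiredExp hq hx)

theorem mu_mono (hq : 1 ≤ q) (hx : 0 < x) (h : A ⊆ B) : mu q x A ≤ mu q x B :=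
  ciInf_mono (bddBelow_wiredExp hq hx) fun E => wexp_mono (wiredWeight_pos hq hx E) fun _ _ =>
    Set.indicator_le_indicator_of_subset h (fun _ => zero_le_one) _

theorem mu_mono_param (hq : 1 ≤ q) (hx : 0 < x) (hxy : x ≤ y) (hA : IsUpperSet A) :
    mu q x A ≤ mu q y A :=
  ciInf_mono (bddBelow_wiredExp hq hx) fun E =>
    wiredExp_le_of_subset hq hx hxy (subset_refl E) (ind_mono hA)

theorem monotone_union_compl (E : Finset G.edgeSet) {f : Set G.edgeSet → ℝ} (hf : Monotone f) :
    Monotone fun S : Finset G.edgeSet => f (↑S ∪ (↑E)ᶜ) :=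
  fun _ _ h => hf (Set.union_subset_union_left _ (by exact_mod_cast h))

theorem mu_mul_le_inter (hq : 1 ≤ q) (hx : 0 < x) (hA : IsUpperSet A) (hB : IsUpperSet B) :
    mu q x A * mu q x B ≤ mu q x (A ∩ B) := by
  refine le_of_tendsto_of_tendsto ((tendsto_mu hq hx hA).mul (tendsto_mu hq hx hB))
    (tendsto_mu hq hx (hA.inter hB)) (Eventually.of_forall fun E => ?_)
  refine ((isFKG_wiredWeight hq hx E).wexp_mul_le (monotone_union_compl E (ind_mono hA))
    (monotone_union_compl E (ind_mono hB))).trans (le_of_eq (wexp_congr fun S _ => ?_))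
  simp only [ind, ← Set.inter_indicator_mul]
  congr 1
  ext; simp

theorem mu_union_le (hq : 1 ≤ q) (hx : 0 < x) (hA : IsUpperSet A) (hB : IsUpperSet B) :
    mu q x (A ∪ B) ≤ mu q x A + mu q x B := by
  refine le_of_tendsto_of_tendsto (tendsto_mu hq hx (hA.union hB))
    ((tendsto_mu hq hx hA).add (tendsto_mu hq hx hB)) (Eventually.of_forall fun E => ?_)
  change wexp _ _ _ ≤ wexp _ _ _ + wexp _ _ _
  rw [← wexp_add]
  refine wexp_mono (wiredWeight_pos hq hx E) fun S _ => ?_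
  simp only [ind]
  by_cases h1 : (S : Set G.edgeSet) ∪ (↑E)ᶜ ∈ A <;> by_cases h2 : (S : Set G.edgeSet) ∪ (↑E)ᶜ ∈ B <;>
    simp [h1, h2]

theorem mu_univ (hq : 1 ≤ q) (hx : 0 < x) : mu q x (Set.univ : Set (Set G.edgeSet)) = 1 := by
  have : ∀ E : Finset G.edgeSet, wiredExp q x E (ind Set.univ) = 1 := fun E => by
    have := wexp_const E (wiredWeight_pos hq hx E) 1
    rw [← this]
    exact wexp_congr fun S _ => by simp [ind]
  simp [mu, this]

theorem mu_empty (hq : 1 ≤ q) (hx : 0 < x) : mu q x (∅ : Set (Set G.edgeSet)) = 0 := by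
  have : ∀ E : Finset G.edgeSet, wiredExp q x E (ind ∅) = 0 := fun E => by
    have := wexp_const E (wiredWeight_pos hq hx E) 0
    rw [← this]
    exact wexp_congr fun S _ => by simp [ind]
  simp [mu, this]

theorem mu_biUnion_le {ι : Type*} (hq : 1 ≤ q) (hx : 0 < x) (s : Finset ι)
    {A : ι → Set (Set G.edgeSet)} (hA : ∀ i ∈ s, IsUpperSet (A i)) :
    mu q x (⋃ i ∈ s, A i) ≤ ∑ i ∈ s, mu q x (A i) := by
  induction s using Finset.induction_on with
  | empty => simp [mu_empty hq hx]
  | insert a s ha ih =>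
    rw [Finset.set_biUnion_insert, Finset.sum_insert ha]
    have h2 : IsUpperSet (⋃ i ∈ s, A i) :=
      isUpperSet_iUnion₂ fun i hi => hA i (Finset.mem_insert_of_mem hi)
    exact (mu_union_le hq hx (hA a (Finset.mem_insert_self _ _)) h2).trans
      (add_le_add_right (ih fun i hi => hA i (Finset.mem_insert_of_mem hi)) _)

theorem mu_prod_le_biInter {ι : Type*} (hq : 1 ≤ q) (hx : 0 < x) (s : Finset ι)
    {A : ι → Set (Set G.edgeSet)} (hA : ∀ i ∈ s, IsUpperSet (A i)) :
    ∏ i ∈ s, mu q x (A i) ≤ mu q x (⋂ i ∈ s, A i) := by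
  induction s using Finset.induction_on with
  | empty => simp [mu_univ hq hx]
  | insert a s ha ih =>
    rw [Finset.set_biInter_insert, Finset.prod_insert ha]
    have h2 : IsUpperSet (⋂ i ∈ s, A i) :=
      isUpperSet_iInter₂ fun i hi => hA i (Finset.mem_insert_of_mem hi)
    exact (mul_le_mul_of_nonneg_left (ih fun i hi => hA i (Finset.mem_insert_of_mem hi))
      (mu_nonneg hq hx _)).trans (mu_mul_le_inter hq hx (hA a (Finset.mem_insert_self _ _)) h2)

/-- The event `A` depends on the edges in `D` only. -/
def LocalOn (D : Set G.edgeSet) (A : Set (Set G.edgeSet)) : Prop :=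
  ∀ S T : Set G.edgeSet, S ∩ D = T ∩ D → (S ∈ A ↔ T ∈ A)

theorem LocalOn.mem_union_compl_iff {D : Set G.edgeSet} (h : LocalOn D A) {E : Finset G.edgeSet}
    (hD : D ⊆ E) (S : Set G.edgeSet) : S ∪ (↑E)ᶜ ∈ A ↔ S ∈ A := by
  refine h _ _ ?_
  ext e
  have := @hD e
  simp only [Set.mem_inter_iff, Set.mem_union, Set.mem_compl_iff]
  tauto

theorem wiredWeight_scale (hx : 0 < x) (E S : Finset G.edgeSet) :
    wiredWeight q y E S = (y / x) ^ S.card * wiredWeight q x E S := by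
  rw [wiredWeight, wiredWeight, ← mul_assoc, ← mul_pow, div_mul_cancel₀ _ hx.ne.symm]

/-- The number of the events `A i` that contain `S`. -/
def count {ι : Type*} (s : Finset ι) (A : ι → Set (Set G.edgeSet)) (S : Finset G.edgeSet) : ℕ :=
  (s.filter fun i => (S : Set G.edgeSet) ∈ A i).card

/-- An event that starts to occur when passing from `S` to `T` must see an edge of `T \ S` in its
own support. The supports being disjoint, these edges are distinct, so the count grows by at most
the number of added edges. -/
theorem count_props {ι : Type*} {s : Finset ι} {A : ι → Set (Set G.edgeSet)}
    {D : ι → Set G.edgeSet} (hA : ∀ i ∈ s, IsUpperSet (A i)) (hloc : ∀ i ∈ s, LocalOn (D i) (A i))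
    (hdis : ∀ i ∈ s, ∀ j ∈ s, i ≠ j → Disjoint (D i) (D j))
    (hemp : ∀ i ∈ s, (∅ : Set G.edgeSet) ∉ A i) :
    Monotone (count s A) ∧ (∀ S, count s A S ≤ S.card) ∧ Monotone fun S => S.card - count s A S := by
  set N : Finset G.edgeSet → ℕ := count s A with hN
  have hNmono : Monotone N := fun S T h => Finset.card_le_card fun i hi => by
    simp only [Finset.mem_filter] at hi ⊢
    exact ⟨hi.1, hA i hi.1 (by exact_mod_cast h) hi.2⟩
  have hinc : ∀ S T : Finset G.edgeSet, S ⊆ T → N T ≤ N S + (T \ S).card := by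
    intro S T hST
    have h1 : N T ≤ N S + (s.filter fun i => (T : Set G.edgeSet) ∈ A i ∧
        (S : Set G.edgeSet) ∉ A i).card := by
      refine (Finset.card_le_card ?_).trans (Finset.card_union_le _ _)
      intro i hi
      simp only [Finset.mem_filter, Finset.mem_union] at hi ⊢
      tauto
    refine h1.trans (Nat.add_le_add_left ?_ _)
    have h2 : ∀ i ∈ s.filter fun i => (T : Set G.edgeSet) ∈ A i ∧ (S : Set G.edgeSet) ∉ A i,
        ∃ e, e ∈ T \ S ∧ e ∈ D i := by
      intro i hi
      simp only [Finset.mem_filter] at hi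
      by_contra hcon
      push Not at hcon
      refine hi.2.2 ((hloc i hi.1 S T ?_).2 hi.2.1)
      ext e
      have := hcon e
      have h5 := @hST e
      simp only [Finset.mem_sdiff] at this
      simp only [Set.mem_inter_iff, Finset.mem_coe]
      tauto
    choose e he heD using h2
    rw [← Finset.card_attach]
    refine Finset.card_le_card_of_injOn (fun i => e i.1 i.2) (fun i _ => he i.1 i.2) ?_
    intro i _ j _ hij
    by_contra hne
    have hi' := (Finset.mem_filter.1 i.2).1
    have hj' := (Finset.mem_filter.1 j.2).1
    have h4 : e i.1 i.2 ∈ D j.1 := by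
      have : e i.1 i.2 = e j.1 j.2 := hij
      rw [this]; exact heD j.1 j.2
    exact Set.disjoint_left.1 (hdis i.1 hi' j.1 hj' fun h => hne (Subtype.ext h))
      (heD i.1 i.2) h4
  have hN0 : N ∅ = 0 := by
    simp only [hN, count, Finset.card_eq_zero, Finset.filter_eq_empty_iff]
    intro i hi
    simpa using hemp i hi
  have hle : ∀ S, N S ≤ S.card := fun S => by
    have := hinc ∅ S (Finset.empty_subset S)
    simpa [hN0] using this
  have hNc : Monotone fun S => S.card - N S := by
    intro S T hST
    have h1 := hinc S T hST
    have h2 := Finset.card_sdiff_add_card_eq_card hST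
    have h3 := hle S
    simp only
    omega
  exact ⟨hNmono, hle, hNc⟩

/-- Sprinkling: a slight increase of the edge parameter makes the union of many local events with
disjoint supports likely. -/
theorem mu_biUnion_ge_of_disjoint {ι : Type*} (hq : 1 ≤ q) (hx : 0 < x) (hxy : x ≤ y)
    (s : Finset ι) {A : ι → Set (Set G.edgeSet)} {D : ι → Set G.edgeSet}
    (hA : ∀ i ∈ s, IsUpperSet (A i)) (hD : ∀ i ∈ s, (D i).Finite)
    (hloc : ∀ i ∈ s, LocalOn (D i) (A i))
    (hdis : ∀ i ∈ s, ∀ j ∈ s, i ≠ j → Disjoint (D i) (D j)) :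
    1 - 1 / (1 + (y / x - 1) * ∑ i ∈ s, mu q x (A i)) ≤ mu q y (⋃ i ∈ s, A i) := by
  have hy := hx.trans_le hxy
  have hup : IsUpperSet (⋃ i ∈ s, A i) := isUpperSet_iUnion₂ hA
  have hl : 1 ≤ y / x := (one_le_div hx).2 hxy
  have hpos : 0 ≤ (y / x - 1) * ∑ i ∈ s, mu q x (A i) :=
    mul_nonneg (by linarith) (Finset.sum_nonneg fun i _ => mu_nonneg hq hx _)
  -- An event that contains the empty configuration always occurs; otherwise the count is zero at
  -- `∅`, as the tilting bound requires.
  by_cases hemp : ∃ i ∈ s, (∅ : Set G.edgeSet) ∈ A i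
  · obtain ⟨i, hi, h0⟩ := hemp
    have : (⋃ i ∈ s, A i) = Set.univ := Set.eq_univ_of_forall fun S =>
      Set.mem_biUnion hi (hA i hi (Set.empty_subset S) h0)
    rw [this, mu_univ hq hy]
    have : 0 ≤ 1 / (1 + (y / x - 1) * ∑ i ∈ s, mu q x (A i)) := by positivity
    linarith
  push Not at hemp
  have hfin : (⋃ i ∈ s, D i).Finite := s.finite_toSet.biUnion hD
  set N : Finset G.edgeSet → ℕ := count s A with hN
  obtain ⟨hNmono, hle, hNc⟩ := count_props hA hloc hdis hemp
  refine ge_of_tendsto (tendsto_mu hq hy hup) ?_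
  filter_upwards [eventually_ge_atTop hfin.toFinset] with E hE
  have hDE : ∀ i ∈ s, D i ⊆ E := fun i hi e he => by
    have : e ∈ hfin.toFinset := by
      rw [Set.Finite.mem_toFinset]; exact Set.mem_biUnion hi he
    exact_mod_cast hE this
  -- Tilting by `(y / x) ^ |S|` turns the wired weight with parameter `x` into the one with
  -- parameter `y`.
  have key := wexp_tilt_zero_le (isFKG_wiredWeight hq hx E) hl hNmono hle hNc
  have e1 : wexp E (fun S => (y / x) ^ S.card * wiredWeight q x E S)
      (fun S => if N S = 0 then 1 else 0) = 1 - wiredExp q y E (ind (⋃ i ∈ s, A i)) := by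
    have h1 : (fun S => (y / x) ^ S.card * wiredWeight q x E S) = wiredWeight q y E := by
      funext S; exact (wiredWeight_scale hx E S).symm
    rw [h1, wiredExp]
    refine Eq.trans ?_ (congrArg (· - _) (wexp_const E (wiredWeight_pos hq hy E) 1))
    rw [← wexp_sub]
    refine wexp_congr fun S _ => ?_
    by_cases h : ∃ i ∈ s, (S : Set G.edgeSet) ∈ A i
    · obtain ⟨i, hi, hiA⟩ := h
      have h2 : N S ≠ 0 := by
        simp only [hN, count, ne_eq, Finset.card_eq_zero, Finset.filter_eq_empty_iff]
        exact fun h => h hi hiA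
      have h3 : (S : Set G.edgeSet) ∪ (↑E)ᶜ ∈ ⋃ i ∈ s, A i := Set.mem_iUnion₂.2
        ⟨i, hi, ((hloc i hi).mem_union_compl_iff (hDE i hi) _).2 hiA⟩
      rw [if_neg h2, ind_of_mem h3, sub_self]
    · push Not at h
      have h2 : N S = 0 := by
        simp only [hN, count, Finset.card_eq_zero, Finset.filter_eq_empty_iff]
        exact fun i hi => h i hi
      rw [if_pos h2, ind_of_notMem, sub_zero]
      rw [Set.mem_iUnion₂]
      rintro ⟨i, hi, h'⟩
      exact h i hi (((hloc i hi).mem_union_compl_iff (hDE i hi) _).1 h')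
  have e2 : ∑ i ∈ s, mu q x (A i) ≤ wexp E (wiredWeight q x E) (fun S => (N S : ℝ)) := by
    have : wexp E (wiredWeight q x E) (fun S => (N S : ℝ)) =
        ∑ i ∈ s, wiredExp q x E (ind (A i)) := by
      unfold wiredExp
      rw [← wexp_sum]
      refine wexp_congr fun S _ => ?_
      simp only [hN, count, Finset.card_filter, Nat.cast_sum]
      refine Finset.sum_congr rfl fun i hi => ?_
      have := (hloc i hi).mem_union_compl_iff (hDE i hi) (S : Set G.edgeSet)
      by_cases h : (S : Set G.edgeSet) ∈ A i
      · rw [ind_of_mem (this.2 h)]; simp [h]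
      · rw [ind_of_notMem (fun h' => h (this.1 h'))]; simp [h]
    rw [this]
    exact Finset.sum_le_sum fun i _ => mu_le_wiredExp hq hx E
  rw [e1] at key
  have h3 : 1 / (1 + (y / x - 1) * wexp E (wiredWeight q x E) (fun S => (N S : ℝ))) ≤
      1 / (1 + (y / x - 1) * ∑ i ∈ s, mu q x (A i)) := by
    refine one_div_le_one_div_of_le (by linarith) ?_
    have := mul_le_mul_of_nonneg_left e2 (sub_nonneg.2 hl)
    linarith
  linarith

/-- Finite energy: pair each `S` not containing `e` with `insert e S`. Opening `e` multiplies the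
weight by `x` and destroys at most one cluster, so the closed mass is at most `q / x` times the open
mass. -/
theorem mu_edge_ge (hq : 1 ≤ q) (hx : 0 < x) (e : G.edgeSet) :
    1 / (1 + q / x) ≤ mu q x {S | e ∈ S} := by
  have hq0 : 0 < q := by linarith
  have hup : IsUpperSet {S : Set G.edgeSet | e ∈ S} := fun S T h hS => h hS
  refine ge_of_tendsto (tendsto_mu hq hx hup) ?_
  filter_upwards [eventually_ge_atTop {e}] with E hE
  have heE : e ∈ E := hE (Finset.mem_singleton_self e)
  have hw := wiredWeight_pos hq hx E
  have h1 : wsum E (wiredWeight q x E) (fun S => if e ∈ S then 0 else 1) ≤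
      q / x * wsum E (wiredWeight q x E) (fun S => if e ∈ S then 1 else 0) := by
    rw [← wsum_const_mul]
    simp only [wsum, mul_ite, mul_one, mul_zero]
    have e1 : ∀ g : Finset G.edgeSet → ℝ, ∑ S ∈ E.powerset, (if e ∈ S then 0 else g S) =
        ∑ S ∈ (E.erase e).powerset, g S := by
      intro g
      simp_rw [← ite_not (p := e ∈ _)]
      rw [← Finset.sum_filter]
      refine Finset.sum_congr ?_ fun _ _ => rfl
      ext S
      simp only [Finset.mem_filter, Finset.mem_powerset]
      exact Finset.subset_erase.symm
    have e2 : ∀ g : Finset G.edgeSet → ℝ, ∑ S ∈ E.powerset, (if e ∈ S then g S else 0) =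
        ∑ S ∈ (E.erase e).powerset, g (insert e S) := by
      intro g
      have := sum_powerset_superset (Finset.erase_subset e E) g
      have h3 : E \ E.erase e = {e} := by
        ext a; simp only [Finset.mem_sdiff, Finset.mem_erase, Finset.mem_singleton]
        constructor
        · rintro ⟨h1, h2⟩; by_contra h; exact h2 ⟨h, h1⟩
        · rintro rfl; exact ⟨heE, fun h => h.1 rfl⟩
      simp only [h3, Finset.singleton_subset_iff] at this
      rw [this]
      exact Finset.sum_congr rfl fun S _ => by rw [Finset.union_comm]; rfl
    rw [e1, e2]
    refine Finset.sum_le_sum fun S hS => ?_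
    have heS : e ∉ S := (Finset.subset_erase.1 (Finset.mem_powerset.1 hS)).2
    rw [wiredWeight, wiredWeight, Finset.card_insert_of_notMem heS, pow_succ]
    have h4 : q ^ wiredRank E S ≤ q ^ (wiredRank E (insert e S) + 1) :=
      pow_le_pow_right₀ hq (wiredRank_le_insert E S e)
    rw [pow_succ] at h4
    calc x ^ S.card * q ^ wiredRank E S ≤ x ^ S.card * (q ^ wiredRank E (insert e S) * q) :=
          mul_le_mul_of_nonneg_left h4 (by positivity)
      _ = _ := by field_simp
  have h2 : wsum E (wiredWeight q x E) (fun S => if e ∈ S then 1 else 0) +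
      wsum E (wiredWeight q x E) (fun S => if e ∈ S then 0 else 1) =
      wsum E (wiredWeight q x E) 1 := by
    rw [← wsum_add]
    exact wsum_congr fun S _ => by split_ifs <;> simp
  have h3 : wiredExp q x E (ind {S | e ∈ S}) =
      wexp E (wiredWeight q x E) (fun S => if e ∈ S then 1 else 0) := by
    refine wexp_congr fun S _ => ?_
    by_cases h : e ∈ S
    · rw [ind_of_mem (by simp [h]), if_pos h]
    · rw [ind_of_notMem (by simp [h, heE]), if_neg h]
  rw [h3, wexp, div_le_div_iff₀ (by positivity) (wsum_one_pos E hw), ← h2]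
  linarith

theorem mu_subset_pos (hq : 1 ≤ q) (hx : 0 < x) (F : Finset G.edgeSet) :
    (1 / (1 + q / x)) ^ F.card ≤ mu q x {S : Set G.edgeSet | (F : Set G.edgeSet) ⊆ S} := by
  have h := mu_prod_le_biInter hq hx F (A := fun e => {S : Set G.edgeSet | e ∈ S})
    fun e _ S T h hS => h hS
  have h2 : (⋂ e ∈ F, {S : Set G.edgeSet | e ∈ S}) = {S | (F : Set G.edgeSet) ⊆ S} := by
    ext S; simp [Set.subset_def]
  rw [h2] at h
  refine le_trans ?_ h
  rw [← Finset.prod_const]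
  have : 0 < 1 + q / x := by positivity
  exact Finset.prod_le_prod (fun _ _ => by positivity) fun e _ => mu_edge_ge hq hx e

theorem mem_mapEdgeSet (σ : G ≃g G) (e : G.edgeSet) (v : V) :
    σ v ∈ (σ.mapEdgeSet e : Sym2 V) ↔ v ∈ (e : Sym2 V) := by
  have : (σ.mapEdgeSet e : Sym2 V) = Sym2.map σ e := rfl
  rw [this, Sym2.mem_map]
  constructor
  · rintro ⟨a, ha, h⟩; rwa [← σ.injective h]
  · exact fun h => ⟨v, h, rfl⟩

theorem mem_verts_map (σ : G ≃g G) (E : Finset G.edgeSet) (v : V) :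
    σ v ∈ verts (E.map σ.mapEdgeSet.toEmbedding) ↔ v ∈ verts E := by
  simp only [verts, Set.mem_ofPred_eq, Finset.mem_map, Equiv.coe_toEmbedding]
  constructor
  · rintro ⟨_, ⟨e, he, rfl⟩, h⟩; exact ⟨e, he, (mem_mapEdgeSet σ e v).1 h⟩
  · rintro ⟨e, he, h⟩; exact ⟨_, ⟨e, he, rfl⟩, (mem_mapEdgeSet σ e v).2 h⟩

theorem mem_bdry_map (σ : G ≃g G) (E : Finset G.edgeSet) (v : V) :
    σ v ∈ bdry (E.map σ.mapEdgeSet.toEmbedding) ↔ v ∈ bdry E := by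
  simp only [bdry, Set.mem_ofPred_eq, mem_verts_map]
  refine and_congr_right fun _ => ?_
  constructor
  · rintro ⟨e, he, h⟩
    obtain ⟨e, rfl⟩ := σ.mapEdgeSet.surjective e
    exact ⟨e, fun h' => he (Finset.mem_map_of_mem _ h'), (mem_mapEdgeSet σ e v).1 h⟩
  · rintro ⟨e, he, h⟩
    refine ⟨σ.mapEdgeSet e, fun h' => he ?_, (mem_mapEdgeSet σ e v).2 h⟩
    obtain ⟨e', he', h⟩ := Finset.mem_map.1 h'
    rwa [← σ.mapEdgeSet.injective h]

theorem finrank_flat_map (σ : G ≃g G) {Z Z' : Set V} (hZ : ∀ v, σ v ∈ Z' ↔ v ∈ Z)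
    {R R' : V → V → Prop} (hR : ∀ v w, R' (σ v) (σ w) ↔ R v w) :
    Module.finrank ℝ (flat Z' R') = Module.finrank ℝ (flat Z R) := by
  have h : (flat Z' R').map (LinearEquiv.funCongrLeft ℝ ℝ σ.toEquiv : (V → ℝ) ≃ₗ[ℝ] _).toLinearMap =
      flat Z R := by
    ext f
    rw [Submodule.mem_map]
    constructor
    · rintro ⟨g, ⟨h1, h2⟩, rfl⟩
      refine ⟨fun v hv => h1 (σ v) (fun h => hv ((hZ v).1 h)), fun v w h => ?_⟩
      exact h2 (σ v) (σ w) ((hR v w).2 h)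
    · rintro ⟨h1, h2⟩
      refine ⟨fun v => f (σ.symm v), ⟨fun v hv => h1 _ fun h => hv ?_, fun v w h => h2 _ _ ?_⟩, ?_⟩
      · simpa using (hZ (σ.symm v)).2 h
      · rw [← hR]; simpa using h
      · funext v
        exact congrArg f (σ.symm_apply_apply v)
  rw [← h, LinearEquiv.finrank_map_eq]

theorem edgeRel_map (σ : G ≃g G) (S : Finset G.edgeSet) (v w : V) :
    edgeRel (↑(S.map σ.mapEdgeSet.toEmbedding) : Set G.edgeSet) (σ v) (σ w) ↔
      edgeRel (S : Set G.edgeSet) v w := by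
  simp only [edgeRel, Finset.mem_coe, Finset.mem_map, Equiv.coe_toEmbedding]
  constructor
  · rintro ⟨_, ⟨e, he, rfl⟩, h1, h2⟩
    exact ⟨e, he, (mem_mapEdgeSet σ e v).1 h1, (mem_mapEdgeSet σ e w).1 h2⟩
  · rintro ⟨e, he, h1, h2⟩
    exact ⟨_, ⟨e, he, rfl⟩, (mem_mapEdgeSet σ e v).2 h1, (mem_mapEdgeSet σ e w).2 h2⟩

theorem wiredRank_map (σ : G ≃g G) (E S : Finset G.edgeSet) :
    wiredRank (E.map σ.mapEdgeSet.toEmbedding) (S.map σ.mapEdgeSet.toEmbedding) =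
      wiredRank E S :=
  finrank_flat_map σ (fun v => by simp only [inner, Set.mem_sdiff, mem_verts_map, mem_bdry_map])
    (edgeRel_map σ S)

theorem relRank_free_map (σ : G ≃g G) (E S : Finset G.edgeSet) :
    relRank (E.map σ.mapEdgeSet.toEmbedding) (fun _ _ => False) (S.map σ.mapEdgeSet.toEmbedding) =
      relRank E (fun _ _ => False) S :=
  finrank_flat_map σ (mem_verts_map σ E) fun v w => by rw [edgeRel_map]

theorem sum_powerset_map {α : Type*} (τ : α ≃ α) (E : Finset α) (g : Finset α → ℝ) :
    ∑ S ∈ (E.map τ.toEmbedding).powerset, g S = ∑ S ∈ E.powerset, g (S.map τ.toEmbedding) := by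
  symm
  refine Finset.sum_bij (fun S _ => S.map τ.toEmbedding) ?_ ?_ ?_ ?_
  · intro S hS
    simpa using hS
  · intro S _ T _ h; exact Finset.map_injective _ h
  · intro S hS
    rw [Finset.mem_powerset, Finset.subset_map_iff] at hS
    obtain ⟨T, hT, rfl⟩ := hS
    exact ⟨T, Finset.mem_powerset.2 hT, rfl⟩
  · intro S _; rfl

theorem wiredExp_map (σ : G ≃g G) (E : Finset G.edgeSet) (f : Set G.edgeSet → ℝ) :
    wiredExp q x (E.map σ.mapEdgeSet.toEmbedding) f =
      wiredExp q x E fun S => f (σ.mapEdgeSet '' S) := by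
  simp only [wiredExp, wexp, wsum, sum_powerset_map, wiredWeight, wiredRank_map, Finset.card_map]
  congr 1
  refine Finset.sum_congr rfl fun S _ => ?_
  congr 2
  rw [Set.image_union, Set.image_compl_eq σ.mapEdgeSet.bijective]
  simp

/-- An automorphism permutes the finite volumes over which the infimum is taken. -/
theorem mu_image (σ : G ≃g G) (A : Set (Set G.edgeSet)) :
    mu q x {S | σ.mapEdgeSet '' S ∈ A} = mu q x A := by
  unfold mu
  symm
  refine Equiv.iInf_congr (σ.mapEdgeSet.symm.finsetCongr) fun E => ?_
  have h := wiredExp_map (q := q) (x := x) σ (E.map σ.mapEdgeSet.symm.toEmbedding) (ind A)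
  have h2 : (E.map σ.mapEdgeSet.symm.toEmbedding).map σ.mapEdgeSet.toEmbedding = E := by
    have : σ.mapEdgeSet.symm.toEmbedding.trans σ.mapEdgeSet.toEmbedding =
        Function.Embedding.refl _ := by
      exact Function.Embedding.ext fun e => σ.mapEdgeSet.apply_symm_apply e
    rw [Finset.map_map, this, Finset.map_refl]
  rw [h2] at h
  rw [h]
  rfl

end Wired

end

section

/-! ### The OSSS inequality for weights with the FKG lattice condition -/

section DecisionTrees

variable {α : Type*} [DecidableEq α]

theorem wexp_eq_const {E : Finset α} {w f : Finset α → ℝ} (hw : ∀ S, 0 < w S) {c : ℝ}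
    (h : ∀ S ⊆ E, f S = c) : wexp E w f = c :=
  (wexp_congr h).trans (wexp_const E hw c)

/-- The function obtained from `f` by declaring `e` open. -/
def lift (e : α) (f : Finset α → ℝ) : Finset α → ℝ := fun S => f (insert e S)

/-- The probability that `e` is open. -/
def edgeProb (E : Finset α) (w : Finset α → ℝ) (e : α) : ℝ :=
  wexp E w fun S => if e ∈ S then 1 else 0

theorem sum_powerset_erase {E : Finset α} {e : α} (he : e ∈ E) (g : Finset α → ℝ) :
    ∑ S ∈ E.powerset, g S =
      ∑ S ∈ (E.erase e).powerset, g S + ∑ S ∈ (E.erase e).powerset, g (insert e S) := by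
  conv_lhs => rw [← Finset.insert_erase he]
  exact Finset.sum_powerset_insert (Finset.notMem_erase e E) g

theorem edgeProb_of_notMem {E : Finset α} {w : Finset α → ℝ} (hw : ∀ S, 0 < w S) {e : α}
    (he : e ∉ E) : edgeProb E w e = 0 :=
  wexp_eq_const hw fun _ hS => if_neg fun h => he (hS h)

theorem wsum_erase {E : Finset α} {w f : Finset α → ℝ} {e : α} (he : e ∈ E) :
    wsum E w f = wsum (E.erase e) w f + wsum (E.erase e) (lift e w) (lift e f) :=
  sum_powerset_erase he _

theorem edgeProb_of_mem {E : Finset α} {w : Finset α → ℝ} {e : α}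
    (he : e ∈ E) : edgeProb E w e = wsum (E.erase e) (lift e w) 1 / wsum E w 1 := by
  rw [edgeProb, wexp, wsum_erase he]
  have h1 : wsum (E.erase e) w (fun S => if e ∈ S then 1 else 0) = 0 := by
    refine Finset.sum_eq_zero fun S hS => ?_
    beta_reduce
    rw [if_neg fun h => Finset.notMem_erase e E (Finset.mem_powerset.1 hS h), mul_zero]
  rw [h1, zero_add]
  congr 1
  exact wsum_congr fun S _ => by simp [lift]

theorem edgeProb_nonneg {E : Finset α} {w : Finset α → ℝ} (hw : ∀ S, 0 < w S) (e : α) :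
    0 ≤ edgeProb E w e := wexp_nonneg hw fun S _ => by split_ifs <;> norm_num

theorem edgeProb_le_one {E : Finset α} {w : Finset α → ℝ} (hw : ∀ S, 0 < w S) (e : α) :
    edgeProb E w e ≤ 1 := wexp_le_one hw fun S _ => by split_ifs <;> norm_num

/-- The law of total expectation, conditioning on the state of `e`. -/
theorem wexp_erase {E : Finset α} {w : Finset α → ℝ} (hw : ∀ S, 0 < w S) (f : Finset α → ℝ)
    (e : α) : wexp E w f = (1 - edgeProb E w e) * wexp (E.erase e) w f +
      edgeProb E w e * wexp (E.erase e) (lift e w) (lift e f) := by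
  by_cases he : e ∈ E
  · have hz := wsum_one_pos E hw
    have h0 := wsum_one_pos (E.erase e) hw
    have h1 := wsum_one_pos (E.erase e) (w := lift e w) fun S => hw _
    have h2 : wsum E w 1 = wsum (E.erase e) w 1 + wsum (E.erase e) (lift e w) 1 := wsum_erase he
    have h3 : 1 - edgeProb E w e = wsum (E.erase e) w 1 / wsum E w 1 := by
      rw [edgeProb_of_mem he, h2]; field_simp; ring
    rw [h3, edgeProb_of_mem he, wexp, wexp, wexp, wsum_erase he]
    field_simp
  · rw [edgeProb_of_notMem hw he, Finset.erase_eq_of_notMem he]; ring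

/-- The covariance of `f` and `g`. -/
def wcov (E : Finset α) (w f g : Finset α → ℝ) : ℝ :=
  wexp E w (fun S => f S * g S) - wexp E w f * wexp E w g

/-- Domination between two weights, in the form of the Holley condition. -/
structure Dom (E : Finset α) (w w' : Finset α → ℝ) : Prop where
  pos : ∀ S, 0 < w S
  pos' : ∀ S, 0 < w' S
  lattice : ∀ a ⊆ E, ∀ b ⊆ E, w a * w' b ≤ w (a ∩ b) * w' (a ∪ b)

theorem Dom.wexp_le {E : Finset α} {w w' g g' : Finset α → ℝ} (h : Dom E w w') (hg : Monotone g)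
    (hgg : ∀ S, g S ≤ g' S) : wexp E w g ≤ wexp E w' g' :=
  (wexp_holley h.pos h.pos' h.lattice hg).trans (wexp_mono h.pos' fun S _ => hgg S)

theorem Dom.edgeProb_le {E : Finset α} {w w' : Finset α → ℝ} (h : Dom E w w') (e : α) :
    edgeProb E w e ≤ edgeProb E w' e := by
  refine h.wexp_le (fun S T hST => ?_) fun _ => le_rfl
  by_cases he : e ∈ S
  · simp [he, hST he]
  · simp only [he, if_false]; split_ifs <;> norm_num

theorem subset_of_subset_erase {E S : Finset α} {e : α} (h : S ⊆ E.erase e) : S ⊆ E :=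
  h.trans (Finset.erase_subset e E)

theorem Dom.erase {E : Finset α} {w w' : Finset α → ℝ} (h : Dom E w w') (e : α) :
    Dom (E.erase e) w w' :=
  ⟨h.pos, h.pos', fun a ha b hb =>
    h.lattice a (subset_of_subset_erase ha) b (subset_of_subset_erase hb)⟩

theorem Dom.erase_lift {E : Finset α} {w w' : Finset α → ℝ} (h : Dom E w w') {e : α} (he : e ∈ E) :
    Dom (E.erase e) w (lift e w') :=
  ⟨h.pos, fun _ => h.pos' _, fun a ha b hb => by
    have h1 := h.lattice a (subset_of_subset_erase ha) (insert e b)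
      (Finset.insert_subset he (subset_of_subset_erase hb))
    rwa [Finset.inter_insert_of_notMem (fun h => Finset.notMem_erase e E (ha h)),
      Finset.union_insert] at h1⟩

theorem Dom.lift_lift {E : Finset α} {w w' : Finset α → ℝ} (h : Dom E w w') {e : α} (he : e ∈ E) :
    Dom (E.erase e) (lift e w) (lift e w') :=
  ⟨fun _ => h.pos _, fun _ => h.pos' _, fun a ha b hb => by
    have h1 := h.lattice (insert e a) (Finset.insert_subset he (subset_of_subset_erase ha))
      (insert e b) (Finset.insert_subset he (subset_of_subset_erase hb))
    rwa [← Finset.insert_inter_distrib, Finset.insert_union, Finset.union_insert,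
      Finset.insert_idem] at h1⟩

theorem lift_mono {f : Finset α → ℝ} (hf : Monotone f) (e : α) : Monotone (lift e f) :=
  fun _ _ h => hf (Finset.insert_subset_insert e h)

theorem le_lift {f : Finset α → ℝ} (hf : Monotone f) (e : α) (S : Finset α) : f S ≤ lift e f S :=
  hf (Finset.subset_insert e S)

/-- In this form the influence of `e` is what querying `e` costs at the root of a tree. -/
theorem wcov_edge {E : Finset α} {w : Finset α → ℝ} (hw : ∀ S, 0 < w S) (g : Finset α → ℝ)
    (e : α) :
    wcov E w g (fun S => if e ∈ S then 1 else 0) = edgeProb E w e * (1 - edgeProb E w e) *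
      (wexp (E.erase e) (lift e w) (lift e g) - wexp (E.erase e) w g) := by
  have h1 : wexp E w (fun S => g S * if e ∈ S then 1 else 0) =
      edgeProb E w e * wexp (E.erase e) (lift e w) (lift e g) := by
    rw [wexp_erase hw _ e]
    have h2 : wexp (E.erase e) w (fun S => g S * if e ∈ S then 1 else 0) = 0 := by
      exact wexp_eq_const hw fun S hS => by
        rw [if_neg fun h => Finset.notMem_erase e E (hS h), mul_zero]
    have h3 : wexp (E.erase e) (lift e w) (lift e fun S => g S * if e ∈ S then 1 else 0) =
        wexp (E.erase e) (lift e w) (lift e g) :=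
      wexp_congr fun S _ => by simp [lift]
    rw [h2, h3, mul_zero, zero_add]
  have h4 : wexp E w (fun S => if e ∈ S then 1 else 0) = edgeProb E w e := rfl
  rw [wcov, h1, h4, wexp_erase hw g e]
  ring

/-- Law of total covariance for two increasing functions. -/
theorem wcov_erase_le {E : Finset α} {w f g : Finset α → ℝ} (hw : Dom E w w) (hf : Monotone f)
    (hg : Monotone g) (e : α) :
    (1 - edgeProb E w e) * wcov (E.erase e) w f g +
      edgeProb E w e * wcov (E.erase e) (lift e w) (lift e f) (lift e g) ≤ wcov E w f g := by
  by_cases he : e ∈ E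
  · have hp := edgeProb_nonneg (E := E) hw.pos e
    have hp' := edgeProb_le_one (E := E) hw.pos e
    have h1 := (hw.erase_lift he).wexp_le hf (le_lift hf e)
    have h2 := (hw.erase_lift he).wexp_le hg (le_lift hg e)
    unfold wcov
    rw [wexp_erase (E := E) hw.pos f e, wexp_erase (E := E) hw.pos g e,
      wexp_erase (E := E) hw.pos (fun S => f S * g S) e]
    have e3 : lift e (fun S => f S * g S) = fun S => lift e f S * lift e g S := rfl
    rw [e3]
    -- The discarded term is the covariance of the two conditional means: `p (1 - p)` times the
    -- product of their increments, both nonnegative by domination.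
    nlinarith [mul_nonneg (mul_nonneg hp (sub_nonneg.2 hp'))
      (mul_nonneg (sub_nonneg.2 h1) (sub_nonneg.2 h2))]
  · rw [edgeProb_of_notMem hw.pos he, Finset.erase_eq_of_notMem he]
    simp

/-- Decision trees. -/
inductive DTree (α : Type*)
  | leaf (v : ℝ) : DTree α
  | node (e : α) (t₀ t₁ : DTree α) : DTree α

namespace DTree

/-- The output of the tree on the open set `S`. -/
def eval : DTree α → Finset α → ℝ
  | leaf v, _ => v
  | node e t₀ t₁, S => if e ∈ S then t₁.eval (S.erase e) else t₀.eval S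

/-- The tree queries `a` on the open set `S`. -/
def Queries : DTree α → Finset α → α → Prop
  | leaf _, _, _ => False
  | node e t₀ t₁, S, a => a = e ∨ if e ∈ S then t₁.Queries (S.erase e) a else t₀.Queries S a

/-- All outputs are in `[0,1]`. -/
def Unit : DTree α → Prop
  | leaf v => 0 ≤ v ∧ v ≤ 1
  | node _ t₀ t₁ => t₀.Unit ∧ t₁.Unit

/-- The expectation of the product of the output of the tree for the weight `u` with `g` for the
weight `w`, the states of the successive queried edges being coupled monotonically. -/
def coupled : DTree α → Finset α → (Finset α → ℝ) → (Finset α → ℝ) → (Finset α → ℝ) → ℝ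
  | leaf v, E, _, w, g => v * wexp E w g
  | node e t₀ t₁, E, u, w, g =>
    let r := edgeProb E u e
    let p := edgeProb E w e
    min r p * t₁.coupled (E.erase e) (lift e u) (lift e w) (lift e g) +
    (r - min r p) * t₁.coupled (E.erase e) (lift e u) w g +
    (p - min r p) * t₀.coupled (E.erase e) u (lift e w) (lift e g) +
    (1 - r - p + min r p) * t₀.coupled (E.erase e) u w g

open Classical in
/-- The probability that `a` is queried. -/
def reveal (t : DTree α) (E : Finset α) (u : Finset α → ℝ) (a : α) : ℝ :=
  wexp E u fun S => if t.Queries S a then 1 else 0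

/-- With equal weights the monotone coupling makes the two configurations agree on every queried
edge, and conditioning step by step recovers one expectation. -/
theorem coupled_self (t : DTree α) (E : Finset α) {w : Finset α → ℝ} (hw : ∀ S, 0 < w S)
    (g : Finset α → ℝ) : t.coupled E w w g = wexp E w fun S => t.eval S * g S := by
  induction t generalizing E w g with
  | leaf v => simp only [coupled, eval]; rw [wexp_const_mul]
  | node e t₀ t₁ ih₀ ih₁ =>
    rw [coupled]
    simp only [min_self, sub_self, zero_mul, add_zero, sub_add_cancel]
    rw [ih₀ _ hw, ih₁ _ (w := lift e w) (fun S => hw _), wexp_erase hw (fun S => (node e t₀ t₁).eval S * g S) e,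
      add_comm]
    congr 2
    · exact wexp_congr fun S hS => by
        rw [eval, if_neg fun h => Finset.notMem_erase e E (hS h)]
    · refine wexp_congr fun S hS => ?_
      have : e ∉ S := fun h => Finset.notMem_erase e E (hS h)
      simp [lift, eval, Finset.erase_insert this]

/-- The law read by the tree is kept fixed while the second configuration is raised. Outputs lie in
`[0,1]`, so the coupled expectation moves upwards, by no more than the expectation of the second
function itself. -/
theorem coupled_mono (t : DTree α) (ht : t.Unit) (E : Finset α) {u : Finset α → ℝ}
    (hu : ∀ S, 0 < u S) {w w' g g' : Finset α → ℝ} (hw : Dom E w w') (hg : Monotone g)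
    (hg' : Monotone g') (hgg : ∀ S, g S ≤ g' S) :
    0 ≤ t.coupled E u w' g' - t.coupled E u w g ∧
      t.coupled E u w' g' - t.coupled E u w g ≤ wexp E w' g' - wexp E w g := by
  induction t generalizing E u w w' g g' with
  | leaf v =>
    have h1 := hw.wexp_le hg hgg
    obtain ⟨h2, h3⟩ := ht
    simp only [coupled]
    constructor <;> nlinarith
  | node e t₀ t₁ ih₀ ih₁ =>
    have hr := edgeProb_nonneg (E := E) hu e
    have hr' := edgeProb_le_one (E := E) hu e
    by_cases he : e ∈ E
    · have a1 := ih₁ ht.2 (E.erase e) (u := lift e u) (fun S => hu _) (hw.lift_lift he)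
        (lift_mono hg e) (lift_mono hg' e) (fun S => hgg _)
      have a2 := ih₁ ht.2 (E.erase e) (u := lift e u) (fun S => hu _) (hw.erase e) hg hg' hgg
      have a3 := ih₁ ht.2 (E.erase e) (u := lift e u) (fun S => hu _) (hw.erase_lift he) hg
        (lift_mono hg' e) (fun S => (hgg S).trans (le_lift hg' e S))
      have b1 := ih₀ ht.1 (E.erase e) hu (hw.lift_lift he)
        (lift_mono hg e) (lift_mono hg' e) (fun S => hgg _)
      have b2 := ih₀ ht.1 (E.erase e) hu (hw.erase e) hg hg' hgg
      have b3 := ih₀ ht.1 (E.erase e) hu (hw.erase_lift he) hg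
        (lift_mono hg' e) (fun S => (hgg S).trans (le_lift hg' e S))
      have hp := edgeProb_nonneg (E := E) hw.pos e
      have hp' := edgeProb_le_one (E := E) hw.pos' e
      have hpp := hw.edgeProb_le e
      rw [wexp_erase hw.pos g e, wexp_erase hw.pos' g' e]
      simp only [coupled]
      set r := edgeProb E u e
      set p := edgeProb E w e
      set p' := edgeProb E w' e
      have hm : min r p ≤ min r p' := min_le_min_left r hpp
      have hm0 : 0 ≤ min r p := le_min hr hp
      have hm1 : min r p' ≤ r := min_le_left _ _
      have hm2 : p - min r p ≤ p' - min r p' := by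
        rcases le_total r p with h | h
        · rw [min_eq_left h, min_eq_left (h.trans hpp)]; linarith
        · rw [min_eq_right h]
          have := min_le_right r p'
          linarith
      have hm3 : 0 ≤ p - min r p := sub_nonneg.2 (min_le_right _ _)
      have hm4 : 0 ≤ 1 - r - p' + min r p' := by
        rcases le_total r p' with h | h
        · rw [min_eq_left h]; linarith
        · rw [min_eq_right h]; linarith
      set m := min r p
      set m' := min r p'
      have c2 : 0 ≤ r - m' := by linarith
      have c3 : 0 ≤ m' - m := by linarith
      have c4 : 0 ≤ (p' - m') - (p - m) := by linarith
      generalize t₁.coupled (E.erase e) (lift e u) (lift e w') (lift e g') = A11 at *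
      generalize t₁.coupled (E.erase e) (lift e u) (lift e w) (lift e g) = B11 at *
      generalize t₁.coupled (E.erase e) (lift e u) w' g' = A10 at *
      generalize t₁.coupled (E.erase e) (lift e u) w g = B10 at *
      generalize t₀.coupled (E.erase e) u (lift e w') (lift e g') = A01 at *
      generalize t₀.coupled (E.erase e) u (lift e w) (lift e g) = B01 at *
      generalize t₀.coupled (E.erase e) u w' g' = A00 at *
      generalize t₀.coupled (E.erase e) u w g = B00 at *
      generalize wexp (E.erase e) (lift e w') (lift e g') = g1' at *
      generalize wexp (E.erase e) (lift e w) (lift e g) = g1 at *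
      generalize wexp (E.erase e) w' g' = g0' at *
      generalize wexp (E.erase e) w g = g0 at *
      -- The six coefficients are the probabilities of the joint states of `e` under `u`, `w` and
      -- `w'` coupled monotonically; they are nonnegative and sum to one, and the induction
      -- hypothesis applies to each bracket.
      have key : m' * A11 + (r - m') * A10 + (p' - m') * A01 + (1 - r - p' + m') * A00 -
          (m * B11 + (r - m) * B10 + (p - m) * B01 + (1 - r - p + m) * B00) =
          m * (A11 - B11) + (r - m') * (A10 - B10) + (m' - m) * (A11 - B10) +
          (p - m) * (A01 - B01) + (1 - r - p' + m') * (A00 - B00) +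
          ((p' - m') - (p - m)) * (A01 - B00) := by ring
      have key2 : (1 - p') * g0' + p' * g1' - ((1 - p) * g0 + p * g1) =
          m * (g1' - g1) + (r - m') * (g0' - g0) + (m' - m) * (g1' - g0) +
          (p - m) * (g1' - g1) + (1 - r - p' + m') * (g0' - g0) +
          ((p' - m') - (p - m)) * (g1' - g0) := by ring
      rw [key, key2]
      constructor
      · have := mul_nonneg hm0 a1.1
        have := mul_nonneg c2 a2.1
        have := mul_nonneg c3 a3.1
        have := mul_nonneg hm3 b1.1
        have := mul_nonneg hm4 b2.1
        have := mul_nonneg c4 b3.1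
        linarith
      · have := mul_le_mul_of_nonneg_left a1.2 hm0
        have := mul_le_mul_of_nonneg_left a2.2 c2
        have := mul_le_mul_of_nonneg_left a3.2 c3
        have := mul_le_mul_of_nonneg_left b1.2 hm3
        have := mul_le_mul_of_nonneg_left b2.2 hm4
        have := mul_le_mul_of_nonneg_left b3.2 c4
        linarith
    · simp only [coupled, edgeProb_of_notMem hu he, edgeProb_of_notMem hw.pos he,
        edgeProb_of_notMem hw.pos' he, min_self, sub_self, zero_mul, zero_add, sub_zero, add_zero,
        one_mul, Finset.erase_eq_of_notMem he]
      exact ih₀ ht.1 E hu hw hg hg' hgg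

theorem ite_le_ite_of_imp {P Q : Prop} [Decidable P] [Decidable Q] (h : P → Q) :
    (if P then (1 : ℝ) else 0) ≤ if Q then 1 else 0 := by
  by_cases hP : P
  · simp [hP, h hP]
  · rw [if_neg hP]; split_ifs <;> norm_num

open Classical in
theorem reveal_node (e : α) (t₀ t₁ : DTree α) (E : Finset α) {u : Finset α → ℝ}
    (hu : ∀ S, 0 < u S) (a : α) :
    (1 - edgeProb E u e) * t₀.reveal (E.erase e) u a +
      edgeProb E u e * t₁.reveal (E.erase e) (lift e u) a ≤ (node e t₀ t₁).reveal E u a := by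
  rw [reveal, reveal, reveal, wexp_erase (E := E) hu _ e]
  refine add_le_add (mul_le_mul_of_nonneg_left (wexp_mono hu fun S hS => ?_)
    (sub_nonneg.2 (edgeProb_le_one hu e))) (mul_le_mul_of_nonneg_left
      (wexp_mono (w := lift e u) (fun S => hu _) fun S hS => ?_) (edgeProb_nonneg hu e))
  · have he : e ∉ S := fun h => Finset.notMem_erase e E (hS h)
    refine ite_le_ite_of_imp fun h => ?_
    rw [Queries, if_neg he]
    exact Or.inr h
  · have he : e ∉ S := fun h => Finset.notMem_erase e E (hS h)
    refine ite_le_ite_of_imp fun h => ?_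
    rw [Queries, if_pos (Finset.mem_insert_self e S), Finset.erase_insert he]
    exact Or.inr h

theorem reveal_node_self (e : α) (t₀ t₁ : DTree α) (E : Finset α) {u : Finset α → ℝ}
    (hu : ∀ S, 0 < u S) : (node e t₀ t₁).reveal E u e = 1 :=
  wexp_eq_const hu fun S _ => by simp [Queries]

theorem monotone_mem (e : α) : Monotone fun S : Finset α => if e ∈ S then (1 : ℝ) else 0 :=
  fun S T h => by
    by_cases he : e ∈ S
    · simp [he, h he]
    · simp only [he, if_false]; split_ifs <;> norm_num

theorem wcov_edge_nonneg {E : Finset α} {w g : Finset α → ℝ} (hw : Dom E w w) (hg : Monotone g)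
    (e : α) : 0 ≤ wcov E w g fun S => if e ∈ S then 1 else 0 := by
  exact sub_nonneg.2 (IsFKG.wexp_mul_le ⟨hw.pos, hw.lattice⟩ hg (monotone_mem e))

/-- The sum of the revealments of the edges times their influences. -/
def cost (t : DTree α) (E : Finset α) (u w g : Finset α → ℝ) : ℝ :=
  ∑ a ∈ E, t.reveal E u a * wcov E w g fun S => if a ∈ S then 1 else 0

/-- Induction on the tree. At the root the monotone coupling of the two states of `e` is replaced by
the independent one, for which the induction hypotheses average to the product of expectations plus
averaged costs. The error of the replacement is at most the influence of `e`, which is queried with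
probability one. -/
theorem coupled_le (t : DTree α) (ht : t.Unit) (E : Finset α) {u w g : Finset α → ℝ}
    (hu : ∀ S, 0 < u S) (hw : Dom E w w) (hg : Monotone g) :
    t.coupled E u w g ≤ wexp E u t.eval * wexp E w g + t.cost E u w g := by
  induction t generalizing E u w g with
  | leaf v =>
    have h1 : wexp E u (leaf v).eval = v := wexp_const E hu v
    rw [h1, coupled]
    have : 0 ≤ (leaf v).cost E u w g := Finset.sum_nonneg fun a _ =>
      mul_nonneg (wexp_nonneg hu fun S _ => by split_ifs <;> norm_num) (wcov_edge_nonneg hw hg a)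
    linarith
  | node e t₀ t₁ ih₀ ih₁ =>
    have ev0 : wexp (E.erase e) u (node e t₀ t₁).eval = wexp (E.erase e) u t₀.eval :=
      wexp_congr fun S hS => by rw [eval, if_neg fun h => Finset.notMem_erase e E (hS h)]
    have ev1 : wexp (E.erase e) (lift e u) (lift e (node e t₀ t₁).eval) =
        wexp (E.erase e) (lift e u) t₁.eval := wexp_congr fun S hS => by
      have : e ∉ S := fun h => Finset.notMem_erase e E (hS h)
      simp [lift, eval, Finset.erase_insert this]
    by_cases he : e ∈ E
    · have hu1 : ∀ S, 0 < lift e u S := fun S => hu _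
      have hw1 := hw.lift_lift he
      have hw0 := hw.erase e
      have i11 := ih₁ ht.2 (E.erase e) hu1 hw1 (lift_mono hg e)
      have i10 := ih₁ ht.2 (E.erase e) hu1 hw0 hg
      have i01 := ih₀ ht.1 (E.erase e) hu hw1 (lift_mono hg e)
      have i00 := ih₀ ht.1 (E.erase e) hu hw0 hg
      have m1 := (coupled_mono t₁ ht.2 (E.erase e) hu1 (hw.erase_lift he) hg (lift_mono hg e)
        (le_lift hg e)).2
      have m0 := (coupled_mono t₀ ht.1 (E.erase e) hu (hw.erase_lift he) hg (lift_mono hg e)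
        (le_lift hg e)).1
      have hr := edgeProb_nonneg (E := E) hu e
      have hr' := edgeProb_le_one (E := E) hu e
      have hp := edgeProb_nonneg (E := E) hw.pos e
      have hp' := edgeProb_le_one (E := E) hw.pos e
      have hG := (hw.erase_lift he).wexp_le hg (le_lift hg e)
      -- the cost of the tree is at least the first influence plus the averaged costs
      have hcost : wcov E w g (fun S => if e ∈ S then 1 else 0) +
          ((1 - edgeProb E u e) * ((1 - edgeProb E w e) * t₀.cost (E.erase e) u w g +
            edgeProb E w e * t₀.cost (E.erase e) u (lift e w) (lift e g)) +
          edgeProb E u e * ((1 - edgeProb E w e) * t₁.cost (E.erase e) (lift e u) w g +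
            edgeProb E w e * t₁.cost (E.erase e) (lift e u) (lift e w) (lift e g))) ≤
          (node e t₀ t₁).cost E u w g := by
        rw [show (node e t₀ t₁).cost E u w g = _ from rfl, cost.eq_1 (node e t₀ t₁),
          ← Finset.add_sum_erase E _ he, reveal_node_self e t₀ t₁ E hu, one_mul]
        refine add_le_add_right ?_ _
        simp only [cost, Finset.mul_sum, ← Finset.sum_add_distrib]
        refine Finset.sum_le_sum fun a ha => ?_
        have hae : a ≠ e := (Finset.mem_erase.1 ha).1
        have t1 := wcov_erase_le hw hg (monotone_mem a) e
        have t2 := reveal_node e t₀ t₁ E hu a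
        have t3 : lift e (fun S => if a ∈ S then (1 : ℝ) else 0) =
            fun S => if a ∈ S then 1 else 0 := by
          funext S; simp [lift, hae]
        rw [t3] at t1
        have t4 := wcov_edge_nonneg hw hg a
        have d0 : 0 ≤ t₀.reveal (E.erase e) u a :=
          wexp_nonneg hu fun S _ => by split_ifs <;> norm_num
        have d1 : 0 ≤ t₁.reveal (E.erase e) (lift e u) a :=
          wexp_nonneg hu1 fun S _ => by split_ifs <;> norm_num
        generalize t₀.reveal (E.erase e) u a = D0 at *
        generalize t₁.reveal (E.erase e) (lift e u) a = D1 at *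
        generalize wcov (E.erase e) w g (fun S => if a ∈ S then 1 else 0) = C0 at *
        generalize wcov (E.erase e) (lift e w) (lift e g) (fun S => if a ∈ S then 1 else 0) =
          C1 at *
        have s1 := mul_le_mul_of_nonneg_right t2 t4
        have s2 := mul_le_mul_of_nonneg_left t1 (add_nonneg
          (mul_nonneg (sub_nonneg.2 hr') d0) (mul_nonneg hr d1))
        refine le_trans (le_of_eq ?_) (s2.trans s1)
        ring
      refine le_trans ?_ (add_le_add_right hcost _)
      rw [wexp_erase hu _ e, ev0, ev1, wexp_erase hw.pos g e, wcov_edge hw.pos g e]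
      simp only [coupled]
      set r := edgeProb E u e
      set p := edgeProb E w e
      have hmin : min r p - r * p ≤ p * (1 - p) := by
        rcases le_total r p with h | h
        · rw [min_eq_left h]; nlinarith
        · rw [min_eq_right h]; nlinarith
      have hmin0 : 0 ≤ min r p - r * p := by
        rcases le_total r p with h | h
        · rw [min_eq_left h]; nlinarith
        · rw [min_eq_right h]; nlinarith
      set m := min r p
      generalize t₁.coupled (E.erase e) (lift e u) (lift e w) (lift e g) = B11 at *
      generalize t₁.coupled (E.erase e) (lift e u) w g = B10 at *
      generalize t₀.coupled (E.erase e) u (lift e w) (lift e g) = B01 at *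
      generalize t₀.coupled (E.erase e) u w g = B00 at *
      generalize wexp (E.erase e) (lift e w) (lift e g) = g1 at *
      generalize wexp (E.erase e) w g = g0 at *
      -- `m - r p` is the excess of the monotone coupling over the independent one. It is at most `p
      -- (1 - p)`, and the bracket is at most `g1 - g0` because `B11 - B10 ≤ g1 - g0` and `B01 ≥
      -- B00`; the product is bounded by the influence of `e`.
      have key : m * B11 + (r - m) * B10 + (p - m) * B01 + (1 - r - p + m) * B00 =
          r * p * B11 + r * (1 - p) * B10 + (1 - r) * p * B01 + (1 - r) * (1 - p) * B00 +
          (m - r * p) * ((B11 - B10) - (B01 - B00)) := by ring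
      rw [key]
      have k1 : (m - r * p) * ((B11 - B10) - (B01 - B00)) ≤ p * (1 - p) * (g1 - g0) := by
        calc _ ≤ (m - r * p) * (g1 - g0) := mul_le_mul_of_nonneg_left (by linarith) hmin0
          _ ≤ _ := mul_le_mul_of_nonneg_right hmin (by linarith)
      have k2 := mul_le_mul_of_nonneg_left i11 (mul_nonneg hr hp)
      have k3 := mul_le_mul_of_nonneg_left i10 (mul_nonneg hr (sub_nonneg.2 hp'))
      have k4 := mul_le_mul_of_nonneg_left i01 (mul_nonneg (sub_nonneg.2 hr') hp)
      have k5 := mul_le_mul_of_nonneg_left i00 (mul_nonneg (sub_nonneg.2 hr') (sub_nonneg.2 hp'))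
      refine (add_le_add (add_le_add (add_le_add (add_le_add k2 k3) k4) k5) k1).trans
        (le_of_eq ?_)
      ring
    · have h0 := ih₀ ht.1 E hu hw hg
      rw [Finset.erase_eq_of_notMem he] at ev0
      have h2 : t₀.cost E u w g ≤ (node e t₀ t₁).cost E u w g := by
        refine Finset.sum_le_sum fun a _ => mul_le_mul_of_nonneg_right ?_ (wcov_edge_nonneg hw hg a)
        have := reveal_node e t₀ t₁ E hu a
        rw [edgeProb_of_notMem hu he, Finset.erase_eq_of_notMem he] at this
        linarith
      have h3 : (node e t₀ t₁).coupled E u w g = t₀.coupled E u w g := by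
        simp only [coupled, edgeProb_of_notMem hu he, edgeProb_of_notMem hw.pos he, min_self,
          sub_self, zero_mul, zero_add, sub_zero, add_zero, one_mul, Finset.erase_eq_of_notMem he]
      rw [h3, ev0]
      linarith

/-- The OSSS inequality for weights satisfying the FKG lattice condition. -/
theorem wcov_eval_le {E : Finset α} {w g : Finset α → ℝ} (hw : IsFKG E w) (hg : Monotone g)
    (t : DTree α) (ht : t.Unit) :
    wcov E w t.eval g ≤
      ∑ a ∈ E, t.reveal E w a * wcov E w g fun S => if a ∈ S then 1 else 0 := by
  have h := coupled_le t ht E hw.pos ⟨hw.pos, hw.pos, hw.lattice⟩ hg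
  rw [coupled_self t E hw.pos] at h
  rw [wcov]
  unfold cost at h
  linarith

end DTree

end DecisionTrees

end

section

open Filter Topology

/-! ### Symmetries and local finiteness of the lattice; one-arm events -/

section Lattice

variable {V : Set (ℝ × ℝ)} {G : SimpleGraph V}

theorem InducesAut.comp {f g : ℝ × ℝ → ℝ × ℝ} (hf : InducesAut G f) (hg : InducesAut G g) :
    InducesAut G (f ∘ g) := by
  obtain ⟨σ, hσ⟩ := hf
  obtain ⟨τ, hτ⟩ := hg
  exact ⟨τ.trans σ, fun v => by simp [hσ, hτ]⟩

theorem InducesAut.symm {f g : ℝ × ℝ → ℝ × ℝ} (hf : InducesAut G f) (h : ∀ v, g (f v) = v) :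
    InducesAut G g := by
  obtain ⟨σ, hσ⟩ := hf
  exact ⟨σ.symm, fun v => by
    have := h (σ.symm v)
    rw [← hσ, RelIso.apply_symm_apply] at this
    exact this.symm⟩

theorem IsLattice.inducesAut_translate (hG : IsLattice G) (a b : ℤ) :
    InducesAut G fun z => (z.1 + a, z.2 + b) := by
  have h1 : ∀ a : ℤ, InducesAut G fun z => (z.1 + a, z.2) := by
    intro a
    induction a using Int.induction_on with
    | zero => exact ⟨RelIso.refl _, fun v => by simp⟩
    | succ n ih =>
      convert hG.translation_fst.comp ih using 1
      funext z; simp; ring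
    | pred n ih =>
      convert (hG.translation_fst.symm (g := fun z => (z.1 - 1, z.2)) (by simp)).comp ih using 1
      funext z; simp; ring
  have h2 : ∀ b : ℤ, InducesAut G fun z => (z.1, z.2 + b) := by
    intro b
    induction b using Int.induction_on with
    | zero => exact ⟨RelIso.refl _, fun v => by simp⟩
    | succ n ih =>
      convert hG.translation_snd.comp ih using 1
      funext z; simp; ring
    | pred n ih =>
      convert (hG.translation_snd.symm (g := fun z => (z.1, z.2 - 1)) (by simp)).comp ih using 1
      funext z; simp; ring
  exact (h1 a).comp (h2 b)

/-- The closed unit square with lower left corner `(a, b)`. -/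
def unitSquare (a b : ℤ) : Set (ℝ × ℝ) := Set.Icc (a : ℝ) (a + 1) ×ˢ Set.Icc (b : ℝ) (b + 1)

theorem mem_unitSquare_floor (v : ℝ × ℝ) : v ∈ unitSquare ⌊v.1⌋ ⌊v.2⌋ :=
  ⟨⟨Int.floor_le _, (Int.lt_floor_add_one _).le⟩, ⟨Int.floor_le _, (Int.lt_floor_add_one _).le⟩⟩

theorem isBounded_unitSquare (a b : ℤ) : Bornology.IsBounded (unitSquare a b) :=
  (Metric.isBounded_Icc _ _).prod (Metric.isBounded_Icc _ _)

theorem IsLattice.finite_verts (hG : IsLattice G) {B : Set (ℝ × ℝ)} (hB : Bornology.IsBounded B) :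
    {v : V | (v : ℝ × ℝ) ∈ B}.Finite := by
  refine Set.Finite.of_finite_image (f := Subtype.val) ((hG.finite_of_bounded B hB).subset ?_)
    Subtype.val_injective.injOn
  rintro _ ⟨v, hv, rfl⟩
  exact ⟨v.2, hv⟩

theorem IsLattice.exists_card_unitSquare_le (hG : IsLattice G) :
    ∃ C : ℕ, ∀ a b : ℤ, {v : V | (v : ℝ × ℝ) ∈ unitSquare a b}.ncard ≤ C := by
  refine ⟨{v : V | (v : ℝ × ℝ) ∈ unitSquare 0 0}.ncard, fun a b => ?_⟩
  obtain ⟨σ, hσ⟩ := hG.inducesAut_translate (-a) (-b)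
  refine Set.ncard_le_ncard_of_injOn σ (fun v hv => ?_) σ.injective.injOn
    (hG.finite_verts (isBounded_unitSquare 0 0))
  simp only [Set.mem_ofPred_eq, unitSquare, Set.mem_prod, Set.mem_Icc] at hv ⊢
  rw [hσ]
  push_cast
  refine ⟨⟨?_, ?_⟩, ?_, ?_⟩ <;> linarith [hv.1.1, hv.1.2, hv.2.1, hv.2.2]

theorem dist_translate (v w : ℝ × ℝ) (a b : ℝ) :
    dist (v.1 + a, v.2 + b) (w.1 + a, w.2 + b) = dist v w := by
  simp [Prod.dist_eq]

/-- Edges have bounded length. -/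
theorem IsLattice.exists_length_le (hG : IsLattice G) :
    ∃ l : ℕ, 0 < l ∧ ∀ u v : V, G.Adj u v → dist (u : ℝ × ℝ) v ≤ l := by
  have hfin : {p : V × V | (p.1 : ℝ × ℝ) ∈ unitSquare 0 0 ∧ G.Adj p.1 p.2}.Finite := by
    have h1 := hG.finite_verts (isBounded_unitSquare 0 0)
    refine (h1.biUnion fun v _ => (hG.finite_neighbors v).image fun w => (v, w)).subset ?_
    rintro ⟨v, w⟩ ⟨hv, hvw⟩
    exact Set.mem_biUnion hv ⟨w, hvw, rfl⟩
  obtain ⟨M, hM⟩ := (hfin.image fun p => dist (p.1 : ℝ × ℝ) p.2).bddAbove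
  refine ⟨⌈M⌉₊ + 1, by omega, fun u v huv => ?_⟩
  obtain ⟨σ, hσ⟩ := hG.inducesAut_translate (-⌊(u : ℝ × ℝ).1⌋) (-⌊(u : ℝ × ℝ).2⌋)
  have h2 : dist (σ u : ℝ × ℝ) (σ v) = dist (u : ℝ × ℝ) v := by
    rw [hσ, hσ]; exact dist_translate _ _ _ _
  rw [← h2]
  have h3 := hM (Set.mem_image_of_mem _ (show (σ u, σ v) ∈ _ from ⟨?_, σ.map_adj_iff.2 huv⟩))
  · push_cast
    exact h3.trans ((Nat.le_ceil M).trans (by linarith))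
  · have := mem_unitSquare_floor (u : ℝ × ℝ)
    simp only [unitSquare, Set.mem_prod, Set.mem_Icc] at this ⊢
    rw [hσ]
    push_cast
    refine ⟨⟨?_, ?_⟩, ?_, ?_⟩ <;> linarith [this.1.1, this.1.2, this.2.1, this.2.2]

theorem exists_eq_mk (e : G.edgeSet) : ∃ a b : V, (e : Sym2 V) = s(a, b) ∧ G.Adj a b := by
  obtain ⟨e, he⟩ := e
  induction e with
  | _ a b => exact ⟨a, b, rfl, he⟩

theorem dist_le_of_mem {l : ℝ} (hl0 : 0 ≤ l) (hl : ∀ u v : V, G.Adj u v → dist (u : ℝ × ℝ) v ≤ l)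
    (e : G.edgeSet) {u v : V} (hu : u ∈ (e : Sym2 V)) (hv : v ∈ (e : Sym2 V)) :
    dist (u : ℝ × ℝ) v ≤ l := by
  obtain ⟨a, b, he, hab⟩ := exists_eq_mk e
  rw [he, Sym2.mem_iff] at hu hv
  rcases hu with rfl | rfl <;> rcases hv with rfl | rfl
  · simpa
  · exact hl _ _ hab
  · exact hl _ _ hab.symm
  · simpa

theorem IsLattice.finite_edges_touching (hG : IsLattice G) {B : Set (ℝ × ℝ)}
    (hB : Bornology.IsBounded B) :
    {e : G.edgeSet | ∃ v ∈ (e : Sym2 V), (v : ℝ × ℝ) ∈ B}.Finite := by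
  have h : ({e : G.edgeSet | ∃ v ∈ (e : Sym2 V), (v : ℝ × ℝ) ∈ B}.image Subtype.val).Finite := by
    refine ((hG.finite_verts hB).biUnion fun v _ =>
      (hG.finite_neighbors v).image fun w => s(v, w)).subset ?_
    rintro _ ⟨e, ⟨v, hv, hvB⟩, rfl⟩
    obtain ⟨a, b, he, hab⟩ := exists_eq_mk e
    rw [he, Sym2.mem_iff] at hv
    rcases hv with rfl | rfl
    · exact Set.mem_biUnion hvB ⟨b, hab, he.symm⟩
    · exact Set.mem_biUnion hvB ⟨a, hab.symm, by rw [he, Sym2.eq_swap]⟩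
  exact Set.Finite.of_finite_image h Subtype.val_injective.injOn

/-- Connection by open edges. -/
def Conn (S : Set G.edgeSet) : V → V → Prop := Relation.ReflTransGen (edgeRel S)

theorem edgeRel_symm {S : Set G.edgeSet} {x y : V} (h : edgeRel S x y) : edgeRel S y x := by
  obtain ⟨e, he, hx, hy⟩ := h
  exact ⟨e, he, hy, hx⟩

theorem Conn.symm {S : Set G.edgeSet} {x y : V} (h : Conn S x y) : Conn S y x := by
  induction h with
  | refl => exact Relation.ReflTransGen.refl
  | tail _ h ih => exact Relation.ReflTransGen.head (edgeRel_symm h) ih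

theorem Conn.trans {S : Set G.edgeSet} {x y z : V} (h : Conn S x y) (h' : Conn S y z) :
    Conn S x z := Relation.ReflTransGen.trans h h'

theorem Conn.mono {S T : Set G.edgeSet} (hST : S ⊆ T) {x y : V} (h : Conn S x y) : Conn T x y :=
  Relation.ReflTransGen.mono (p := edgeRel T) (fun _ _ ⟨e, he, hx⟩ => ⟨e, hST he, hx⟩) _ _ h

theorem conn_map (σ : G ≃g G) {S : Set G.edgeSet} {x y : V} (h : Conn S x y) :
    Conn (σ.mapEdgeSet '' S) (σ x) (σ y) := by
  induction h with
  | refl => exact Relation.ReflTransGen.refl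
  | tail _ h ih =>
    obtain ⟨e, he, hx, hy⟩ := h
    exact Relation.ReflTransGen.tail ih ⟨_, ⟨e, he, rfl⟩, (mem_mapEdgeSet σ e _).2 hx,
      (mem_mapEdgeSet σ e _).2 hy⟩

/-- The vertex `u` is connected to distance `n`. -/
def arm (G : SimpleGraph V) (u : V) (n : ℝ) : Set (Set G.edgeSet) :=
  {S | ∃ v : V, n ≤ dist (u : ℝ × ℝ) v ∧ Conn S u v}

/-- The edges with an end-point at distance less than `n` from `u`. -/
def nearEdges (G : SimpleGraph V) (u : V) (n : ℝ) : Set G.edgeSet :=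
  {e | ∃ v ∈ (e : Sym2 V), dist (u : ℝ × ℝ) v < n}

theorem IsLattice.finite_nearEdges (hG : IsLattice G) (u : V) (n : ℝ) :
    (nearEdges G u n).Finite := by
  have := hG.finite_edges_touching (Metric.isBounded_ball (x := (u : ℝ × ℝ)) (r := n))
  simp only [Metric.mem_ball, dist_comm] at this
  exact this

theorem isUpperSet_arm (u : V) (n : ℝ) : IsUpperSet (arm G u n) :=
  fun _ _ h ⟨v, hv, hc⟩ => ⟨v, hv, hc.mono h⟩

/-- Follow the path until its first vertex at distance at least `n`: every edge used so far starts
at a vertex closer than `n`. -/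
theorem arm_inter_nearEdges {u : V} {n : ℝ} {S : Set G.edgeSet} (h : S ∈ arm G u n) :
    S ∩ nearEdges G u n ∈ arm G u n := by
  obtain ⟨v, hv, hc⟩ := h
  have : Conn (S ∩ nearEdges G u n) u v ∨ S ∩ nearEdges G u n ∈ arm G u n := by
    clear hv
    induction hc with
    | refl => exact Or.inl Relation.ReflTransGen.refl
    | @tail y z _ h ih =>
      obtain ⟨e, he, hx, hy⟩ := h
      refine ih.elim (fun hc => ?_) Or.inr
      by_cases hd : dist (u : ℝ × ℝ) y < n
      · exact Or.inl (Relation.ReflTransGen.tail hc ⟨e, ⟨he, _, hx, hd⟩, hx, hy⟩)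
      · exact Or.inr ⟨_, not_lt.1 hd, hc⟩
  exact this.elim (fun h => ⟨v, hv, h⟩) id

theorem localOn_arm (u : V) (n : ℝ) : LocalOn (nearEdges G u n) (arm G u n) := by
  have : ∀ S T : Set G.edgeSet, S ∩ nearEdges G u n = T ∩ nearEdges G u n →
      S ∈ arm G u n → T ∈ arm G u n := fun S T h hS =>
    isUpperSet_arm u n (Set.inter_subset_left) (h ▸ arm_inter_nearEdges hS)
  exact fun S T h => ⟨this S T h, this T S h.symm⟩

theorem arm_anti (u : V) {m n : ℝ} (h : m ≤ n) : arm G u n ⊆ arm G u m :=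
  fun _ ⟨v, hv, hc⟩ => ⟨v, h.trans hv, hc⟩

end Lattice

/-! ### Decision trees exploring clusters -/

section Exploration

variable {V : Set (ℝ × ℝ)} {G : SimpleGraph V}

open Classical

/-- The edge `e` touches the cluster of `B` in `O`. -/
def Touches (B : Set V) (O : Set G.edgeSet) (e : G.edgeSet) : Prop :=
  ∃ v ∈ (e : Sym2 V), ∃ b ∈ B, Conn O b v

/-- The exploration, within the edges of `U`, of the clusters of the vertices of `B`, when the edges
of `O` are already known to be open; the output is `f` of the open edges found. -/
def explore (B : Set V) (f : Finset G.edgeSet → ℝ) :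
    ℕ → Finset G.edgeSet → Finset G.edgeSet → DTree G.edgeSet
  | 0, _, O => DTree.leaf (f O)
  | n + 1, U, O =>
    if h : ∃ e ∈ U, Touches B (O : Set G.edgeSet) e then
      DTree.node h.choose (explore B f n (U.erase h.choose) O)
        (explore B f n (U.erase h.choose) (insert h.choose O))
    else DTree.leaf (f O)

theorem explore_unit (B : Set V) {f : Finset G.edgeSet → ℝ} (hf : ∀ S, 0 ≤ f S ∧ f S ≤ 1) (n : ℕ)
    (U O : Finset G.edgeSet) : (explore B f n U O).Unit := by
  induction n generalizing U O with
  | zero => exact hf O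
  | succ n ih =>
    rw [explore]
    split_ifs with h
    · exact ⟨ih _ _, ih _ _⟩
    · exact hf O

/-- With enough fuel, the exploration stops only when no unqueried edge touches the discovered
clusters; by `hf` the remaining edges are then irrelevant to `f`. -/
theorem explore_eval (B : Set V) {f : Finset G.edgeSet → ℝ}
    (hf : ∀ O S : Finset G.edgeSet, (∀ e ∈ S, ¬ Touches B (O : Set G.edgeSet) e) → f (O ∪ S) = f O)
    (n : ℕ) (U O S : Finset G.edgeSet) (hn : U.card ≤ n) :
    (explore B f n U O).eval S = f (O ∪ (S ∩ U)) := by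
  induction n generalizing U O S with
  | zero =>
    have : U = ∅ := Finset.card_eq_zero.1 (Nat.le_zero.1 hn)
    simp [explore, DTree.eval, this]
  | succ n ih =>
    rw [explore]
    split_ifs with h
    · have he := h.choose_spec.1
      set e := h.choose
      have hcard : (U.erase e).card ≤ n := by rw [Finset.card_erase_of_mem he]; omega
      rw [DTree.eval]
      split_ifs with heS
      · rw [ih _ _ _ hcard]
        congr 1
        ext a
        simp only [Finset.mem_union, Finset.mem_insert, Finset.mem_inter, Finset.mem_erase]
        by_cases hae : a = e
        · subst hae; simp [heS, he]
        · simp [hae]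
      · rw [ih _ _ _ hcard]
        congr 1
        ext a
        simp only [Finset.mem_union, Finset.mem_inter, Finset.mem_erase]
        by_cases hae : a = e
        · subst hae; simp [heS]
        · simp [hae]
    · push Not at h
      rw [DTree.eval, hf]
      exact fun e he => h e (Finset.mem_of_mem_inter_right he)

/-- This bounds revealments: an edge is queried only if one of its ends is connected to `B` by open
edges. -/
theorem explore_queries (B : Set V) (f : Finset G.edgeSet → ℝ) (n : ℕ) (U O S : Finset G.edgeSet)
    (a : G.edgeSet) (h : (explore B f n U O).Queries S a) :
    a ∈ U ∧ Touches B ((O ∪ S : Finset _) : Set G.edgeSet) a := by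
  induction n generalizing U O S with
  | zero => exact h.elim
  | succ n ih =>
    rw [explore] at h
    split_ifs at h with hex
    · have he := hex.choose_spec
      set e := hex.choose
      rw [DTree.Queries] at h
      rcases h with rfl | h
      · refine ⟨he.1, ?_⟩
        obtain ⟨v, hv, b, hb, hc⟩ := he.2
        exact ⟨v, hv, b, hb, hc.mono (by simp)⟩
      · split_ifs at h with heS
        · obtain ⟨h1, h2⟩ := ih _ _ _ h
          refine ⟨Finset.mem_of_mem_erase h1, ?_⟩
          have : insert e O ∪ S.erase e = O ∪ S := by
            ext x; simp only [Finset.mem_union, Finset.mem_insert, Finset.mem_erase]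
            by_cases hx : x = e
            · subst hx; simp [heS]
            · simp [hx]
          rwa [this] at h2
        · obtain ⟨h1, h2⟩ := ih _ _ _ h
          exact ⟨Finset.mem_of_mem_erase h1, h2⟩
    · exact h.elim

end Exploration

end

section

open Filter Topology

/-! ### OSSS applied to one-arm events -/

section Sharpness

variable {V : Set (ℝ × ℝ)} {G : SimpleGraph V}

open Classical

theorem exists_conn_between {l : ℝ} (hl0 : 0 ≤ l)
    (hl : ∀ u v : V, G.Adj u v → dist (u : ℝ × ℝ) v ≤ l) {S : Set G.edgeSet} {u v : V}
    (hc : Conn S u v) {k : ℝ} (hk0 : 0 ≤ k) (hk : k ≤ dist (u : ℝ × ℝ) v) :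
    ∃ b : V, k ≤ dist (u : ℝ × ℝ) b ∧ dist (u : ℝ × ℝ) b ≤ k + l ∧ Conn S u b := by
  induction hc with
  | refl => exact ⟨u, hk, by simp; linarith, Relation.ReflTransGen.refl⟩
  | @tail y z hy h ih =>
    by_cases hky : k ≤ dist (u : ℝ × ℝ) y
    · exact ih hky
    · obtain ⟨e, he, h1, h2⟩ := h
      refine ⟨z, hk, ?_, Relation.ReflTransGen.tail hy ⟨e, he, h1, h2⟩⟩
      have := dist_le_of_mem hl0 hl e h1 h2
      linarith [dist_triangle (u : ℝ × ℝ) y z, not_le.1 hky]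

/-- The vertices at distance between `k` and `k + l` of `u`. -/
def shell (u : V) (k l : ℝ) : Set V := {b | k ≤ dist (u : ℝ × ℝ) b ∧ dist (u : ℝ × ℝ) b ≤ k + l}

/-- Edges have length at most `l`, so a path from `u` to distance `n` has a vertex in the shell and
lies entirely in the cluster of that vertex. Exploring the clusters of the shell therefore decides
the arm event. -/
theorem ind_arm_union {l : ℝ} (hl0 : 0 ≤ l)
    (hl : ∀ u v : V, G.Adj u v → dist (u : ℝ × ℝ) v ≤ l) {u : V} {n k : ℝ} (hk0 : 0 ≤ k)
    (hkn : k ≤ n) (O S : Finset G.edgeSet)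
    (h : ∀ e ∈ S, ¬ Touches (shell u k l) (O : Set G.edgeSet) e) :
    ind (arm G u n) ((O ∪ S : Finset _) : Set G.edgeSet) = ind (arm G u n) (O : Set G.edgeSet) := by
  by_cases hO : (O : Set G.edgeSet) ∈ arm G u n
  · rw [ind_of_mem hO, ind_of_mem (isUpperSet_arm u n (by simp) hO)]
  · rw [ind_of_notMem hO, ind_of_notMem]
    rintro ⟨v, hv, hc⟩
    obtain ⟨b, hb1, hb2, hcb⟩ := exists_conn_between hl0 hl hc hk0 (hkn.trans hv)
    have key : ∀ z, Conn ((O ∪ S : Finset _) : Set G.edgeSet) b z → Conn (O : Set G.edgeSet) b z := by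
      intro z hz
      induction hz with
      | refl => exact Relation.ReflTransGen.refl
      | @tail y z _ hyz ih =>
        obtain ⟨e, he, h1, h2⟩ := hyz
        simp only [Finset.coe_union, Set.mem_union, Finset.mem_coe] at he
        rcases he with he | he
        · exact Relation.ReflTransGen.tail ih ⟨e, he, h1, h2⟩
        · exact absurd ⟨y, h1, b, ⟨hb1, hb2⟩, ih⟩ (h e he)
    exact hO ⟨v, hv, (key u hcb.symm).symm.trans (key v (hcb.symm.trans hc))⟩

/-- On each side of `d` distinct integers `k` give distinct floors of `|d - k|`, all below `n + l +
1`; the first `l` of them are truncated to index zero. The two sides give the factor 2. -/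
theorem sum_floor_le {Θ : ℕ → ℝ} (hΘ : ∀ j, 0 ≤ Θ j) (n l : ℕ) {d : ℝ} (hd0 : 0 ≤ d)
    (hd : d ≤ n + l) :
    ∑ k ∈ Finset.Icc 1 n, Θ (⌊|d - k|⌋₊ - l) ≤
      2 * (l * Θ 0 + ∑ j ∈ Finset.range (n + 1), Θ j) := by
  have hsum : ∑ m ∈ Finset.range (l + (n + 1)), Θ (m - l) =
      l * Θ 0 + ∑ j ∈ Finset.range (n + 1), Θ j := by
    rw [Finset.sum_range_add]
    congr 1
    · rw [Finset.sum_congr rfl (g := fun _ => Θ 0)]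
      · simp
      · intro m hm
        rw [Nat.sub_eq_zero_of_le (Finset.mem_range.1 hm).le]
    · exact Finset.sum_congr rfl fun j _ => by rw [Nat.add_sub_cancel_left]
  have hpiece : ∀ s ⊆ Finset.Icc 1 n, Set.InjOn (fun k : ℕ => ⌊|d - k|⌋₊) s →
      ∑ k ∈ s, Θ (⌊|d - k|⌋₊ - l) ≤ l * Θ 0 + ∑ j ∈ Finset.range (n + 1), Θ j := by
    intro s hs hinj
    rw [← hsum, ← Finset.sum_image (f := fun m => Θ (m - l)) (g := fun k : ℕ => ⌊|d - k|⌋₊) hinj]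
    refine Finset.sum_le_sum_of_subset_of_nonneg ?_ fun _ _ _ => hΘ _
    intro m hm
    obtain ⟨k, hk, rfl⟩ := Finset.mem_image.1 hm
    have hk' := Finset.mem_Icc.1 (hs hk)
    rw [Finset.mem_range]
    have h1 : (1 : ℝ) ≤ k := by exact_mod_cast hk'.1
    have h2 : (k : ℝ) ≤ n := by exact_mod_cast hk'.2
    have hl0 : (0 : ℝ) ≤ l := Nat.cast_nonneg l
    have h3 : |d - k| < ((l + (n + 1) : ℕ) : ℝ) := by
      rw [abs_lt]; push_cast
      constructor <;> linarith
    exact (Nat.floor_lt (abs_nonneg _)).2 h3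
  have hinj : ∀ (a b : ℝ) (i : ℤ), 0 ≤ a → a - b = i → ⌊a⌋₊ = ⌊b⌋₊ → 0 ≤ b → i = 0 := by
    intro a b i ha hab hfl hb
    have h1 := Nat.floor_le ha
    have h2 := Nat.lt_floor_add_one a
    have h3 := Nat.floor_le hb
    have h4 := Nat.lt_floor_add_one b
    rw [hfl] at h1 h2
    have h5 : (i : ℝ) < 1 := by linarith
    have h6 : (-1 : ℝ) < i := by linarith
    have h5' : i < 1 := by exact_mod_cast h5
    have h6' : -1 < i := by exact_mod_cast h6
    omega
  rw [← Finset.sum_filter_add_sum_filter_not (Finset.Icc 1 n) (fun k : ℕ => (k : ℝ) ≤ d), two_mul]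
  refine add_le_add (hpiece _ (Finset.filter_subset _ _) ?_)
    (hpiece _ (Finset.filter_subset _ _) ?_)
  · intro k hk k' hk' h
    simp only [Finset.coe_filter, Set.mem_ofPred_eq] at hk hk'
    simp only [abs_of_nonneg (sub_nonneg.2 hk.2), abs_of_nonneg (sub_nonneg.2 hk'.2)] at h
    have := hinj (d - k) (d - k') ((k' : ℤ) - k) (sub_nonneg.2 hk.2) (by push_cast; ring) h
      (sub_nonneg.2 hk'.2)
    omega
  · intro k hk k' hk' h
    simp only [Finset.coe_filter, Set.mem_ofPred_eq, not_le] at hk hk'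
    have a1 : d - (k : ℝ) ≤ 0 := by linarith [hk.2]
    have a2 : d - (k' : ℝ) ≤ 0 := by linarith [hk'.2]
    simp only [abs_of_nonpos a1, abs_of_nonpos a2] at h
    have := hinj (-(d - k)) (-(d - k')) ((k : ℤ) - k') (by linarith) (by push_cast; ring) h
      (by linarith)
    omega

theorem wcov_sum_right {α ι : Type*} [DecidableEq α] (E : Finset α) (w g : Finset α → ℝ)
    (s : Finset ι) (f : ι → Finset α → ℝ) :
    wcov E w g (fun S => ∑ i ∈ s, f i S) = ∑ i ∈ s, wcov E w g (f i) := by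
  simp only [wcov, Finset.mul_sum, wexp_sum, Finset.sum_sub_distrib]

theorem wcov_card {α : Type*} [DecidableEq α] (E : Finset α) (w g : Finset α → ℝ) :
    wcov E w g (fun S => (S.card : ℝ)) = ∑ a ∈ E, wcov E w g fun S => if a ∈ S then 1 else 0 := by
  rw [← wcov_sum_right, wcov, wcov]
  have : ∀ S ⊆ E, (S.card : ℝ) = ∑ a ∈ E, if a ∈ S then (1 : ℝ) else 0 := by
    intro S hS
    rw [Finset.sum_ite_mem, Finset.inter_eq_right.2 hS]; simp
  rw [wexp_congr (f := fun S => (S.card : ℝ)) this, wexp_congr (f := fun S => g S * (S.card : ℝ))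
    fun S hS => by rw [this S hS]]

/-- The differential inequality behind sharpness, before differentiation. -/
theorem arm_variance_le {q x : ℝ} (hq : 1 ≤ q) (hx : 0 < x) {l : ℕ}
    (hl : ∀ u v : V, G.Adj u v → dist (u : ℝ × ℝ) v ≤ l) (u : V) (n : ℕ) {E : Finset G.edgeSet}
    (hfin : (nearEdges G u n).Finite) {Θ : ℕ → ℝ}
    (hΘ : ∀ j, 0 ≤ Θ j)
    (hΘE : ∀ a ∈ nearEdges G u n, ∀ v ∈ (a : Sym2 V), ∀ j ≤ n,
      wexp E (wiredWeight q x E) (fun S => ind (arm G v j) ↑S) ≤ Θ j) :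
    n * (wexp E (wiredWeight q x E) (fun S => ind (arm G u n) ↑S) *
      (1 - wexp E (wiredWeight q x E) (fun S => ind (arm G u n) ↑S))) ≤
      4 * (l + 1) * (∑ j ∈ Finset.range (n + 1), Θ j) *
        wcov E (wiredWeight q x E) (fun S => ind (arm G u n) ↑S) (fun S => (S.card : ℝ)) := by
  set w := wiredWeight q x E with hwdef
  have hw : IsFKG E w := isFKG_wiredWeight hq hx E
  set g : Finset G.edgeSet → ℝ := fun S => ind (arm G u n) ↑S with hg
  have hgm : Monotone g := fun S T h => ind_mono (isUpperSet_arm u n) (by exact_mod_cast h)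
  have hDom : Dom E w w := ⟨hw.pos, hw.pos, hw.lattice⟩
  set tot := ∑ j ∈ Finset.range (n + 1), Θ j with htot
  have htot0 : Θ 0 ≤ tot :=
    Finset.single_le_sum (f := Θ) (fun j _ => hΘ j) (Finset.mem_range.2 (Nat.succ_pos n))
  let U := hfin.toFinset
  -- One tree per shell radius `k`. All compute the same event, and averaging over `k` makes the
  -- mean revealment of each edge of order `tot / n`.
  let t : ℕ → DTree G.edgeSet := fun k => explore (shell u k l) g U.card U ∅
  have heval : ∀ k ∈ Finset.Icc 1 n, (t k).eval = g := by
    intro k hk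
    funext S
    have hk' := Finset.mem_Icc.1 hk
    rw [explore_eval _ (fun O S h => ind_arm_union (Nat.cast_nonneg l) hl (Nat.cast_nonneg k)
      (by exact_mod_cast hk'.2) O S h) _ _ _ _ le_rfl, Finset.empty_union]
    have h1 : ((S ∩ U : Finset _) : Set G.edgeSet) = ↑S ∩ nearEdges G u n := by
      simp [U]
    simp only [hg, h1]
    have h2 := localOn_arm u (n : ℝ) (↑S ∩ nearEdges G u n) (↑S : Set G.edgeSet) (by
      rw [Set.inter_assoc, Set.inter_self])
    by_cases h : (S : Set G.edgeSet) ∈ arm G u n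
    · rw [ind_of_mem h, ind_of_mem (h2.2 h)]
    · rw [ind_of_notMem h, ind_of_notMem fun h' => h (h2.1 h')]
  have hvar : wexp E w g * (1 - wexp E w g) = wcov E w g g := by
    have : wexp E w (fun S => g S * g S) = wexp E w g := wexp_congr fun S _ => by
      simp only [hg]
      by_cases h : (S : Set G.edgeSet) ∈ arm G u n
      · rw [ind_of_mem h]; ring
      · rw [ind_of_notMem h]; ring
    rw [wcov, this]; ring
  have hunit : ∀ S, 0 ≤ g S ∧ g S ≤ 1 := fun S => ⟨ind_nonneg _ _, ind_le_one _ _⟩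
  have hosss : ∀ k ∈ Finset.Icc 1 n, wexp E w g * (1 - wexp E w g) ≤
      ∑ a ∈ E, (t k).reveal E w a * wcov E w g fun S => if a ∈ S then 1 else 0 := by
    intro k hk
    have := DTree.wcov_eval_le hw hgm (t k) (explore_unit _ hunit _ _ _)
    rwa [heval k hk, ← hvar] at this
  have hsum := Finset.sum_le_sum hosss
  rw [Finset.sum_const, Nat.card_Icc, Nat.add_sub_cancel, nsmul_eq_mul, Finset.sum_comm] at hsum
  refine hsum.trans ?_
  rw [wcov_card, Finset.mul_sum]
  refine Finset.sum_le_sum fun a haE => ?_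
  rw [← Finset.sum_mul]
  refine mul_le_mul_of_nonneg_right ?_ (DTree.wcov_edge_nonneg hDom hgm a)
  by_cases haU : a ∈ nearEdges G u n
  · obtain ⟨v₁, v₂, hav, hadj⟩ := exists_eq_mk a
    have hdist : ∀ v ∈ (a : Sym2 V), dist (u : ℝ × ℝ) v ≤ n + l := by
      intro v hv
      obtain ⟨v', hv', hd⟩ := haU
      have := dist_le_of_mem (Nat.cast_nonneg l) hl a hv' hv
      linarith [dist_triangle (u : ℝ × ℝ) v' v]
    have hrev : ∀ k ∈ Finset.Icc 1 n, (t k).reveal E w a ≤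
        Θ (⌊|dist (u : ℝ × ℝ) v₁ - k|⌋₊ - l) + Θ (⌊|dist (u : ℝ × ℝ) v₂ - k|⌋₊ - l) := by
      intro k hk
      have hk' := Finset.mem_Icc.1 hk
      have hkn : (k : ℝ) ≤ n := by exact_mod_cast hk'.2
      have hk1 : (1 : ℝ) ≤ k := by exact_mod_cast hk'.1
      have hv1 : v₁ ∈ (a : Sym2 V) := by rw [hav]; simp
      have hv2 : v₂ ∈ (a : Sym2 V) := by rw [hav]; simp
      have hj : ∀ v ∈ (a : Sym2 V), ⌊|dist (u : ℝ × ℝ) v - k|⌋₊ - l ≤ n := by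
        intro v hv
        have h1 : |dist (u : ℝ × ℝ) v - k| ≤ ((n + l : ℕ) : ℝ) := by
          have := hdist v hv
          have h0 := dist_nonneg (x := (u : ℝ × ℝ)) (y := v)
          have hl0 : (0 : ℝ) ≤ l := Nat.cast_nonneg l
          rw [abs_le]; push_cast
          constructor <;> linarith
        have := Nat.floor_le_of_le h1
        omega
      refine le_trans ?_ (add_le_add (hΘE a haU v₁ hv1 _ (hj v₁ hv1))
        (hΘE a haU v₂ hv2 _ (hj v₂ hv2)))
      rw [← wexp_add, DTree.reveal]
      refine wexp_mono hw.pos fun S _ => ?_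
      have hn1 := ind_nonneg (arm G v₁ ((⌊|dist (u : ℝ × ℝ) v₁ - k|⌋₊ - l : ℕ) : ℝ))
        (S : Set G.edgeSet)
      have hn2 := ind_nonneg (arm G v₂ ((⌊|dist (u : ℝ × ℝ) v₂ - k|⌋₊ - l : ℕ) : ℝ))
        (S : Set G.edgeSet)
      split_ifs with hQ
      · obtain ⟨_, v, hva, b, hb, hc⟩ := explore_queries _ _ _ _ _ _ _ hQ
        rw [Finset.empty_union] at hc
        -- The end `v` of a queried edge is connected to a vertex at distance between `k` and `k +
        -- l` from `u`, hence at distance at least `|dist u v - k| - l` from `v`.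
        have harm : (S : Set G.edgeSet) ∈
            arm G v ((⌊|dist (u : ℝ × ℝ) v - k|⌋₊ - l : ℕ) : ℝ) := by
          refine ⟨b, ?_, hc.symm⟩
          have t1 := dist_triangle (u : ℝ × ℝ) v b
          have t2 := dist_triangle (u : ℝ × ℝ) b v
          rw [dist_comm (b : ℝ × ℝ) v] at t2
          have h4 : |dist (u : ℝ × ℝ) v - k| ≤ dist (v : ℝ × ℝ) b + l := by
            have hl0 : (0 : ℝ) ≤ l := Nat.cast_nonneg l
            rw [abs_le]
            constructor <;> linarith [hb.1, hb.2]
          have h5 := Nat.floor_le (abs_nonneg (dist (u : ℝ × ℝ) v - k))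
          rcases le_total ⌊|dist (u : ℝ × ℝ) v - k|⌋₊ l with h | h
          · rw [Nat.sub_eq_zero_of_le h]; simp
          · rw [Nat.cast_sub h]; linarith
        rw [hav, Sym2.mem_iff] at hva
        rcases hva with rfl | rfl
        · rw [ind_of_mem harm]; linarith
        · rw [ind_of_mem harm]; linarith
      · linarith
    have hb : ∀ v ∈ (a : Sym2 V), ∑ k ∈ Finset.Icc 1 n, Θ (⌊|dist (u : ℝ × ℝ) v - k|⌋₊ - l) ≤
        2 * ((l + 1) * tot) := by
      intro v hv
      have hl0 : (0 : ℝ) ≤ l := Nat.cast_nonneg l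
      have := mul_le_mul_of_nonneg_left htot0 hl0
      refine (sum_floor_le hΘ n l dist_nonneg (hdist v hv)).trans ?_
      linarith
    refine (Finset.sum_le_sum hrev).trans ?_
    rw [Finset.sum_add_distrib]
    have h1 := hb v₁ (by rw [hav]; simp)
    have h2 := hb v₂ (by rw [hav]; simp)
    linarith
  · have : ∀ k ∈ Finset.Icc 1 n, (t k).reveal E w a = 0 := fun k _ =>
      wexp_eq_const hw.pos fun S _ => if_neg fun hQ => haU (by
        have := (explore_queries _ _ _ _ _ _ _ hQ).1
        simpa [U] using this)
    rw [Finset.sum_eq_zero this]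
    have : 0 ≤ tot := (hΘ 0).trans htot0
    positivity

end Sharpness

/-! ### Derivative in the edge parameter -/

section Derivative

variable {α : Type*} [DecidableEq α]

/-- The logarithmic derivative of `y ^ |S|` at `x` is `|S| / x`; normalisation turns it into a
covariance. -/
theorem hasDerivAt_wexp (E : Finset α) {h : Finset α → ℝ} (hh : ∀ S, 0 < h S) (f : Finset α → ℝ)
    {x : ℝ} (hx : 0 < x) :
    HasDerivAt (fun y => wexp E (fun S => y ^ S.card * h S) f)
      (wcov E (fun S => x ^ S.card * h S) f (fun S => (S.card : ℝ)) / x) x := by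
  have hd : ∀ f : Finset α → ℝ, HasDerivAt (fun y => wsum E (fun S => y ^ S.card * h S) f)
      (wsum E (fun S => x ^ S.card * h S) (fun S => f S * S.card) / x) x := by
    intro f
    have : wsum E (fun S => x ^ S.card * h S) (fun S => f S * S.card) / x =
        ∑ S ∈ E.powerset, (S.card * x ^ (S.card - 1)) * h S * f S := by
      rw [wsum, Finset.sum_div]
      refine Finset.sum_congr rfl fun S _ => ?_
      rcases Nat.eq_zero_or_pos S.card with h0 | h0
      · simp [h0]
      · obtain ⟨m, hm⟩ := Nat.exists_eq_succ_of_ne_zero h0.ne'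
        rw [hm, Nat.succ_sub_one, pow_succ]
        field_simp
    rw [this]
    refine HasDerivAt.fun_sum fun S _ => ?_
    exact ((hasDerivAt_pow S.card x).mul_const (h S)).mul_const (f S)
  have hz : wsum E (fun S => x ^ S.card * h S) 1 ≠ 0 :=
    (wsum_one_pos E fun S => mul_pos (pow_pos hx _) (hh S)).ne'
  have := (hd f).div (hd 1) hz
  have e1 : wsum E (fun S => x ^ S.card * h S) (fun S => (1 : Finset α → ℝ) S * S.card) =
      wsum E (fun S => x ^ S.card * h S) (fun S => (S.card : ℝ)) := wsum_congr fun S _ => by simp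
  rw [e1] at this
  refine this.congr_deriv ?_
  simp only [wcov, wexp]
  field_simp

end Derivative

end

section

open Filter Topology

/-! ### Integrating the differential inequality -/

section Decay

variable {V : Set (ℝ × ℝ)} {G : SimpleGraph V}

open Classical

/-- The largest probability that a vertex is connected to distance `n`. -/
def theta (G : SimpleGraph V) (q : ℝ) (n : ℕ) (x : ℝ) : ℝ := ⨆ u : V, mu q x (arm G u n)

variable {q x y : ℝ}

theorem bddAbove_mu_arm (hq : 1 ≤ q) (hx : 0 < x) (n : ℕ) :
    BddAbove (Set.range fun u : V => mu q x (arm G u n)) :=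
  ⟨1, by rintro _ ⟨u, rfl⟩; exact mu_le_one hq hx _⟩

theorem mu_arm_le_theta (hq : 1 ≤ q) (hx : 0 < x) (n : ℕ) (u : V) :
    mu q x (arm G u n) ≤ theta G q n x := le_ciSup (bddAbove_mu_arm hq hx n) u

theorem theta_nonneg (hq : 1 ≤ q) (hx : 0 < x) (n : ℕ) : 0 ≤ theta G q n x :=
  Real.iSup_nonneg fun _ => mu_nonneg hq hx _

theorem theta_le_one [Nonempty V] (hq : 1 ≤ q) (hx : 0 < x) (n : ℕ) : theta G q n x ≤ 1 :=
  ciSup_le fun _ => mu_le_one hq hx _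

theorem theta_anti [Nonempty V] (hq : 1 ≤ q) (hx : 0 < x) {m n : ℕ} (h : m ≤ n) :
    theta G q n x ≤ theta G q m x :=
  ciSup_mono (bddAbove_mu_arm hq hx m) fun u => mu_mono hq hx (arm_anti u (by exact_mod_cast h))

theorem theta_mono [Nonempty V] (hq : 1 ≤ q) (hx : 0 < x) (hxy : x ≤ y) (n : ℕ) :
    theta G q n x ≤ theta G q n y :=
  ciSup_mono (bddAbove_mu_arm hq (hx.trans_le hxy) n) fun u =>
    mu_mono_param hq hx hxy (isUpperSet_arm u n)

theorem theta_zero [Nonempty V] (hq : 1 ≤ q) (hx : 0 < x) : theta G q 0 x = 1 := by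
  have : ∀ u : V, mu q x (arm G u (0 : ℕ)) = 1 := fun u => by
    have : arm G u (0 : ℕ) = Set.univ := Set.eq_univ_of_forall fun S =>
      ⟨u, by simp, Relation.ReflTransGen.refl⟩
    rw [this, mu_univ hq hx]
  simp only [theta, this, ciSup_const]

theorem wiredExp_ind_of_local {D : Set G.edgeSet} {A : Set (Set G.edgeSet)} (h : LocalOn D A)
    {E : Finset G.edgeSet} (hD : D ⊆ E) :
    wiredExp q x E (ind A) = wexp E (wiredWeight q x E) fun S => ind A ↑S := by
  refine wexp_congr fun S _ => ?_
  have := h.mem_union_compl_iff hD (S : Set G.edgeSet)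
  by_cases hS : (S : Set G.edgeSet) ∈ A
  · rw [ind_of_mem hS, ind_of_mem (this.2 hS)]
  · rw [ind_of_notMem hS, ind_of_notMem fun h => hS (this.1 h)]

/-- Decay of the one-arm probability below a parameter where it is small. -/
theorem theta_le_exp [Nonempty V] (hG : IsLattice G) (hq : 1 ≤ q) {l : ℕ}
    (hl : ∀ u v : V, G.Adj u v → dist (u : ℝ × ℝ) v ≤ l) (hx : 0 < x) (hxy : x < y) (n : ℕ)
    (hn : theta G q n y ≤ 1 / 4) :
    theta G q n x ≤ Real.exp (-((y - x) * n /
      (16 * (l + 1) * y * ∑ j ∈ Finset.range (n + 1), theta G q j y))) := by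
  have hy := hx.trans hxy
  set tot := ∑ j ∈ Finset.range (n + 1), theta G q j y with htot
  have htot1 : 1 ≤ tot := by
    rw [← theta_zero (G := G) hq hy]
    exact Finset.single_le_sum (f := fun j => theta G q j y) (fun j _ => theta_nonneg hq hy j)
      (Finset.mem_range.2 (Nat.succ_pos n))
  refine ciSup_le fun u => ?_
  -- The error of a finite-volume approximation: at most 1/4, so that the arm probability at `y`
  -- stays below 1/2, and `(n + 1) ε ≤ 1 ≤ tot`, so that the sum of the errors at most doubles
  -- `tot`.
  set ε : ℝ := 1 / (n + 4) with hε
  have hε0 : 0 < ε := by positivity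
  have hε4 : ε ≤ 1 / 4 := by
    rw [hε]; exact one_div_le_one_div_of_le (by norm_num) (by linarith [Nat.cast_nonneg (α := ℝ) n])
  have hfin := hG.finite_nearEdges u (n : ℝ)
  let W : Set V := {v | ∃ a ∈ nearEdges G u n, v ∈ (a : Sym2 V)} ∪ {u}
  have hW : W.Finite := by
    refine Set.Finite.union ((verts_finite hfin.toFinset).subset ?_) (Set.finite_singleton u)
    rintro v ⟨a, ha, hv⟩
    exact ⟨a, by simpa using ha, hv⟩
  -- Finitely many vertices and radii are involved, so one volume `E` approximates all their arm
  -- probabilities at `y`; smaller parameters follow by monotonicity.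
  have hev : ∀ᶠ E : Finset G.edgeSet in atTop, ∀ v ∈ W, ∀ j ∈ Finset.range (n + 1),
      wexp E (wiredWeight q y E) (fun S => ind (arm G v (j : ℕ)) ↑S) ≤ theta G q j y + ε := by
    refine (eventually_all_finite hW).2 fun v _ => (eventually_all_finset _).2 fun j _ => ?_
    have h1 := (tendsto_mu hq hy (isUpperSet_arm (G := G) v (j : ℝ))).eventually
      (gt_mem_nhds (show mu q y (arm G v (j : ℝ)) < theta G q j y + ε by
        linarith [mu_arm_le_theta (G := G) hq hy j v]))
    filter_upwards [h1, eventually_ge_atTop (hG.finite_nearEdges v (j : ℝ)).toFinset] with E hE1 hE2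
    rw [← wiredExp_ind_of_local (localOn_arm v (j : ℝ))]
    · exact hE1.le
    · intro e he
      exact_mod_cast hE2 (by simpa using he)
  obtain ⟨E, hE, hEu⟩ := (hev.and (eventually_ge_atTop hfin.toFinset)).exists
  have hEnear : nearEdges G u n ⊆ E := fun e he => by
    exact_mod_cast hEu (by simpa using he)
  set P : ℝ → ℝ := fun z => wexp E (fun S => z ^ S.card * q ^ wiredRank E S)
    (fun S => ind (arm G u n) ↑S) with hP
  have hPmono : ∀ z, 0 < z → z ≤ y → ∀ v : V, ∀ j : ℕ,
      wexp E (wiredWeight q z E) (fun S => ind (arm G v j) ↑S) ≤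
      wexp E (wiredWeight q y E) (fun S => ind (arm G v j) ↑S) := by
    intro z hz hzy v j
    refine wexp_holley (wiredWeight_pos hq hz E) (wiredWeight_pos hq (hz.trans_le hzy) E) ?_
      (fun S T h => ind_mono (isUpperSet_arm v j) (by exact_mod_cast h))
    intro a ha b hb
    refine weight_mul_le hq (by positivity) (pow_nonneg (hz.le.trans hzy) _)
      (pow_mul_pow_le_of_card hz.le hzy a b) ?_
    have := wiredRank_add_le (subset_refl E) a b
    rwa [Finset.inter_eq_left.2 hb, Finset.inter_eq_left.2 (Finset.union_subset ha hb)] at this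
  have hPmono' : ∀ z z', 0 < z → z ≤ z' → P z ≤ P z' := by
    intro z z' hz hzz
    refine wexp_holley (wiredWeight_pos hq hz E) (wiredWeight_pos hq (hz.trans_le hzz) E) ?_
      (fun S T h => ind_mono (isUpperSet_arm u n) (by exact_mod_cast h))
    intro a ha b hb
    refine weight_mul_le hq (by positivity) (pow_nonneg (hz.le.trans hzz) _)
      (pow_mul_pow_le_of_card hz.le hzz a b) ?_
    have := wiredRank_add_le (subset_refl E) a b
    rwa [Finset.inter_eq_left.2 hb, Finset.inter_eq_left.2 (Finset.union_subset ha hb)] at this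
  have hmuP : mu q x (arm G u n) ≤ P x := by
    have := mu_le_wiredExp (A := arm G u n) hq hx E
    rwa [wiredExp_ind_of_local (localOn_arm u n) hEnear] at this
  refine hmuP.trans ?_
  by_cases hP0 : P x ≤ 0
  · exact hP0.trans (Real.exp_pos _).le
  push Not at hP0
  -- The 16 is the 4 of `arm_variance_le`, times 2 for the sum of errors, times 2 for `1 - P ≥ 1/2`;
  -- the `y` comes from the division by `z ≤ y` in the derivative.
  set κ : ℝ := n / (16 * (l + 1) * y * tot) with hκ
  have hden : 0 < 16 * ((l : ℝ) + 1) * y * tot := by positivity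
  have hPpos : ∀ z, x ≤ z → 0 < P z := fun z hz => hP0.trans_le (hPmono' x z hx hz)
  have hPy : P y ≤ 1 / 2 := by
    have := hE u (Or.inr rfl) n (Finset.mem_range.2 (Nat.lt_succ_self n))
    have h2 : P y = wexp E (wiredWeight q y E) (fun S => ind (arm G u n) ↑S) := rfl
    rw [h2]; linarith
  have hder : ∀ z, 0 < z → HasDerivAt P (wcov E (wiredWeight q z E)
      (fun S => ind (arm G u n) ↑S) (fun S => (S.card : ℝ)) / z) z := fun z hz =>
    hasDerivAt_wexp E (fun S => pow_pos (by linarith) _) _ hz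
  have hbound : ∀ z, x ≤ z → z ≤ y → κ * P z ≤ wcov E (wiredWeight q z E)
      (fun S => ind (arm G u n) ↑S) (fun S => (S.card : ℝ)) / z := by
    intro z hxz hzy
    have hz := hx.trans_le hxz
    have key := arm_variance_le hq hz hl u n (E := E) hfin (Θ := fun j => theta G q j y + ε)
      (fun j => add_nonneg (theta_nonneg hq hy j) hε0.le) (fun a ha v hv j hj =>
        (hPmono z hz hzy v j).trans (hE v (Or.inl ⟨a, ha, hv⟩) j
          (Finset.mem_range.2 (Nat.lt_succ_of_le hj))))
    have hsum : ∑ j ∈ Finset.range (n + 1), (theta G q j y + ε) ≤ 2 * tot := by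
      rw [Finset.sum_add_distrib, Finset.sum_const, Finset.card_range, nsmul_eq_mul]
      have : ((n + 1 : ℕ) : ℝ) * ε ≤ 1 := by
        rw [hε, mul_one_div, div_le_one (by positivity)]; push_cast; linarith
      linarith
    have hcov0 : 0 ≤ wcov E (wiredWeight q z E) (fun S => ind (arm G u n) ↑S)
        (fun S => (S.card : ℝ)) := by
      refine sub_nonneg.2 ((isFKG_wiredWeight hq hz E).wexp_mul_le
        (fun S T h => ind_mono (isUpperSet_arm u n) (by exact_mod_cast h)) fun S T h => ?_)
      exact_mod_cast Finset.card_le_card h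
    have hPz : P z ≤ 1 / 2 := (hPmono' z y hz hzy).trans hPy
    have hPz0 := hPpos z hxz
    change n * (P z * (1 - P z)) ≤ _ at key
    set C := wcov E (wiredWeight q z E) (fun S => ind (arm G u n) ↑S) (fun S => (S.card : ℝ))
    have h1 : (n : ℝ) * (P z * (1 / 2)) ≤ n * (P z * (1 - P z)) := by
      have : P z * (1 / 2) ≤ P z * (1 - P z) := mul_le_mul_of_nonneg_left (by linarith) hPz0.le
      exact mul_le_mul_of_nonneg_left this (Nat.cast_nonneg n)
    have h2 : 4 * ((l : ℝ) + 1) * (∑ j ∈ Finset.range (n + 1), (theta G q j y + ε)) * C ≤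
        4 * ((l : ℝ) + 1) * (2 * tot) * C := by
      refine mul_le_mul_of_nonneg_right (mul_le_mul_of_nonneg_left hsum (by positivity)) hcov0
    have h3 : (n : ℝ) * P z ≤ 16 * ((l : ℝ) + 1) * tot * C := by linarith
    rw [hκ, le_div_iff₀ hz, div_mul_eq_mul_div, div_mul_eq_mul_div, div_le_iff₀ hden]
    calc (n : ℝ) * P z * z ≤ 16 * ((l : ℝ) + 1) * tot * C * y :=
          mul_le_mul h3 hzy hz.le (by positivity)
      _ = _ := by ring
  -- The differential inequality `P' ≥ κ P` says that `log P - κ z` increases.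
  have hmono : MonotoneOn (fun z => Real.log (P z) - κ * z) (Set.Icc x y) := by
    have hd : ∀ z ∈ Set.Icc x y, HasDerivAt (fun z => Real.log (P z) - κ * z)
        (wcov E (wiredWeight q z E) (fun S => ind (arm G u n) ↑S) (fun S => (S.card : ℝ)) / z / P z
          - κ * 1) z := fun z hz =>
      ((hder z (hx.trans_le hz.1)).log (hPpos z hz.1).ne').sub ((hasDerivAt_id z).const_mul κ)
    refine monotoneOn_of_deriv_nonneg (convex_Icc x y)
      (fun z hz => (hd z hz).continuousAt.continuousWithinAt) (fun z hz => ?_) fun z hz => ?_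
    · rw [interior_Icc] at hz
      exact (hd z (Set.Ioo_subset_Icc_self hz)).differentiableAt.differentiableWithinAt
    · rw [interior_Icc] at hz
      have hz' := Set.Ioo_subset_Icc_self hz
      rw [(hd z hz').deriv, sub_nonneg, mul_one, le_div_iff₀ (hPpos z hz'.1)]
      exact hbound z hz'.1 hz'.2
  have hfinal := hmono (Set.left_mem_Icc.2 hxy.le) (Set.right_mem_Icc.2 hxy.le) hxy.le
  simp only at hfinal
  have hlog : Real.log (P y) ≤ 0 := Real.log_nonpos (hPpos y hxy.le).le (by linarith)
  have : Real.log (P x) ≤ -((y - x) * n / (16 * (l + 1) * y * tot)) := by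
    have e : (y - x) * n / (16 * (l + 1) * y * tot) = κ * y - κ * x := by
      rw [hκ]; field_simp
    rw [e]; linarith
  exact (Real.log_le_iff_le_exp hP0).1 this

/-- If the values at `x₁` were not bounded below, a decay of order `M⁻¹` at one scale `M` would be
bootstrapped while the parameter descends by halves to `x₀`. Along suitable scales `M θ_M(x₀)` would
then tend to zero, against the lower bound `c' / M`. -/
theorem exists_pos_le_of_exp_step {θ : ℕ → ℝ → ℝ} {c c' x₀ x₁ : ℝ} {n₀ : ℕ} (hc : 0 < c)
    (hc' : 0 < c') (h01 : x₀ < x₁)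
    (hanti : ∀ x, x₀ ≤ x → ∀ m n, m ≤ n → θ n x ≤ θ m x)
    (hmono : ∀ x y, x₀ ≤ x → x ≤ y → ∀ n, θ n x ≤ θ n y)
    (hnn : ∀ x, x₀ ≤ x → ∀ n, 0 ≤ θ n x) (hle : ∀ x, x₀ ≤ x → ∀ n, θ n x ≤ 1)
    (hpos : ∀ x, x₀ ≤ x → θ 0 x = 1)
    (hstep : ∀ n x y, x₀ ≤ x → x < y → y ≤ x₁ → θ n y ≤ 1 / 4 →
      θ n x ≤ Real.exp (-(c * (y - x) * n / ∑ j ∈ Finset.range (n + 1), θ j y)))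
    (hlow : ∀ n, n₀ ≤ n → c' / n ≤ θ n x₀) : ∃ t, 0 < t ∧ ∀ m, t ≤ θ m x₁ := by
  by_contra hcon
  push Not at hcon
  set δ := x₁ - x₀ with hδ
  have hδ0 : 0 < δ := sub_pos.2 h01
  set a := c * δ / 4 with ha
  have ha0 : 0 < a := by positivity
  -- Chosen so that `Y ^ 3 ^ k ≥ Y * 16 ^ k ≥ 24 * 16 ^ k / a ^ 4`, which is what each step of the
  -- induction consumes.
  obtain ⟨Y, hY16, hYa⟩ : ∃ Y : ℕ, 16 ≤ Y ∧ 24 / a ^ 4 ≤ Y :=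
    ⟨max 16 ⌈24 / a ^ 4⌉₊, le_max_left _ _, (Nat.le_ceil _).trans (by exact_mod_cast le_max_right _ _)⟩
  have hY0 : (0 : ℝ) < Y := by exact_mod_cast (by omega : 0 < Y)
  obtain ⟨m₀, hm₀⟩ := hcon (1 / Y) (by positivity)
  set M₀ := max m₀ (max n₀ 1) with hM₀
  have hpow : ∀ k : ℕ, ((Y : ℝ) * 16 ^ k) ≤ (Y : ℝ) ^ 3 ^ k := by
    intro k
    have h1 : k + 1 ≤ 3 ^ k := by
      induction k with
      | zero => simp
      | succ k ih => rw [pow_succ]; omega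
    have hY1 : (1 : ℝ) ≤ Y := by exact_mod_cast (by omega : 1 ≤ Y)
    have h2 : (16 : ℝ) ≤ Y := by exact_mod_cast hY16
    calc (Y : ℝ) * 16 ^ k ≤ Y * Y ^ k :=
          mul_le_mul_of_nonneg_left (pow_le_pow_left₀ (by norm_num) h2 k) hY0.le
      _ = (Y : ℝ) ^ (k + 1) := by rw [pow_succ]; ring
      _ ≤ _ := pow_le_pow_right₀ hY1 h1
  -- With `y = Y ^ 3 ^ k`, step `k` replaces the scale `M` by `y M` and the bound `1 / y` by its
  -- cube. The last clause records that `M` stays below the inverse of the bound by the diverging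
  -- factor `2 ^ k`, up to a constant.
  have key : ∀ k : ℕ, ∃ M : ℕ, n₀ ≤ M ∧ 1 ≤ M ∧ θ M (x₀ + δ / 2 ^ k) ≤ 1 / (Y : ℝ) ^ 3 ^ k ∧
      (M : ℝ) * 2 ^ k ≤ M₀ * (Y : ℝ) ^ 3 ^ k := by
    intro k
    induction k with
    | zero =>
      refine ⟨M₀, by simp [hM₀], by simp [hM₀], ?_, ?_⟩
      · have e : x₀ + δ / 2 ^ 0 = x₁ := by rw [hδ]; ring
        rw [e, pow_zero, pow_one]
        exact (hanti x₁ h01.le m₀ M₀ (le_max_left _ _)).trans hm₀.le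
      · have hY1 : (1 : ℝ) ≤ Y := by exact_mod_cast (by omega : 1 ≤ Y)
        have : (0 : ℝ) ≤ M₀ := Nat.cast_nonneg _
        simp only [pow_zero, mul_one, pow_one]
        nlinarith
    | succ k ih =>
      obtain ⟨M, hM1, hM2, hM3, hM4⟩ := ih
      set y := Y ^ 3 ^ k with hy
      have hyR : ((y : ℕ) : ℝ) = (Y : ℝ) ^ 3 ^ k := by rw [hy]; push_cast; rfl
      rw [← hyR] at hM3 hM4
      have hyk := hpow k
      rw [← hyR] at hyk
      have h16k : (1 : ℝ) ≤ 16 ^ k := one_le_pow₀ (by norm_num)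
      have hy16 : (16 : ℝ) ≤ y := by
        have : (16 : ℝ) ≤ Y := by exact_mod_cast hY16
        nlinarith
      have hMR : (1 : ℝ) ≤ M := by exact_mod_cast hM2
      have hy0 : (0 : ℝ) < y := by linarith
      have hynat : 1 ≤ y := by
        have : (1 : ℝ) ≤ y := by linarith
        exact_mod_cast this
      have hxk : x₀ ≤ x₀ + δ / 2 ^ k := by have : 0 ≤ δ / 2 ^ k := by positivity
                                           linarith
      have hxk1 : x₀ ≤ x₀ + δ / 2 ^ (k + 1) := by
        have : 0 ≤ δ / 2 ^ (k + 1) := by positivity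
        linarith
      have hMy : M ≤ y * M := Nat.le_mul_of_pos_left M hynat
      refine ⟨y * M, hM1.trans hMy, hM2.trans hMy, ?_, ?_⟩
      · have hsmall : θ (y * M) (x₀ + δ / 2 ^ k) ≤ 1 / 4 := by
          refine (hanti _ hxk M _ hMy).trans (hM3.trans ?_)
          exact one_div_le_one_div_of_le (by norm_num) (by linarith)
        have hlt : x₀ + δ / 2 ^ (k + 1) < x₀ + δ / 2 ^ k := by
          have : δ / 2 ^ (k + 1) = δ / 2 ^ k / 2 := by rw [pow_succ]; field_simp
          have h2 : 0 < δ / 2 ^ k := by positivity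
          linarith
        have hlex : x₀ + δ / 2 ^ k ≤ x₁ := by
          have : δ / 2 ^ k ≤ δ := div_le_self hδ0.le (one_le_pow₀ (by norm_num))
          linarith
        refine (hstep (y * M) _ _ hxk1 hlt hlex hsmall).trans ?_
        set X := x₀ + δ / 2 ^ k with hX
        -- The first `M` terms are at most one, the other `y M + 1 - M ≤ y M` terms at most `1 / y`.
        have hsum : ∑ j ∈ Finset.range (y * M + 1), θ j X ≤ 2 * M := by
          have e : y * M + 1 = M + (y * M + 1 - M) := by omega
          rw [e, Finset.sum_range_add]
          have s1 : ∑ j ∈ Finset.range M, θ j X ≤ M := by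
            refine (Finset.sum_le_sum fun j _ => hle X hxk j).trans ?_
            simp
          have s2 : ∑ j ∈ Finset.range (y * M + 1 - M), θ (M + j) X ≤ M := by
            refine (Finset.sum_le_sum (g := fun _ => 1 / (y : ℝ)) fun j _ =>
              (hanti X hxk M (M + j) (Nat.le_add_right _ _)).trans hM3).trans ?_
            rw [Finset.sum_const, Finset.card_range, nsmul_eq_mul, mul_one_div, div_le_iff₀ hy0,
              Nat.cast_sub (by omega)]
            push_cast
            linarith
          linarith
        have hsum0 : 1 ≤ ∑ j ∈ Finset.range (y * M + 1), θ j X := by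
          rw [← hpos X hxk]
          exact Finset.single_le_sum (f := fun j => θ j X) (fun j _ => hnn X hxk j)
            (Finset.mem_range.2 (Nat.succ_pos _))
        set T := a / 2 ^ k * y with hT
        have hT0 : 0 < T := by positivity
        have hexp : T ≤ c * (X - (x₀ + δ / 2 ^ (k + 1))) * ((y * M : ℕ) : ℝ) /
            ∑ j ∈ Finset.range (y * M + 1), θ j X := by
          rw [le_div_iff₀ (by linarith)]
          have e : X - (x₀ + δ / 2 ^ (k + 1)) = δ / 2 ^ k / 2 := by
            rw [hX, pow_succ]; field_simp; ring
          rw [e]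
          push_cast
          calc T * ∑ j ∈ Finset.range (y * M + 1), θ j X ≤ T * (2 * M) :=
                mul_le_mul_of_nonneg_left hsum hT0.le
            _ = c * (δ / 2 ^ k / 2) * (y * M) := by rw [hT, ha]; field_simp; norm_num
        have h1 : Real.exp (-(c * (X - (x₀ + δ / 2 ^ (k + 1))) * ((y * M : ℕ) : ℝ) /
            ∑ j ∈ Finset.range (y * M + 1), θ j X)) ≤ Real.exp (-T) :=
          Real.exp_le_exp.2 (neg_le_neg hexp)
        refine h1.trans ?_
        -- The fourth power beats the target `y ^ 3` by one factor `y`, which absorbs the `16 ^ k`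
        -- caused by the shrinking parameter increments.
        have h2 : T ^ 4 / 24 ≤ Real.exp T := by
          have := Real.pow_div_factorial_le_exp T hT0.le 4
          simpa [Nat.factorial] using this
        have e3 : (Y : ℝ) ^ 3 ^ (k + 1) = (y : ℝ) ^ 3 := by
          rw [hyR, ← pow_mul, pow_succ]
        rw [e3, Real.exp_neg, ← one_div]
        refine one_div_le_one_div_of_le (by positivity) (le_trans ?_ h2)
        have h3 : 24 / a ^ 4 * 16 ^ k ≤ y := (mul_le_mul_of_nonneg_right hYa (by positivity)).trans hyk
        have h4 : T ^ 4 = a ^ 4 / 16 ^ k * (y : ℝ) ^ 4 := by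
          rw [hT, mul_pow, div_pow, ← pow_mul, mul_comm k 4, pow_mul]; norm_num
        rw [h4, le_div_iff₀ (by norm_num)]
        have h5 : 24 * (16 : ℝ) ^ k ≤ y * a ^ 4 := by
          rw [div_mul_eq_mul_div, div_le_iff₀ (by positivity)] at h3
          exact h3
        have h6 : 24 ≤ y * (a ^ 4 / 16 ^ k) := by
          rw [← mul_div_assoc, le_div_iff₀ (by positivity)]; exact h5
        calc (y : ℝ) ^ 3 * 24 ≤ (y : ℝ) ^ 3 * (y * (a ^ 4 / 16 ^ k)) :=
              mul_le_mul_of_nonneg_left h6 (by positivity)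
          _ = _ := by ring
      · have e3 : (Y : ℝ) ^ 3 ^ (k + 1) = (y : ℝ) ^ 3 := by
          rw [hyR, ← pow_mul, pow_succ]
        rw [e3, pow_succ]
        push_cast
        have hM₀' : (0 : ℝ) ≤ M₀ := Nat.cast_nonneg _
        calc (y : ℝ) * M * (2 ^ k * 2) = y * 2 * (M * 2 ^ k) := by ring
          _ ≤ y * 2 * (M₀ * y) := mul_le_mul_of_nonneg_left hM4 (by positivity)
          _ = M₀ * (y ^ 2 * 2) := by ring
          _ ≤ M₀ * (y ^ 2 * y) := by
            refine mul_le_mul_of_nonneg_left ?_ hM₀'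
            exact mul_le_mul_of_nonneg_left (by linarith) (by positivity)
          _ = _ := by ring
  obtain ⟨k, hk⟩ := pow_unbounded_of_one_lt (M₀ / c' : ℝ) (one_lt_two)
  obtain ⟨M, hM1, hM2, hM3, hM4⟩ := key k
  have h1 := hlow M hM1
  have hMR : (0 : ℝ) < M := by exact_mod_cast hM2
  have h2 : θ M x₀ ≤ θ M (x₀ + δ / 2 ^ k) := hmono _ _ le_rfl
    (by have : 0 ≤ δ / 2 ^ k := by positivity
        linarith) M
  have h3 : c' / M ≤ 1 / (Y : ℝ) ^ 3 ^ k := h1.trans (h2.trans hM3)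
  rw [div_le_div_iff₀ hMR (by positivity)] at h3
  rw [div_lt_iff₀ hc'] at hk
  have hYk : (0 : ℝ) < (Y : ℝ) ^ 3 ^ k := by positivity
  have h4 : c' * (Y : ℝ) ^ 3 ^ k * 2 ^ k ≤ M₀ * (Y : ℝ) ^ 3 ^ k :=
    (mul_le_mul_of_nonneg_right (by linarith) (by positivity)).trans hM4
  nlinarith

end Decay

end

section

open Filter Topology

/-! ### Crossing paths in the plane -/

section PlaneTopology

/-- Two points joined in `Y` are the end-points of a continuous map defined on the line. -/
theorem joinedIn_exists_map {E : Type*} [TopologicalSpace E] {Y : Set E} {p p' : E}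
    (h : JoinedIn Y p p') :
    ∃ γ : ℝ → E, Continuous γ ∧ γ 0 = p ∧ γ 1 = p' ∧ ∀ s, γ s ∈ Y := by
  obtain ⟨γ, hγ⟩ := h
  refine ⟨γ.extend, γ.continuous_extend, γ.extend_zero, γ.extend_one, fun s => ?_⟩
  exact hγ _

theorem joinedIn_of_map {E : Type*} [TopologicalSpace E] {Y : Set E} {γ : ℝ → E}
    (hγ : Continuous γ) {a b : ℝ} (h : ∀ s ∈ Set.uIcc a b, γ s ∈ Y) : JoinedIn Y (γ a) (γ b) := by
  have h1 : IsPathConnected (γ '' Set.uIcc a b) :=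
    ((convex_uIcc a b).isPathConnected ⟨a, Set.left_mem_uIcc⟩).image hγ
  refine (h1.joinedIn _ ⟨a, Set.left_mem_uIcc, rfl⟩ _ ⟨b, Set.right_mem_uIcc, rfl⟩).mono ?_
  rintro _ ⟨s, hs, rfl⟩
  exact h s hs

/-- A path stops when a continuous function first reaches the level `t`. -/
theorem joinedIn_first_hit {E : Type*} [TopologicalSpace E] {Y : Set E} {p p' : E}
    (h : JoinedIn Y p p') {g : E → ℝ} (hg : Continuous g) {t : ℝ} (h0 : g p ≤ t) (h1 : t ≤ g p') :
    ∃ w ∈ Y, g w = t ∧ JoinedIn ((Y ∩ {z | g z < t}) ∪ {w}) p w := by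
  obtain ⟨γ, hγ, rfl, rfl, hY⟩ := joinedIn_exists_map h
  set T : Set ℝ := Set.Icc 0 1 ∩ {s | t ≤ g (γ s)} with hT
  have hclosed : IsClosed T := isClosed_Icc.inter (isClosed_le continuous_const (hg.comp hγ))
  have hbdd : BddBelow T := ⟨0, fun s hs => hs.1.1⟩
  have hne : T.Nonempty := ⟨1, ⟨zero_le_one, le_rfl⟩, h1⟩
  have hmem : sInf T ∈ T := hclosed.csInf_mem hne hbdd
  set s₀ := sInf T with hs₀
  have hlt : ∀ s, 0 ≤ s → s < s₀ → g (γ s) < t := by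
    intro s hs hss
    by_contra hcon
    push Not at hcon
    exact absurd (csInf_le hbdd (show s ∈ T from ⟨⟨hs, (hss.le.trans hmem.1.2)⟩, hcon⟩)) (not_le.2 hss)
  have heq : g (γ s₀) = t := by
    refine le_antisymm ?_ hmem.2
    rcases eq_or_lt_of_le hmem.1.1 with h | h
    · rw [← h]; exact h0
    · by_contra hcon
      push Not at hcon
      obtain ⟨s, hs, hst⟩ := intermediate_value_Icc h.le (hg.comp hγ).continuousOn
        (show (t + g (γ s₀)) / 2 ∈ Set.Icc ((g ∘ γ) 0) ((g ∘ γ) s₀) by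
          simp only [Function.comp]; constructor <;> linarith)
      simp only [Function.comp] at hst
      rcases eq_or_lt_of_le hs.2 with h' | h'
      · rw [h'] at hst; linarith
      · have := hlt s hs.1 h'; linarith
  refine ⟨γ s₀, hY _, heq, joinedIn_of_map hγ fun s hs => ?_⟩
  rw [Set.uIcc_of_le hmem.1.1] at hs
  rcases eq_or_lt_of_le hs.2 with h' | h'
  · right; rw [h']; rfl
  · left; exact ⟨hY _, hlt s hs.1 h'⟩

theorem le_of_avoid {θ : ℝ → ℝ} (hθ : Continuous θ) {b : ℝ}
    (hb : ∀ s, θ s ∉ Set.Ioo b (b + Real.pi)) {s₀ s₁ : ℝ} (h : θ s₀ ≤ b) : θ s₁ ≤ b := by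
  by_contra hcon
  push Not at hcon
  have hpi := Real.pi_pos
  set v := min (θ s₁) (b + 1)
  have hv1 : b < v := lt_min hcon (by linarith)
  have hv2 : v ≤ b + 1 := min_le_right _ _
  have hpi3 := Real.pi_gt_three
  obtain ⟨s, hs⟩ := mem_range_of_exists_le_of_exists_ge hθ ⟨s₀, h.trans hv1.le⟩
    ⟨s₁, min_le_left (θ s₁) (b + 1)⟩
  exact hb s ⟨by rw [hs]; exact hv1, by rw [hs]; linarith⟩

theorem ge_of_avoid {θ : ℝ → ℝ} (hθ : Continuous θ) {b : ℝ}
    (hb : ∀ s, θ s ∉ Set.Ioo (b - Real.pi) b) {s₀ s₁ : ℝ} (h : b ≤ θ s₀) : b ≤ θ s₁ := by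
  have := le_of_avoid (θ := fun s => -θ s) hθ.neg (b := -b) (fun s hs => hb s ⟨by linarith [hs.2],
    by linarith [hs.1]⟩) (s₀ := s₀) (s₁ := s₁) (by linarith)
  linarith

/-- The planar Poincaré-Miranda theorem, for maps constant outside of the unit square. -/
theorem exists_zero_of_signs {F : ℝ × ℝ → ℝ × ℝ} (hF : Continuous F) (h1 : ∀ t, (F (0, t)).1 ≤ 0)
    (h2 : ∀ t, 0 ≤ (F (1, t)).1) (h3 : ∀ s, 0 ≤ (F (s, 0)).2) (h4 : ∀ s, (F (s, 1)).2 ≤ 0) :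
    ∃ z, F z = 0 := by
  by_contra hcon
  push Not at hcon
  let f : C(ℝ × ℝ, ℂ) := ⟨fun z => ⟨(F z).1, (F z).2⟩, by
    have : (fun z => (⟨(F z).1, (F z).2⟩ : ℂ)) =
        fun z => Complex.equivRealProdCLM.symm (F z) := by
      funext z; rfl
    rw [this]; fun_prop⟩
  have hf : ∀ z, f z ≠ 0 := by
    intro z h
    have e1 : (f z).re = 0 := by rw [h]; rfl
    have e2 : (f z).im = 0 := by rw [h]; rfl
    exact hcon z (Prod.ext e1 e2)
  -- A nonvanishing map of the plane lifts through the exponential, so it has a continuous argument.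
  -- The sign conditions confine the argument along each side, and the two ways round the square
  -- disagree at the corner `(1, 1)`.
  obtain ⟨h, ⟨-, hh⟩, -⟩ := Complex.isCoveringMapOn_exp.existsUnique_continuousMap_lifts f
    (a₀ := (0, 0)) (e₀ := Complex.log (f (0, 0))) (Complex.exp_log (hf _)) (fun a => hf a)
  have hexp : ∀ z, Complex.exp (h z) = f z := fun z => congrFun hh z
  have hre : ∀ z, (F z).1 = Real.exp (h z).re * Real.cos (h z).im := fun z => by
    rw [← Complex.exp_re, hexp z]; rfl
  have him : ∀ z, (F z).2 = Real.exp (h z).re * Real.sin (h z).im := fun z => by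
    rw [← Complex.exp_im, hexp z]; rfl
  have hcos : ∀ z, (0 ≤ (F z).1 → 0 ≤ Real.cos (h z).im) ∧
      ((F z).1 ≤ 0 → Real.cos (h z).im ≤ 0) := fun z => by
    have := Real.exp_pos (h z).re
    rw [hre]
    exact ⟨fun h => by by_contra hc; push Not at hc; nlinarith,
      fun h => by by_contra hc; push Not at hc; nlinarith⟩
  have hsin : ∀ z, (0 ≤ (F z).2 → 0 ≤ Real.sin (h z).im) ∧
      ((F z).2 ≤ 0 → Real.sin (h z).im ≤ 0) := fun z => by
    have := Real.exp_pos (h z).re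
    rw [him]
    exact ⟨fun h => by by_contra hc; push Not at hc; nlinarith,
      fun h => by by_contra hc; push Not at hc; nlinarith⟩
  have hpi := Real.pi_pos
  -- normalise the argument at the corner
  obtain ⟨k, hk⟩ : ∃ k : ℤ, (h (0, 0)).im - k * (2 * Real.pi) ∈ Set.Ico 0 (2 * Real.pi) := by
    obtain ⟨k, hk, -⟩ := existsUnique_sub_zsmul_mem_Ico (a := 2 * Real.pi) (by linarith)
      (h (0, 0)).im 0
    exact ⟨k, by simpa using hk⟩
  set θ : ℝ × ℝ → ℝ := fun z => (h z).im - k * (2 * Real.pi) with hθ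
  have hθc : Continuous θ := by fun_prop
  have hc' : ∀ z, Real.cos (θ z) = Real.cos (h z).im := fun z => Real.cos_sub_int_mul_two_pi _ k
  have hs' : ∀ z, Real.sin (θ z) = Real.sin (h z).im := fun z => Real.sin_sub_int_mul_two_pi _ k
  have c1 : ∀ t, Real.cos (θ (0, t)) ≤ 0 := fun t => by rw [hc']; exact (hcos _).2 (h1 t)
  have c2 : ∀ t, 0 ≤ Real.cos (θ (1, t)) := fun t => by rw [hc']; exact (hcos _).1 (h2 t)
  have c3 : ∀ s, 0 ≤ Real.sin (θ (s, 0)) := fun s => by rw [hs']; exact (hsin _).1 (h3 s)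
  have c4 : ∀ s, Real.sin (θ (s, 1)) ≤ 0 := fun s => by rw [hs']; exact (hsin _).2 (h4 s)
  have sinneg : ∀ v, v ∈ Set.Ioo Real.pi (Real.pi + Real.pi) → Real.sin v < 0 := fun v hv => by
    have := Real.sin_pos_of_pos_of_lt_pi (x := v - Real.pi) (by linarith [hv.1])
      (by linarith [hv.2])
    rw [Real.sin_sub_pi] at this; linarith
  have sinneg' : ∀ v, v ∈ Set.Ioo (0 - Real.pi) 0 → Real.sin v < 0 := fun v hv =>
    Real.sin_neg_of_neg_of_neg_pi_lt hv.2 (by linarith [hv.1])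
  have sinpos : ∀ v, v ∈ Set.Ioo (Real.pi - Real.pi) Real.pi → 0 < Real.sin v := fun v hv =>
    Real.sin_pos_of_pos_of_lt_pi (by linarith [hv.1]) hv.2
  have cospos : ∀ v, v ∈ Set.Ioo (Real.pi / 2 - Real.pi) (Real.pi / 2) → 0 < Real.cos v :=
    fun v hv => Real.cos_pos_of_mem_Ioo ⟨by linarith [hv.1], hv.2⟩
  have cosneg : ∀ v, v ∈ Set.Ioo (Real.pi / 2) (Real.pi / 2 + Real.pi) → Real.cos v < 0 :=
    fun v hv => Real.cos_neg_of_pi_div_two_lt_of_lt hv.1 (by linarith [hv.2])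
  have hcorner : Real.pi / 2 ≤ θ (0, 0) ∧ θ (0, 0) ≤ Real.pi := by
    have a1 := hk.1
    have a2 := hk.2
    change 0 ≤ θ (0, 0) at a1
    change θ (0, 0) < 2 * Real.pi at a2
    constructor
    · by_contra hc; push Not at hc
      exact absurd (c1 0) (not_le.2 (cospos _ ⟨by linarith, hc⟩))
    · by_contra hc; push Not at hc
      exact absurd (c3 0) (not_le.2 (sinneg _ ⟨hc, by linarith⟩))
  -- bottom side
  have b1 : θ (1, 0) ≤ Real.pi := le_of_avoid (θ := fun s => θ (s, 0)) (by fun_prop)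
    (fun s hs => absurd (c3 s) (not_le.2 (sinneg _ hs))) (s₀ := 0) hcorner.2
  have b3 : θ (1, 0) ≤ Real.pi / 2 := by
    by_contra hc; push Not at hc
    exact absurd (c2 0) (not_le.2 (cosneg _ ⟨hc, by linarith⟩))
  -- left side
  have l1 : Real.pi / 2 ≤ θ (0, 1) := ge_of_avoid (θ := fun t => θ (0, t)) (by fun_prop)
    (fun s hs => absurd (c1 s) (not_le.2 (cospos _ hs))) (s₀ := 0) hcorner.1
  have l2 : Real.pi ≤ θ (0, 1) := by
    by_contra hc; push Not at hc
    exact absurd (c4 0) (not_le.2 (sinpos _ ⟨by linarith, hc⟩))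
  -- right and top sides
  have r1 : θ (1, 1) ≤ Real.pi / 2 := le_of_avoid (θ := fun t => θ (1, t)) (by fun_prop)
    (fun s hs => absurd (c2 s) (not_le.2 (cosneg _ hs))) (s₀ := 0) b3
  have t1 : Real.pi ≤ θ (1, 1) := ge_of_avoid (θ := fun s => θ (s, 1)) (by fun_prop)
    (fun s hs => absurd (c4 s) (not_le.2 (sinpos _ hs))) (s₀ := 0) l2
  linarith

/-- A horizontal and a vertical crossing of a rectangle meet. -/
theorem joinedIn_meet {Y Z : Set (ℝ × ℝ)} {p p' r r' : ℝ × ℝ} {a b c d : ℝ}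
    (h1 : JoinedIn Y p p') (h2 : JoinedIn Z r r') (hY : ∀ z ∈ Y, c ≤ z.2 ∧ z.2 ≤ d)
    (hZ : ∀ z ∈ Z, a ≤ z.1 ∧ z.1 ≤ b) (hp : p.1 ≤ a) (hp' : b ≤ p'.1) (hr : r.2 ≤ c)
    (hr' : d ≤ r'.2) : ∃ z ∈ Y ∩ Z, JoinedIn Y p z ∧ JoinedIn Z r z := by
  obtain ⟨γ, hγ, rfl, rfl, hγY⟩ := joinedIn_exists_map h1
  obtain ⟨δ, hδ, rfl, rfl, hδZ⟩ := joinedIn_exists_map h2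
  -- A zero of the difference of the two parametrised paths is a common point; crossing the
  -- rectangle in two directions gives the required signs.
  obtain ⟨⟨s, t⟩, h⟩ := exists_zero_of_signs (F := fun z => γ z.1 - δ z.2) (by fun_prop)
    (fun t => by have := (hZ _ (hδZ t)).1; simp only [Prod.fst_sub]; linarith)
    (fun t => by have := (hZ _ (hδZ t)).2; simp only [Prod.fst_sub]; linarith)
    (fun s => by have := (hY _ (hγY s)).1; simp only [Prod.snd_sub]; linarith)
    (fun s => by have := (hY _ (hγY s)).2; simp only [Prod.snd_sub]; linarith)
  have heq : γ s = δ t := sub_eq_zero.1 h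
  refine ⟨γ s, ⟨hγY s, heq ▸ hδZ t⟩, joinedIn_of_map hγ fun _ _ => hγY _, ?_⟩
  rw [heq]
  exact joinedIn_of_map hδ fun _ _ => hδZ _

theorem joinedIn_image {E F : Type*} [TopologicalSpace E] [TopologicalSpace F]
    {f : E → F} (hf : Continuous f) {Y : Set E} {p p' : E} (h : JoinedIn Y p p') :
    JoinedIn (f '' Y) (f p) (f p') := by
  obtain ⟨γ, hγ, rfl, rfl, hY⟩ := joinedIn_exists_map h
  exact joinedIn_of_map (hf.comp hγ) fun s _ => ⟨_, hY s, rfl⟩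

/-- From a path in a horizontal strip to a crossing of a rectangle. -/
theorem joinedIn_truncate_fst {Y : Set (ℝ × ℝ)} {p p' : ℝ × ℝ} {a b : ℝ} (h : JoinedIn Y p p')
    (hab : a ≤ b) (hp : p.1 ≤ a) (hp' : b ≤ p'.1) :
    ∃ w w' : ℝ × ℝ, w.1 = a ∧ w'.1 = b ∧ JoinedIn (Y ∩ {z | a ≤ z.1 ∧ z.1 ≤ b}) w w' := by
  obtain ⟨w', hw'Y, hw', hj⟩ := joinedIn_first_hit h continuous_fst (hp.trans hab) hp'
  obtain ⟨w, hwY, hw, hj2⟩ := joinedIn_first_hit hj.symm (g := fun z => -z.1) (by fun_prop)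
    (t := -a) (by linarith) (by linarith)
  refine ⟨w, w', by linarith, hw', hj2.symm.mono ?_⟩
  rintro z (⟨⟨hzY, hz⟩ | rfl, hz2⟩ | rfl)
  · simp only [Set.mem_ofPred_eq] at hz hz2
    exact ⟨hzY, by linarith, by linarith⟩
  · exact ⟨hw'Y, by linarith, by linarith⟩
  · refine ⟨?_, by linarith, by linarith⟩
    rcases hwY with h | h
    · exact h.1
    · rw [h]; exact hw'Y

end PlaneTopology

end

section

open Filter Topology

/-! ### Edges as plane segments, and events of the drawn open set -/

section Drawing

variable {V : Set (ℝ × ℝ)} {G : SimpleGraph V}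

/-- The segment representing the edge `e`. -/
def seg (e : G.edgeSet) : Set (ℝ × ℝ) :=
  {z | ∃ a b : V, (e : Sym2 V) = s(a, b) ∧ z ∈ segment ℝ (a : ℝ × ℝ) b}

theorem seg_eq {e : G.edgeSet} {a b : V} (h : (e : Sym2 V) = s(a, b)) :
    seg e = segment ℝ (a : ℝ × ℝ) b := by
  ext z
  constructor
  · rintro ⟨a', b', h', hz⟩
    rw [h, Sym2.eq_iff] at h'
    rcases h' with ⟨rfl, rfl⟩ | ⟨rfl, rfl⟩
    · exact hz
    · rwa [segment_symm]
  · exact fun hz => ⟨a, b, h, hz⟩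

theorem mem_seg_of_mem {e : G.edgeSet} {v : V} (h : v ∈ (e : Sym2 V)) : (v : ℝ × ℝ) ∈ seg e := by
  obtain ⟨a, b, he, -⟩ := exists_eq_mk e
  rw [he, Sym2.mem_iff] at h
  rw [seg_eq he]
  rcases h with rfl | rfl
  exacts [left_mem_segment _ _ _, right_mem_segment _ _ _]

theorem convex_seg (e : G.edgeSet) : Convex ℝ (seg e) := by
  obtain ⟨a, b, he, -⟩ := exists_eq_mk e
  rw [seg_eq he]; exact convex_segment _ _

theorem isCompact_seg (e : G.edgeSet) : IsCompact (seg e) := by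
  obtain ⟨a, b, he, -⟩ := exists_eq_mk e
  rw [seg_eq he, segment_eq_image_lineMap]
  exact isCompact_Icc.image (AffineMap.lineMap_continuous)

theorem joinedIn_seg (e : G.edgeSet) {y z : ℝ × ℝ} (hy : y ∈ seg e) (hz : z ∈ seg e) :
    JoinedIn (seg e) y z :=
  ((convex_seg e).isPathConnected ⟨y, hy⟩).joinedIn _ hy _ hz

theorem dist_le_of_mem_seg {l : ℝ} (hl0 : 0 ≤ l)
    (hl : ∀ u v : V, G.Adj u v → dist (u : ℝ × ℝ) v ≤ l)
    {e : G.edgeSet} {v : V} (hv : v ∈ (e : Sym2 V)) {z : ℝ × ℝ} (hz : z ∈ seg e) :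
    dist z v ≤ l := by
  obtain ⟨a, b, he, hab⟩ := exists_eq_mk e
  rw [seg_eq he] at hz
  rw [he, Sym2.mem_iff] at hv
  have h := (convex_closedBall (v : ℝ × ℝ) l).segment_subset (x := (a : ℝ × ℝ)) (y := (b : ℝ × ℝ))
    ?_ ?_ hz
  · exact h
  · rw [Metric.mem_closedBall]; rcases hv with rfl | rfl
    · simpa
    · exact hl _ _ hab
  · rw [Metric.mem_closedBall]; rcases hv with rfl | rfl
    · exact hl _ _ hab.symm
    · simpa

/-- The subset of the plane covered by the edges of `S`. -/
def drawing (S : Set G.edgeSet) : Set (ℝ × ℝ) := ⋃ e ∈ S, seg e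

theorem seg_subset_drawing {S : Set G.edgeSet} {e : G.edgeSet} (h : e ∈ S) : seg e ⊆ drawing S :=
  Set.subset_biUnion_of_mem h

theorem mem_drawing {S : Set G.edgeSet} {z : ℝ × ℝ} : z ∈ drawing S ↔ ∃ e ∈ S, z ∈ seg e := by
  simp [drawing]

theorem drawing_mono {S T : Set G.edgeSet} (h : S ⊆ T) : drawing S ⊆ drawing T :=
  Set.biUnion_subset_biUnion_left h

theorem Conn.joinedIn {S : Set G.edgeSet} {u v : V} (h : Conn S u v)
    (hu : (u : ℝ × ℝ) ∈ drawing S) : JoinedIn (drawing S) (u : ℝ × ℝ) v := by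
  induction h with
  | refl => exact JoinedIn.refl hu
  | tail _ h ih =>
    obtain ⟨e, he, h1, h2⟩ := h
    exact ih.trans ((joinedIn_seg e (mem_seg_of_mem h1) (mem_seg_of_mem h2)).mono
      (seg_subset_drawing he))

theorem Conn.mem_drawing {S : Set G.edgeSet} {u v : V} (h : Conn S u v) (hne : u ≠ v) :
    (u : ℝ × ℝ) ∈ drawing S := by
  induction h with
  | refl => exact absurd rfl hne
  | @tail y z _ h ih =>
    by_cases huy : u = y
    · obtain ⟨e, he, h1, h2⟩ := h
      exact seg_subset_drawing he (mem_seg_of_mem (huy ▸ h1))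
    · exact ih huy

theorem IsLattice.exists_edge (hG : IsLattice G) (v : V) : ∃ e : G.edgeSet, v ∈ (e : Sym2 V) := by
  obtain ⟨σ, hσ⟩ := hG.translation_fst
  have hne : v ≠ σ v := fun h => by
    have := congrArg (fun w : V => (w : ℝ × ℝ).1) h
    simp only [hσ] at this
    linarith
  obtain ⟨w⟩ := hG.connected.preconnected v (σ v)
  have key : ∀ u : V, G.Walk v u → v ≠ u → ∃ e : G.edgeSet, v ∈ (e : Sym2 V) := by
    intro u w hne
    cases w with
    | nil => exact absurd rfl hne
    | cons h _ => exact ⟨⟨s(v, _), h⟩, by simp⟩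
  exact key _ w hne

theorem IsLattice.planar_seg (hG : IsLattice G) {e e' : G.edgeSet} (hne : e ≠ e') {z : ℝ × ℝ}
    (hz : z ∈ seg e) (hz' : z ∈ seg e') :
    ∃ v : V, (v : ℝ × ℝ) = z ∧ v ∈ (e : Sym2 V) ∧ v ∈ (e' : Sym2 V) := by
  obtain ⟨a, b, he, hab⟩ := exists_eq_mk e
  obtain ⟨a', b', he', hab'⟩ := exists_eq_mk e'
  rw [seg_eq he] at hz
  rw [seg_eq he'] at hz'
  have hne' : s(a, b) ≠ s(a', b') := fun h => hne (Subtype.ext (by rw [he, he', h]))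
  obtain ⟨h1, h2⟩ := hG.planar a b a' b' hab hab' hne' ⟨hz, hz'⟩
  have key : ∀ c d : V, z = c → z = d → c = d := fun c d h h' => Subtype.ext (h.symm.trans h')
  rw [he, he']
  simp only [Set.mem_insert_iff, Set.mem_singleton_iff] at h1 h2
  rcases h1 with h1 | h1 <;> rcases h2 with h2 | h2
  · exact ⟨a, h1.symm, by simp, by simp [key a a' h1 h2]⟩
  · exact ⟨a, h1.symm, by simp, by simp [key a b' h1 h2]⟩
  · exact ⟨b, h1.symm, by simp, by simp [key b a' h1 h2]⟩
  · exact ⟨b, h1.symm, by simp, by simp [key b b' h1 h2]⟩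

/-- A vertex lying on an edge is one of its end-points. -/
theorem IsLattice.mem_of_mem_seg (hG : IsLattice G) {e : G.edgeSet} {v : V}
    (h : (v : ℝ × ℝ) ∈ seg e) : v ∈ (e : Sym2 V) := by
  obtain ⟨e', he'⟩ := hG.exists_edge v
  by_cases hee : e = e'
  · rwa [hee]
  · obtain ⟨w, hw, h1, -⟩ := hG.planar_seg hee h (mem_seg_of_mem he')
    rwa [← Subtype.ext hw]

theorem IsLattice.finite_seg_meeting (hG : IsLattice G) {B : Set (ℝ × ℝ)}
    (hB : Bornology.IsBounded B) : {e : G.edgeSet | (seg e ∩ B).Nonempty}.Finite := by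
  obtain ⟨l, -, hl⟩ := hG.exists_length_le
  obtain ⟨r, hr⟩ := hB.subset_closedBall 0
  refine (hG.finite_edges_touching (Metric.isBounded_closedBall (x := (0 : ℝ × ℝ))
    (r := l + r))).subset ?_
  rintro e ⟨z, hz, hzB⟩
  obtain ⟨a, b, he, -⟩ := exists_eq_mk e
  have ha : a ∈ (e : Sym2 V) := by rw [he]; simp
  refine ⟨a, ha, ?_⟩
  have h1 := dist_le_of_mem_seg (Nat.cast_nonneg l) hl ha hz
  have h2 := hr hzB
  rw [Metric.mem_closedBall] at h2 ⊢
  rw [dist_comm] at h1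
  linarith [dist_triangle (a : ℝ × ℝ) z 0]

/-- In a planar drawing, vertices joined inside a set are connected by edges with both
end-points in this set. -/
theorem IsLattice.conn_of_joinedIn (hG : IsLattice G) {S : Set G.edgeSet} {R : Set (ℝ × ℝ)}
    {u v : V} (h : JoinedIn (drawing S ∩ R) (u : ℝ × ℝ) v) :
    Conn (S ∩ edgesIn G R) u v := by
  have huR : (u : ℝ × ℝ) ∈ R := h.source_mem.2
  have hvR : (v : ℝ × ℝ) ∈ R := h.target_mem.2
  obtain ⟨e₀, he₀, hue₀⟩ := mem_drawing.1 h.source_mem.1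
  obtain ⟨e₁, he₁, hve₁⟩ := mem_drawing.1 h.target_mem.1
  obtain ⟨γ, hγ⟩ := h
  have hbdd : Bornology.IsBounded (Set.range γ) := (isCompact_range γ.continuous).isBounded
  set T : Set G.edgeSet := {e | e ∈ S ∧ (seg e ∩ Set.range γ).Nonempty} with hT
  have hTfin : T.Finite := (hG.finite_seg_meeting hbdd).subset fun e he => he.2
  set C : V → Prop := fun w => Conn (S ∩ edgesIn G R) u w with hC
  have hCR : ∀ w, C w → (w : ℝ × ℝ) ∈ R := by
    intro w hw
    induction hw with
    | refl => exact huR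
    | tail _ h _ =>
      obtain ⟨e, he, _, h2⟩ := h
      exact he.2 _ h2
  have hstep : ∀ e ∈ S, ∀ c ∈ (e : Sym2 V), C c → ∀ z ∈ (e : Sym2 V), (z : ℝ × ℝ) ∈ R → C z := by
    intro e he c hc hCc z hz hzR
    by_cases hcz : c = z
    · rwa [← hcz]
    refine Relation.ReflTransGen.tail hCc ⟨e, ⟨he, fun w hw => ?_⟩, hc, hz⟩
    obtain ⟨a, b, hab, -⟩ := exists_eq_mk e
    rw [hab, Sym2.mem_iff] at hc hz hw
    have hcR := hCR c hCc
    rcases hc with rfl | rfl <;> rcases hz with rfl | rfl <;> rcases hw with rfl | rfl <;>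
      first | exact hcR | exact hzR | exact absurd rfl hcz
  -- The path is covered by finitely many closed segments, split according to whether the edge has
  -- an end in the cluster of `u`. By planarity a common point on the path would be a shared vertex
  -- lying in `R`, which would join the cluster, so connectedness forces the path to stay in `A`.
  set A : Set (ℝ × ℝ) := ⋃ e ∈ {e | e ∈ T ∧ ∃ c ∈ (e : Sym2 V), C c}, seg e with hA
  set B : Set (ℝ × ℝ) := ⋃ e ∈ {e | e ∈ T ∧ ¬ ∃ c ∈ (e : Sym2 V), C c}, seg e with hB
  have hAc : IsClosed A := Set.Finite.isClosed_biUnion (hTfin.subset fun e he => he.1)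
    fun e _ => (isCompact_seg e).isClosed
  have hBc : IsClosed B := Set.Finite.isClosed_biUnion (hTfin.subset fun e he => he.1)
    fun e _ => (isCompact_seg e).isClosed
  have hcover : Set.range γ ⊆ A ∪ B := by
    rintro _ ⟨t, rfl⟩
    obtain ⟨e, he, hz⟩ := mem_drawing.1 (hγ t).1
    have heT : e ∈ T := ⟨he, γ t, hz, Set.mem_range_self t⟩
    by_cases hc : ∃ c ∈ (e : Sym2 V), C c
    · exact Or.inl (Set.mem_biUnion (show e ∈ {e | e ∈ T ∧ ∃ c ∈ (e : Sym2 V), C c} from ⟨heT, hc⟩) hz)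
    · exact Or.inr (Set.mem_biUnion
        (show e ∈ {e | e ∈ T ∧ ¬ ∃ c ∈ (e : Sym2 V), C c} from ⟨heT, hc⟩) hz)
  have hdisj : Set.range γ ∩ (A ∩ B) = ∅ := by
    refine Set.eq_empty_of_forall_notMem ?_
    rintro _ ⟨⟨t, rfl⟩, hzA, hzB⟩
    obtain ⟨e, ⟨heT, c, hc, hCc⟩, hze⟩ := Set.mem_iUnion₂.1 hzA
    obtain ⟨e', ⟨heT', hc'⟩, hze'⟩ := Set.mem_iUnion₂.1 hzB
    have hne : e ≠ e' := fun h => hc' ⟨c, h ▸ hc, hCc⟩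
    obtain ⟨w, hw, h1, h2⟩ := hG.planar_seg hne hze hze'
    exact hc' ⟨w, h2, hstep e heT.1 c hc hCc w h1 (hw ▸ (hγ t).2)⟩
  have huA : (u : ℝ × ℝ) ∈ A := Set.mem_biUnion (x := e₀)
    (show e₀ ∈ {e | e ∈ T ∧ ∃ c ∈ (e : Sym2 V), C c} from
      ⟨⟨he₀, u, hue₀, 0, γ.source⟩, u, hG.mem_of_mem_seg hue₀, Relation.ReflTransGen.refl⟩) hue₀
  have hconn : IsPreconnected (Set.range γ) := isPreconnected_range γ.continuous
  have hsub : Set.range γ ⊆ A := by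
    intro z hz
    refine (hcover hz).elim id fun hzB => absurd ?_ (Set.not_nonempty_iff_eq_empty.2 hdisj)
    exact isPreconnected_closed_iff.1 hconn A B hAc hBc hcover ⟨u, ⟨0, γ.source⟩, huA⟩ ⟨z, hz, hzB⟩
  obtain ⟨e, ⟨heT, c, hc, hCc⟩, hze⟩ := Set.mem_iUnion₂.1 (hsub ⟨1, γ.target⟩)
  exact hstep e heT.1 c hc hCc v (hG.mem_of_mem_seg hze) hvR

/-- A continuous map of the plane that preserves segments and the lattice. -/
structure IsSym (G : SimpleGraph V) (f : ℝ × ℝ → ℝ × ℝ) : Prop where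
  aut : InducesAut G f
  cont : Continuous f
  segs : ∀ a b, f '' segment ℝ a b = segment ℝ (f a) (f b)

theorem IsSym.comp {f g : ℝ × ℝ → ℝ × ℝ} (hf : IsSym G f) (hg : IsSym G g) : IsSym G (f ∘ g) :=
  ⟨hf.aut.comp hg.aut, hf.cont.comp hg.cont, fun a b => by
    rw [Set.image_comp, hg.segs, hf.segs]; rfl⟩

theorem IsLattice.isSym_translate (hG : IsLattice G) (a b : ℤ) :
    IsSym G fun z => (z.1 + a, z.2 + b) :=
  ⟨hG.inducesAut_translate a b, by fun_prop, fun p q => by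
    have := image_segment ℝ (AffineEquiv.vaddConst ℝ ((a : ℝ), (b : ℝ))).toAffineMap p q
    exact this⟩

theorem IsLattice.isSym_reflect (hG : IsLattice G) : IsSym G fun z => (-z.1, z.2) :=
  ⟨hG.reflection, by fun_prop, fun p q => by
    have := image_segment ℝ
      (LinearMap.prodMap (-LinearMap.id) LinearMap.id : ℝ × ℝ →ₗ[ℝ] ℝ × ℝ).toAffineMap p q
    exact this⟩

theorem IsLattice.isSym_swap (hG : IsLattice G) : IsSym G fun z => (z.2, z.1) :=
  ⟨by
    convert hG.reflection.comp hG.rotation using 1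
    funext z; simp, by fun_prop, fun p q => by
    have := image_segment ℝ
      (LinearEquiv.prodComm ℝ ℝ ℝ : ℝ × ℝ →ₗ[ℝ] ℝ × ℝ).toAffineMap p q
    exact this⟩

theorem IsLattice.isSym_reflect_snd (hG : IsLattice G) : IsSym G fun z => (z.1, -z.2) := by
  convert (hG.isSym_swap.comp hG.isSym_reflect).comp hG.isSym_swap using 1
  funext z; rfl

theorem drawing_image {σ : G ≃g G} {f : ℝ × ℝ → ℝ × ℝ} (hσ : ∀ v : V, ((σ v : V) : ℝ × ℝ) = f v)
    (hf : IsSym G f) (S : Set G.edgeSet) : drawing (σ.mapEdgeSet '' S) = f '' drawing S := by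
  have hs : ∀ e : G.edgeSet, seg (σ.mapEdgeSet e) = f '' seg e := by
    intro e
    obtain ⟨a, b, he, -⟩ := exists_eq_mk e
    have h2 : (σ.mapEdgeSet e : Sym2 V) = s(σ a, σ b) := by
      have : (σ.mapEdgeSet e : Sym2 V) = Sym2.map σ e := rfl
      rw [this, he]; rfl
    rw [seg_eq he, seg_eq h2, hσ, hσ, hf.segs]
  simp only [drawing, Set.biUnion_image, Set.image_iUnion, hs]

/-- The event that the drawing of the open edges satisfies `P`. -/
def ev (G : SimpleGraph V) (P : Set (ℝ × ℝ) → Prop) : Set (Set G.edgeSet) := {S | P (drawing S)}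

/-- The limiting wired probability that the drawing of the open edges satisfies `P`. -/
def pr (G : SimpleGraph V) (q x : ℝ) (P : Set (ℝ × ℝ) → Prop) : ℝ := mu q x (ev G P)

theorem isUpperSet_ev {P : Set (ℝ × ℝ) → Prop} (hP : Monotone P) : IsUpperSet (ev G P) :=
  fun _ _ h hS => hP (drawing_mono h) hS

variable {q x y : ℝ} {P Q : Set (ℝ × ℝ) → Prop}

theorem pr_mono (hq : 1 ≤ q) (hx : 0 < x)
    (h : ∀ X, X ⊆ drawing (Set.univ : Set G.edgeSet) → P X → Q X) : pr G q x P ≤ pr G q x Q :=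
  mu_mono hq hx fun S hS => h _ (drawing_mono (Set.subset_univ S)) hS

theorem pr_mono_param (hq : 1 ≤ q) (hx : 0 < x) (hxy : x ≤ y) (hP : Monotone P) :
    pr G q x P ≤ pr G q y P := mu_mono_param hq hx hxy (isUpperSet_ev hP)

theorem pr_nonneg (hq : 1 ≤ q) (hx : 0 < x) : 0 ≤ pr G q x P := mu_nonneg hq hx _

theorem pr_mul_le_and (hq : 1 ≤ q) (hx : 0 < x) (hP : Monotone P) (hQ : Monotone Q) :
    pr G q x P * pr G q x Q ≤ pr G q x fun X => P X ∧ Q X :=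
  mu_mul_le_inter hq hx (isUpperSet_ev hP) (isUpperSet_ev hQ)

theorem pr_and_ge (hq : 1 ≤ q) (hx : 0 < x) (hP : Monotone P) (hQ : Monotone Q) {a b : ℝ}
    (ha0 : 0 ≤ a) (hb0 : 0 ≤ b) (ha : a ≤ pr G q x P) (hb : b ≤ pr G q x Q) :
    a * b ≤ pr G q x fun X => P X ∧ Q X :=
  (mul_le_mul ha hb hb0 (ha0.trans ha)).trans (pr_mul_le_and hq hx hP hQ)

theorem pr_or_le (hq : 1 ≤ q) (hx : 0 < x) (hP : Monotone P) (hQ : Monotone Q) :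
    pr G q x (fun X => P X ∨ Q X) ≤ pr G q x P + pr G q x Q :=
  mu_union_le hq hx (isUpperSet_ev hP) (isUpperSet_ev hQ)

theorem pr_exists_le {ι : Type*} (hq : 1 ≤ q) (hx : 0 < x) (s : Finset ι)
    {P : ι → Set (ℝ × ℝ) → Prop} (hP : ∀ i ∈ s, Monotone (P i)) :
    pr G q x (fun X => ∃ i ∈ s, P i X) ≤ ∑ i ∈ s, pr G q x (P i) := by
  have h := mu_biUnion_le (x := x) hq hx s (A := fun i => ev G (P i)) fun i hi =>
    isUpperSet_ev (hP i hi)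
  have e : ev G (fun X => ∃ i ∈ s, P i X) = ⋃ i ∈ s, ev G (P i) := by
    ext S; simp [ev]
  rw [pr, e]; exact h

theorem pr_forall_ge {ι : Type*} (hq : 1 ≤ q) (hx : 0 < x) (s : Finset ι)
    {P : ι → Set (ℝ × ℝ) → Prop} (hP : ∀ i ∈ s, Monotone (P i)) {c : ℝ} (hc : 0 ≤ c)
    (h : ∀ i ∈ s, c ≤ pr G q x (P i)) : c ^ s.card ≤ pr G q x (fun X => ∀ i ∈ s, P i X) := by
  have h1 := mu_prod_le_biInter (x := x) hq hx s (A := fun i => ev G (P i)) fun i hi =>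
    isUpperSet_ev (hP i hi)
  have e : ev G (fun X => ∀ i ∈ s, P i X) = ⋂ i ∈ s, ev G (P i) := by
    ext S; simp [ev]
  rw [pr, e]
  refine le_trans ?_ h1
  rw [← Finset.prod_const]
  exact Finset.prod_le_prod (fun _ _ => hc) h

theorem pr_image {f : ℝ × ℝ → ℝ × ℝ} (hf : IsSym G f) (P : Set (ℝ × ℝ) → Prop) :
    pr G q x (fun X => P (f '' X)) = pr G q x P := by
  obtain ⟨σ, hσ⟩ := hf.aut
  rw [pr, pr, ← mu_image σ (ev G P)]
  congr 1
  ext S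
  simp only [ev, Set.mem_ofPred_eq, drawing_image hσ hf]

theorem image_drawing_univ {f : ℝ × ℝ → ℝ × ℝ} (hf : IsSym G f) :
    f '' drawing (Set.univ : Set G.edgeSet) = drawing (Set.univ : Set G.edgeSet) := by
  obtain ⟨σ, hσ⟩ := hf.aut
  rw [← drawing_image hσ hf, Set.image_univ, σ.mapEdgeSet.surjective.range_eq]

theorem localOn_ev {B : Set (ℝ × ℝ)} (hP : ∀ X Y : Set (ℝ × ℝ), X ∩ B = Y ∩ B → (P X ↔ P Y)) :
    LocalOn {e : G.edgeSet | (seg e ∩ B).Nonempty} (ev G P) := by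
  intro S T h
  refine hP _ _ ?_
  have key : ∀ S T : Set G.edgeSet, S ∩ {e : G.edgeSet | (seg e ∩ B).Nonempty} =
      T ∩ {e : G.edgeSet | (seg e ∩ B).Nonempty} → drawing S ∩ B ⊆ drawing T ∩ B := by
    rintro S T h z ⟨hz, hzB⟩
    obtain ⟨e, he, hze⟩ := mem_drawing.1 hz
    have : e ∈ T ∩ {e : G.edgeSet | (seg e ∩ B).Nonempty} := h ▸ ⟨he, z, hze, hzB⟩
    exact ⟨seg_subset_drawing this.1 hze, hzB⟩
  exact (key S T h).antisymm (key T S h.symm)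

theorem IsLattice.pr_inter_subset_pos (hG : IsLattice G) (hq : 1 ≤ q) (hx : 0 < x)
    {B : Set (ℝ × ℝ)} (hB : Bornology.IsBounded B) :
    0 < pr G q x fun X => drawing (Set.univ : Set G.edgeSet) ∩ B ⊆ X := by
  have hfin := hG.finite_seg_meeting hB
  have h1 := mu_subset_pos hq hx hfin.toFinset
  have hq0 : 0 < q := by linarith
  refine lt_of_lt_of_le (pow_pos (by positivity) _) (h1.trans (mu_mono hq hx ?_))
  intro S hS z hz
  obtain ⟨e, -, hze⟩ := mem_drawing.1 hz.1
  exact seg_subset_drawing (hS (by simpa using ⟨z, hze, hz.2⟩)) hze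

end Drawing

end

section

open Filter Topology

/-! ### The core and the feet that leave it -/

section Core

variable {V : Set (ℝ × ℝ)} {G : SimpleGraph V}

/-- The square of side `2r` centred at the origin. -/
def box (r : ℝ) : Set (ℝ × ℝ) := {z | |z.1| ≤ r ∧ |z.2| ≤ r}

theorem mem_box_iff_norm {r : ℝ} {z : ℝ × ℝ} : z ∈ box r ↔ ‖z‖ ≤ r := by
  simp [box, Prod.norm_def]

theorem isBounded_box (r : ℝ) : Bornology.IsBounded (box r) := by
  refine (Metric.isBounded_closedBall (x := (0 : ℝ × ℝ)) (r := r)).subset fun z hz => ?_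
  simpa using mem_box_iff_norm.1 hz

/-- A bounded connected part of the lattice, invariant under the symmetries of the square, that
contains everything close to the origin. -/
structure IsCore (G : SimpleGraph V) (K : Set (ℝ × ℝ)) (r : ℕ) : Prop where
  joined : ∀ p ∈ K, ∀ p' ∈ K, JoinedIn K p p'
  nonempty : K.Nonempty
  near : ∀ z ∈ drawing (Set.univ : Set G.edgeSet), |z.1| ≤ 3 → |z.2| ≤ 3 → z ∈ K
  sub_drawing : K ⊆ drawing (Set.univ : Set G.edgeSet)
  sub_box : K ⊆ box r
  reflect : ∀ z ∈ K, (-z.1, z.2) ∈ K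
  swap : ∀ z ∈ K, (z.2, z.1) ∈ K

theorem joinedIn_component {E : Type*} [TopologicalSpace E] {D : Set E} {a b : E}
    (h : JoinedIn D a b) : JoinedIn {z | JoinedIn D a z} a b := by
  obtain ⟨γ, hγ, rfl, rfl, hD⟩ := joinedIn_exists_map h
  exact joinedIn_of_map hγ fun s _ => joinedIn_of_map hγ fun _ _ => hD _

theorem IsLattice.conn_univ (hG : IsLattice G) (u v : V) : Conn (Set.univ : Set G.edgeSet) u v := by
  obtain ⟨w⟩ := hG.connected.preconnected u v
  induction w with
  | nil => exact Relation.ReflTransGen.refl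
  | cons h _ ih => exact Relation.ReflTransGen.head ⟨⟨s(_, _), h⟩, Set.mem_univ _, by simp, by simp⟩ ih

/-- The finitely many edges meeting the box of radius 3 are joined to one another inside some larger
box; the core is everything joined to the small box inside the large one. Both boxes are symmetric,
hence so is the core. -/
theorem IsLattice.exists_core (hG : IsLattice G) : ∃ K r, IsCore G K r := by
  set Γ : Set (ℝ × ℝ) := drawing (Set.univ : Set G.edgeSet) with hΓ
  have hvert : ∀ v : V, (v : ℝ × ℝ) ∈ Γ := fun v => by
    obtain ⟨e, he⟩ := hG.exists_edge v
    exact seg_subset_drawing (Set.mem_univ e) (mem_seg_of_mem he)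
  have hfin := hG.finite_seg_meeting (isBounded_box 3)
  set F := hfin.toFinset with hF
  have hev : ∀ᶠ L : ℝ in atTop, ∀ u ∈ verts F, ∀ v ∈ verts F,
      JoinedIn (Γ ∩ box L) (u : ℝ × ℝ) v := by
    refine (eventually_all_finite (verts_finite F)).2 fun u _ =>
      (eventually_all_finite (verts_finite F)).2 fun v _ => ?_
    obtain ⟨γ, hγ⟩ := (hG.conn_univ u v).joinedIn (hvert u)
    obtain ⟨L₀, hL₀⟩ := ((isCompact_range γ.continuous).isBounded).subset_closedBall 0
    filter_upwards [eventually_ge_atTop L₀] with L hL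
    refine ⟨γ, fun t => ⟨hγ t, mem_box_iff_norm.2 ?_⟩⟩
    have := hL₀ (Set.mem_range_self t)
    rw [mem_closedBall_zero_iff] at this
    exact this.trans hL
  have hev2 : ∀ᶠ L : ℝ in atTop, ∀ e ∈ F, seg e ⊆ box L := by
    refine (eventually_all_finset F).2 fun e _ => ?_
    obtain ⟨L₀, hL₀⟩ := (isCompact_seg e).isBounded.subset_closedBall 0
    filter_upwards [eventually_ge_atTop L₀] with L hL z hz
    have := hL₀ hz
    rw [mem_closedBall_zero_iff] at this
    exact mem_box_iff_norm.2 (this.trans hL)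
  obtain ⟨L, hL1, hL2, hL3⟩ := (hev.and (hev2.and (eventually_ge_atTop 3))).exists
  have hyy : ∀ y ∈ Γ ∩ box 3, ∀ y' ∈ Γ ∩ box 3, JoinedIn (Γ ∩ box L) y y' := by
    have key : ∀ y ∈ Γ ∩ box 3, ∃ u ∈ verts F, JoinedIn (Γ ∩ box L) y (u : ℝ × ℝ) := by
      rintro y ⟨hy, hyb⟩
      obtain ⟨e, -, hye⟩ := mem_drawing.1 hy
      have heF : e ∈ F := by simpa [hF] using ⟨y, hye, hyb⟩
      obtain ⟨a, b, he, -⟩ := exists_eq_mk e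
      have ha : a ∈ (e : Sym2 V) := by rw [he]; simp
      exact ⟨a, ⟨e, heF, ha⟩, (joinedIn_seg e hye (mem_seg_of_mem ha)).mono fun z hz =>
        ⟨seg_subset_drawing (Set.mem_univ e) hz, hL2 e heF hz⟩⟩
    intro y hy y' hy'
    obtain ⟨u, hu, h1⟩ := key y hy
    obtain ⟨u', hu', h2⟩ := key y' hy'
    exact h1.trans ((hL1 u hu u' hu').trans h2.symm)
  set K : Set (ℝ × ℝ) := {z | ∃ y ∈ Γ ∩ box 3, JoinedIn (Γ ∩ box L) y z} with hK
  have hbox : box (3 : ℝ) ⊆ box L := fun z hz => ⟨hz.1.trans hL3, hz.2.trans hL3⟩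
  have himage : ∀ f : ℝ × ℝ → ℝ × ℝ, IsSym G f → (∀ s, ∀ z ∈ box s, f z ∈ box s) →
      ∀ z ∈ K, f z ∈ K := by
    rintro f hf hfb z ⟨y, hy, hj⟩
    refine ⟨f y, ⟨(image_drawing_univ hf).subset (Set.mem_image_of_mem f hy.1), hfb _ _ hy.2⟩, ?_⟩
    refine (joinedIn_image hf.cont hj).mono ?_
    rintro _ ⟨v, hv, rfl⟩
    exact ⟨(image_drawing_univ hf).subset (Set.mem_image_of_mem f hv.1), hfb _ _ hv.2⟩
  refine ⟨K, ⌈L⌉₊, ?_, ?_, ?_, ?_, ?_, ?_, ?_⟩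
  · have key : ∀ p ∈ K, ∀ y ∈ Γ ∩ box 3, JoinedIn K y p := by
      rintro p ⟨y₀, hy₀, hj⟩ y hy
      exact (joinedIn_component ((hyy y hy y₀ hy₀).trans hj)).mono fun z hz => ⟨y, hy, hz⟩
    intro p hp p' hp'
    obtain ⟨y, hy, -⟩ := id hp
    exact (key p hp y hy).symm.trans (key p' hp' y hy)
  · obtain ⟨v⟩ := hG.connected.nonempty
    obtain ⟨σ, hσ⟩ := hG.inducesAut_translate (-⌊(v : ℝ × ℝ).1⌋) (-⌊(v : ℝ × ℝ).2⌋)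
    have hb : ((σ v : V) : ℝ × ℝ) ∈ box 3 := by
      rw [hσ]
      have h1 := Int.floor_le (v : ℝ × ℝ).1
      have h2 := Int.lt_floor_add_one (v : ℝ × ℝ).1
      have h3 := Int.floor_le (v : ℝ × ℝ).2
      have h4 := Int.lt_floor_add_one (v : ℝ × ℝ).2
      refine ⟨abs_le.2 ⟨?_, ?_⟩, abs_le.2 ⟨?_, ?_⟩⟩ <;> push_cast <;> linarith
    exact ⟨_, _, ⟨hvert (σ v), hb⟩, JoinedIn.refl ⟨hvert _, hbox hb⟩⟩
  · exact fun z hz h1 h2 => ⟨z, ⟨hz, h1, h2⟩, JoinedIn.refl ⟨hz, hbox ⟨h1, h2⟩⟩⟩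
  · rintro z ⟨y, -, hj⟩; exact hj.target_mem.1
  · rintro z ⟨y, -, hj⟩
    have := hj.target_mem.2
    exact ⟨this.1.trans (Nat.le_ceil L), this.2.trans (Nat.le_ceil L)⟩
  · exact himage _ hG.isSym_reflect fun s z hz => ⟨by simpa using hz.1, hz.2⟩
  · exact himage _ hG.isSym_swap fun s z hz => ⟨hz.2, hz.1⟩

/-- Translation by an integer vector. -/
def tr (a b : ℤ) (z : ℝ × ℝ) : ℝ × ℝ := (z.1 + a, z.2 + b)

theorem tr_tr_neg (a b : ℤ) (z : ℝ × ℝ) : tr a b (tr (-a) (-b) z) = z := by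
  ext <;> simp [tr]

/-- The core is open and there is an open path from the core to the right side of the square of
side `2t`, which reaches this side at its end only, at a height in `J`. -/
def Foot (K : Set (ℝ × ℝ)) (t : ℝ) (J : Set ℝ) (X : Set (ℝ × ℝ)) : Prop :=
  K ⊆ X ∧ ∃ p ∈ K, ∃ w ∈ X, w.1 = t ∧ w.2 ∈ J ∧ |w.2| ≤ t ∧
    JoinedIn ((X ∩ {z | z ∈ box t ∧ z.1 < t}) ∪ {w}) p w

theorem foot_mono (K : Set (ℝ × ℝ)) (t : ℝ) (J : Set ℝ) : Monotone (Foot K t J) := by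
  rintro X Y h ⟨hK, p, hp, w, hw, h1, h2, h3, hj⟩
  exact ⟨hK.trans h, p, hp, w, h hw, h1, h2, h3,
    hj.mono (Set.union_subset_union_left _ (Set.inter_subset_inter_left _ h))⟩

theorem monotone_image {P : Set (ℝ × ℝ) → Prop} (hP : Monotone P) (f : ℝ × ℝ → ℝ × ℝ) :
    Monotone fun X => P (f '' X) := fun _ _ h => hP (Set.image_mono h)

theorem foot_transfer {K : Set (ℝ × ℝ)} {t : ℝ} {J : Set ℝ} {X : Set (ℝ × ℝ)}
    {f g : ℝ × ℝ → ℝ × ℝ} (hf : Continuous f) (hfg : ∀ z, f (g z) = z) (h : Foot K t J (g '' X)) :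
    (∀ z ∈ K, f z ∈ X) ∧ ∃ p ∈ K, ∃ w, f w ∈ X ∧ w.1 = t ∧ w.2 ∈ J ∧ |w.2| ≤ t ∧
      JoinedIn ({z | z ∈ X ∧ g z ∈ box t ∧ (g z).1 < t} ∪ {f w}) (f p) (f w) := by
  obtain ⟨hK, p, hp, w, hw, h1, h2, h3, hj⟩ := h
  have hX : ∀ z ∈ g '' X, f z ∈ X := by
    rintro _ ⟨z, hz, rfl⟩; rwa [hfg]
  refine ⟨fun z hz => hX z (hK hz), p, hp, w, hX w hw, h1, h2, h3,
    (joinedIn_image hf hj).mono ?_⟩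
  rintro _ ⟨z, ⟨⟨z', hz', rfl⟩, hz⟩ | hz, rfl⟩
  · left
    simp only [Set.mem_ofPred_eq, hfg] at hz ⊢
    exact ⟨hz', hz⟩
  · right
    rw [Set.mem_singleton_iff] at hz
    rw [hz]; rfl

/-- The point `k` and its translate by `(d, 0)` are joined in the part of `X` inside a horizontal
strip. -/
def Link (k : ℝ × ℝ) (d : ℤ) (s : ℝ) (X : Set (ℝ × ℝ)) : Prop :=
  JoinedIn (X ∩ {z | |z.2| ≤ s}) k (tr d 0 k)

theorem link_mono (k : ℝ × ℝ) (d : ℤ) (s : ℝ) : Monotone (Link k d s) :=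
  fun _ _ h hX => JoinedIn.mono hX (Set.inter_subset_inter_left _ h)

theorem subset_mono (B : Set (ℝ × ℝ)) : Monotone fun X : Set (ℝ × ℝ) => B ⊆ X :=
  fun _ _ h hB => Set.Subset.trans hB h

variable {K : Set (ℝ × ℝ)} {r : ℕ} {q x : ℝ}

theorem IsCore.reflect_snd (hK : IsCore G K r) (z : ℝ × ℝ) (hz : z ∈ K) : (z.1, -z.2) ∈ K :=
  hK.swap _ (hK.reflect _ (hK.swap _ hz))

/-- If the one-arm probabilities do not tend to zero, the probability that the core is connected to
the right side of a large square is bounded below. -/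
theorem IsCore.exists_foot_ge (hK : IsCore G K r) (hG : IsLattice G) (hq : 1 ≤ q) (hx : 0 < x)
    {θ : ℝ} (hθ : 0 < θ) (harm : ∀ n : ℕ, θ ≤ theta G q n x) :
    ∃ a, 0 < a ∧ ∀ t : ℕ, r < t → a ≤ pr G q x (Foot K t Set.univ) := by
  set Γ : Set (ℝ × ℝ) := drawing (Set.univ : Set G.edgeSet) with hΓ
  set cK := pr G q x fun X => Γ ∩ box r ⊆ X with hcK
  have hcK0 : 0 < cK := hG.pr_inter_subset_pos hq hx (isBounded_box r)
  have hKcK : cK ≤ pr G q x fun X => K ⊆ X := pr_mono hq hx fun X _ h z hz =>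
    h ⟨hK.sub_drawing hz, hK.sub_box hz⟩
  -- Positive association combines the open core with an exit from the box; the four sides are
  -- equally likely.
  refine ⟨cK * (θ / 2) / 4, by positivity, fun t ht => ?_⟩
  have htR : (r : ℝ) < t := by exact_mod_cast ht
  set Exit : Set (ℝ × ℝ) → Prop := fun X => ∃ p ∈ K, ∃ w ∈ X, ‖w‖ = t ∧
    JoinedIn ((X ∩ {z | ‖z‖ < t}) ∪ {w}) p w with hExit
  have hExit_mono : Monotone Exit := by
    rintro X Y h ⟨p, hp, w, hw, h1, hj⟩
    exact ⟨p, hp, w, h hw, h1, hj.mono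
      (Set.union_subset_union_left _ (Set.inter_subset_inter_left _ h))⟩
  have hexit : θ / 2 ≤ pr G q x Exit := by
    -- The starting vertex is moved to norm at most 1, so an arm of length `t + 2` leaves the box of
    -- radius `t`. Halving `θ` allows an actual vertex in place of the supremum.
    have hlt : θ / 2 < theta G q (t + 2) x := by linarith [harm (t + 2)]
    obtain ⟨v⟩ := hG.connected.nonempty
    have : Nonempty V := ⟨v⟩
    obtain ⟨u, hu⟩ := exists_lt_of_lt_ciSup hlt
    refine hu.le.trans ?_
    obtain ⟨σ, hσ⟩ := hG.inducesAut_translate (-⌊(u : ℝ × ℝ).1⌋) (-⌊(u : ℝ × ℝ).2⌋)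
    rw [pr, ← mu_image σ (ev G Exit)]
    refine mu_mono hq hx ?_
    rintro S ⟨w, hw, hc⟩
    have hc' := conn_map σ hc
    set T := σ.mapEdgeSet '' S
    have hb : |((σ u : V) : ℝ × ℝ).1| ≤ 1 ∧ |((σ u : V) : ℝ × ℝ).2| ≤ 1 := by
      rw [hσ]
      have h1 := Int.floor_le (u : ℝ × ℝ).1
      have h2 := Int.lt_floor_add_one (u : ℝ × ℝ).1
      have h3 := Int.floor_le (u : ℝ × ℝ).2
      have h4 := Int.lt_floor_add_one (u : ℝ × ℝ).2
      refine ⟨abs_le.2 ⟨?_, ?_⟩, abs_le.2 ⟨?_, ?_⟩⟩ <;> push_cast <;> linarith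
    have hnorm : ‖((σ u : V) : ℝ × ℝ)‖ ≤ 1 := mem_box_iff_norm.1 hb
    have hdist : (t : ℝ) + 2 ≤ dist ((σ u : V) : ℝ × ℝ) (σ w) := by
      rw [hσ, hσ]
      rw [dist_translate]
      have : ((t + 2 : ℕ) : ℝ) = t + 2 := by push_cast; ring
      rw [← this]; exact hw
    have hne : σ u ≠ σ w := fun h => by
      rw [h, dist_self] at hdist
      have : (0 : ℝ) ≤ t := Nat.cast_nonneg t
      linarith
    have hmem := Conn.mem_drawing hc' hne
    have hj := hc'.joinedIn hmem
    have hr0 : (0 : ℝ) ≤ r := Nat.cast_nonneg r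
    have ht1 : (1 : ℝ) ≤ t := by exact_mod_cast (by omega : 1 ≤ t)
    obtain ⟨z, hz, hzt, hjz⟩ := joinedIn_first_hit hj (g := fun z => ‖z‖) continuous_norm
      (t := (t : ℝ)) (by linarith) (by
        have h1 : dist ((σ u : V) : ℝ × ℝ) (σ w) ≤ ‖((σ u : V) : ℝ × ℝ)‖ + ‖((σ w : V) : ℝ × ℝ)‖ := by
          rw [dist_eq_norm]; exact norm_sub_le _ _
        linarith)
    refine ⟨_, hK.near _ (drawing_mono (Set.subset_univ _) hmem) (hb.1.trans (by norm_num))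
      (hb.2.trans (by norm_num)), z, hz, hzt, hjz⟩
  have hboth := pr_and_ge hq hx (subset_mono K) hExit_mono hcK0.le (by positivity) hKcK hexit
  -- each side of the square is equally likely
  have hside : ∀ f g : ℝ × ℝ → ℝ × ℝ, IsSym G f → (∀ z ∈ K, f z ∈ K) → (∀ z ∈ K, g z ∈ K) →
      (∀ z, f (g z) = z) → (∀ z, ‖f z‖ = ‖z‖) →
      ∀ X, K ⊆ X → ∀ p ∈ K, ∀ w ∈ X, ‖w‖ = t → (f w).1 = t →
      JoinedIn ((X ∩ {z | ‖z‖ < t}) ∪ {w}) p w → Foot K t Set.univ (f '' X) := by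
    intro f g hf hfK hgK hfg hnorm X hKX p hp w hw hwt hfw hj
    have hfbox := mem_box_iff_norm (z := f w) (r := t)
    rw [hnorm, hwt] at hfbox
    refine ⟨fun z hz => ⟨g z, hKX (hgK z hz), hfg z⟩, f p, hfK p hp, f w, ⟨w, hw, rfl⟩, hfw,
      Set.mem_univ _, (hfbox.2 le_rfl).2, (joinedIn_image hf.cont hj).mono ?_⟩
    rintro _ ⟨z, ⟨hzX, hz⟩ | hz, rfl⟩
    · left
      simp only [Set.mem_ofPred_eq] at hz
      rw [← hnorm] at hz
      refine ⟨⟨z, hzX, rfl⟩, mem_box_iff_norm.2 hz.le, ?_⟩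
      exact (le_abs_self _).trans_lt (lt_of_le_of_lt (norm_fst_le (f z)) hz)
    · right
      rw [Set.mem_singleton_iff] at hz
      rw [hz]; rfl
  have hns : ∀ z : ℝ × ℝ, ‖((z.2, z.1) : ℝ × ℝ)‖ = ‖z‖ := fun z => by
    simp [Prod.norm_def, max_comm]
  have hnr : ∀ z : ℝ × ℝ, ‖((-z.1, z.2) : ℝ × ℝ)‖ = ‖z‖ := fun z => by simp [Prod.norm_def]
  have hcover : pr G q x (fun X => K ⊆ X ∧ Exit X) ≤
      pr G q x (fun X => (Foot K t Set.univ X ∨ Foot K t Set.univ ((fun z => (-z.1, z.2)) '' X)) ∨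
        (Foot K t Set.univ ((fun z => (z.2, z.1)) '' X) ∨
          Foot K t Set.univ (((fun z => (-z.1, z.2)) ∘ fun z => (z.2, z.1)) '' X))) := by
    refine pr_mono hq hx ?_
    rintro X - ⟨hKX, p, hp, w, hw, hwt, hj⟩
    have ht0 : (0 : ℝ) ≤ t := Nat.cast_nonneg t
    have hmax : |w.1| = t ∨ |w.2| = t := by
      rw [Prod.norm_def] at hwt
      simp only [Real.norm_eq_abs] at hwt
      rcases max_choice |w.1| |w.2| with h | h
      · left; rw [← h, hwt]
      · right; rw [← h, hwt]
    rcases hmax with h | h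
    · rcases (abs_eq ht0).1 h with h | h
      · left; left
        have := hside id id ⟨⟨RelIso.refl _, fun _ => rfl⟩, continuous_id, fun a b => by simp⟩
          (fun z hz => hz) (fun z hz => hz) (fun _ => rfl) (fun _ => rfl) X hKX p hp w hw hwt h hj
        simpa using this
      · left; right
        exact hside _ _ hG.isSym_reflect hK.reflect hK.reflect (by simp) hnr X hKX p hp w hw hwt
          (by simp [h]) hj
    · rcases (abs_eq ht0).1 h with h | h
      · right; left
        exact hside _ _ hG.isSym_swap hK.swap hK.swap (by simp) hns X hKX p hp w hw hwt
          (by simp [h]) hj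
      · right; right
        refine hside _ ((fun z => (z.2, z.1)) ∘ fun z => (-z.1, z.2))
          (hG.isSym_reflect.comp hG.isSym_swap) (fun z hz => hK.reflect _ (hK.swap z hz))
          (fun z hz => hK.swap _ (hK.reflect z hz)) (by simp)
          (fun z => (hnr _).trans (hns z)) X hKX p hp w hw hwt (by simp [h]) hj
  have hm := foot_mono K t Set.univ
  have m1 := monotone_image hm (fun z : ℝ × ℝ => (-z.1, z.2))
  have m2 := monotone_image hm (fun z : ℝ × ℝ => (z.2, z.1))
  have m3 := monotone_image hm ((fun z : ℝ × ℝ => (-z.1, z.2)) ∘ fun z : ℝ × ℝ => (z.2, z.1))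
  have mor : ∀ {P Q : Set (ℝ × ℝ) → Prop}, Monotone P → Monotone Q →
      Monotone fun X => P X ∨ Q X := fun hP hQ X Y h => Or.imp (hP h) (hQ h)
  have o1 := pr_or_le (G := G) (x := x) hq hx (mor hm m1) (mor m2 m3)
  have o2 := pr_or_le (G := G) (x := x) hq hx hm m1
  have o3 := pr_or_le (G := G) (x := x) hq hx m2 m3
  rw [pr_image hG.isSym_reflect (Foot K t Set.univ)] at o2
  rw [pr_image hG.isSym_swap (Foot K t Set.univ),
    pr_image (hG.isSym_reflect.comp hG.isSym_swap) (Foot K t Set.univ)] at o3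
  linarith

/-- The typical height at which the right side of the square of side `2t` is reached. -/
theorem IsCore.exists_height (hK : IsCore G K r) (hG : IsLattice G) (hq : 1 ≤ q) (hx : 0 < x)
    {a : ℝ} {t : ℕ} (ha : a ≤ pr G q x (Foot K t Set.univ)) :
    ∃ h : ℕ, h ≤ t ∧ a / 3 ≤ pr G q x (Foot K t (Set.Icc (-h) h)) ∧
      (1 ≤ h → a / 3 ≤ pr G q x (Foot K t (Set.Ici ((h : ℝ) - 1))) ∧
        a / 3 ≤ pr G q x (Foot K t (Set.Iic (-((h : ℝ) - 1))))) := by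
  classical
  have hex : ∃ h : ℕ, a / 3 ≤ pr G q x (Foot K t (Set.Icc (-(h : ℝ)) h)) := by
    refine ⟨t, ?_⟩
    have h1 : pr G q x (Foot K t Set.univ) ≤ pr G q x (Foot K t (Set.Icc (-(t : ℝ)) t)) :=
      pr_mono hq hx fun X _ ⟨hK, p, hp, w, hw, h1, _, h3, hj⟩ =>
        ⟨hK, p, hp, w, hw, h1, abs_le.1 h3, h3, hj⟩
    have h0 := pr_nonneg (G := G) (P := Foot K t (Set.Icc (-(t : ℝ)) t)) hq hx
    rcases le_total 0 a with h | h <;> linarith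
  refine ⟨Nat.find hex, Nat.find_min' hex ?_, Nat.find_spec hex, fun h1 => ?_⟩
  · have h1 : pr G q x (Foot K t Set.univ) ≤ pr G q x (Foot K t (Set.Icc (-(t : ℝ)) t)) :=
      pr_mono hq hx fun X _ ⟨hK, p, hp, w, hw, h1, _, h3, hj⟩ =>
        ⟨hK, p, hp, w, hw, h1, abs_le.1 h3, h3, hj⟩
    have h0 := pr_nonneg (G := G) (P := Foot K t (Set.Icc (-(t : ℝ)) t)) hq hx
    rcases le_total 0 a with h | h <;> linarith
  · set h := Nat.find hex with hh
    -- The height is minimal, so the central window at `h - 1` has probability below `a / 3`; the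
    -- two outer windows share the remainder and are equally likely by reflection.
    have hmin : pr G q x (Foot K t (Set.Icc (-((h - 1 : ℕ) : ℝ)) ((h - 1 : ℕ) : ℝ))) < a / 3 := by
      have := Nat.find_min hex (m := h - 1) (by omega)
      exact not_le.1 this
    have hcast : ((h - 1 : ℕ) : ℝ) = (h : ℝ) - 1 := by rw [Nat.cast_sub h1]; simp
    rw [hcast] at hmin
    have hsym : pr G q x (Foot K t (Set.Iic (-((h : ℝ) - 1)))) =
        pr G q x (Foot K t (Set.Ici ((h : ℝ) - 1))) := by
      have key : ∀ J J' : Set ℝ, (∀ y ∈ J, -y ∈ J') →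
          pr G q x (Foot K t J) ≤ pr G q x (Foot K t J') := by
        intro J J' hJ
        rw [← pr_image hG.isSym_reflect_snd (Foot K t J')]
        refine pr_mono hq hx ?_
        rintro X - ⟨hKX, p, hp, w, hw, h1, h2, h3, hj⟩
        refine ⟨fun z hz => ⟨(z.1, -z.2), hKX (hK.reflect_snd z hz), by simp⟩, (p.1, -p.2),
          hK.reflect_snd p hp, (w.1, -w.2), ⟨w, hw, rfl⟩, h1, hJ _ h2, by simpa using h3,
          (joinedIn_image hG.isSym_reflect_snd.cont hj).mono ?_⟩
        rintro _ ⟨z, ⟨hzX, hz⟩ | hz, rfl⟩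
        · left
          exact ⟨⟨z, hzX, rfl⟩, ⟨hz.1.1, by simpa using hz.1.2⟩, hz.2⟩
        · right
          rw [Set.mem_singleton_iff] at hz
          rw [hz]; rfl
      refine le_antisymm (key _ _ fun y hy => ?_) (key _ _ fun y hy => ?_)
      · simp only [Set.mem_Iic, Set.mem_Ici] at *; linarith
      · simp only [Set.mem_Iic, Set.mem_Ici] at *; linarith
    have hor : pr G q x (Foot K t Set.univ) ≤ pr G q x (fun X =>
        Foot K t (Set.Icc (-((h : ℝ) - 1)) ((h : ℝ) - 1)) X ∨
          (Foot K t (Set.Ici ((h : ℝ) - 1)) X ∨ Foot K t (Set.Iic (-((h : ℝ) - 1))) X)) := by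
      refine pr_mono hq hx ?_
      rintro X - ⟨hKX, p, hp, w, hw, h1, -, h3, hj⟩
      rcases le_total ((h : ℝ) - 1) w.2 with h4 | h4
      · exact Or.inr (Or.inl ⟨hKX, p, hp, w, hw, h1, h4, h3, hj⟩)
      · rcases le_total w.2 (-((h : ℝ) - 1)) with h5 | h5
        · exact Or.inr (Or.inr ⟨hKX, p, hp, w, hw, h1, h5, h3, hj⟩)
        · exact Or.inl ⟨hKX, p, hp, w, hw, h1, ⟨h5, h4⟩, h3, hj⟩
    have hm := fun J => foot_mono K t J
    have o1 := pr_or_le (G := G) (x := x) hq hx (hm (Set.Icc (-((h : ℝ) - 1)) ((h : ℝ) - 1)))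
      (Q := fun X => Foot K t (Set.Ici ((h : ℝ) - 1)) X ∨ Foot K t (Set.Iic (-((h : ℝ) - 1))) X)
      (fun X Y h => Or.imp (hm _ h) (hm _ h))
    have o2 := pr_or_le (G := G) (x := x) hq hx (hm (Set.Ici ((h : ℝ) - 1)))
      (hm (Set.Iic (-((h : ℝ) - 1))))
    constructor <;> linarith

end Core

end

section

open Filter Topology

/-! ### Linking cores when the landing height is low or comparable to an earlier one -/

section Catch

variable {V : Set (ℝ × ℝ)} {G : SimpleGraph V} {K : Set (ℝ × ℝ)} {r : ℕ} {q x : ℝ}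

theorem IsLattice.isSym_tr (hG : IsLattice G) (a b : ℤ) : IsSym G (tr a b) :=
  hG.isSym_translate a b

theorem continuous_tr (a b : ℤ) : Continuous (tr a b) := by
  unfold tr; fun_prop

/-- Reflection in the vertical line `x = N / 2`. -/
def mirror (N : ℤ) (z : ℝ × ℝ) : ℝ × ℝ := (N - z.1, z.2)

theorem mirror_mirror (N : ℤ) (z : ℝ × ℝ) : mirror N (mirror N z) = z := by
  ext <;> simp [mirror]

theorem continuous_mirror (N : ℤ) : Continuous (mirror N) := by
  unfold mirror; fun_prop

theorem IsLattice.isSym_mirror (hG : IsLattice G) (N : ℤ) : IsSym G (mirror N) := by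
  have h := (hG.isSym_tr N 0).comp hG.isSym_reflect
  convert h using 1
  funext z
  ext <;> simp [mirror, tr]; ring

theorem mem_image_of_leftInverse {f g : ℝ × ℝ → ℝ × ℝ} (hfg : ∀ z, f (g z) = z)
    {X : Set (ℝ × ℝ)} {z : ℝ × ℝ} (h : z ∈ g '' X) : f z ∈ X := by
  obtain ⟨y, hy, rfl⟩ := h
  rwa [hfg]

theorem joinedIn_of_image {f g : ℝ × ℝ → ℝ × ℝ} (hf : Continuous f) (hfg : ∀ z, f (g z) = z)
    {X : Set (ℝ × ℝ)} {s : ℝ} (hs : ∀ z, (f z).2 = z.2) {p p' : ℝ × ℝ}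
    (h : JoinedIn (g '' X ∩ {z | |z.2| ≤ s}) p p') : JoinedIn (X ∩ {z | |z.2| ≤ s}) (f p) (f p') := by
  refine (joinedIn_image hf h).mono ?_
  rintro _ ⟨z, hz, rfl⟩
  exact ⟨mem_image_of_leftInverse hfg hz.1, by simpa [hs] using hz.2⟩

theorem IsCore.pr_subset_pos (hK : IsCore G K r) (hG : IsLattice G) (hq : 1 ≤ q) (hx : 0 < x) :
    0 < pr G q x fun X => K ⊆ X :=
  lt_of_lt_of_le (hG.pr_inter_subset_pos hq hx (isBounded_box r)) (pr_mono hq hx fun _ _ h _ hz =>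
    h ⟨hK.sub_drawing hz, hK.sub_box hz⟩)

/-- A translate of the core lies in a strip. -/
theorem IsCore.joinedIn_tr (hK : IsCore G K r) {X : Set (ℝ × ℝ)} {a b : ℤ} {s : ℝ}
    (hX : ∀ z ∈ K, tr a b z ∈ X) (hs : |(b : ℝ)| + r ≤ s) {p p' : ℝ × ℝ} (hp : p ∈ K) (hp' : p' ∈ K) :
    JoinedIn (X ∩ {z | |z.2| ≤ s}) (tr a b p) (tr a b p') := by
  refine (joinedIn_image (continuous_tr a b) (hK.joined p hp p' hp')).mono ?_
  rintro _ ⟨z, hz, rfl⟩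
  refine ⟨hX z hz, ?_⟩
  have h1 := (hK.sub_box hz).2
  have h2 := abs_add_le z.2 (b : ℝ)
  simp only [Set.mem_ofPred_eq, tr]
  linarith

theorem IsCore.joinedIn_strip (hK : IsCore G K r) {X : Set (ℝ × ℝ)} {s : ℝ}
    (hX : K ⊆ X) (hs : (r : ℝ) ≤ s) {p p' : ℝ × ℝ} (hp : p ∈ K) (hp' : p' ∈ K) :
    JoinedIn (X ∩ {z | |z.2| ≤ s}) p p' :=
  (hK.joined p hp p' hp').mono fun _ hz => ⟨hX hz, (hK.sub_box hz).2.trans hs⟩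

/-- A foot of bounded height is contained in the next core. -/
theorem IsCore.link_of_low (hK : IsCore G K r) {k : ℝ × ℝ} (hk : k ∈ K) {t : ℕ} (ht : r < t)
    {X : Set (ℝ × ℝ)} (hX : X ⊆ drawing (Set.univ : Set G.edgeSet)) (hG : IsLattice G)
    (h1 : Foot K t (Set.Icc (-2) 2) X) (h2 : K ⊆ tr (-t) (-0) '' X) :
    Link k t (3 * t) X := by
  have htR : (r : ℝ) < t := by exact_mod_cast ht
  have hr0 : (0 : ℝ) ≤ r := Nat.cast_nonneg r
  obtain ⟨hKX, p, hp, w, hw, hw1, hw2, hw3, hj⟩ := h1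
  have hwK : tr (-t) (-0) w ∈ K := by
    -- The landing point lies within distance 2 of the centre of the translated core, hence inside
    -- it.
    refine hK.near _ ((image_drawing_univ (hG.isSym_tr _ _)).subset ⟨w, hX hw, rfl⟩) ?_ ?_
    · simp [tr, hw1]
    · have : |w.2| ≤ 2 := abs_le.2 hw2
      simp only [tr]; push_cast; rw [neg_zero, add_zero]; linarith
  have h3 := hK.joinedIn_tr (X := X) (a := t) (b := 0) (s := 3 * t)
    (fun z hz => mem_image_of_leftInverse (tr_tr_neg _ _) (h2 hz)) (by simp; linarith) hwK hk
  rw [tr_tr_neg] at h3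
  refine (hK.joinedIn_strip hKX (by linarith) hk hp).trans (JoinedIn.trans (hj.mono ?_) h3)
  rintro z (⟨hz, hz2, -⟩ | hz)
  · exact ⟨hz, hz2.2.trans (by linarith)⟩
  · rw [Set.mem_singleton_iff.1 hz]
    exact ⟨hw, hw3.trans (by linarith)⟩

/-- The two feet of a translated core catch a foot that arrives between them. -/
theorem IsCore.joinedIn_of_feet (hK : IsCore G K r) {k : ℝ × ℝ} (hk : k ∈ K) {m n β : ℕ} {i : ℤ}
    (hrm : r ≤ m) (hmn : 2 * m + r < n) (hβ : β ≤ m) {X : Set (ℝ × ℝ)}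
    (h0 : Foot K n (Set.Icc (i * β : ℝ) ((i + 1) * β)) X)
    (h1 : Foot K m (Set.Ici (β : ℝ)) (tr (-((n : ℤ) - m)) (-(i * β)) '' X))
    (h2 : Foot K m (Set.Iic (-(β : ℝ))) (tr (-((n : ℤ) - m)) (-(i * β)) '' X)) :
    JoinedIn (X ∩ {z | |z.2| ≤ 3 * n}) k (tr ((n : ℤ) - m) (i * β) k) ∧
      (∀ z ∈ K, tr ((n : ℤ) - m) (i * β) z ∈ X) ∧ |((i * β : ℤ) : ℝ)| + r ≤ 3 * n := by
  obtain ⟨hKX, p, hp, w, hw, hw1, hw2, hw3, hj⟩ := h0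
  obtain ⟨hcK, p₁, hp₁, w₁, hw₁X, h11, h12, h13, hj₁⟩ :=
    foot_transfer (continuous_tr _ _) (tr_tr_neg _ _) h1
  obtain ⟨-, p₂, hp₂, w₂, hw₂X, h21, h22, h23, hj₂⟩ :=
    foot_transfer (continuous_tr _ _) (tr_tr_neg _ _) h2
  have hmnR : (2 * m + r : ℝ) < n := by exact_mod_cast hmn
  have hr0 : (0 : ℝ) ≤ r := Nat.cast_nonneg r
  have hm0 : (0 : ℝ) ≤ m := Nat.cast_nonneg m
  have hβ0 : (0 : ℝ) ≤ β := Nat.cast_nonneg β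
  have hβm : (β : ℝ) ≤ m := by exact_mod_cast hβ
  simp only [Set.mem_Icc, Set.mem_Ici, Set.mem_Iic] at hw2 h12 h22
  have hrmR : (r : ℝ) ≤ m := by exact_mod_cast hrm
  obtain ⟨hwl, hwu⟩ := abs_le.1 hw3
  obtain ⟨hw₁l, hw₁u⟩ := abs_le.1 h13
  obtain ⟨hw₂l, hw₂u⟩ := abs_le.1 h23
  have hiβ : |((i * β : ℤ) : ℝ)| ≤ n + m := by
    push_cast; rw [abs_le]; constructor <;> linarith
  set c := tr ((n : ℤ) - m) (i * β) with hc
  have hcx : ∀ z, (c z).1 = z.1 + (n - m) := fun z => by simp [hc, tr]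
  have hcy : ∀ z, (c z).2 = z.2 + i * β := fun z => by simp [hc, tr]
  have hgx : ∀ z, (tr (-((n : ℤ) - m)) (-(i * β)) z).1 = z.1 - (n - m) := fun z => by
    simp [tr]; ring
  have hgy : ∀ z, (tr (-((n : ℤ) - m)) (-(i * β)) z).2 = z.2 - i * β := fun z => by
    simp [tr]; ring
  set D : Set (ℝ × ℝ) := X ∩ {z | (n : ℝ) - 2 * m ≤ z.1 ∧ z.1 ≤ n ∧ |z.2 - i * β| ≤ m} with hD
  have hDK : ∀ p' ∈ K, ∀ p'' ∈ K, JoinedIn D (c p') (c p'') := by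
    intro p' hp' p'' hp''
    refine (joinedIn_image (continuous_tr _ _) (hK.joined p' hp' p'' hp'')).mono ?_
    rintro _ ⟨z, hz, rfl⟩
    obtain ⟨hz1, hz2⟩ := hK.sub_box hz
    obtain ⟨hz3, hz4⟩ := abs_le.1 hz1
    refine ⟨hcK z hz, ?_, ?_, ?_⟩
    · rw [hcx]; linarith
    · rw [hcx]; linarith
    · rw [hcy, add_sub_cancel_right]; linarith
  have hDfoot : ∀ w', c w' ∈ X → w'.1 = m → |w'.2| ≤ m → ∀ p', p' ∈ K →
      JoinedIn ({z | z ∈ X ∧ tr (-((n : ℤ) - m)) (-(i * β)) z ∈ box m ∧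
        (tr (-((n : ℤ) - m)) (-(i * β)) z).1 < m} ∪ {c w'}) (c p') (c w') →
      JoinedIn D (c k) (c w') := by
    intro w' hw'X hw'1 hw'2 p' hp' hj'
    refine (hDK k hk p' hp').trans (hj'.mono ?_)
    rintro z (⟨hzX, ⟨hz1, hz2⟩, -⟩ | hz)
    · rw [hgx] at hz1
      rw [hgy] at hz2
      obtain ⟨hz3, hz4⟩ := abs_le.1 hz1
      exact ⟨hzX, by linarith, by linarith, hz2⟩
    · rw [Set.mem_singleton_iff.1 hz]
      refine ⟨hw'X, ?_, ?_, ?_⟩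
      · rw [hcx]; linarith
      · rw [hcx]; linarith
      · rw [hcy, add_sub_cancel_right]; linarith
  have hj1 := hDfoot w₁ hw₁X h11 h13 p₁ hp₁ hj₁
  have hj2 := hDfoot w₂ hw₂X h21 h23 p₂ hp₂ hj₂
  -- The translated core and its two feet, prolonged by vertical half-lines on the line of abscissa
  -- `n`, form a barrier from bottom to top of the box. A path from the core to the right side must
  -- meet it.
  set Z : Set (ℝ × ℝ) := {z | JoinedIn D (c k) z} ∪
    ({(n : ℝ)} ×ˢ Set.Ici (c w₁).2 ∪ {(n : ℝ)} ×ˢ Set.Iic (c w₂).2) with hZ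
  have hup : JoinedIn Z (c k) ((n : ℝ), max n (c w₁).2) := by
    refine ((joinedIn_component hj1).mono Set.subset_union_left).trans ?_
    refine JoinedIn.mono ?_ (Set.subset_union_of_subset_right Set.subset_union_left _)
    refine (((convex_singleton (n : ℝ)).prod (convex_Ici (c w₁).2)).isPathConnected
      ⟨((n : ℝ), (c w₁).2), by simp⟩).joinedIn _ ⟨?_, ?_⟩ _ ⟨?_, ?_⟩
    · rw [Set.mem_singleton_iff, hcx, h11]; ring
    · simp
    · simp
    · simp
  have hdown : JoinedIn Z (c k) ((n : ℝ), min (-n) (c w₂).2) := by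
    refine ((joinedIn_component hj2).mono Set.subset_union_left).trans ?_
    refine JoinedIn.mono ?_ (Set.subset_union_of_subset_right Set.subset_union_right _)
    refine (((convex_singleton (n : ℝ)).prod (convex_Iic (c w₂).2)).isPathConnected
      ⟨((n : ℝ), (c w₂).2), by simp⟩).joinedIn _ ⟨?_, ?_⟩ _ ⟨?_, ?_⟩
    · rw [Set.mem_singleton_iff, hcx, h21]; ring
    · simp
    · simp
    · simp
  have hYs : ∀ z ∈ (X ∩ {z | z ∈ box n ∧ z.1 < n}) ∪ {w}, z ∈ X ∧ |z.2| ≤ n := by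
    rintro z (⟨hz, hz2, -⟩ | hz)
    · exact ⟨hz, hz2.2⟩
    · rw [Set.mem_singleton_iff.1 hz]; exact ⟨hw, hw3⟩
  obtain ⟨z, ⟨hzY, hzZ⟩, hpz, -⟩ := joinedIn_meet (a := (n : ℝ) - 2 * m) (b := n) (c := -n) (d := n)
    hj (hdown.symm.trans hup) (fun z hz => abs_le.1 (hYs z hz).2) (by
      rintro z (hz | ⟨hz, -⟩ | ⟨hz, -⟩)
      · exact ⟨hz.target_mem.2.1, hz.target_mem.2.2.1⟩
      · rw [Set.mem_singleton_iff.1 hz]; constructor <;> linarith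
      · rw [Set.mem_singleton_iff.1 hz]; constructor <;> linarith)
    (by have := (abs_le.1 (hK.sub_box hp).1).2; linarith) hw1.ge (min_le_left _ _) (le_max_left _ _)
  -- The path touches the right side only at its end `w`, whose height lies between the ends of the
  -- feet. So a meeting on a half-line can only take place at the end of a foot, which is joined to
  -- the translated core as well.
  have hzw : z.1 = n → z = w := by
    intro hz
    rcases hzY with ⟨-, -, h⟩ | h
    · exact absurd h (by rw [hz]; exact lt_irrefl _)
    · exact h
  have hzD : JoinedIn D (c k) z := by
    rcases hzZ with hz | ⟨hz, hz2⟩ | ⟨hz, hz2⟩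
    · exact hz
    · have e := hzw hz
      have e2 : z = c w₁ := by
        have e3 := hcy w₁
        rw [Set.mem_Ici] at hz2
        refine Prod.ext ?_ ?_
        · rw [Set.mem_singleton_iff.1 hz, hcx, h11]; ring
        · refine le_antisymm ?_ hz2
          rw [e]; linarith
      rw [e2]; exact hj1
    · have e := hzw hz
      have e2 : z = c w₂ := by
        have e3 := hcy w₂
        rw [Set.mem_Iic] at hz2
        refine Prod.ext ?_ ?_
        · rw [Set.mem_singleton_iff.1 hz, hcx, h21]; ring
        · refine le_antisymm hz2 ?_
          rw [e]; linarith
      rw [e2]; exact hj2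
  refine ⟨(hK.joinedIn_strip hKX (by linarith) hk hp).trans (JoinedIn.trans (hpz.mono fun z hz =>
    ⟨(hYs z hz).1, (hYs z hz).2.trans (by linarith)⟩) (hzD.symm.mono ?_)), hcK, by linarith⟩
  rintro z ⟨hzX, -, -, hz⟩
  push_cast at hiβ
  have := abs_add_le (z.2 - i * β) (i * β)
  rw [sub_add_cancel] at this
  exact ⟨hzX, this.trans (by linarith)⟩

/-- The event that a path from the core is caught by a translated core at `(n - m, i β)`. -/
def Caught (K : Set (ℝ × ℝ)) (m n β : ℕ) (i : ℤ) (X : Set (ℝ × ℝ)) : Prop :=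
  Foot K n (Set.Icc (i * β : ℝ) ((i + 1) * β)) X ∧
    Foot K m (Set.Ici (β : ℝ)) (tr (-((n : ℤ) - m)) (-(i * β)) '' X) ∧
    Foot K m (Set.Iic (-(β : ℝ))) (tr (-((n : ℤ) - m)) (-(i * β)) '' X)

theorem caught_mono (K : Set (ℝ × ℝ)) (m n β : ℕ) (i : ℤ) : Monotone (Caught K m n β i) :=
  fun _ _ h hX => ⟨foot_mono _ _ _ h hX.1, foot_mono _ _ _ (Set.image_mono h) hX.2.1,
    foot_mono _ _ _ (Set.image_mono h) hX.2.2⟩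

/-- The mirror line passes through the centre of the catching core, so the mirrored event joins the
same place to the mirrored core; the reflection symmetry of the core identifies the pieces. -/
theorem IsCore.link_of_caught (hK : IsCore G K r) {k : ℝ × ℝ} (hk : k ∈ K) {m n β : ℕ} {i : ℤ}
    (hrm : r ≤ m) (hmn : 2 * m + r < n) (hβ : β ≤ m) {X : Set (ℝ × ℝ)}
    (h0 : Caught K m n β i X) (h1 : Caught K m n β i (mirror (2 * ((n : ℤ) - m)) '' X)) :
    Link k (2 * ((n : ℤ) - m)) (3 * n) X := by
  obtain ⟨hj0, hc0, hs⟩ := hK.joinedIn_of_feet hk hrm hmn hβ h0.1 h0.2.1 h0.2.2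
  obtain ⟨hj1, -, -⟩ := hK.joinedIn_of_feet hk hrm hmn hβ h1.1 h1.2.1 h1.2.2
  have hKX := h1.1.1
  have hmm := mirror_mirror (2 * ((n : ℤ) - m))
  have hj1' := joinedIn_of_image (continuous_mirror _) hmm (fun _ => rfl) hj1
  have e1 : mirror (2 * ((n : ℤ) - m)) k = tr (2 * ((n : ℤ) - m)) 0 (-k.1, k.2) := by
    ext <;> simp [mirror, tr]; ring
  have e2 : mirror (2 * ((n : ℤ) - m)) (tr ((n : ℤ) - m) (i * β) k) =
      tr ((n : ℤ) - m) (i * β) (-k.1, k.2) := by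
    ext <;> simp [mirror, tr]; ring
  rw [e1, e2] at hj1'
  have hk' := hK.reflect k hk
  have hX2 : ∀ z ∈ K, tr (2 * ((n : ℤ) - m)) 0 z ∈ X := by
    intro z hz
    have := mem_image_of_leftInverse hmm (hKX (hK.reflect z hz))
    have e : mirror (2 * ((n : ℤ) - m)) (-z.1, z.2) = tr (2 * ((n : ℤ) - m)) 0 z := by
      ext <;> simp [mirror, tr]; ring
    rwa [e] at this
  have hs2 : |((0 : ℤ) : ℝ)| + r ≤ 3 * n := by
    have := abs_nonneg ((i * β : ℤ) : ℝ)
    simp only [Int.cast_zero, abs_zero]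
    linarith
  exact hj0.trans ((hK.joinedIn_tr hc0 hs hk hk').trans (hj1'.symm.trans
    (hK.joinedIn_tr hX2 hs2 hk' hk)))

theorem IsCore.pr_link_of_low (hK : IsCore G K r) (hG : IsLattice G) (hq : 1 ≤ q) (hx : 0 < x)
    {k : ℝ × ℝ} (hk : k ∈ K) {t : ℕ} (ht : r < t) {a : ℝ} (ha0 : 0 ≤ a)
    (ha : a ≤ pr G q x (Foot K t (Set.Icc (-2) 2))) :
    a * (pr G q x fun X => K ⊆ X) ≤ pr G q x (Link k t (3 * t)) := by
  refine (pr_and_ge hq hx (foot_mono _ _ _) (monotone_image (subset_mono K) (tr (-t) (-0))) ha0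
    (pr_nonneg hq hx) ha (pr_image (hG.isSym_tr _ _) (fun X => K ⊆ X)).ge).trans ?_
  exact pr_mono hq hx fun X hX h => hK.link_of_low hk ht hX hG h.1 h.2

theorem IsCore.pr_link_of_heights (hK : IsCore G K r) (hG : IsLattice G) (hq : 1 ≤ q) (hx : 0 < x)
    {k : ℝ × ℝ} (hk : k ∈ K) {m n β : ℕ} {s : ℝ} (hrm : r ≤ m) (hmn : 2 * m + r < n) (hβ : β ≤ m)
    (hβ0 : 0 < β) (hs : s ≤ 24 * β) {a : ℝ} (ha0 : 0 ≤ a)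
    (ha : a ≤ pr G q x (Foot K n (Set.Icc (-s) s)))
    (h1 : a ≤ pr G q x (Foot K m (Set.Ici (β : ℝ))))
    (h2 : a ≤ pr G q x (Foot K m (Set.Iic (-(β : ℝ))))) :
    (a / 48 * (a * a)) * (a / 48 * (a * a)) ≤
      pr G q x (Link k (2 * ((n : ℤ) - m)) (3 * n)) := by
  have hβR : (0 : ℝ) < β := by exact_mod_cast hβ0
  -- The interval `[-24 β, 24 β]` is cut into 48 pieces of length `β`; one of them carries a
  -- proportional share of the landing probability.
  have hpig : ∃ i ∈ Finset.Icc (-24 : ℤ) 23,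
      a / 48 ≤ pr G q x (Foot K n (Set.Icc (i * β : ℝ) ((i + 1) * β))) := by
    by_contra! hcon
    have h3 := pr_exists_le (G := G) (x := x) hq hx (Finset.Icc (-24 : ℤ) 23)
      (P := fun i => Foot K n (Set.Icc (i * β : ℝ) ((i + 1) * β))) fun i _ => foot_mono _ _ _
    have h4 := Finset.sum_lt_sum_of_nonempty (s := Finset.Icc (-24 : ℤ) 23) (by simp) hcon
    rw [Finset.sum_const, nsmul_eq_mul] at h4
    have h5 : ((Finset.Icc (-24 : ℤ) 23).card : ℝ) = 48 := by simp
    rw [h5] at h4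
    have h6 : pr G q x (Foot K n (Set.Icc (-s) s)) ≤ pr G q x (fun X => ∃ i ∈ Finset.Icc (-24 : ℤ) 23,
        Foot K n (Set.Icc (i * β : ℝ) ((i + 1) * β)) X) := by
      refine pr_mono hq hx ?_
      rintro X - ⟨hKX, p, hp, w, hw, hw1, hw2, hw3, hj⟩
      have hw4 : w.2 ≤ 24 * β := hw2.2.trans hs
      have hw5 : -(24 * β) ≤ w.2 := by linarith [hw2.1]
      have key : ∃ i ∈ Finset.Icc (-24 : ℤ) 23, (i * β : ℝ) ≤ w.2 ∧ w.2 ≤ (i + 1) * β := by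
        by_cases hw6 : w.2 = 24 * β
        · exact ⟨23, by simp, by push_cast; linarith, by push_cast; linarith⟩
        · have hw7 := lt_of_le_of_ne hw4 hw6
          refine ⟨⌊w.2 / β⌋, Finset.mem_Icc.2 ⟨?_, ?_⟩, ?_, ?_⟩
          · rw [Int.le_floor, le_div_iff₀ hβR]; push_cast; linarith
          · rw [← Int.lt_add_one_iff, Int.floor_lt, div_lt_iff₀ hβR]; push_cast; linarith
          · rw [← le_div_iff₀ hβR]; exact Int.floor_le _
          · rw [← div_le_iff₀ hβR]; exact (Int.lt_floor_add_one _).le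
      obtain ⟨i, hi, hi2⟩ := key
      exact ⟨i, hi, hKX, p, hp, w, hw, hw1, hi2, hw3, hj⟩
    linarith
  obtain ⟨i, -, hi⟩ := hpig
  have ht := hG.isSym_tr (-((n : ℤ) - m)) (-(i * β))
  have hc : a / 48 * (a * a) ≤ pr G q x (Caught K m n β i) := by
    refine pr_and_ge hq hx (foot_mono _ _ _) ?_ (by positivity) (by positivity) hi
      (pr_and_ge hq hx (monotone_image (foot_mono _ _ _) _) (monotone_image (foot_mono _ _ _) _)
        ha0 ha0 (h1.trans (pr_image ht _).ge) (h2.trans (pr_image ht _).ge))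
    exact fun _ _ h hX => ⟨foot_mono _ _ _ (Set.image_mono h) hX.1,
      foot_mono _ _ _ (Set.image_mono h) hX.2⟩
  refine (pr_and_ge hq hx (caught_mono K m n β i) (monotone_image (caught_mono K m n β i)
    (mirror (2 * ((n : ℤ) - m)))) (by positivity) (by positivity) hc
    (hc.trans (pr_image (hG.isSym_mirror _) _).ge)).trans ?_
  exact pr_mono hq hx fun X _ h => hK.link_of_caught hk hrm hmn hβ h.1 h.2

end Catch

end

section

open Filter Topology

/-! ### Crossings and circuits built from links -/

section Annuli

variable {V : Set (ℝ × ℝ)} {G : SimpleGraph V} {K : Set (ℝ × ℝ)} {r : ℕ} {q x : ℝ}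

/-- A horizontal crossing of `[a,b] × [c,d]` in the plane set `X`. -/
def Cross (a b c d : ℝ) (X : Set (ℝ × ℝ)) : Prop :=
  ∃ w w' : ℝ × ℝ, w.1 = a ∧ w'.1 = b ∧
    JoinedIn (X ∩ {z | (a ≤ z.1 ∧ z.1 ≤ b) ∧ c ≤ z.2 ∧ z.2 ≤ d}) w w'

theorem cross_mono (a b c d : ℝ) : Monotone (Cross a b c d) := by
  rintro X Y h ⟨w, w', hw, hw', hj⟩
  exact ⟨w, w', hw, hw', hj.mono (Set.inter_subset_inter_left _ h)⟩

/-- At scale `t`, the core is linked to a translate at distance between `t` and `2t` with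
probability at least `g`. -/
def Good (G : SimpleGraph V) (q x : ℝ) (k : ℝ × ℝ) (t : ℕ) (g : ℝ) : Prop :=
  ∃ d : ℤ, t ≤ d ∧ d ≤ 2 * t ∧ g ≤ pr G q x (Link k d (3 * t))

theorem Good.mono {k : ℝ × ℝ} {t : ℕ} {g g' : ℝ} (h : Good G q x k t g) (hg : g' ≤ g) :
    Good G q x k t g' := by
  obtain ⟨d, h1, h2, h3⟩ := h
  exact ⟨d, h1, h2, hg.trans h3⟩

theorem Good.mono_param {k : ℝ × ℝ} {t : ℕ} {g y : ℝ} (hq : 1 ≤ q) (hx : 0 < x) (hxy : x ≤ y)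
    (h : Good G q x k t g) : Good G q y k t g := by
  obtain ⟨d, h1, h2, h3⟩ := h
  exact ⟨d, h1, h2, h3.trans (pr_mono_param hq hx hxy (link_mono _ _ _))⟩

theorem joinedIn_chain {X : Set (ℝ × ℝ)} {k : ℝ × ℝ} {d y : ℤ} {s : ℝ} (a : ℤ) (n : ℕ)
    (h : ∀ i ∈ Finset.Ico a (a + n), Link k d s (tr (-(i * d)) (-y) '' X)) (hn : 0 < n) :
    JoinedIn (X ∩ {z | y - s ≤ z.2 ∧ z.2 ≤ y + s}) (tr (a * d) y k) (tr ((a + n) * d) y k) := by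
  have hstep : ∀ i ∈ Finset.Ico a (a + n),
      JoinedIn (X ∩ {z | y - s ≤ z.2 ∧ z.2 ≤ y + s}) (tr (i * d) y k) (tr ((i + 1) * d) y k) := by
    intro i hi
    have h1 := joinedIn_image (continuous_tr (i * d) y) (h i hi)
    have e : tr (i * d) y (tr d 0 k) = tr ((i + 1) * d) y k := by
      ext <;> simp [tr]; ring
    rw [e] at h1
    refine h1.mono ?_
    rintro _ ⟨z, ⟨⟨z', hz', rfl⟩, hz⟩, rfl⟩
    rw [tr_tr_neg]
    refine ⟨hz', ?_⟩
    simp only [Set.mem_ofPred_eq, tr] at hz ⊢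
    push_cast at hz
    rw [abs_le] at hz
    constructor <;> linarith [hz.1, hz.2]
  have key : ∀ j : ℕ, j < n → JoinedIn (X ∩ {z | y - s ≤ z.2 ∧ z.2 ≤ y + s})
      (tr (a * d) y k) (tr ((a + (j + 1 : ℕ)) * d) y k) := by
    intro j
    induction j with
    | zero =>
      intro h0
      simpa using hstep a (by simp; omega)
    | succ j ih =>
      intro hj
      refine (ih (by omega)).trans ?_
      have := hstep (a + (j + 1 : ℕ)) (by simp; omega)
      convert this using 3
      push_cast; ring
  obtain ⟨j, rfl⟩ : ∃ j, n = j + 1 := ⟨n - 1, by omega⟩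
  exact key j (by omega)

/-- A chain of `2 (N + 1)` translated links, each of horizontal length at least `t`, spans from `-(N
+ 1) t` to `(N + 1) t` up to the size of the core, within height `3 t` of its axis. The extra unit
at each end absorbs the core. -/
theorem IsCore.pr_cross_ge (hK : IsCore G K r) (hG : IsLattice G) (hq : 1 ≤ q) (hx : 0 < x)
    {k : ℝ × ℝ} (hk : k ∈ K) {t : ℕ} (ht : r ≤ t) {g : ℝ} (hg : 0 ≤ g) (h : Good G q x k t g)
    (N : ℕ) (y : ℤ) {a b c d : ℝ} (hab : a ≤ b) (ha : -(N * t) ≤ a) (hb : b ≤ N * t)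
    (hc : c ≤ y - 3 * t) (hd : y + 3 * t ≤ d) :
    g ^ (2 * (N + 1)) ≤ pr G q x (Cross a b c d) := by
  obtain ⟨D, hD1, hD2, hD⟩ := h
  have h1 := pr_forall_ge (G := G) (x := x) hq hx
    (Finset.Ico (-(N + 1 : ℤ)) (-(N + 1 : ℤ) + (2 * (N + 1) : ℕ)))
    (P := fun i X => Link k D (3 * t) (tr (-(i * D)) (-y) '' X)) (c := g)
    (fun i _ => monotone_image (link_mono _ _ _) _) hg fun i _ => hD.trans
      (pr_image (hG.isSym_tr _ _) (Link k D (3 * t))).ge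
  rw [Int.card_Ico, add_sub_cancel_left, Int.toNat_natCast] at h1
  refine h1.trans (pr_mono hq hx fun X _ hX => ?_)
  have hj := joinedIn_chain _ _ hX (by omega)
  have hDR : (t : ℝ) ≤ D := by exact_mod_cast hD1
  have htR : (r : ℝ) ≤ t := by exact_mod_cast ht
  have hkx := abs_le.1 (hK.sub_box hk).1
  have hN : (0 : ℝ) ≤ N := Nat.cast_nonneg N
  have hND : ((N : ℝ) + 1) * t ≤ (N + 1) * D := by gcongr
  obtain ⟨w, w', hw, hw', hj'⟩ := joinedIn_truncate_fst hj hab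
    (by simp only [tr]; push_cast; linarith [hkx.2])
    (by simp only [tr]; push_cast; linarith [hkx.1])
  refine ⟨w, w', hw, hw', hj'.mono ?_⟩
  rintro z ⟨⟨hzX, hz1, hz2⟩, hz3⟩
  exact ⟨hzX, hz3, by linarith, by linarith⟩

/-- The crossing of the top rectangle of the annulus with radii `5t` and `11t`. -/
def TopCross (t : ℝ) : Set (ℝ × ℝ) → Prop := Cross (-(11 * t)) (11 * t) (5 * t) (11 * t)

/-- Four crossings which surround the square `[-5t,5t]²`. -/
def Ann (t : ℝ) (X : Set (ℝ × ℝ)) : Prop :=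
  TopCross t X ∧ TopCross t ((fun z => (z.1, -z.2)) '' X) ∧ TopCross t ((fun z => (z.2, z.1)) '' X) ∧
    TopCross t (((fun z => (z.1, -z.2)) ∘ fun z => (z.2, z.1)) '' X)

theorem ann_mono (t : ℝ) : Monotone (Ann t) := fun _ _ h hX =>
  ⟨cross_mono _ _ _ _ h hX.1, cross_mono _ _ _ _ (Set.image_mono h) hX.2.1,
    cross_mono _ _ _ _ (Set.image_mono h) hX.2.2.1, cross_mono _ _ _ _ (Set.image_mono h) hX.2.2.2⟩

theorem IsLattice.pr_ann_ge (hG : IsLattice G) (hq : 1 ≤ q) (hx : 0 < x) {t c : ℝ} (h0 : 0 ≤ c)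
    (h1 : c ≤ pr G q x (TopCross t)) : c * (c * (c * c)) ≤ pr G q x (Ann t) := by
  have hm : Monotone (TopCross t) := cross_mono _ _ _ _
  have m1 := monotone_image hm fun z => (z.1, -z.2)
  have m2 := monotone_image hm fun z => (z.2, z.1)
  have m3 := monotone_image hm ((fun z => (z.1, -z.2)) ∘ fun z => (z.2, z.1))
  have p1 := h1.trans (pr_image (q := q) (x := x) hG.isSym_reflect_snd (TopCross t)).ge
  have p2 := h1.trans (pr_image (q := q) (x := x) hG.isSym_swap (TopCross t)).ge
  have p3 := h1.trans (pr_image (q := q) (x := x) (hG.isSym_reflect_snd.comp hG.isSym_swap)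
    (TopCross t)).ge
  have h2 := pr_and_ge hq hx m2 m3 h0 h0 p2 p3
  have h3 := pr_and_ge hq hx m1 (fun _ _ h hX => ⟨m2 h hX.1, m3 h hX.2⟩) h0 (mul_nonneg h0 h0) p1 h2
  exact pr_and_ge hq hx hm (fun _ _ h hX => ⟨m1 h hX.1, m2 h hX.2.1, m3 h hX.2.2⟩) h0
    (mul_nonneg h0 (mul_nonneg h0 h0)) h1 h3

/-- Four crossings of `2 (11 + 1)` links each. A chain along height `8 t` stays between heights `5
t` and `11 t`. -/
theorem IsCore.pr_ann_ge (hK : IsCore G K r) (hG : IsLattice G) (hq : 1 ≤ q) (hx : 0 < x)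
    {k : ℝ × ℝ} (hk : k ∈ K) {t : ℕ} (ht : r ≤ t) {g : ℝ} (hg : 0 ≤ g) (h : Good G q x k t g) :
    g ^ 96 ≤ pr G q x (Ann t) := by
  have ht0 : (0 : ℝ) ≤ t := Nat.cast_nonneg t
  have h1 := hK.pr_cross_ge hG hq hx hk ht hg h 11 (8 * t) (a := -(11 * t)) (b := 11 * t)
      (c := 5 * t) (d := 11 * t) (by linarith) (by norm_num) (by norm_num)
      (by push_cast; linarith) (by push_cast; linarith)
  refine le_trans (le_of_eq ?_) (hG.pr_ann_ge hq hx (pow_nonneg hg _) h1)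
  simp only [← pow_add]

theorem topCross_inter {t : ℝ} {X : Set (ℝ × ℝ)} {g : ℝ × ℝ → ℝ × ℝ} (hg : ∀ z, ‖g z‖ = ‖z‖)
    (h : TopCross t (g '' X)) : TopCross t (g '' (X ∩ {z | 5 * t ≤ ‖z‖ ∧ ‖z‖ ≤ 11 * t})) := by
  obtain ⟨w, w', hw, hw', hj⟩ := h
  refine ⟨w, w', hw, hw', hj.mono ?_⟩
  rintro _ ⟨⟨z, hz, rfl⟩, h1, h2⟩
  refine ⟨⟨z, ⟨hz, ?_, ?_⟩, rfl⟩, h1, h2⟩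
  · rw [← hg]
    exact h2.1.trans ((le_abs_self _).trans (norm_snd_le (g z)))
  · rw [← hg, ← mem_box_iff_norm]
    exact ⟨abs_le.2 h1, abs_le.2 ⟨by linarith [h1.1, h1.2, h2.1, h2.2], h2.2⟩⟩

/-- The event depends only on what lies between radii `5 t` and `11 t`, which gives annuli at
separated scales disjoint supports for the sprinkling. -/
theorem ann_inter {t : ℝ} {X : Set (ℝ × ℝ)} (h : Ann t X) :
    Ann t (X ∩ {z | 5 * t ≤ ‖z‖ ∧ ‖z‖ ≤ 11 * t}) := by
  have hns : ∀ z : ℝ × ℝ, ‖((z.2, z.1) : ℝ × ℝ)‖ = ‖z‖ := fun z => by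
    simp [Prod.norm_def, max_comm]
  have hnr : ∀ z : ℝ × ℝ, ‖((z.1, -z.2) : ℝ × ℝ)‖ = ‖z‖ := fun z => by simp [Prod.norm_def]
  refine ⟨?_, topCross_inter hnr h.2.1, topCross_inter hns h.2.2.1,
    topCross_inter (fun z => (hnr _).trans (hns z)) h.2.2.2⟩
  have := topCross_inter (g := id) (fun _ => rfl) (by simpa using h.1)
  simpa using this

/-- The four sides are treated at once: `g` carries the side considered to the top. A path that ends
on this side of the box, starting below the rectangle, crosses the rectangle in the other direction.
-/
theorem topCross_catch {t : ℝ} {X : Set (ℝ × ℝ)} {f g : ℝ × ℝ → ℝ × ℝ} (hf : Continuous f)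
    (hgc : Continuous g) (hfg : ∀ z, f (g z) = z) (hgf : ∀ z, g (f z) = z) (hg : ∀ z, ‖g z‖ = ‖z‖)
    (h : TopCross t (g '' X)) : ∃ b b' : ℝ × ℝ, (g b).1 = -(11 * t) ∧ (g b').1 = 11 * t ∧
      JoinedIn (X ∩ box (11 * t)) b b' ∧
      ∀ Y p w, JoinedIn Y p w → Y ⊆ box (11 * t) → (g p).2 ≤ 5 * t → (g w).2 = 11 * t →
        ∃ z ∈ Y, JoinedIn Y p z ∧ JoinedIn (X ∩ box (11 * t)) b z := by
  obtain ⟨b, b', hb, hb', hj⟩ := h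
  have hsub : ∀ z ∈ g '' X ∩ {z | (-(11 * t) ≤ z.1 ∧ z.1 ≤ 11 * t) ∧ 5 * t ≤ z.2 ∧ z.2 ≤ 11 * t},
      f z ∈ X ∩ box (11 * t) := by
    rintro _ ⟨⟨z, hz, rfl⟩, h1, h2⟩
    rw [hfg]
    refine ⟨hz, ?_⟩
    rw [mem_box_iff_norm, ← hg, ← mem_box_iff_norm]
    exact ⟨abs_le.2 h1, abs_le.2 ⟨by linarith [h1.1, h1.2, h2.1, h2.2], h2.2⟩⟩
  refine ⟨f b, f b', by rw [hgf, hb], by rw [hgf, hb'], (joinedIn_image hf hj).mono ?_, ?_⟩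
  · rintro _ ⟨z, hz, rfl⟩; exact hsub z hz
  · intro Y p w hY hYb hp hw
    obtain ⟨z, ⟨hz1, ⟨z', hz', rfl⟩⟩, hz2, hz3⟩ := joinedIn_meet (a := -(11 * t)) (b := 11 * t)
      (c := 5 * t) (d := 11 * t) hj (joinedIn_image hgc hY) (fun z hz => hz.2.2) (by
        rintro _ ⟨z, hz, rfl⟩
        have := mem_box_iff_norm.1 (hYb hz)
        rw [← hg, ← mem_box_iff_norm] at this
        exact abs_le.1 this.1) hb.le hb'.ge hp hw.ge
    refine ⟨z', hz', ?_, ?_⟩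
    · have := joinedIn_image hf hz3
      rw [hfg, hfg] at this
      refine this.mono ?_
      rintro _ ⟨_, ⟨z, hz, rfl⟩, rfl⟩
      rwa [hfg]
    · have := joinedIn_image hf hz2
      rw [hfg] at this
      refine this.mono ?_
      rintro _ ⟨z, hz, rfl⟩
      exact hsub z hz

/-- The crossings of an annulus are connected and meet every path which crosses the annulus. -/
theorem ann_catch {t : ℝ} (ht : 0 ≤ t) {X : Set (ℝ × ℝ)} (h : Ann t X) :
    ∃ b, ∀ Y p p', JoinedIn Y p p' → ‖p‖ ≤ 5 * t → 11 * t ≤ ‖p'‖ →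
      ∃ z ∈ Y, JoinedIn Y p z ∧ JoinedIn (X ∩ box (11 * t)) b z := by
  have hns : ∀ z : ℝ × ℝ, ‖((z.2, z.1) : ℝ × ℝ)‖ = ‖z‖ := fun z => by
    simp [Prod.norm_def, max_comm]
  have hnr : ∀ z : ℝ × ℝ, ‖((z.1, -z.2) : ℝ × ℝ)‖ = ‖z‖ := fun z => by simp [Prod.norm_def]
  obtain ⟨h1, h2, h3, h4⟩ := h
  have h1' : TopCross t (id '' X) := by simpa using h1
  obtain ⟨b₁, b₁', hb₁, hb₁', hj₁, hc₁⟩ := topCross_catch continuous_id continuous_id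
    (fun _ => rfl) (fun _ => rfl) (fun _ => rfl) h1'
  obtain ⟨b₂, b₂', hb₂, hb₂', hj₂, hc₂⟩ := topCross_catch (f := fun z => (z.1, -z.2)) (by fun_prop)
    (by fun_prop) (by simp) (by simp) hnr h2
  obtain ⟨b₃, b₃', hb₃, hb₃', hj₃, hc₃⟩ := topCross_catch (f := fun z => (z.2, z.1)) (by fun_prop)
    (by fun_prop) (by simp) (by simp) hns h3
  obtain ⟨b₄, b₄', hb₄, hb₄', hj₄, hc₄⟩ := topCross_catch
    (f := (fun z => (z.2, z.1)) ∘ fun z => (z.1, -z.2)) (by fun_prop)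
    (by fun_prop) (by simp) (by simp) (fun z => (hnr _).trans (hns z)) h4
  simp only [id, Function.comp] at *
  -- Each crossing reaches two neighbouring sides of the box and so is caught by the neighbouring
  -- crossings: the top one meets the right and left ones, the right one meets the bottom one.
  obtain ⟨z₃, -, e1, e2⟩ := hc₃ _ _ _ hj₁ Set.inter_subset_right (by linarith) hb₁'
  obtain ⟨z₄, -, e3, e4⟩ := hc₄ _ _ _ hj₁.symm Set.inter_subset_right (by linarith) (by linarith)
  obtain ⟨z₂, -, e5, e6⟩ := hc₂ _ _ _ hj₃.symm Set.inter_subset_right (by linarith) (by linarith)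
  have g3 : JoinedIn (X ∩ box (11 * t)) b₁ b₃ := e1.trans e2.symm
  have g4 : JoinedIn (X ∩ box (11 * t)) b₁ b₄ := hj₁.trans (e3.trans e4.symm)
  have g2 : JoinedIn (X ∩ box (11 * t)) b₁ b₂ := g3.trans (hj₃.trans (e5.trans e6.symm))
  refine ⟨b₁, fun Y p p' hY hp hp' => ?_⟩
  obtain ⟨w, hwY, hw, hj⟩ := joinedIn_first_hit hY continuous_norm (by linarith) hp'
  have hsubY : Y ∩ {z | ‖z‖ < 11 * t} ∪ {w} ⊆ Y := by
    rintro z (hz | hz)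
    · exact hz.1
    · rwa [Set.mem_singleton_iff.1 hz]
  have hsubB : Y ∩ {z | ‖z‖ < 11 * t} ∪ {w} ⊆ box (11 * t) := by
    rintro z (hz | hz)
    · exact mem_box_iff_norm.2 (le_of_lt hz.2)
    · rw [Set.mem_singleton_iff.1 hz]; exact mem_box_iff_norm.2 hw.le
  have hpb := mem_box_iff_norm.2 hp
  obtain ⟨p1, p2⟩ := abs_le.1 hpb.1
  obtain ⟨p3, p4⟩ := abs_le.1 hpb.2
  have fin : ∀ b, JoinedIn (X ∩ box (11 * t)) b₁ b →
      (∃ z ∈ Y ∩ {z | ‖z‖ < 11 * t} ∪ {w}, JoinedIn (Y ∩ {z | ‖z‖ < 11 * t} ∪ {w}) p z ∧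
        JoinedIn (X ∩ box (11 * t)) b z) → ∃ z ∈ Y, JoinedIn Y p z ∧
        JoinedIn (X ∩ box (11 * t)) b₁ z := by
    rintro b hb ⟨z, hz, hz1, hz2⟩
    exact ⟨z, hsubY hz, hz1.mono hsubY, hb.trans hz2⟩
  have hmax : |w.1| = 11 * t ∨ |w.2| = 11 * t := by
    rw [Prod.norm_def] at hw
    simp only [Real.norm_eq_abs] at hw
    rcases max_choice |w.1| |w.2| with h | h
    · left; rw [← h, hw]
    · right; rw [← h, hw]
  rcases hmax with h | h
  · rcases (abs_eq (by linarith)).1 h with h | h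
    · exact fin _ g3 (hc₃ _ _ _ hj hsubB p2 h)
    · exact fin _ g4 (hc₄ _ _ _ hj hsubB (by linarith) (by linarith))
  · rcases (abs_eq (by linarith)).1 h with h | h
    · exact fin _ (JoinedIn.refl hj₁.source_mem) (hc₁ _ _ _ hj hsubB p4 h)
    · exact fin _ g2 (hc₂ _ _ _ hj hsubB (by linarith) (by linarith))

/-- Two paths that end at a low height on either side of an annulus are linked by it. -/
theorem IsCore.link_of_ann (hK : IsCore G K r) {k : ℝ × ℝ} (hk : k ∈ K) {m n : ℕ} {h : ℝ}
    (hh : h ≤ 5 * m) (hmn : 11 * m + r < n) {X : Set (ℝ × ℝ)} (h0 : Foot K n (Set.Icc (-h) h) X)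
    (h1 : Foot K n (Set.Icc (-h) h) (mirror (2 * n) '' X)) (hA : Ann m (tr (-n) (-0) '' X)) :
    Link k (2 * n) (3 * n) X := by
  have hmnR : (11 * m + r : ℝ) < n := by exact_mod_cast hmn
  have hm0 : (0 : ℝ) ≤ m := Nat.cast_nonneg m
  have hr0 : (0 : ℝ) ≤ r := Nat.cast_nonneg r
  obtain ⟨hKX, p, hp, w, hw, hw1, hw2, hw3, hj⟩ := h0
  obtain ⟨hKX', p', hp', w', hw', hw1', hw2', hw3', hj'⟩ :=
    foot_transfer (continuous_mirror _) (mirror_mirror _) h1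
  obtain ⟨b, hb⟩ := ann_catch hm0 hA
  -- Applied to both feet, read from their landing points: these lie on the mirror line at height at
  -- most `5 m`, inside the annulus, while the cores lie beyond radius `11 m`.
  have catch' : ∀ Y ⊆ X ∩ {z | |z.2| ≤ 3 * n}, ∀ u v, JoinedIn Y u v → u.1 = n → |u.2| ≤ h →
      11 * m ≤ |v.1 - n| → JoinedIn (X ∩ {z | |z.2| ≤ 3 * n}) u (tr n 0 b) := by
    intro Y hY u v huv hu hu2 hv
    obtain ⟨z, ⟨z', hz', rfl⟩, hz2, hz3⟩ := hb _ _ _ (joinedIn_image (continuous_tr (-n) (-0)) huv)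
      (by
        rw [← mem_box_iff_norm]
        constructor
        · simp only [tr, hu]; push_cast; simp
        · simp only [tr]; push_cast; rw [neg_zero, add_zero]; linarith)
      (by
        refine hv.trans ?_
        refine le_trans (le_of_eq ?_) (norm_fst_le _)
        simp [tr, sub_eq_add_neg])
    have i1 := joinedIn_image (continuous_tr n 0) hz2
    have i2 := joinedIn_image (continuous_tr n 0) hz3
    rw [tr_tr_neg, tr_tr_neg] at i1
    rw [tr_tr_neg] at i2
    refine (i1.mono ?_).trans (i2.symm.mono ?_)
    · rintro _ ⟨_, ⟨y, hy, rfl⟩, rfl⟩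
      rw [tr_tr_neg]; exact hY hy
    · rintro _ ⟨_, ⟨⟨y, hy, rfl⟩, hy2⟩, rfl⟩
      rw [tr_tr_neg]
      refine ⟨hy, ?_⟩
      have := hy2.2
      simp only [tr] at this
      push_cast at this
      rw [neg_zero, add_zero] at this
      exact this.trans (by linarith)
  have hpx := abs_le.1 (hK.sub_box hp).1
  have hpx' := abs_le.1 (hK.sub_box hp').1
  have c1 := catch' ((X ∩ {z | z ∈ box n ∧ z.1 < n}) ∪ {w}) (by
      rintro z (⟨hz, hz2, -⟩ | hz)
      · exact ⟨hz, hz2.2.trans (by linarith)⟩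
      · rw [Set.mem_singleton_iff.1 hz]; exact ⟨hw, hw3.trans (by linarith)⟩) _ _ hj.symm hw1
      (abs_le.2 hw2) (by rw [abs_sub_comm]; refine le_trans ?_ (le_abs_self _); linarith)
  have c2 := catch' _ (by
      rintro z (⟨hz, hz2, -⟩ | hz)
      · exact ⟨hz, hz2.2.trans (by linarith)⟩
      · rw [Set.mem_singleton_iff.1 hz]; exact ⟨hw', hw3'.trans (by linarith)⟩) _ _ hj'.symm
      (by simp [mirror, hw1']; ring)
      (abs_le.2 hw2') (by refine le_trans ?_ (le_abs_self _); simp [mirror]; linarith)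
  have d1 : JoinedIn (X ∩ {z | |z.2| ≤ 3 * n}) p w := hj.mono (by
      rintro z (⟨hz, hz2, -⟩ | hz)
      · exact ⟨hz, hz2.2.trans (by linarith)⟩
      · rw [Set.mem_singleton_iff.1 hz]; exact ⟨hw, hw3.trans (by linarith)⟩)
  have d2 : JoinedIn (X ∩ {z | |z.2| ≤ 3 * n}) (mirror (2 * n) p') (mirror (2 * n) w') :=
    hj'.mono (by
      rintro z (⟨hz, hz2, -⟩ | hz)
      · exact ⟨hz, hz2.2.trans (by linarith)⟩
      · rw [Set.mem_singleton_iff.1 hz]; exact ⟨hw', hw3'.trans (by linarith)⟩)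
  have e : ∀ z, mirror (2 * n) z = tr (2 * n) 0 (-z.1, z.2) := fun z => by
    ext <;> simp [mirror, tr]; ring
  have hX2 : ∀ z ∈ K, tr (2 * n) 0 z ∈ X := by
    intro z hz
    have := hKX' _ (hK.reflect z hz)
    rw [e] at this
    simpa using this
  have d3 := hK.joinedIn_tr hX2 (s := 3 * n) (by simp; linarith) (hK.reflect _ hp') hk
  rw [← e] at d3
  exact (hK.joinedIn_strip hKX (by linarith) hk hp).trans (d1.trans (c1.trans (c2.symm.trans
    (d2.symm.trans d3))))

/-- The foot, its mirror image and the union of the annulus events are increasing, hence positively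
associated. It is immaterial which annulus occurs. -/
theorem IsCore.good_of_ann (hK : IsCore G K r) (hG : IsLattice G) (hq : 1 ≤ q) (hx : 0 < x)
    {k : ℝ × ℝ} (hk : k ∈ K) {ι : Type*} (s : Finset ι) {m : ι → ℕ} {n : ℕ} {h : ℝ}
    (hh : ∀ i ∈ s, h ≤ 5 * m i) (hmn : ∀ i ∈ s, 11 * m i + r < n) {a b : ℝ} (ha : 0 ≤ a)
    (hb : 0 ≤ b) (hfoot : a ≤ pr G q x (Foot K n (Set.Icc (-h) h)))
    (hann : b ≤ pr G q x (fun X => ∃ i ∈ s, Ann (m i) (tr (-n) (-0) '' X))) :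
    Good G q x k n (a * (a * b)) := by
  refine ⟨2 * n, by omega, le_rfl, ?_⟩
  have hm := foot_mono K n (Set.Icc (-h) h)
  have hma : Monotone fun X => ∃ i ∈ s, Ann (m i) (tr (-n) (-0) '' X) := by
    rintro X Y hXY ⟨i, hi, h⟩
    exact ⟨i, hi, ann_mono _ (Set.image_mono hXY) h⟩
  have h1 := pr_and_ge hq hx (monotone_image hm (mirror (2 * n))) hma ha hb
    (hfoot.trans (pr_image (hG.isSym_mirror _) _).ge) hann
  have h2 := pr_and_ge hq hx hm (fun X Y hXY hX => ⟨hm (Set.image_mono hXY) hX.1, hma hXY hX.2⟩) ha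
    (by positivity) hfoot h1
  refine h2.trans (pr_mono hq hx ?_)
  rintro X - ⟨f1, f2, i, hi, hA⟩
  exact hK.link_of_ann hk (hh i hi) (hmn i hi) f1 f2 hA

end Annuli

end

section

open Filter Topology

/-! ### Finding good scales -/

section Scales

variable {V : Set (ℝ × ℝ)} {G : SimpleGraph V} {K : Set (ℝ × ℝ)} {r : ℕ} {q x y : ℝ}

/-- By sprinkling, one of many annuli around a point is very likely to occur. -/
theorem IsLattice.pr_exists_ann_ge (hG : IsLattice G) (hq : 1 ≤ q) (hx : 0 < x) (hxy : x ≤ y)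
    {l : ℕ} (hl0 : 0 < l) (hl : ∀ u v : V, G.Adj u v → dist (u : ℝ × ℝ) v ≤ l) (n : ℤ)
    (s : Finset ℕ) {m : ℕ → ℕ} (hm : ∀ i ∈ s, l ≤ m i)
    (hs : ∀ i ∈ s, ∀ j ∈ s, i < j → 4 * m i ≤ m j) {c : ℝ}
    (hc : ∀ i ∈ s, c ≤ pr G q x (Ann (m i))) (hsum : 1 ≤ (y / x - 1) * (s.card * c)) :
    1 / 2 ≤ pr G q y (fun X => ∃ i ∈ s, Ann (m i) (tr (-n) (-0) '' X)) := by
  set B : ℕ → Set (ℝ × ℝ) := fun i => {z | 5 * (m i : ℝ) ≤ ‖tr (-n) (-0) z‖ ∧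
    ‖tr (-n) (-0) z‖ ≤ 11 * m i} with hB
  set P : ℕ → Set (ℝ × ℝ) → Prop := fun i X => Ann (m i) (tr (-n) (-0) '' X) with hP
  have hPm : ∀ i, Monotone (P i) := fun i => monotone_image (ann_mono _) _
  have hloc : ∀ i, ∀ X Y : Set (ℝ × ℝ), X ∩ B i = Y ∩ B i → (P i X ↔ P i Y) := by
    intro i
    have key : ∀ X Y : Set (ℝ × ℝ), X ∩ B i = Y ∩ B i → P i X → P i Y := by
      intro X Y h hX
      refine ann_mono _ ?_ (ann_inter hX)
      rintro _ ⟨⟨z, hz, rfl⟩, h1⟩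
      have : z ∈ Y ∩ B i := h ▸ ⟨hz, h1⟩
      exact ⟨z, this.1, rfl⟩
    exact fun X Y h => ⟨key X Y h, key Y X h.symm⟩
  have hBb : ∀ i, Bornology.IsBounded (B i) := by
    intro i
    refine (Metric.isBounded_closedBall (x := (((n : ℝ), 0) : ℝ × ℝ)) (r := 11 * m i)).subset ?_
    rintro z ⟨-, hz⟩
    rw [Metric.mem_closedBall, dist_eq_norm]
    have e : z - ((n : ℝ), 0) = tr (-n) (-0) z := by
      ext <;> simp [tr, sub_eq_add_neg]
    rw [e]
    exact hz
  -- An edge meeting both annuli would join radius at most `11 m i` to radius at least `5 m j ≥ 20 m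
  -- i`, although any two of its points are within `2 l ≤ 2 m i`.
  have hdis : ∀ i ∈ s, ∀ j ∈ s, i < j → Disjoint {e : G.edgeSet | (seg e ∩ B i).Nonempty}
      {e : G.edgeSet | (seg e ∩ B j).Nonempty} := by
    intro i hi j hj hij
    rw [Set.disjoint_left]
    rintro e ⟨z, hz, -, hz2⟩ ⟨z', hz', hz'2, -⟩
    obtain ⟨a, b, he, -⟩ := exists_eq_mk e
    have ha : a ∈ (e : Sym2 V) := by rw [he]; simp
    have hl0R : (0 : ℝ) < l := by exact_mod_cast hl0
    have d1 := dist_le_of_mem_seg hl0R.le hl ha hz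
    have d2 := dist_le_of_mem_seg hl0R.le hl ha hz'
    have d3 : dist z' z ≤ l + l := (dist_triangle_right z' z a).trans (add_le_add d2 d1)
    have d4 : dist (tr (-n) (-0) z') (tr (-n) (-0) z) = dist z' z := dist_translate _ _ _ _
    have d5 : ‖tr (-n) (-0) z'‖ ≤ ‖tr (-n) (-0) z‖ + dist (tr (-n) (-0) z') (tr (-n) (-0) z) := by
      rw [dist_eq_norm]
      have := norm_add_le (tr (-n) (-0) z) (tr (-n) (-0) z' - tr (-n) (-0) z)
      rwa [add_sub_cancel] at this
    have h4 : (4 * m i : ℝ) ≤ m j := by exact_mod_cast hs i hi j hj hij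
    have hmi : (l : ℝ) ≤ m i := by exact_mod_cast hm i hi
    linarith
  have h1 := mu_biUnion_ge_of_disjoint hq hx hxy s (A := fun i => ev G (P i))
    (D := fun i => {e : G.edgeSet | (seg e ∩ B i).Nonempty}) (fun i _ => isUpperSet_ev (hPm i))
    (fun i _ => hG.finite_seg_meeting (hBb i)) (fun i _ => localOn_ev (hloc i))
    (fun i hi j hj hij => by
      rcases lt_or_gt_of_ne hij with h | h
      · exact hdis i hi j hj h
      · exact (hdis j hj i hi h).symm)
  have h2 : s.card * c ≤ ∑ i ∈ s, mu q x (ev G (P i)) := by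
    rw [← nsmul_eq_mul]
    refine Finset.card_nsmul_le_sum _ _ _ fun i hi => (hc i hi).trans ?_
    exact (pr_image (hG.isSym_tr (-n) (-0)) (Ann (m i))).ge
  have hl : 0 ≤ y / x - 1 := by linarith [(one_le_div hx).2 hxy]
  have h3 := hsum.trans (mul_le_mul_of_nonneg_left h2 hl)
  have e : ev G (fun X => ∃ i ∈ s, Ann (m i) (tr (-n) (-0) '' X)) = ⋃ i ∈ s, ev G (P i) := by
    ext S; simp [ev, hP]
  rw [pr, e]
  refine le_trans ?_ h1
  have h4 : 1 / (1 + (y / x - 1) * ∑ i ∈ s, mu q x (ev G (P i))) ≤ 1 / 2 :=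
    one_div_le_one_div_of_le (by norm_num) (by linarith)
  linarith

/-- The heights grow too fast to be of the order of the scale. -/
theorem height_le_of_growth {T : ℕ} {H : ℕ → ℕ} (hH : ∀ j, H j ≤ T * 2 ^ j) {s N : ℕ}
    (hgrow : ∀ j, s ≤ j → j + 2 ≤ N → 16 * H j ≤ H (j + 2)) {j : ℕ} (hsj : s ≤ j) (hjN : j ≤ N) :
    2 ^ (N - j) * H j ≤ 2 * (T * 2 ^ j) := by
  -- Over two scales the height gains a factor 16 but its upper bound only a factor 4. Comparing at
  -- the top scale shows that `H j` is small by a factor 4 per two scales.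
  have key : ∀ u j, s ≤ j → j + 2 * u ≤ N → 16 ^ u * H j ≤ H (j + 2 * u) := by
    intro u
    induction u with
    | zero => intro j _ _; simp
    | succ u ih =>
      intro j h1 h2
      have h3 := ih (j + 2) (by omega) (by omega)
      have h4 := hgrow j h1 (by omega)
      calc 16 ^ (u + 1) * H j = 16 ^ u * (16 * H j) := by ring
        _ ≤ 16 ^ u * H (j + 2) := Nat.mul_le_mul_left _ h4
        _ ≤ H (j + 2 + 2 * u) := h3
        _ = H (j + 2 * (u + 1)) := by congr 1; ring
  obtain ⟨u, v, hv, hu⟩ : ∃ u v, v < 2 ∧ N - j = 2 * u + v := ⟨(N - j) / 2, (N - j) % 2, by omega,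
    by omega⟩
  have h1 := (key u j hsj (by omega)).trans (hH _)
  have h2 : 4 ^ u * H j ≤ T * 2 ^ j := by
    refine le_of_mul_le_mul_left ?_ (by positivity : 0 < 4 ^ u)
    calc 4 ^ u * (4 ^ u * H j) = 16 ^ u * H j := by
          rw [← mul_assoc, ← mul_pow, show 4 * 4 = 16 from rfl]
      _ ≤ T * 2 ^ (j + 2 * u) := h1
      _ = 4 ^ u * (T * 2 ^ j) := by
          rw [pow_add, pow_mul]; ring
  have h3 : 2 ^ v ≤ 2 := by
    interval_cases v <;> norm_num
  calc 2 ^ (N - j) * H j = 2 ^ v * (4 ^ u * H j) := by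
        rw [hu, pow_add, pow_mul]; ring
    _ ≤ 2 * (T * 2 ^ j) := Nat.mul_le_mul h3 h2

/-- Under the growth alternative the height at scale `j` is at most of order `T 2 ^ (2 j - N)`; this
is below the inner radius of the annulus of scale `i` as soon as `2 j ≤ N + i`. -/
theorem le_of_two_pow {T a i j N : ℕ} (h : 2 ^ (N - j) * a ≤ 2 * (T * 2 ^ j)) (hjN : j ≤ N)
    (hij : 2 * j ≤ N + i) : a ≤ 5 * (T * 2 ^ i) := by
  refine le_of_mul_le_mul_left ?_ (by positivity : 0 < 2 ^ (N - j))
  refine h.trans ?_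
  have h1 : 2 ^ j ≤ 2 ^ (N - j) * 2 ^ i := by
    rw [← pow_add]
    exact Nat.pow_le_pow_right (by norm_num) (by omega)
  calc 2 * (T * 2 ^ j) ≤ 5 * (T * (2 ^ (N - j) * 2 ^ i)) := by gcongr; norm_num
    _ = 2 ^ (N - j) * (5 * (T * 2 ^ i)) := by ring

/-- The parameter `x exp (8 / (c v))` is attached to a window of about `v` scales. Passing to a
window about two thirds as long gains a relative increase `2 / (v c)`, just enough for `v / 2`
annuli of probability `c`. The increments telescope, so the total increase stays bounded by the last
one reached. -/
theorem exp_sub_ge {c : ℝ} (hx : x ≠ 0) (hc : 0 < c) {v v' : ℕ} (hv : 5 ≤ v) (hv'0 : 0 < v')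
    (hv' : 3 * v' ≤ 2 * v + 2) :
    1 ≤ (x * Real.exp (8 / c / v') / (x * Real.exp (8 / c / v)) - 1) * (v / 2 * c) := by
  have hvR : (5 : ℝ) ≤ v := by exact_mod_cast hv
  have hv'R : (0 : ℝ) < v' := by exact_mod_cast hv'0
  have hv'' : (3 * v' : ℝ) ≤ 2 * v + 2 := by exact_mod_cast hv'
  rw [mul_div_mul_left _ _ hx, ← Real.exp_sub]
  have h1 := Real.add_one_le_exp (8 / c / v' - 8 / c / v)
  have h2 : 2 / (v * c) ≤ 8 / c / v' - 8 / c / v := by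
    rw [div_div, div_div, div_sub_div _ _ (by positivity) (by positivity),
      div_le_div_iff₀ (by positivity) (by positivity)]
    have : 0 ≤ 2 * c * c * c * v * (4 * (v - v') - v') := by
      have : (0 : ℝ) ≤ 4 * (v - v') - v' := by linarith
      positivity
    nlinarith [this]
  have h3 : (2 / (v * c)) * (v / 2 * c) = 1 := by field_simp
  rw [← h3]
  gcongr
  linarith

/-- If the one-arm probability is bounded below at `x`, then at `y > x` links exist with uniformly
positive probability, at a scale comparable to any given one. -/
theorem IsCore.exists_good (hK : IsCore G K r) (hG : IsLattice G) (hq : 1 ≤ q) (hx : 0 < x)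
    (hxy : x < y) {k : ℝ × ℝ} (hk : k ∈ K) {a : ℝ} (ha : 0 < a)
    (harm : ∀ t : ℕ, r < t → a ≤ pr G q x (Foot K t Set.univ)) :
    ∃ (T : ℕ) (g : ℝ) (M N₀ : ℕ), r ≤ T ∧ 0 < T ∧ 0 < g ∧ ∀ N ≥ N₀, ∃ j ≤ N, N ≤ j + M ∧
      Good G q y k (T * 2 ^ j) g := by
  obtain ⟨l, hl0, hl⟩ := hG.exists_length_le
  set T : ℕ := r + l + 1 with hT
  have hTj : ∀ j, T ≤ T * 2 ^ j := fun j => Nat.le_mul_of_pos_right _ (by positivity)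
  have hex := fun j => hK.exists_height hG hq hx (harm (T * 2 ^ j) (by have := hTj j; omega))
  choose H hH1 hH2 hH3 using hex
  set α := a / 3 with hα
  have hα0 : 0 < α := by positivity
  set g₁ := min (α * (pr G q x fun X => K ⊆ X)) (α / 48 * (α * α) * (α / 48 * (α * α))) with hg₁
  have hg₁0 : 0 < g₁ := lt_min (mul_pos hα0 (hK.pr_subset_pos hG hq hx)) (by positivity)
  -- The scales at which the link comes from a low landing point or from a comparable earlier
  -- height, without annuli.
  set Direct : ℕ → Prop := fun j => H j ≤ 2 ∨ ∃ i, i + 2 ≤ j ∧ 3 ≤ H i ∧ H j ≤ 16 * H i with hDirect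
  have hgood : ∀ j, Direct j → Good G q x k (T * 2 ^ j) g₁ := by
    rintro j (hj | ⟨i, hij, hi, hj⟩)
    · refine ⟨(T * 2 ^ j : ℕ), le_rfl, by push_cast; nlinarith [Nat.zero_le (T * 2 ^ j)], ?_⟩
      refine (min_le_left _ _).trans (hK.pr_link_of_low hG hq hx hk (by have := hTj j; omega) hα0.le
        ((hH2 j).trans (pr_mono hq hx ?_)))
      rintro X - ⟨hKX, p, hp, w, hw, h1, h2, h3⟩
      have hjR : (H j : ℝ) ≤ 2 := by exact_mod_cast hj
      exact ⟨hKX, p, hp, w, hw, h1, ⟨by linarith [h2.1], h2.2.trans hjR⟩, h3⟩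
    · have h4 : 4 * (T * 2 ^ i) ≤ T * 2 ^ j := by
        calc 4 * (T * 2 ^ i) = T * 2 ^ (i + 2) := by rw [pow_add]; ring
          _ ≤ T * 2 ^ j := Nat.mul_le_mul_left _ (Nat.pow_le_pow_right (by norm_num) hij)
      have hTi := hTj i
      have hcast : ((H i - 1 : ℕ) : ℝ) = (H i : ℝ) - 1 := by rw [Nat.cast_sub (by omega)]; simp
      have hf := hH3 i (by omega)
      rw [← hcast] at hf
      have hiR : (3 : ℝ) ≤ H i := by exact_mod_cast hi
      have hjR : (H j : ℝ) ≤ 16 * H i := by exact_mod_cast hj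
      -- With `β = H i - 1` and `H i ≥ 3` one has `16 H i ≤ 24 β`, which is the required window.
      have := hK.pr_link_of_heights hG hq hx hk (m := T * 2 ^ i) (n := T * 2 ^ j) (β := H i - 1)
        (s := H j) (by omega) (by omega) (by have := hH1 i; omega) (by omega)
        (by rw [hcast]; linarith) hα0.le (hH2 j) hf.1 hf.2
      exact ⟨_, by omega, by omega, (min_le_right _ _).trans this⟩
  set g₂ := α * (α * min (1 / 2) (g₁ ^ 96)) with hg₂
  have hg₂0 : 0 < g₂ := by positivity
  set c := g₂ ^ 96 with hc
  have hc0 : 0 < c := by positivity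
  -- Windows are shortened until their length is between `M` and `2 M`; `M` is large enough that the
  -- parameter then still lies below `y`. The bound 24 provides the room between annuli and feet.
  obtain ⟨M, hM24, hM⟩ : ∃ M : ℕ, 24 ≤ M ∧ x * Real.exp (8 / c / M) ≤ y := by
    have h1 : Tendsto (fun M : ℕ => x * Real.exp (8 / c / M)) atTop (𝓝 (x * Real.exp 0)) :=
      ((Real.continuous_exp.tendsto 0).comp (tendsto_const_div_atTop_nhds_zero_nat (8 / c))).const_mul x
    rw [Real.exp_zero, mul_one] at h1
    obtain ⟨M, h2, h3⟩ := ((h1.eventually (eventually_le_nhds hxy)).and (eventually_ge_atTop 24)).exists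
    exact ⟨M, h3, h2⟩
  refine ⟨T, min g₁ g₂, 8 * M + 8, T, by omega, by omega, lt_min hg₁0 hg₂0, fun N hN => ?_⟩
  -- Without any direct scale the growth alternative holds from scale 0, and `3 * 2 ^ N ≤ 2 ^ N * H
  -- 0 ≤ 2 T` contradicts `N ≥ T`.
  have hdir : ∃ s, s ≤ N ∧ Direct s := by
    by_contra! hcon
    have h1 := height_le_of_growth (T := T) (H := H) hH1 (s := 0) (N := N) (fun j _ hj => by
      have h2 := hcon j (by omega)
      have h3 := hcon (j + 2) hj
      simp only [hDirect, not_or, not_exists, not_and, not_le] at h2 h3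
      exact (h3.2 j le_rfl (by omega)).le) (j := 0) le_rfl (Nat.zero_le N)
    have h4 := hcon 0 (Nat.zero_le N)
    simp only [hDirect, not_or, not_le] at h4
    have h5 : N < 2 ^ N := Nat.lt_two_pow_self
    simp only [Nat.sub_zero, pow_zero, mul_one] at h1
    nlinarith [h4.1]
  classical
  obtain ⟨s, hsN, hs, hlast⟩ : ∃ s, s ≤ N ∧ Direct s ∧ ∀ j, s < j → j ≤ N → ¬ Direct j := by
    obtain ⟨s₀, hs₀, hd⟩ := hdir
    refine ⟨Nat.findGreatest Direct N, Nat.findGreatest_le N, Nat.findGreatest_spec hs₀ hd, ?_⟩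
    exact fun j h1 h2 => Nat.findGreatest_is_greatest h1 h2
  by_cases hsmall : N ≤ s + (4 * M + 8)
  · exact ⟨s, hsN, by omega, ((hgood s hs).mono (min_le_left _ _)).mono_param hq hx hxy.le⟩
  have hheight : ∀ i j, s < j → j ≤ N → 2 * j ≤ N + i → (H j : ℝ) ≤ 5 * (T * 2 ^ i : ℕ) := by
    intro i j hsj hjN hij
    have h1 := height_le_of_growth (T := T) (H := H) hH1 (s := s + 1) (N := N) (fun j hsj hj => by
      have h3 := hlast (j + 2) (by omega) hj
      have h2 := hlast j (by omega) (by omega)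
      simp only [hDirect, not_or, not_exists, not_and, not_le] at h2 h3
      exact (h3.2 j le_rfl (by omega)).le) (j := j) hsj hjN
    exact_mod_cast le_of_two_pow h1 hjN hij
  have hfar : ∀ i j, i + 4 ≤ j → 11 * (T * 2 ^ i) + r < T * 2 ^ j := by
    intro i j hij
    have h4 : 16 * (T * 2 ^ i) ≤ T * 2 ^ j := by
      calc 16 * (T * 2 ^ i) = T * 2 ^ (i + 4) := by rw [pow_add]; ring
        _ ≤ T * 2 ^ j := Nat.mul_le_mul_left _ (Nat.pow_le_pow_right (by norm_num) hij)
    have := hTj i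
    omega
  have hfeet : ∀ x', x ≤ x' → ∀ j, α ≤ pr G q x' (Foot K ((T * 2 ^ j : ℕ) : ℝ)
      (Set.Icc (-(H j : ℝ)) (H j))) := fun x' hx' j =>
    (hH2 j).trans (pr_mono_param hq hx hx' (foot_mono _ _ _))
  have hmin0 : 0 ≤ min (1 / 2) (g₁ ^ 96) := by positivity
  have hxv : ∀ v : ℕ, x ≤ x * Real.exp (8 / c / v) := fun v => by
    have : 1 ≤ Real.exp (8 / c / v) := Real.one_le_exp (by positivity)
    nlinarith
  -- The window for `v` consists of the scales from `N - 4 v` to `N - 3 v`. Shrinking `v` moves it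
  -- towards `N`, always with the same constant `g₂`.
  have hind : ∀ v : ℕ, M ≤ v → s + 4 * v + 4 ≤ N →
      (∀ j, N ≤ j + 4 * v → j + 3 * v ≤ N →
        Good G q (x * Real.exp (8 / c / v)) k (T * 2 ^ j) g₂) →
      ∃ j ≤ N, N ≤ j + (8 * M + 8) ∧ Good G q y k (T * 2 ^ j) g₂ := by
    intro v
    induction v using Nat.strong_induction_on with
    | _ v ih =>
      intro hMv hsv hW
      by_cases hv2 : v ≤ 2 * M
      · refine ⟨N - 4 * v, by omega, by omega, ((hW (N - 4 * v) (by omega) (by omega)).mono_param hq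
          (hx.trans_le (hxv v)) (le_trans ?_ hM))⟩
        have hMR : (M : ℝ) ≤ v := by exact_mod_cast hMv
        have hM0 : (0 : ℝ) < M := by exact_mod_cast (by omega : 0 < M)
        gcongr
      -- This is `2 v / 3` rounded up, the least value for which `2 (N - 3 v') ≤ N + (N - 4 v)`, so
      -- that landing heights at the new scales fit inside the old annuli.
      · set v' := (2 * v + 2) / 3 with hv'
        refine ih v' (by omega) (by omega) (by omega) fun j hj1 hj2 => ?_
        have hcast : (v : ℝ) / 2 ≤ (v / 2 + 1 : ℕ) := by
          have : v ≤ 2 * (v / 2 + 1) := by omega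
          have : (v : ℝ) ≤ 2 * (v / 2 + 1 : ℕ) := by exact_mod_cast this
          linarith
        have hexp := exp_sub_ge hx.ne' hc0 (v := v) (v' := v') (by omega) (by omega) (by omega)
        have hle : x * Real.exp (8 / c / v) ≤ x * Real.exp (8 / c / v') := by
          have h1 : (v' : ℝ) ≤ v := by exact_mod_cast (by omega : v' ≤ v)
          have h2 : (0 : ℝ) < v' := by exact_mod_cast (by omega : 0 < v')
          gcongr
        have hx1 := hx.trans_le (hxv v)
        -- Every second scale of the old window provides an annulus, so that consecutive radii
        -- differ by a factor 4.
        have hann := hG.pr_exists_ann_ge hq hx1 hle hl0 hl (T * 2 ^ j : ℕ) (Finset.range (v / 2 + 1))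
          (m := fun u => T * 2 ^ (N - 4 * v + 2 * u)) (c := c)
          (fun u _ => by have := hTj (N - 4 * v + 2 * u); omega)
          (fun u _ u' _ huu => by
            calc 4 * (T * 2 ^ (N - 4 * v + 2 * u)) = T * 2 ^ (N - 4 * v + 2 * u + 2) := by
                  rw [pow_add _ _ 2]; ring
              _ ≤ _ := Nat.mul_le_mul_left _ (Nat.pow_le_pow_right (by norm_num) (by omega)))
          (fun u hu => by
            rw [Finset.mem_range] at hu
            exact hK.pr_ann_ge hG hq hx1 hk (by have := hTj (N - 4 * v + 2 * u); omega) hg₂0.le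
              (hW _ (by omega) (by omega)))
          (by
            rw [Finset.card_range]
            refine hexp.trans ?_
            have h1 : 0 ≤ x * Real.exp (8 / c / v') / (x * Real.exp (8 / c / v)) - 1 := by
              linarith [(one_le_div hx1).2 hle]
            gcongr)
        refine (hK.good_of_ann hG hq (hx.trans_le (hxv v')) hk _ (h := H j) (fun u hu => ?_)
          (fun u hu => ?_) hα0.le hmin0 (hfeet _ (hxv v') j) ((min_le_left _ _).trans hann))
        · exact hheight _ _ (by omega) (by omega) (by omega)
        · rw [Finset.mem_range] at hu
          exact hfar _ _ (by omega)
  -- The first window is supplied by a single annulus at the last direct scale `s`, with no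
  -- sprinkling.
  obtain ⟨j, hj1, hj2, hj3⟩ := hind ((N - s - 4) / 4) (by omega) (by omega) fun j hj1 hj2 => by
    refine Good.mono_param hq hx (hxv _) ?_
    have hs1 := hK.pr_ann_ge hG hq hx hk (by have := hTj s; omega) hg₁0.le (hgood s hs)
    refine hK.good_of_ann hG hq hx hk (Finset.range 1) (m := fun _ => T * 2 ^ s) (h := H j)
      (fun _ _ => hheight _ _ (by omega) (by omega) (by omega)) (fun _ _ => hfar _ _ (by omega))
      hα0.le hmin0 (hfeet _ le_rfl j) ((min_le_right _ _).trans (hs1.trans ?_))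
    rw [← pr_image (hG.isSym_tr (-(T * 2 ^ j : ℕ)) (-0)) (Ann ((T * 2 ^ s : ℕ) : ℝ))]
    exact pr_mono hq hx fun X _ hX => ⟨0, by simp, hX⟩
  exact ⟨j, hj1, hj2, hj3.mono (min_le_right _ _)⟩

end Scales

end

section

open Filter Topology

/-! ### Comparing means under comparable weights -/

section Tilt

variable {α : Type*} [DecidableEq α] {E : Finset α}

/-- Jensen's inequality, from the tangent line of the exponential at the mean. -/
theorem exp_wexp_le {w f : Finset α → ℝ} (hw : ∀ S, 0 < w S) :
    Real.exp (wexp E w f) ≤ wexp E w fun S => Real.exp (f S) := by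
  set m := wexp E w f with hm
  have h1 : wexp E w (fun S => Real.exp m * (f S - m + 1)) ≤ wexp E w fun S => Real.exp (f S) := by
    refine wexp_mono hw fun S _ => ?_
    have h2 := Real.add_one_le_exp (f S - m)
    calc Real.exp m * (f S - m + 1) ≤ Real.exp m * Real.exp (f S - m) :=
          mul_le_mul_of_nonneg_left h2 (Real.exp_pos m).le
      _ = Real.exp (f S) := by rw [← Real.exp_add]; congr 1; ring
  refine le_trans (le_of_eq ?_) h1
  rw [wexp_const_mul, wexp_add, wexp_sub, wexp_const E hw, wexp_const E hw, ← hm]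
  ring

theorem wexp_le_mul_wexp {w w' f : Finset α → ℝ} (hw : ∀ S, 0 < w S) (hw' : ∀ S, 0 < w' S) {C : ℝ}
    (h1 : ∀ S, w' S ≤ w S) (h2 : ∀ S, w S ≤ C * w' S) (hf : ∀ S, 0 ≤ f S) :
    wexp E w' f ≤ C * wexp E w f := by
  have z1 := wsum_one_pos E hw
  have z2 := wsum_one_pos E hw'
  have a1 : wsum E w' f ≤ wsum E w f :=
    Finset.sum_le_sum fun S _ => mul_le_mul_of_nonneg_right (h1 S) (hf S)
  have a2 : wsum E w 1 ≤ C * wsum E w' 1 := by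
    simp only [wsum, Finset.mul_sum, Pi.one_apply, mul_one]
    exact Finset.sum_le_sum fun S _ => h2 S
  have a3 : 0 ≤ wsum E w f := Finset.sum_nonneg fun S _ => mul_nonneg (hw S).le (hf S)
  rw [wexp, wexp, ← mul_div_assoc, div_le_div_iff₀ z2 z1]
  calc wsum E w' f * wsum E w 1 ≤ wsum E w f * (C * wsum E w' 1) :=
        mul_le_mul a1 a2 z1.le a3
    _ = C * wsum E w f * wsum E w' 1 := by ring

/-- The mean of `N` for a comparable weight is almost dominated by its mean for the tilted
weight. -/
theorem wexp_le_wexp_tilt_add {w w' : Finset α → ℝ} (hw : IsFKG E w) (hw' : ∀ S, 0 < w' S) {C l : ℝ}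
    (h1 : ∀ S, w' S ≤ w S) (h2 : ∀ S, w S ≤ C * w' S) (hC : 0 < C) (hl : 1 < l)
    {N : Finset α → ℕ} (hN : Monotone N) (hle : ∀ S, N S ≤ S.card)
    (hNc : Monotone fun S => S.card - N S) :
    wexp E w' (fun S => (N S : ℝ)) ≤
      wexp E (fun S => l ^ S.card * w S) (fun S => (N S : ℝ)) + Real.log C / Real.log l := by
  have hl0 : 0 < l := by linarith
  have hlog : 0 < Real.log l := Real.log_pos hl
  have hpow : Monotone fun n : ℕ => l ^ n := pow_right_mono₀ hl.le
  have hwt : ∀ S : Finset α, 0 < l ^ S.card * w S := fun S => mul_pos (pow_pos hl0 _) (hw.pos S)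
  have hexp : ∀ n : ℕ, Real.exp (Real.log l * n) = l ^ n := fun n => by
    rw [mul_comm, Real.exp_nat_mul, Real.exp_log hl0]
  have hexp' : ∀ n : ℕ, Real.exp (-Real.log l * n) = (l ^ n)⁻¹ := fun n => by
    rw [neg_mul, Real.exp_neg, hexp]
  -- Exponential moments bound the mean from above under `w'` and from below under the tilted
  -- weight. Passing from `w'` to `w` costs the factor `C`, and positive association of `w` bounds
  -- the product of the two moments by one.
  have j1 := exp_wexp_le (E := E) hw' (f := fun S => Real.log l * N S)
  have j2 := exp_wexp_le (E := E) hwt (f := fun S => -Real.log l * N S)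
  simp only [hexp, hexp', wexp_const_mul] at j1 j2
  have j3 := wexp_le_mul_wexp (E := E) hw.pos hw' h1 h2 (f := fun S => l ^ N S) fun S => by positivity
  have fkg := hw.wsum_mul_le (hpow.comp hNc) (hpow.comp hN)
  have z := wsum_one_pos E hw.pos
  have zt := wsum_one_pos E hwt
  have e1 : wsum E w (fun S => (fun n : ℕ => l ^ n) (S.card - N S) * (fun n : ℕ => l ^ n) (N S)) =
      wsum E (fun S => l ^ S.card * w S) 1 := by
    refine wsum_congr fun S _ => ?_
    simp only [Pi.one_apply, mul_one]
    rw [← pow_add, Nat.sub_add_cancel (hle S)]; ring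
  have e2 : wsum E (fun S => l ^ S.card * w S) (fun S => (l ^ N S)⁻¹) =
      wsum E w (fun S => l ^ (S.card - N S)) := by
    refine wsum_congr fun S _ => ?_
    rw [pow_sub₀ _ hl0.ne' (hle S)]; ring
  simp only [Function.comp_def] at fkg
  rw [e1] at fkg
  have j4 : wexp E w (fun S => l ^ N S) *
      wexp E (fun S => l ^ S.card * w S) (fun S => (l ^ N S)⁻¹) ≤ 1 := by
    rw [wexp, wexp, e2, div_mul_div_comm, div_le_one (mul_pos z zt)]
    linarith
  have hpos : 0 < wexp E w (fun S => l ^ N S) := wexp_pos hw.pos fun S _ => by positivity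
  set a := wexp E w' (fun S => (N S : ℝ))
  set b := wexp E (fun S => l ^ S.card * w S) (fun S => (N S : ℝ))
  have j5 : Real.exp (Real.log l * a) * Real.exp (-Real.log l * b) ≤ C := by
    calc _ ≤ (C * wexp E w (fun S => l ^ N S)) *
          wexp E (fun S => l ^ S.card * w S) (fun S => (l ^ N S)⁻¹) :=
          mul_le_mul (j1.trans j3) j2 (Real.exp_pos _).le (by positivity)
      _ = C * (wexp E w (fun S => l ^ N S) *
          wexp E (fun S => l ^ S.card * w S) (fun S => (l ^ N S)⁻¹)) := by ring
      _ ≤ C * 1 := mul_le_mul_of_nonneg_left j4 hC.le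
      _ = C := mul_one C
  rw [← Real.exp_add, ← Real.le_log_iff_exp_le hC] at j5
  have : a - b ≤ Real.log C / Real.log l := by
    rw [le_div_iff₀ hlog]; linarith
  linarith

end Tilt

/-! ### Free measures against wired measures -/

section Free

variable {V : Set (ℝ × ℝ)} {G : SimpleGraph V} {q x y : ℝ}

open Classical

/-- The expectation of `f` under the free random-cluster measure on `E`, all the edges outside `E`
being closed. -/
def freeExp (q x : ℝ) (E : Finset G.edgeSet) (f : Set G.edgeSet → ℝ) : ℝ :=
  wexp E (relWeight q x E fun _ _ => False) fun S => f ↑S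

theorem freeExp_map (σ : G ≃g G) (E : Finset G.edgeSet) (f : Set G.edgeSet → ℝ) :
    freeExp q x (E.map σ.mapEdgeSet.toEmbedding) f =
      freeExp q x E fun S => f (σ.mapEdgeSet '' S) := by
  simp only [freeExp, wexp, wsum, sum_powerset_map, relWeight, relRank_free_map, Finset.card_map]
  congr 1
  refine Finset.sum_congr rfl fun S _ => ?_
  simp

theorem isFKG_relWeight (hq : 1 ≤ q) (hx : 0 < x) (E : Finset G.edgeSet) (R : V → V → Prop) :
    IsFKG E (relWeight q x E R) := by
  refine ⟨relWeight_pos hq hx E R, fun a _ b _ => ?_⟩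
  exact weight_mul_le hq (by positivity) (by positivity) (pow_mul_pow_le_of_card hx.le le_rfl a b)
    (relRank_add_le (fun _ _ h => h) a b)

theorem wexp_count {ι : Type*} (E : Finset G.edgeSet) (w : Finset G.edgeSet → ℝ) (s : Finset ι)
    (A : ι → Set (Set G.edgeSet)) :
    wexp E w (fun S => (count s A S : ℝ)) = ∑ i ∈ s, wexp E w fun S => ind (A i) ↑S := by
  rw [← wexp_sum]
  refine wexp_congr fun S _ => ?_
  simp only [count, Finset.card_filter, Nat.cast_sum]
  refine Finset.sum_congr rfl fun i hi => ?_
  by_cases h : (S : Set G.edgeSet) ∈ A i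
  · rw [ind_of_mem h]; simp [h]
  · rw [ind_of_notMem h]; simp [h]

/-- The free weight at `x` is within a factor `q ^ |∂E|` of the wired one, and tilting by `y / x`
turns it into the free weight at `y`. Only the logarithm of the factor enters, so the total error is
of surface order. -/
theorem sum_mu_le_sum_freeExp {ι : Type*} (hq : 1 ≤ q) (hx : 0 < x) (hxy : x < y)
    (s : Finset ι) {A : ι → Set (Set G.edgeSet)} {D : ι → Set G.edgeSet} {E : Finset G.edgeSet}
    (hA : ∀ i ∈ s, IsUpperSet (A i)) (hD : ∀ i ∈ s, D i ⊆ E) (hloc : ∀ i ∈ s, LocalOn (D i) (A i))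
    (hdis : ∀ i ∈ s, ∀ j ∈ s, i ≠ j → Disjoint (D i) (D j))
    (hemp : ∀ i ∈ s, (∅ : Set G.edgeSet) ∉ A i) :
    ∑ i ∈ s, mu q x (A i) ≤ ∑ i ∈ s, freeExp q y E (ind (A i)) +
      (bdry E).ncard * (Real.log q / Real.log (y / x)) := by
  obtain ⟨hN, hle, hNc⟩ := count_props hA hloc hdis hemp
  have hq0 : 0 < q := by linarith
  have key := wexp_le_wexp_tilt_add (isFKG_relWeight hq hx E fun _ _ => False)
    (wiredWeight_pos hq hx E) (C := q ^ (bdry E).ncard) (l := y / x) (fun S => ?_) (fun S => ?_)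
    (by positivity) ((one_lt_div hx).2 hxy) hN hle hNc
  · have h1 : (fun S => (y / x) ^ S.card * relWeight q x E (fun _ _ => False) S) =
        relWeight q y E fun _ _ => False := by
      funext S
      rw [relWeight, relWeight, ← mul_assoc, ← mul_pow, div_mul_cancel₀ _ hx.ne']
    rw [h1, wexp_count, wexp_count, Real.log_pow, mul_div_assoc] at key
    refine le_trans (Finset.sum_le_sum fun i hi => ?_) key
    refine (mu_le_wiredExp hq hx E).trans (le_of_eq (wexp_congr fun S _ => ?_))
    have := (hloc i hi).mem_union_compl_iff (hD i hi) (S : Set G.edgeSet)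
    by_cases h : (S : Set G.edgeSet) ∈ A i
    · rw [ind_of_mem (this.2 h), ind_of_mem h]
    · rw [ind_of_notMem (fun h' => h (this.1 h')), ind_of_notMem h]
  · exact mul_le_mul_of_nonneg_left (pow_le_pow_right₀ hq (wiredRank_le_relRank E S)) (by positivity)
  · have h1 := pow_le_pow_right₀ hq (relRank_le_wiredRank_add E S)
    rw [pow_add] at h1
    calc x ^ S.card * q ^ relRank E (fun _ _ => False) S
        ≤ x ^ S.card * (q ^ wiredRank E S * q ^ (bdry E).ncard) :=
          mul_le_mul_of_nonneg_left h1 (by positivity)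
      _ = q ^ (bdry E).ncard * (x ^ S.card * q ^ wiredRank E S) := by ring

theorem IsLattice.finite_edgesIn (hG : IsLattice G) {B : Set (ℝ × ℝ)}
    (hB : Bornology.IsBounded B) : (edgesIn G B).Finite := by
  refine (hG.finite_seg_meeting hB).subset fun e he => ?_
  obtain ⟨a, b, hab, -⟩ := exists_eq_mk e
  have ha : a ∈ (e : Sym2 V) := by rw [hab]; simp
  exact ⟨a, mem_seg_of_mem ha, he a ha⟩

/-- The boundary of a large square is small. -/
theorem IsLattice.exists_ncard_bdry_le (hG : IsLattice G) :
    ∃ C : ℝ, ∀ (n : ℕ) (E : Finset G.edgeSet),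
      (∀ e, e ∈ E ↔ e ∈ edgesIn G (Set.Icc 0 (n : ℝ) ×ˢ Set.Icc 0 (n : ℝ))) →
      ((bdry E).ncard : ℝ) ≤ C * (n + 1) := by
  obtain ⟨C, hC⟩ := hG.exists_card_unitSquare_le
  obtain ⟨l, -, hl⟩ := hG.exists_length_le
  refine ⟨(2 * (2 * l + 3) : ℕ) * C, fun n E hE => ?_⟩
  -- A boundary vertex has a neighbour outside the square within distance `l`, so one of its
  -- coordinates lies in these two layers of bounded width.
  set I : Finset ℤ := Finset.Icc 0 (l : ℤ) ∪ Finset.Icc ((n : ℤ) - l - 1) n with hI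
  set J : Finset ℤ := Finset.Icc 0 (n : ℤ) with hJ
  set Q : Finset (ℤ × ℤ) := I ×ˢ J ∪ J ×ˢ I with hQ
  have hIc : I.card ≤ 2 * l + 3 := by
    refine (Finset.card_union_le _ _).trans ?_
    simp only [Int.card_Icc]; omega
  have hJc : J.card = n + 1 := by simp [hJ]
  have hQc : Q.card ≤ 2 * (2 * l + 3) * (n + 1) := by
    refine (Finset.card_union_le _ _).trans ?_
    rw [Finset.card_product, Finset.card_product, hJc]
    nlinarith
  have hsub : bdry E ⊆ ⋃ p ∈ Q, {v : V | (v : ℝ × ℝ) ∈ unitSquare p.1 p.2} := by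
    rintro v ⟨⟨e, heE, hve⟩, e', he', hve'⟩
    have hv := (hE e).1 heE v hve
    rw [hE] at he'
    simp only [edgesIn, Set.mem_ofPred_eq, not_forall] at he'
    obtain ⟨w, hw, hwn⟩ := he'
    have hd : dist (v : ℝ × ℝ) w ≤ l := by
      obtain ⟨a, b, he'', hab⟩ := exists_eq_mk e'
      rw [he'', Sym2.mem_iff] at hve' hw
      rcases hve' with rfl | rfl <;> rcases hw with rfl | rfl
      · simp
      · exact hl _ _ hab
      · exact hl _ _ hab.symm
      · simp
    rw [Prod.dist_eq, max_le_iff, Real.dist_eq, Real.dist_eq, abs_le, abs_le] at hd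
    obtain ⟨⟨hv1, hv2⟩, hv3, hv4⟩ := hv
    refine Set.mem_biUnion (x := (⌊(v : ℝ × ℝ).1⌋, ⌊(v : ℝ × ℝ).2⌋)) ?_
      (mem_unitSquare_floor (v : ℝ × ℝ))
    have f1 : 0 ≤ ⌊(v : ℝ × ℝ).1⌋ := Int.floor_nonneg.2 hv1
    have f2 : ⌊(v : ℝ × ℝ).1⌋ ≤ n := by
      have := Int.floor_mono hv2
      simpa using this
    have f3 : 0 ≤ ⌊(v : ℝ × ℝ).2⌋ := Int.floor_nonneg.2 hv3
    have f4 : ⌊(v : ℝ × ℝ).2⌋ ≤ n := by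
      have := Int.floor_mono hv4
      simpa using this
    have key : ∀ s t : ℝ, 0 ≤ ⌊s⌋ → ⌊s⌋ ≤ n → -(l : ℝ) ≤ s - t → s - t ≤ l → (t < 0 ∨ (n : ℝ) < t) →
        ⌊s⌋ ∈ I := by
      intro s t g1 g2 g3 g4 g5
      rw [hI, Finset.mem_union, Finset.mem_Icc, Finset.mem_Icc]
      rcases g5 with g5 | g5
      · left
        refine ⟨g1, ?_⟩
        have : s ≤ (l : ℤ) := by push_cast; linarith
        simpa using Int.floor_mono this
      · right
        refine ⟨?_, g2⟩
        rw [Int.le_floor]; push_cast; linarith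
    simp only [Set.mem_prod, Set.mem_Icc, not_and_or, not_le] at hwn
    rw [hQ, Finset.mem_coe, Finset.mem_union, Finset.mem_product, Finset.mem_product]
    rcases hwn with h | h
    · exact Or.inl ⟨key _ _ f1 f2 hd.1.1 hd.1.2 h, by rw [hJ, Finset.mem_Icc]; exact ⟨f3, f4⟩⟩
    · exact Or.inr ⟨by rw [hJ, Finset.mem_Icc]; exact ⟨f1, f2⟩, key _ _ f3 f4 hd.2.1 hd.2.2 h⟩
  have hfin : (⋃ p ∈ Q, {v : V | (v : ℝ × ℝ) ∈ unitSquare p.1 p.2}).Finite :=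
    Q.finite_toSet.biUnion fun p _ => hG.finite_verts (isBounded_unitSquare _ _)
  have h1 : (bdry E).ncard ≤ Q.card * C := by
    refine (Set.ncard_le_ncard hsub hfin).trans ((Finset.set_ncard_biUnion_le _ _).trans ?_)
    exact Finset.sum_le_card_nsmul _ _ _ fun p _ => hC p.1 p.2
  have h2 : (bdry E).ncard ≤ 2 * (2 * l + 3) * C * (n + 1) := by
    refine h1.trans ((Nat.mul_le_mul_right C hQc).trans (le_of_eq (by ring)))
  exact_mod_cast h2

/-- The free measure at a larger parameter dominates the wired measure on increasing events, in a
suitable finite volume and up to a small error. -/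
theorem IsLattice.exists_freeExp_ge (hG : IsLattice G) (hq : 1 ≤ q) (hx : 0 < x) (hxy : x < y)
    {A : Set (Set G.edgeSet)} (hA : IsUpperSet A) {D : Finset G.edgeSet} (hloc : LocalOn ↑D A)
    {ε : ℝ} (hε : 0 < ε) : ∃ E, D ⊆ E ∧ mu q x A - ε ≤ freeExp q y E (ind A) := by
  have hy := hx.trans hxy
  by_cases hemp : (∅ : Set G.edgeSet) ∈ A
  · refine ⟨D, subset_rfl, ?_⟩
    have : freeExp q y D (ind A) = 1 := by
      rw [freeExp, ← wexp_const D (relWeight_pos hq hy D fun _ _ => False) 1]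
      exact wexp_congr fun S _ => ind_of_mem (hA (Set.empty_subset _) hemp)
    rw [this]
    linarith [mu_le_one hq hx A]
  obtain ⟨C, hC⟩ := hG.exists_ncard_bdry_le
  obtain ⟨R, hR⟩ : ∃ R : ℕ, ∀ v ∈ verts D, |(v : ℝ × ℝ).1| ≤ R ∧ |(v : ℝ × ℝ).2| ≤ R := by
    obtain ⟨M, hM⟩ := ((verts_finite D).image fun v : V => ‖(v : ℝ × ℝ)‖).bddAbove
    refine ⟨⌈M⌉₊, fun v hv => mem_box_iff_norm.2 ?_⟩
    exact (hM ⟨v, hv, rfl⟩).trans (Nat.le_ceil M)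
  -- All vertices of `D` lie in the box of radius `R`, so translates by distinct multiples of `L`
  -- share no edge.
  set L : ℕ := 2 * R + 1 with hL
  set κ := Real.log q / Real.log (y / x) with hκ
  have hκ0 : 0 ≤ κ := div_nonneg (Real.log_nonneg hq) (Real.log_nonneg ((one_le_div hx).2 hxy.le))
  -- The boundary grows like `N`, the number of disjoint copies like `N ^ 2`.
  obtain ⟨N, hN0, hN⟩ : ∃ N : ℕ, 0 < N ∧ C * ((L * N : ℕ) + 1) * κ ≤ ε * (N * N) := by
    obtain ⟨N, hN⟩ := exists_nat_ge (|C| * (L + 1) * κ / ε)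
    refine ⟨N + 1, by omega, ?_⟩
    rw [div_le_iff₀ hε] at hN
    have hN1 : (1 : ℝ) ≤ ((N + 1 : ℕ) : ℝ) := by push_cast; linarith [Nat.cast_nonneg (α := ℝ) N]
    have h1 : ((L * (N + 1) : ℕ) : ℝ) + 1 ≤ (L + 1) * ((N + 1 : ℕ) : ℝ) := by
      push_cast at hN1 ⊢; linarith
    calc C * (((L * (N + 1) : ℕ) : ℝ) + 1) * κ ≤ |C| * ((L + 1) * ((N + 1 : ℕ) : ℝ)) * κ := by
          gcongr
          exact le_abs_self C
      _ = (|C| * (L + 1) * κ) * ((N + 1 : ℕ) : ℝ) := by ring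
      _ ≤ (N * ε) * ((N + 1 : ℕ) : ℝ) := by gcongr
      _ ≤ ε * (((N + 1 : ℕ) : ℝ) * ((N + 1 : ℕ) : ℝ)) := by
          have : (N : ℝ) * ε ≤ ((N + 1 : ℕ) : ℝ) * ε := by gcongr; omega
          nlinarith
  choose σ hσ using fun p : ℕ × ℕ => hG.inducesAut_translate (-(L * p.1 + R)) (-(L * p.2 + R))
  have hbd : Bornology.IsBounded (Set.Icc 0 ((L * N : ℕ) : ℝ) ×ˢ Set.Icc 0 ((L * N : ℕ) : ℝ)) :=
    (Metric.isBounded_Icc _ _).prod (Metric.isBounded_Icc _ _)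
  have hfin := hG.finite_edgesIn hbd
  set E := hfin.toFinset with hE
  have hcoord : ∀ p e, (σ p).mapEdgeSet e ∈ D → ∀ v ∈ (e : Sym2 V),
      (L * p.1 : ℝ) ≤ (v : ℝ × ℝ).1 ∧ (v : ℝ × ℝ).1 ≤ L * p.1 + 2 * R ∧
      (L * p.2 : ℝ) ≤ (v : ℝ × ℝ).2 ∧ (v : ℝ × ℝ).2 ≤ L * p.2 + 2 * R := by
    intro p e he v hv
    have h1 := hR (σ p v) ⟨_, he, (mem_mapEdgeSet (σ p) e v).2 hv⟩
    rw [hσ, abs_le, abs_le] at h1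
    push_cast at h1
    refine ⟨?_, ?_, ?_, ?_⟩ <;> linarith [h1.1.1, h1.1.2, h1.2.1, h1.2.2]
  have hLN : ∀ i : ℕ, i < N → (L * i + 2 * R : ℝ) ≤ (L * N : ℕ) := by
    intro i hi
    have : L * i + 2 * R ≤ L * N := by
      have : L * (i + 1) ≤ L * N := Nat.mul_le_mul_left _ hi
      rw [mul_add] at this
      omega
    exact_mod_cast this
  have hDE : ∀ p ∈ Finset.range N ×ˢ Finset.range N, {e | (σ p).mapEdgeSet e ∈ D} ⊆ (E : Set G.edgeSet) := by
    intro p hp e he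
    rw [Finset.mem_product, Finset.mem_range, Finset.mem_range] at hp
    rw [hE, Set.Finite.coe_toFinset]
    intro v hv
    obtain ⟨h1, h2, h3, h4⟩ := hcoord p e he v hv
    have h5 := hLN p.1 hp.1
    have h6 := hLN p.2 hp.2
    exact ⟨⟨le_trans (by positivity) h1, h2.trans h5⟩, le_trans (by positivity) h3, h4.trans h6⟩
  have hsep : ∀ (i j : ℕ) (s : ℝ), (L * i : ℝ) ≤ s → s ≤ L * i + 2 * R → (L * j : ℝ) ≤ s →
      s ≤ L * j + 2 * R → i ≤ j := by
    intro i j s h1 _ _ h4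
    by_contra! hij
    have h5 : L * (j + 1) ≤ L * i := Nat.mul_le_mul_left _ hij
    have h6 : L * i ≤ L * j + 2 * R := by exact_mod_cast h1.trans h4
    rw [mul_add] at h5
    omega
  have key := sum_mu_le_sum_freeExp hq hx hxy (Finset.range N ×ˢ Finset.range N) (E := E)
    (A := fun p => {S | (σ p).mapEdgeSet '' S ∈ A}) (D := fun p => {e | (σ p).mapEdgeSet e ∈ D})
    (fun p _ S T h hS => hA (Set.image_mono h) hS) hDE (fun p _ S T h => hloc _ _ ?_)
    (fun p _ p' _ hne => ?_) (fun p _ h => hemp (by simpa using h))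
  · simp only [mu_image, Finset.sum_const, nsmul_eq_mul, Finset.card_product, Finset.card_range] at key
    have hb := hC (L * N) E fun e => by rw [hE, Set.Finite.mem_toFinset]
    have hb2 := (mul_le_mul_of_nonneg_right hb hκ0).trans hN
    have h1 : ∑ p ∈ Finset.range N ×ˢ Finset.range N, (mu q x A - ε) ≤
        ∑ p ∈ Finset.range N ×ˢ Finset.range N,
          freeExp q y E (ind {S | (σ p).mapEdgeSet '' S ∈ A}) := by
      rw [Finset.sum_const, nsmul_eq_mul, Finset.card_product, Finset.card_range]
      push_cast at key ⊢
      linarith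
    -- Some copy does at least as well as the average; translating the square by `σ p` brings this
    -- copy back to `D`.
    obtain ⟨p, hp, hle⟩ := Finset.exists_le_of_sum_le (by simpa using hN0.ne') h1
    refine ⟨E.map (σ p).mapEdgeSet.toEmbedding, fun e he => ?_, hle.trans (le_of_eq ?_)⟩
    · rw [Finset.mem_map]
      refine ⟨(σ p).mapEdgeSet.symm e, ?_, (σ p).mapEdgeSet.apply_symm_apply e⟩
      refine hDE p hp ?_
      rw [Set.mem_ofPred_eq, (σ p).mapEdgeSet.apply_symm_apply]
      exact he
    · rw [freeExp_map]
      rfl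
  · have e1 : ∀ S : Set G.edgeSet, (σ p).mapEdgeSet '' S ∩ ↑D =
        (σ p).mapEdgeSet '' (S ∩ {e | (σ p).mapEdgeSet e ∈ D}) := by
      intro S
      ext e
      constructor
      · rintro ⟨⟨e', he', rfl⟩, h2⟩; exact ⟨e', ⟨he', h2⟩, rfl⟩
      · rintro ⟨e', ⟨he', h2⟩, rfl⟩; exact ⟨⟨e', he', rfl⟩, h2⟩
    rw [e1, e1, h]
  · rw [Set.disjoint_left]
    intro e he he'
    obtain ⟨v, _, hab, -⟩ := exists_eq_mk e
    have hv : v ∈ (e : Sym2 V) := by rw [hab]; simp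
    obtain ⟨h1, h2, h3, h4⟩ := hcoord p e he v hv
    obtain ⟨g1, g2, g3, g4⟩ := hcoord p' e he' v hv
    exact hne (Prod.ext (le_antisymm (hsep _ _ _ h1 h2 g1 g2) (hsep _ _ _ g1 g2 h1 h2))
      (le_antisymm (hsep _ _ _ h3 h4 g3 g4) (hsep _ _ _ g3 g4 h3 h4)))

end Free

end

section

open Filter Topology

/-! ### Infinite-volume measures between the free and the wired measures -/

section InfiniteVolume

variable {V : Set (ℝ × ℝ)} {G : SimpleGraph V} {p q x y : ℝ}

open Classical

/-- The relation on vertices defined by a boundary condition. -/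
def bcRel (E : Finset G.edgeSet) (ξ : Setoid (bdry E)) (v w : V) : Prop :=
  ∃ (hv : v ∈ bdry E) (hw : w ∈ bdry E), ξ ⟨v, hv⟩ ⟨w, hw⟩

/-- The set of open edges of a configuration on `E`. -/
def openEdges {E : Finset G.edgeSet} (η : E → Bool) : Finset G.edgeSet :=
  (Finset.univ.filter fun e : E => η e = true).map (Function.Embedding.subtype _)

theorem mem_openEdges {E : Finset G.edgeSet} {η : E → Bool} {e : G.edgeSet} :
    e ∈ openEdges η ↔ ∃ h : e ∈ E, η ⟨e, h⟩ = true := by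
  simp [openEdges]

/-- Functions on the set of components are the same as functions on the vertices that are constant
along open edges and along identifications. -/
theorem numClusters_eq (E : Finset G.edgeSet) (ξ : Setoid (bdry E)) (η : E → Bool) :
    numClusters E ξ η = relRank E (bcRel E ξ) (openEdges η) := by
  set R : V → V → Prop := fun v w => edgeRel (openEdges η : Set G.edgeSet) v w ∨ bcRel E ξ v w
  have hadj : ∀ v w : verts E, (wiredGraph E ξ η).Adj v w → R v w := by
    intro v w h
    rw [wiredGraph, SimpleGraph.fromRel_adj] at h
    rcases h.2 with (⟨e, he, hvw⟩ | ⟨hv, hw, h⟩) | ⟨e, he, hvw⟩ | ⟨hv, hw, h⟩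
    · exact Or.inl ⟨e, mem_openEdges.2 ⟨e.2, he⟩, by rw [hvw]; simp, by rw [hvw]; simp⟩
    · exact Or.inr ⟨hv, hw, h⟩
    · exact Or.inl ⟨e, mem_openEdges.2 ⟨e.2, he⟩, by rw [hvw]; simp, by rw [hvw]; simp⟩
    · exact Or.inr ⟨hw, hv, ξ.symm h⟩
  have hreach : ∀ v w : V, R v w → ∀ (hv : v ∈ verts E) (hw : w ∈ verts E),
      (wiredGraph E ξ η).Reachable ⟨v, hv⟩ ⟨w, hw⟩ := by
    intro v w h hv hw
    by_cases hvw : v = w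
    · subst hvw; rfl
    · refine SimpleGraph.Adj.reachable ?_
      rw [wiredGraph, SimpleGraph.fromRel_adj]
      refine ⟨fun h => hvw (congrArg Subtype.val h), Or.inl ?_⟩
      rcases h with ⟨e, he, hve, hwe⟩ | h
      · obtain ⟨heE, he⟩ := mem_openEdges.1 he
        exact Or.inl ⟨⟨e, heE⟩, he, (Sym2.mem_and_mem_iff hvw).1 ⟨hve, hwe⟩⟩
      · exact Or.inr h
  have hverts : ∀ v w : V, R v w → (v ∈ verts E ↔ w ∈ verts E) := by
    rintro v w (⟨e, he, hve, hwe⟩ | ⟨hv, hw, -⟩)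
    · obtain ⟨heE, -⟩ := mem_openEdges.1 he
      exact ⟨fun _ => ⟨e, heE, hwe⟩, fun _ => ⟨e, heE, hve⟩⟩
    · exact ⟨fun _ => hw.1, fun _ => hv.1⟩
  let L : ((wiredGraph E ξ η).ConnectedComponent → ℝ) ≃ₗ[ℝ] flat (verts E) R :=
    { toFun := fun g => ⟨fun v => if hv : v ∈ verts E then
          g ((wiredGraph E ξ η).connectedComponentMk ⟨v, hv⟩) else 0,
        fun v hv => dif_neg hv, fun v w h => by
          beta_reduce
          by_cases hv : v ∈ verts E
          · have hw := (hverts v w h).1 hv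
            rw [dif_pos hv, dif_pos hw, SimpleGraph.ConnectedComponent.sound (hreach v w h hv hw)]
          · have hw := fun hw => hv ((hverts v w h).2 hw)
            rw [dif_neg hv, dif_neg hw]⟩
      map_add' := fun g g' => by
        ext v
        by_cases hv : v ∈ verts E <;> simp [hv]
      map_smul' := fun c g => by
        ext v
        by_cases hv : v ∈ verts E <;> simp [hv]
      invFun := fun f c => c.lift (fun v => f.1 v.1) fun v w P _ => by
        induction P with
        | nil => rfl
        | cons h _ ih => exact (f.2.2 _ _ (hadj _ _ h)).trans (ih (by simp_all [SimpleGraph.Walk.cons_isPath_iff]))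
      left_inv := fun g => by
        funext c
        induction c using SimpleGraph.ConnectedComponent.ind with
        | _ v => simp
      right_inv := fun f => by
        ext v
        by_cases hv : v ∈ verts E
        · simp [hv]
        · simp [hv, f.2.1 v hv] }
  have hfinv : Finite (verts E) := (verts_finite E).to_subtype
  have : Finite (wiredGraph E ξ η).ConnectedComponent := Quot.finite _
  have := Fintype.ofFinite (wiredGraph E ξ η).ConnectedComponent
  rw [numClusters, relRank, ← L.finrank_eq, Module.finrank_fintype_fun_eq_card, Nat.card_eq_fintype_card]

theorem sum_openEdges (E : Finset G.edgeSet) (F : Finset G.edgeSet → ℝ) :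
    ∑ η : E → Bool, F (openEdges η) = ∑ S ∈ E.powerset, F S := by
  refine Finset.sum_bij (fun η _ => openEdges η) ?_ ?_ ?_ fun _ _ => rfl
  · intro η _
    rw [Finset.mem_powerset]
    intro e he
    exact (mem_openEdges.1 he).1
  · intro η _ η' _ h
    funext e
    have h1 := Finset.ext_iff.1 h e.1
    rw [mem_openEdges, mem_openEdges] at h1
    simp only [Subtype.coe_eta, e.2, exists_true_left] at h1
    rwa [Bool.eq_iff_iff]
  · intro S hS
    refine ⟨fun e => decide (e.1 ∈ S), Finset.mem_univ _, ?_⟩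
    ext e
    rw [mem_openEdges]
    simp only [decide_eq_true_eq, exists_prop, and_iff_right_iff_imp]
    exact fun h => Finset.mem_powerset.1 hS h

theorem card_openEdges {E : Finset G.edgeSet} (η : E → Bool) :
    (Finset.univ.filter fun e : E => η e = true).card = (openEdges η).card := by
  rw [openEdges, Finset.card_map]

theorem card_closed {E : Finset G.edgeSet} (η : E → Bool) :
    (openEdges η).card + (Finset.univ.filter fun e : E => η e = false).card = E.card := by
  rw [← card_openEdges]
  have := Finset.card_filter_add_card_filter_not (s := (Finset.univ : Finset E)) (fun e => η e = true)
  simpa using this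

theorem weight_eq (hp : p < 1) (E : Finset G.edgeSet) (ξ : Setoid (bdry E)) (η : E → Bool) :
    weight p q E ξ η = (1 - p) ^ E.card * relWeight q (p / (1 - p)) E (bcRel E ξ) (openEdges η) := by
  have h1 : 1 - p ≠ 0 := by linarith
  rw [weight, relWeight, numClusters_eq, card_openEdges, ← card_closed η, pow_add, div_pow]
  field_simp

theorem sum_finiteVolumeProb (hp : p < 1) (E : Finset G.edgeSet) (ξ : Setoid (bdry E))
    (f : Finset G.edgeSet → ℝ) :
    ∑ η : E → Bool, finiteVolumeProb p q E ξ η * f (openEdges η) =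
      wexp E (relWeight q (p / (1 - p)) E (bcRel E ξ)) f := by
  have h1 : (1 - p) ^ E.card ≠ 0 := pow_ne_zero _ (by linarith)
  have e : ∀ η : E → Bool, finiteVolumeProb p q E ξ η * f (openEdges η) =
      relWeight q (p / (1 - p)) E (bcRel E ξ) (openEdges η) * f (openEdges η) /
        wsum E (relWeight q (p / (1 - p)) E (bcRel E ξ)) 1 := by
    intro η
    rw [finiteVolumeProb]
    simp only [weight_eq hp, ← Finset.mul_sum]
    rw [sum_openEdges E (relWeight q (p / (1 - p)) E (bcRel E ξ)), mul_div_mul_left _ _ h1, wsum]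
    simp only [Pi.one_apply, mul_one]
    ring
  simp only [e]
  rw [← Finset.sum_div, sum_openEdges E fun S => relWeight q (p / (1 - p)) E (bcRel E ξ) S * f S]
  rfl

theorem finiteVolumeProb_nonneg (hp0 : 0 ≤ p) (hp : p ≤ 1) (hq : 1 ≤ q) (E : Finset G.edgeSet)
    (ξ : Setoid (bdry E)) (η : E → Bool) : 0 ≤ finiteVolumeProb p q E ξ η := by
  have h : ∀ η, 0 ≤ weight p q E ξ η := fun η =>
    mul_nonneg (mul_nonneg (pow_nonneg hp0 _) (pow_nonneg (by linarith) _))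
      (pow_nonneg (by linarith) _)
  exact div_nonneg (h η) (Finset.sum_nonneg fun η _ => h η)

theorem finiteVolumeProb_one (hq : 1 ≤ q) (E : Finset G.edgeSet) (ξ : Setoid (bdry E)) :
    finiteVolumeProb 1 q E ξ (fun _ => true) = 1 := by
  have h : ∀ η : E → Bool, η ≠ (fun _ => true) → weight 1 q E ξ η = 0 := by
    intro η hη
    have : (Finset.univ.filter fun e : E => η e = false).card ≠ 0 := by
      rw [Finset.card_ne_zero]
      by_contra hcon
      rw [Finset.not_nonempty_iff_eq_empty, Finset.filter_eq_empty_iff] at hcon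
      refine hη (funext fun e => ?_)
      simpa using hcon (Finset.mem_univ e)
    rw [weight, sub_self, zero_pow this, mul_zero, zero_mul]
  have h2 : weight 1 q E ξ (fun _ => true) ≠ 0 := by
    have : q ≠ 0 := by linarith
    simp [weight, this]
  rw [finiteVolumeProb, Finset.sum_eq_single (fun _ => true) (fun η _ hη => h η hη)
    (fun h => absurd (Finset.mem_univ _) h), div_self h2]

/-- The set of open edges. -/
def openSet (ω : Config G) : Set G.edgeSet := {e | ω e = true}

theorem reachable_openGraph_iff {ω : Config G} {F : Set G.edgeSet} {u v : V} :
    (openGraph ω F).Reachable u v ↔ Conn (openSet ω ∩ F) u v := by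
  constructor
  · rintro ⟨w⟩
    induction w with
    | nil => exact Relation.ReflTransGen.refl
    | cons h _ ih =>
      refine Relation.ReflTransGen.head ?_ ih
      rw [openGraph, SimpleGraph.fromRel_adj] at h
      rcases h.2 with ⟨e, he, ho, h⟩ | ⟨e, he, ho, h⟩
      · exact ⟨e, ⟨ho, he⟩, by rw [h]; simp, by rw [h]; simp⟩
      · exact ⟨e, ⟨ho, he⟩, by rw [h]; simp, by rw [h]; simp⟩
  · intro h
    induction h with
    | refl => rfl
    | @tail b c _ h ih =>
      refine ih.trans ?_
      by_cases hbc : b = c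
      · subst hbc; rfl
      · obtain ⟨e, ⟨ho, he⟩, hb, hc⟩ := h
        refine SimpleGraph.Adj.reachable ?_
        rw [openGraph, SimpleGraph.fromRel_adj]
        exact ⟨hbc, Or.inl ⟨e, he, ho, (Sym2.mem_and_mem_iff hbc).1 ⟨hb, hc⟩⟩⟩

theorem Conn.exists_finset {S : Set G.edgeSet} {u v : V} (h : Conn S u v) :
    ∃ T : Finset G.edgeSet, ↑T ⊆ S ∧ Conn (T : Set G.edgeSet) u v := by
  induction h with
  | refl => exact ⟨∅, by simp, Relation.ReflTransGen.refl⟩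
  | tail _ h ih =>
    obtain ⟨T, hT, hc⟩ := ih
    obtain ⟨e, he, hb, hc'⟩ := h
    refine ⟨insert e T, by simp [Set.insert_subset_iff, he, hT], ?_⟩
    exact (hc.mono (by simp)).tail ⟨e, by simp, hb, hc'⟩

theorem IsLattice.countable (hG : IsLattice G) : Countable V := by
  have : V = ⋃ n : ℕ, V ∩ Metric.closedBall 0 n := by
    ext v
    simp only [Set.mem_iUnion, Set.mem_inter_iff, exists_and_left, iff_self_and]
    intro _
    obtain ⟨n, hn⟩ := exists_nat_ge ‖v‖
    exact ⟨n, by simpa using hn⟩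
  have h : V.Countable := by
    rw [this]
    exact Set.countable_iUnion fun n => (hG.finite_of_bounded _ Metric.isBounded_closedBall).countable
  exact h.to_subtype

theorem IsLattice.countable_edgeSet (hG : IsLattice G) : Countable G.edgeSet := by
  have := hG.countable
  have : Countable (Sym2 V) := inferInstanceAs (Countable (Quot _))
  infer_instance

theorem measurableSet_cylinder (E : Finset G.edgeSet) (η : E → Bool) :
    MeasurableSet {ω : Config G | ∀ e : E, ω e.1 = η e} := by
  have : {ω : Config G | ∀ e : E, ω e.1 = η e} = ⋂ e : E, (fun ω : Config G => ω e.1) ⁻¹' {η e} := by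
    ext ω; simp
  rw [this]
  exact MeasurableSet.iInter fun e => measurable_pi_apply _ (measurableSet_singleton _)

theorem IsLattice.measurableSet_reachable (hG : IsLattice G) (F : Set G.edgeSet) (u v : V) :
    MeasurableSet {ω : Config G | (openGraph ω F).Reachable u v} := by
  have := hG.countable_edgeSet
  have : {ω : Config G | (openGraph ω F).Reachable u v} =
      ⋃ (T : Finset G.edgeSet) (_ : Conn (T : Set G.edgeSet) u v ∧ ↑T ⊆ F),
        {ω : Config G | ∀ e : T, ω e.1 = (fun _ => true) e} := by
    ext ω
    simp only [Set.mem_ofPred_eq, reachable_openGraph_iff, Set.mem_iUnion, exists_prop]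
    constructor
    · intro h
      obtain ⟨T, hT, hc⟩ := h.exists_finset
      exact ⟨T, ⟨hc, fun e he => (hT he).2⟩, fun e => (hT e.2).1⟩
    · rintro ⟨T, ⟨hc, hF⟩, h⟩
      exact Conn.mono (T := openSet ω ∩ F) (fun e he => ⟨h ⟨e, Finset.mem_coe.1 he⟩, hF he⟩) hc
  rw [this]
  exact MeasurableSet.iUnion fun T => MeasurableSet.iUnion fun _ => measurableSet_cylinder T _

theorem finite_setoid (E : Finset G.edgeSet) : Finite (Setoid (bdry E)) := by
  have : Finite (bdry E) := ((verts_finite E).subset fun v hv => hv.1).to_subtype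
  refine Finite.of_injective (fun ξ : Setoid (bdry E) => (ξ : bdry E → bdry E → Prop)) ?_
  intro ξ ξ' h
  exact Setoid.ext fun a b => by
    have := congrFun (congrFun h a) b
    exact this.to_iff

theorem IsLattice.measurableSet_inducedBC (hG : IsLattice G) (E : Finset G.edgeSet)
    (ξ : Setoid (bdry E)) : MeasurableSet {ω : Config G | inducedBC E ω = ξ} := by
  have : Finite (bdry E) := ((verts_finite E).subset fun v hv => hv.1).to_subtype
  have e : {ω : Config G | inducedBC E ω = ξ} = ⋂ (a : bdry E) (b : bdry E),
      {ω : Config G | (openGraph ω {e | e ∉ E}).Reachable a.1 b.1 ↔ ξ a b} := by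
    ext ω
    simp only [Set.mem_ofPred_eq, Set.mem_iInter, Setoid.ext_iff]
    rfl
  rw [e]
  refine MeasurableSet.iInter fun a => MeasurableSet.iInter fun b => ?_
  by_cases h : ξ a b
  · simp only [h, iff_true]
    exact hG.measurableSet_reachable {e | e ∉ E} a.1 b.1
  · simp only [h, iff_false]
    exact (hG.measurableSet_reachable {e | e ∉ E} a.1 b.1).compl

theorem openSet_mem_iff {E : Finset G.edgeSet} {A : Set (Set G.edgeSet)} (hloc : LocalOn ↑E A)
    {ω : Config G} {η : E → Bool} (h : ∀ e : E, ω e.1 = η e) :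
    openSet ω ∈ A ↔ (openEdges η : Set G.edgeSet) ∈ A := by
  refine hloc _ _ ?_
  ext e
  simp only [openSet, Set.mem_inter_iff, Set.mem_ofPred_eq, Finset.mem_coe, mem_openEdges]
  constructor
  · rintro ⟨h1, h2⟩; exact ⟨⟨h2, by rw [← h]; exact h1⟩, h2⟩
  · rintro ⟨⟨h1, h2⟩, h3⟩; exact ⟨by rw [← h ⟨e, h1⟩] at h2; exact h2, h3⟩

/-- The event that the set of open edges belongs to `A` is a finite union of cylinders. -/
theorem openSet_preimage_eq {E : Finset G.edgeSet} {A : Set (Set G.edgeSet)} (hloc : LocalOn ↑E A) :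
    {ω : Config G | openSet ω ∈ A} =
      ⋃ η ∈ Finset.univ.filter fun η : E → Bool => (openEdges η : Set G.edgeSet) ∈ A,
        {ω : Config G | ∀ e : E, ω e.1 = η e} := by
  ext ω
  simp only [Set.mem_ofPred_eq, Finset.mem_filter, Finset.mem_univ, true_and, Set.mem_iUnion,
    exists_prop]
  constructor
  · intro h
    exact ⟨fun e => ω e.1, (openSet_mem_iff hloc fun _ => rfl).1 h, fun _ => rfl⟩
  · rintro ⟨η, h1, h2⟩
    exact (openSet_mem_iff hloc h2).2 h1

/-- The measure of a local event, as an average over boundary conditions. -/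
theorem IsInfiniteVolume.measure_eq {φ : Measure (Config G)} (hφ : IsInfiniteVolume p q φ)
    (hG : IsLattice G) (hq : 1 ≤ q) (hp0 : 0 ≤ p) (hp : p ≤ 1) {E : Finset G.edgeSet}
    {A : Set (Set G.edgeSet)} (hloc : LocalOn ↑E A) [Fintype (Setoid (bdry E))] :
    φ {ω | openSet ω ∈ A} = ∑ ξ : Setoid (bdry E), φ {ω | inducedBC E ω = ξ} *
      ENNReal.ofReal (∑ η : E → Bool, finiteVolumeProb p q E ξ η * ind A ↑(openEdges η)) := by
  have := hφ.isProbabilityMeasure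
  have hmeas : MeasurableSet {ω : Config G | openSet ω ∈ A} := by
    rw [openSet_preimage_eq hloc]
    exact Finset.measurableSet_biUnion _ fun η _ => measurableSet_cylinder E η
  have hcover : {ω : Config G | openSet ω ∈ A} = ⋃ ξ ∈ (Finset.univ : Finset (Setoid (bdry E))),
      {ω | inducedBC E ω = ξ} ∩ {ω | openSet ω ∈ A} := by
    ext ω; simp
  rw [hcover, measure_biUnion_finset]
  · refine Finset.sum_congr rfl fun ξ _ => ?_
    by_cases h0 : φ {ω | inducedBC E ω = ξ} = 0
    · rw [h0, zero_mul]
      exact measure_mono_null Set.inter_subset_left h0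
    · rw [← ProbabilityTheory.cond_mul_eq_inter (hG.measurableSet_inducedBC E ξ), mul_comm]
      congr 1
      rw [openSet_preimage_eq hloc, measure_biUnion_finset]
      · simp only [hφ.cond_eq E ξ h0]
        rw [← ENNReal.ofReal_sum_of_nonneg fun η _ => finiteVolumeProb_nonneg hp0 hp hq E ξ η,
          Finset.sum_filter]
        congr 1
        refine Finset.sum_congr rfl fun η _ => ?_
        by_cases h : (openEdges η : Set G.edgeSet) ∈ A
        · rw [if_pos h, ind_of_mem h, mul_one]
        · rw [if_neg h, ind_of_notMem h, mul_zero]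
      · intro η _ η' _ hne
        refine Set.disjoint_left.2 fun ω h h' => hne (funext fun e => ?_)
        rw [← h e, ← h' e]
      · exact fun η _ => measurableSet_cylinder E η
  · intro ξ _ ξ' _ hne
    refine Set.disjoint_left.2 fun ω h h' => hne ?_
    exact h.1.symm.trans h'.1
  · exact fun ξ _ => (hG.measurableSet_inducedBC E ξ).inter hmeas

theorem IsInfiniteVolume.sum_inducedBC {φ : Measure (Config G)} (hφ : IsInfiniteVolume p q φ)
    (hG : IsLattice G) (E : Finset G.edgeSet) [Fintype (Setoid (bdry E))] :
    ∑ ξ : Setoid (bdry E), φ {ω | inducedBC E ω = ξ} = 1 := by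
  have := hφ.isProbabilityMeasure
  rw [← measure_biUnion_finset]
  · rw [← measure_univ (μ := φ)]
    congr 1
    ext ω; simp
  · intro ξ _ ξ' _ hne
    exact Set.disjoint_left.2 fun ω h h' => hne (Eq.trans (Eq.symm h) h')
  · exact fun ξ _ => hG.measurableSet_inducedBC E ξ

/-- In each large volume the measure averages finite-volume measures over boundary conditions, and
the wired measure dominates each of them; the volume then tends to infinity. -/
theorem IsInfiniteVolume.measure_le_mu {φ : Measure (Config G)} (hφ : IsInfiniteVolume p q φ)
    (hG : IsLattice G) (hq : 1 ≤ q) (hp0 : 0 < p) (hp : p < 1) {D : Finset G.edgeSet}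
    {A : Set (Set G.edgeSet)} (hA : IsUpperSet A) (hloc : LocalOn ↑D A) :
    φ {ω | openSet ω ∈ A} ≤ ENNReal.ofReal (mu q (p / (1 - p)) A) := by
  have hx : 0 < p / (1 - p) := div_pos hp0 (by linarith)
  have key : ∀ E : Finset G.edgeSet, D ⊆ E →
      φ {ω | openSet ω ∈ A} ≤ ENNReal.ofReal (wiredExp q (p / (1 - p)) E (ind A)) := by
    intro E hDE
    have hlocE : LocalOn ↑E A := fun S T h => hloc S T (by
      have hD : (D : Set G.edgeSet) = ↑E ∩ ↑D :=
        (Set.inter_eq_self_of_subset_right (by exact_mod_cast hDE)).symm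
      rw [hD, ← Set.inter_assoc, ← Set.inter_assoc, h])
    have := finite_setoid E
    have := Fintype.ofFinite (Setoid (bdry E))
    rw [hφ.measure_eq hG hq hp0.le hp.le hlocE]
    calc _ ≤ ∑ ξ : Setoid (bdry E), φ {ω | inducedBC E ω = ξ} *
          ENNReal.ofReal (wiredExp q (p / (1 - p)) E (ind A)) := by
          refine Finset.sum_le_sum fun ξ _ => mul_le_mul_right (ENNReal.ofReal_le_ofReal ?_) _
          rw [sum_finiteVolumeProb hp E ξ fun S => ind A ↑S]
          refine (wexp_holley (relWeight_pos hq hx _ _) (wiredWeight_pos hq hx E)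
            (fun a _ b _ => weight_mul_le hq (by positivity) (by positivity)
              (pow_mul_pow_le_of_card hx.le le_rfl a b) (relRank_add_wiredRank_le
                (fun v w h => ⟨h.1, h.2.1⟩) a b))
            (fun S T h => ind_mono hA (by exact_mod_cast h))).trans (le_of_eq ?_)
          refine wexp_congr fun S _ => ?_
          have := hlocE.mem_union_compl_iff (subset_rfl) (S : Set G.edgeSet)
          by_cases h : (S : Set G.edgeSet) ∈ A
          · rw [ind_of_mem (this.2 h), ind_of_mem h]
          · rw [ind_of_notMem (fun h' => h (this.1 h')), ind_of_notMem h]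
      _ = _ := by rw [← Finset.sum_mul, hφ.sum_inducedBC hG, one_mul]
  refine ge_of_tendsto (ENNReal.tendsto_ofReal (tendsto_mu hq hx hA)) ?_
  filter_upwards [eventually_ge_atTop D] with E hE using key E hE

/-- The same averaging, with the free measure below every boundary condition. -/
theorem IsInfiniteVolume.freeExp_le_measure {φ : Measure (Config G)} (hφ : IsInfiniteVolume p q φ)
    (hG : IsLattice G) (hq : 1 ≤ q) (hp0 : 0 < p) (hp : p ≤ 1) (hy : 0 < y)
    (hyp : p < 1 → y ≤ p / (1 - p)) {E : Finset G.edgeSet}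
    {A : Set (Set G.edgeSet)} (hA : IsUpperSet A) (hloc : LocalOn ↑E A) :
    ENNReal.ofReal (freeExp q y E (ind A)) ≤ φ {ω | openSet ω ∈ A} := by
  have := finite_setoid E
  have := Fintype.ofFinite (Setoid (bdry E))
  rw [hφ.measure_eq hG hq hp0.le hp hloc]
  calc ENNReal.ofReal (freeExp q y E (ind A)) = ∑ ξ : Setoid (bdry E), φ {ω | inducedBC E ω = ξ} *
          ENNReal.ofReal (freeExp q y E (ind A)) := by
        rw [← Finset.sum_mul, hφ.sum_inducedBC hG, one_mul]
    _ ≤ _ := by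
      refine Finset.sum_le_sum fun ξ _ => mul_le_mul_right (ENNReal.ofReal_le_ofReal ?_) _
      rcases lt_or_eq_of_le hp with hp1 | rfl
      · have hx : 0 < p / (1 - p) := div_pos hp0 (by linarith)
        rw [sum_finiteVolumeProb hp1 E ξ fun S => ind A ↑S]
        exact wexp_holley (relWeight_pos hq hy _ _) (relWeight_pos hq hx _ _)
            (fun a _ b _ => weight_mul_le hq (by positivity) (by positivity)
              (pow_mul_pow_le_of_card hy.le (hyp hp1) a b) (relRank_add_le
                (fun v w h => h.elim) a b))
            (fun S T h => ind_mono hA (by exact_mod_cast h))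
      -- The odds are undefined at `p = 1`. There all the mass sits on the fully open configuration;
      -- if it does not satisfy the increasing event, no configuration does.
      · have hnn : ∀ η : E → Bool, 0 ≤ finiteVolumeProb 1 q E ξ η * ind A ↑(openEdges η) := fun η =>
          mul_nonneg (finiteVolumeProb_nonneg hp0.le hp hq E ξ η) (ind_nonneg _ _)
        by_cases hEA : (E : Set G.edgeSet) ∈ A
        · have h1 : freeExp q y E (ind A) ≤ 1 :=
            wexp_le_one (relWeight_pos hq hy _ _) fun S _ => ind_le_one _ _
          refine h1.trans (le_trans (le_of_eq ?_)
            (Finset.single_le_sum (fun η _ => hnn η) (Finset.mem_univ fun _ => true)))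
          have : openEdges (fun _ : E => true) = E := by ext e; simp [mem_openEdges]
          rw [finiteVolumeProb_one hq, this, ind_of_mem hEA, one_mul]
        · refine le_trans (le_of_eq ?_) (Finset.sum_nonneg fun η _ => hnn η)
          rw [freeExp, ← wexp_const E (relWeight_pos hq hy E fun _ _ => False) 0]
          refine wexp_congr fun S hS => ind_of_notMem fun h => hEA (hA ?_ h)
          exact_mod_cast hS

/-- An infinite-volume measure dominates, on increasing local events, the wired measure at any
smaller parameter. -/
theorem IsInfiniteVolume.mu_le_measure {φ : Measure (Config G)} (hφ : IsInfiniteVolume p q φ)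
    (hG : IsLattice G) (hq : 1 ≤ q) (hp0 : 0 < p) (hp : p ≤ 1) (hx : 0 < x) (hxy : x < y)
    (hyp : p < 1 → y ≤ p / (1 - p)) {D : Finset G.edgeSet}
    {A : Set (Set G.edgeSet)} (hA : IsUpperSet A) (hloc : LocalOn ↑D A) :
    ENNReal.ofReal (mu q x A) ≤ φ {ω | openSet ω ∈ A} := by
  have h1 : ∀ ε : ℝ, 0 < ε → ENNReal.ofReal (mu q x A - ε) ≤ φ {ω | openSet ω ∈ A} := by
    intro ε hε
    obtain ⟨E, hDE, hE⟩ := hG.exists_freeExp_ge hq hx hxy hA hloc hε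
    have hlocE : LocalOn ↑E A := fun S T h => hloc S T (by
      have hD : (D : Set G.edgeSet) = ↑E ∩ ↑D :=
        (Set.inter_eq_self_of_subset_right (by exact_mod_cast hDE)).symm
      rw [hD, ← Set.inter_assoc, ← Set.inter_assoc, h])
    exact (ENNReal.ofReal_le_ofReal hE).trans
      (hφ.freeExp_le_measure hG hq hp0 hp (hx.trans hxy) hyp hA hlocE)
  have h2 : Tendsto (fun n : ℕ => ENNReal.ofReal (mu q x A - 1 / ((n : ℝ) + 1))) atTop
      (𝓝 (ENNReal.ofReal (mu q x A))) := by
    refine ENNReal.tendsto_ofReal ?_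
    simpa using (tendsto_one_div_add_atTop_nhds_zero_nat (𝕜 := ℝ)).const_sub (mu q x A)
  exact le_of_tendsto h2 (Eventually.of_forall fun n => h1 _ (by positivity))

end InfiniteVolume

end

section

open Filter Topology

/-! ### From links to crossings between vertices -/

section Crossings

variable {V : Set (ℝ × ℝ)} {G : SimpleGraph V} {p q x y : ℝ} {K : Set (ℝ × ℝ)} {r : ℕ}

/-- Some vertex of `A` is connected to some vertex of `B` by open edges of the subgraph induced by
the vertices in `R`. -/
def linked (G : SimpleGraph V) (R A B : Set (ℝ × ℝ)) : Set (Set G.edgeSet) :=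
  {S | ∃ u v : V, (u : ℝ × ℝ) ∈ A ∧ (v : ℝ × ℝ) ∈ B ∧ Conn (S ∩ edgesIn G R) u v}

theorem isUpperSet_linked (R A B : Set (ℝ × ℝ)) : IsUpperSet (linked G R A B) :=
  fun _ _ h ⟨u, v, hu, hv, hc⟩ => ⟨u, v, hu, hv, hc.mono (Set.inter_subset_inter_left _ h)⟩

theorem localOn_linked {R A B : Set (ℝ × ℝ)} {E : Finset G.edgeSet} (hE : (E : Set _) = edgesIn G R) :
    LocalOn ↑E (linked G R A B) := by
  intro S T h
  rw [hE] at h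
  simp only [linked, Set.mem_ofPred_eq, h]

theorem crossV_eq (a b c d : ℝ) : crossV G a b c d = {ω | openSet ω ∈
    linked G (Set.Icc a b ×ˢ Set.Icc c d) (Set.Icc a b ×ˢ {c}) (Set.Icc a b ×ˢ {d})} := by
  ext ω
  simp only [crossV, linked, Set.mem_ofPred_eq, reachable_openGraph_iff]

theorem crossH_eq (a b c d : ℝ) : crossH G a b c d = {ω | openSet ω ∈
    linked G (Set.Icc a b ×ˢ Set.Icc c d) ({a} ×ˢ Set.Icc c d) ({b} ×ˢ Set.Icc c d)} := by
  ext ω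
  simp only [crossH, linked, Set.mem_ofPred_eq, reachable_openGraph_iff]

theorem isBounded_rect (a b c d : ℝ) : Bornology.IsBounded (Set.Icc a b ×ˢ Set.Icc c d) :=
  (Metric.isBounded_Icc _ _).prod (Metric.isBounded_Icc _ _)

/-- The event that `[0,2n] × [0,n]` is crossed vertically. -/
def vert (G : SimpleGraph V) (n : ℕ) : Set (Set G.edgeSet) :=
  linked G (Set.Icc 0 (2 * (n : ℝ)) ×ˢ Set.Icc 0 (n : ℝ)) (Set.Icc 0 (2 * (n : ℝ)) ×ˢ {0})
    (Set.Icc 0 (2 * (n : ℝ)) ×ˢ {(n : ℝ)})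

theorem IsInfiniteVolume.exists_mu_vert_ge {φ : Measure (Config G)} (hφ : IsInfiniteVolume p q φ)
    (hG : IsLattice G) (hq : 1 ≤ q) (hp0 : 0 < p) (hp : p < 1)
    (h : 0 < liminf (fun n : ℕ => φ (crossV G 0 (2 * (n : ℝ)) 0 (n : ℝ))) atTop) :
    ∃ c : ℝ, ∃ n₀ : ℕ, 0 < c ∧ ∀ n ≥ n₀, c ≤ mu q (p / (1 - p)) (vert G n) := by
  obtain ⟨b, hb0, hb⟩ := exists_between h
  have hev := eventually_lt_of_lt_liminf hb
  obtain ⟨n₀, hn₀⟩ := eventually_atTop.1 hev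
  have := hφ.isProbabilityMeasure
  have hbtop : b ≠ ⊤ := by
    have := (hn₀ n₀ le_rfl).le.trans prob_le_one
    exact ne_top_of_le_ne_top ENNReal.one_ne_top this
  refine ⟨b.toReal, n₀, ENNReal.toReal_pos hb0.ne' hbtop, fun n hn => ?_⟩
  have h1 := (hn₀ n hn).le
  rw [crossV_eq] at h1
  have hfin := hG.finite_edgesIn (isBounded_rect 0 (2 * (n : ℝ)) 0 n)
  have h2 := h1.trans (hφ.measure_le_mu hG hq hp0 hp (isUpperSet_linked _ _ _)
    (localOn_linked (E := hfin.toFinset) (by simp)))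
  have hx : 0 < p / (1 - p) := div_pos hp0 (by linarith)
  exact ENNReal.toReal_le_of_le_ofReal (mu_nonneg hq hx _) h2

/-- If vertical crossings are likely, the one-arm probability decays at most as `1 / n`. -/
theorem IsLattice.exists_le_theta (hG : IsLattice G) (hq : 1 ≤ q) (hx : 0 < x) {c : ℝ} (hc : 0 < c)
    {n₀ : ℕ} (h : ∀ n ≥ n₀, c ≤ mu q x (vert G n)) :
    ∃ c' : ℝ, ∃ n₁ : ℕ, 0 < c' ∧ ∀ n, n₁ ≤ n → c' / n ≤ theta G q n x := by
  obtain ⟨C, hC⟩ := hG.exists_card_unitSquare_le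
  refine ⟨c / (3 * C + 1), n₀ + 1, by positivity, fun n hn => ?_⟩
  have hn1 : (1 : ℝ) ≤ n := by exact_mod_cast (by omega : 1 ≤ n)
  set B : Set V := {v | (v : ℝ × ℝ) ∈ Set.Icc 0 (2 * (n : ℝ)) ×ˢ ({0} : Set ℝ)} with hB
  have hBsub : B ⊆ ⋃ i ∈ Finset.range (2 * n + 1), {v : V | (v : ℝ × ℝ) ∈ unitSquare i 0} := by
    rintro v ⟨⟨h1, h2⟩, h3⟩
    rw [Set.mem_singleton_iff] at h3
    refine Set.mem_biUnion (x := ⌊(v : ℝ × ℝ).1⌋₊) ?_ ⟨⟨?_, ?_⟩, ?_, ?_⟩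
    · rw [Finset.coe_range, Set.mem_Iio, Nat.lt_succ_iff]
      refine Nat.floor_le_of_le ?_
      push_cast; exact h2
    · push_cast; exact Nat.floor_le h1
    · push_cast; exact (Nat.lt_floor_add_one _).le
    · rw [h3]; simp
    · rw [h3]; simp
  have hfin : (⋃ i ∈ Finset.range (2 * n + 1), {v : V | (v : ℝ × ℝ) ∈ unitSquare i 0}).Finite :=
    (Finset.range (2 * n + 1)).finite_toSet.biUnion fun i _ =>
      hG.finite_verts (isBounded_unitSquare _ _)
  have hBfin : B.Finite := hfin.subset hBsub
  have hcard : hBfin.toFinset.card ≤ (2 * n + 1) * C := by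
    rw [← Set.ncard_eq_toFinset_card B hBfin]
    refine (Set.ncard_le_ncard hBsub hfin).trans ((Finset.set_ncard_biUnion_le _ _).trans ?_)
    refine (Finset.sum_le_card_nsmul _ _ C fun i _ => hC (i : ℕ) 0).trans (le_of_eq ?_)
    rw [Finset.card_range, smul_eq_mul]
  -- A vertical crossing is an arm of length `n` from one of the vertices on the bottom side, of
  -- which there are at most a constant times `n`.
  have h1 : mu q x (vert G n) ≤ mu q x (⋃ u ∈ hBfin.toFinset, arm G u n) := by
    refine mu_mono hq hx ?_
    rintro S ⟨u, v, hu, hv, hconn⟩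
    refine Set.mem_iUnion₂.2 ⟨u, by simpa [hB] using hu, v, ?_, hconn.mono Set.inter_subset_left⟩
    refine le_trans ?_ (le_max_right _ _)
    rw [Set.mem_singleton_iff.1 hu.2, Set.mem_singleton_iff.1 hv.2]
    simp
  have h2 := mu_biUnion_le (x := x) hq hx hBfin.toFinset (A := fun u => arm G u n)
    fun u _ => isUpperSet_arm u n
  have h3 : ∑ u ∈ hBfin.toFinset, mu q x (arm G u n) ≤ hBfin.toFinset.card * theta G q n x := by
    rw [← nsmul_eq_mul]
    exact Finset.sum_le_card_nsmul _ _ _ fun u _ => mu_arm_le_theta hq hx n u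
  have h4 : (hBfin.toFinset.card : ℝ) ≤ (2 * n + 1) * C := by exact_mod_cast hcard
  have hθ := theta_nonneg (G := G) hq hx n
  have h5 := h n (by omega)
  have hC0 : (0 : ℝ) ≤ C := Nat.cast_nonneg C
  rw [div_div, div_le_iff₀ (by positivity)]
  calc c ≤ ((2 * n + 1) * C) * theta G q n x :=
        h5.trans (h1.trans (h2.trans (h3.trans (mul_le_mul_of_nonneg_right h4 hθ))))
    _ ≤ theta G q n x * ((3 * C + 1) * n) := by nlinarith [mul_nonneg hC0 hθ]

/-- Combines the lower bound of order `1 / n` at `x` with the dichotomy at the larger parameter `y`.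
-/
theorem IsLattice.exists_theta_ge (hG : IsLattice G) (hq : 1 ≤ q) (hx : 0 < x) (hxy : x < y) {c : ℝ}
    (hc : 0 < c) {n₀ : ℕ} (h : ∀ n ≥ n₀, c ≤ mu q x (vert G n)) :
    ∃ t, 0 < t ∧ ∀ n : ℕ, t ≤ theta G q n y := by
  obtain ⟨c', n₁, hc', hlow⟩ := hG.exists_le_theta hq hx hc h
  obtain ⟨l, -, hl⟩ := hG.exists_length_le
  have := hG.connected.nonempty
  have hy := hx.trans hxy
  refine exists_pos_le_of_exp_step (θ := fun n x => theta G q n x) (c := 1 / (16 * (l + 1) * y))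
    (by positivity) hc' hxy (fun z hz m n hmn => theta_anti hq (hx.trans_le hz) hmn)
    (fun z w hz hzw n => theta_mono hq (hx.trans_le hz) hzw n)
    (fun z hz n => theta_nonneg hq (hx.trans_le hz) n)
    (fun z hz n => theta_le_one hq (hx.trans_le hz) n)
    (fun z hz => theta_zero hq (hx.trans_le hz)) (fun n z w hz hzw hwy hn => ?_) hlow
  have hz0 := hx.trans_le hz
  have hw0 := hz0.trans hzw
  refine (theta_le_exp hG hq hl hz0 hzw n hn).trans (Real.exp_le_exp.2 (neg_le_neg ?_))
  have hs : 1 ≤ ∑ j ∈ Finset.range (n + 1), theta G q j w := by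
    rw [← theta_zero (G := G) hq hw0]
    exact Finset.single_le_sum (f := fun j => theta G q j w) (fun j _ => theta_nonneg hq hw0 j)
      (Finset.mem_range.2 (by omega))
  have e : 1 / (16 * (l + 1) * y) * (w - z) * n / ∑ j ∈ Finset.range (n + 1), theta G q j w =
      (w - z) * n / (16 * (l + 1) * y * ∑ j ∈ Finset.range (n + 1), theta G q j w) := by
    field_simp
  rw [e]
  have : 0 ≤ w - z := by linarith
  gcongr

/-- The drawing contains a vertical crossing of `[0,2m] × [0,m]` between vertices. -/
def VertexCross (V : Set (ℝ × ℝ)) (m : ℕ) (X : Set (ℝ × ℝ)) : Prop :=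
  ∃ u v : V, (u : ℝ × ℝ).2 = 0 ∧ (v : ℝ × ℝ).2 = m ∧
    JoinedIn (X ∩ Set.Icc 0 (2 * (m : ℝ)) ×ˢ Set.Icc 0 (m : ℝ)) (u : ℝ × ℝ) v

theorem vertexCross_mono (m : ℕ) : Monotone (VertexCross V m) :=
  fun _ _ h ⟨u, v, hu, hv, hj⟩ => ⟨u, v, hu, hv, hj.mono (Set.inter_subset_inter_left _ h)⟩

theorem mu_vert_le (hq : 1 ≤ q) (hx : 0 < x) {m : ℕ} (hm : 0 < m) :
    mu q x (vert G m) ≤ pr G q x (VertexCross V m) := by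
  refine mu_mono hq hx ?_
  rintro S ⟨u, v, ⟨-, hu⟩, ⟨-, hv⟩, hc⟩
  rw [Set.mem_singleton_iff] at hu hv
  have hne : u ≠ v := fun h => by
    rw [h, hv] at hu
    exact hm.ne' (by exact_mod_cast hu)
  refine ⟨u, v, hu, hv, (hc.joinedIn (hc.mem_drawing hne)).mono ?_⟩
  intro z hz
  obtain ⟨e, ⟨heS, heR⟩, hze⟩ := mem_drawing.1 hz
  refine ⟨seg_subset_drawing heS hze, ?_⟩
  obtain ⟨a, b, hab, -⟩ := exists_eq_mk e
  rw [seg_eq hab] at hze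
  exact ((convex_Icc _ _).prod (convex_Icc _ _)).segment_subset (heR a (by rw [hab]; simp))
    (heR b (by rw [hab]; simp)) hze

/-- Gluing a crossing that starts at a vertex of the left side to a long crossing. -/
theorem exists_vertex_joinedIn (hswap : IsSym G fun z => (z.2, z.1)) {m n : ℕ} (hm : 2 * m ≤ n)
    {X : Set (ℝ × ℝ)} (h1 : VertexCross V m ((fun z => (z.2, z.1)) '' X))
    (h2 : Cross 0 n 0 m ((fun z => (z.2, z.1)) '' X)) {w w' : ℝ × ℝ} (hw : w.1 = 0)
    (hw' : w'.1 = 2 * n)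
    (h3 : JoinedIn (X ∩ Set.Icc 0 (2 * (n : ℝ)) ×ˢ Set.Icc 0 (n : ℝ)) w w') :
    ∃ u : V, (u : ℝ × ℝ).1 = 0 ∧
      JoinedIn (X ∩ Set.Icc 0 (2 * (n : ℝ)) ×ˢ Set.Icc 0 (n : ℝ)) (u : ℝ × ℝ) w := by
  have hmR : 2 * (m : ℝ) ≤ n := by exact_mod_cast hm
  have hm0 : (0 : ℝ) ≤ m := Nat.cast_nonneg m
  obtain ⟨u, v, hu, hv, hj1⟩ := h1
  obtain ⟨s, s', hs, hs', hj2⟩ := h2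
  obtain ⟨σ, hσ⟩ := hswap.aut
  have i1 := joinedIn_image hswap.cont hj1
  have i2 := joinedIn_image hswap.cont hj2
  -- A vertical crossing of the strip of width `m` meets both the crossing that starts at a vertex
  -- and the long crossing, and so joins the two.
  obtain ⟨z, ⟨-, -⟩, k1, k2⟩ := joinedIn_meet (a := 0) (b := m) (c := 0) (d := n) i1 i2
    (by
      rintro _ ⟨y, ⟨-, ⟨⟨h1, h2⟩, -⟩⟩, rfl⟩
      exact ⟨h1, h2.trans hmR⟩)
    (by
      rintro _ ⟨y, ⟨-, -, h⟩, rfl⟩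
      exact h) hu.le hv.ge hs.le hs'.ge
  obtain ⟨z', ⟨-, -⟩, k3, k4⟩ := joinedIn_meet (a := 0) (b := m) (c := 0) (d := n) h3 i2
    (fun y hy => hy.2.2)
    (by
      rintro _ ⟨y, ⟨-, -, h⟩, rfl⟩
      exact h) hw.le (by rw [hw']; linarith) hs.le hs'.ge
  refine ⟨σ u, by rw [hσ]; exact hu, ?_⟩
  rw [hσ]
  refine (k1.mono ?_).trans ((k2.symm.trans k4).mono ?_ |>.trans k3.symm)
  · rintro _ ⟨_, ⟨⟨y, hy, rfl⟩, ⟨h1, h2⟩, h3, h4⟩, rfl⟩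
    simp only at h1 h2 h3 h4
    exact ⟨hy, ⟨h3, by linarith⟩, h1, by linarith⟩
  · rintro _ ⟨_, ⟨⟨y, hy, rfl⟩, ⟨h1, h2⟩, h3, h4⟩, rfl⟩
    simp only at h1 h2 h3 h4
    exact ⟨hy, ⟨h3, by linarith⟩, h1, h2⟩

/-- The event that the left side of `[0,2n] × [0,n]` is well connected. -/
def Side (V : Set (ℝ × ℝ)) (m n : ℕ) (X : Set (ℝ × ℝ)) : Prop :=
  VertexCross V m ((fun z => (z.2, z.1)) '' X) ∧ Cross 0 n 0 m ((fun z => (z.2, z.1)) '' X)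

theorem side_mono (m n : ℕ) : Monotone (Side V m n) := fun _ _ h hX =>
  ⟨vertexCross_mono _ (Set.image_mono h) hX.1, cross_mono _ _ _ _ (Set.image_mono h) hX.2⟩

/-- A long crossing of the drawing may start in the middle of an edge. The well-connected sides, one
mirrored from the other, extend it to vertices on both sides, and planarity turns the plane path
into a graph path. -/
theorem IsLattice.linked_of_sides (hG : IsLattice G) {m n : ℕ} (hm : 2 * m ≤ n) {S : Set G.edgeSet}
    (h1 : Side V m n (drawing S)) (h2 : Side V m n (mirror (2 * n) '' drawing S))
    (h3 : Cross 0 (2 * n) 0 n (drawing S)) :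
    S ∈ linked G (Set.Icc 0 (2 * (n : ℝ)) ×ˢ Set.Icc 0 (n : ℝ)) ({0} ×ˢ Set.Icc 0 (n : ℝ))
      ({2 * (n : ℝ)} ×ˢ Set.Icc 0 (n : ℝ)) := by
  obtain ⟨w, w', hw, hw', hj⟩ := h3
  have hj' : JoinedIn (drawing S ∩ Set.Icc 0 (2 * (n : ℝ)) ×ˢ Set.Icc 0 (n : ℝ)) w w' :=
    hj.mono fun z hz => ⟨hz.1, hz.2.1, hz.2.2⟩
  obtain ⟨u, hu, hju⟩ := exists_vertex_joinedIn hG.isSym_swap hm h1.1 h1.2 hw hw' hj'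
  have hrect : ∀ z ∈ Set.Icc 0 (2 * (n : ℝ)) ×ˢ Set.Icc 0 (n : ℝ),
      mirror (2 * n) z ∈ Set.Icc 0 (2 * (n : ℝ)) ×ˢ Set.Icc 0 (n : ℝ) := by
    rintro z ⟨⟨h1, h2⟩, h3⟩
    refine ⟨⟨?_, ?_⟩, h3⟩
    · simp only [mirror]; push_cast; linarith
    · simp only [mirror]; push_cast; linarith
  have hjm : JoinedIn (mirror (2 * n) '' drawing S ∩ Set.Icc 0 (2 * (n : ℝ)) ×ˢ Set.Icc 0 (n : ℝ))
      (mirror (2 * n) w') (mirror (2 * n) w) := by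
    refine (joinedIn_image (continuous_mirror (2 * n)) hj'.symm).mono ?_
    rintro _ ⟨z, hz, rfl⟩
    exact ⟨⟨z, hz.1, rfl⟩, hrect z hz.2⟩
  obtain ⟨v, hv, hjv⟩ := exists_vertex_joinedIn hG.isSym_swap hm h2.1 h2.2
    (by simp [mirror, hw']) (by simp [mirror, hw]) hjm
  obtain ⟨τ, hτ⟩ := (hG.isSym_mirror (2 * n)).aut
  have hjv' := joinedIn_image (continuous_mirror (2 * n)) hjv
  rw [mirror_mirror, ← hτ] at hjv'
  have hjv'' : JoinedIn (drawing S ∩ Set.Icc 0 (2 * (n : ℝ)) ×ˢ Set.Icc 0 (n : ℝ))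
      ((τ v : V) : ℝ × ℝ) w' := by
    refine hjv'.mono ?_
    rintro _ ⟨_, ⟨⟨z, hz, rfl⟩, hz2⟩, rfl⟩
    have := hrect _ hz2
    rw [mirror_mirror] at this ⊢
    exact ⟨hz, this⟩
  have hfin := hju.trans (hj'.trans hjv''.symm)
  refine ⟨u, τ v, ⟨hu, hfin.source_mem.2.2⟩, ⟨?_, hfin.target_mem.2.2⟩, hG.conn_of_joinedIn hfin⟩
  rw [Set.mem_singleton_iff, hτ]
  simp [mirror, hv]

theorem IsCore.exists_mu_linked_ge (hK : IsCore G K r) (hG : IsLattice G) (hq : 1 ≤ q) (hx : 0 < x)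
    {k : ℝ × ℝ} (hk : k ∈ K) {T M N₀ n₀ : ℕ} {g c : ℝ} (hrT : r ≤ T) (hT : 0 < T) (hg : 0 < g)
    (hgood : ∀ N ≥ N₀, ∃ j ≤ N, N ≤ j + M ∧ Good G q x k (T * 2 ^ j) g) (hc : 0 < c)
    (hvert : ∀ n ≥ n₀, c ≤ mu q x (vert G n)) :
    ∃ c' : ℝ, ∃ n₁ : ℕ, 0 < c' ∧ ∀ n ≥ n₁, c' ≤ mu q x
      (linked G (Set.Icc 0 (2 * (n : ℝ)) ×ˢ Set.Icc 0 (n : ℝ)) ({0} ×ˢ Set.Icc 0 (n : ℝ))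
        ({2 * (n : ℝ)} ×ˢ Set.Icc 0 (n : ℝ))) := by
  set L : ℕ := 2 * (32 * 2 ^ M) with hL
  set b := g ^ (2 * (L + 1)) with hb
  have hb0 : 0 < b := by positivity
  refine ⟨c * b * (c * b * b), 16 * T * 2 ^ N₀ + 2 * n₀ + 4, by positivity, fun n hn => ?_⟩
  -- The scale `T 2 ^ N` is about `n / 16`, so the good scale `t` satisfies `16 t ≤ n ≤ L t / 2`:
  -- strips of height `6 t` fit into `[0, n / 2]`, while boundedly many links span the length `2 n`.
  obtain ⟨N, hN1, hN2⟩ : ∃ N, 16 * T * 2 ^ N ≤ n ∧ n < 16 * T * 2 ^ (N + 1) := by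
    have hpos : 0 < n / (16 * T) := by
      refine Nat.div_pos ?_ (by positivity)
      have : 1 ≤ 2 ^ N₀ := Nat.one_le_two_pow
      nlinarith
    refine ⟨Nat.log 2 (n / (16 * T)), ?_, ?_⟩
    · have h1 := Nat.pow_log_le_self 2 hpos.ne'
      rw [Nat.le_div_iff_mul_le (by positivity)] at h1
      linarith
    · have h1 := Nat.lt_pow_succ_log_self (b := 2) (by norm_num) (n / (16 * T))
      rw [Nat.div_lt_iff_lt_mul (by positivity), mul_comm] at h1
      exact h1
  have hNN : N₀ ≤ N := by
    by_contra! hlt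
    have h1 : 2 ^ (N + 1) ≤ 2 ^ N₀ := Nat.pow_le_pow_right (by norm_num) hlt
    have h2 : 16 * T * 2 ^ (N + 1) ≤ 16 * T * 2 ^ N₀ := Nat.mul_le_mul_left _ h1
    omega
  obtain ⟨j, hjN, hNj, hj⟩ := hgood N hNN
  set t := T * 2 ^ j with ht
  have ht1 : 16 * t ≤ n := by
    have : 2 ^ j ≤ 2 ^ N := Nat.pow_le_pow_right (by norm_num) hjN
    calc 16 * t = 16 * T * 2 ^ j := by rw [ht]; ring
      _ ≤ 16 * T * 2 ^ N := Nat.mul_le_mul_left _ this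
      _ ≤ n := hN1
  have ht2 : 2 * n ≤ L * t := by
    have : 2 ^ (N + 1) ≤ 2 ^ (j + M + 1) := Nat.pow_le_pow_right (by norm_num) (by omega)
    have h2 : 16 * T * 2 ^ (N + 1) ≤ 16 * T * 2 ^ (j + M + 1) := Nat.mul_le_mul_left _ this
    have h3 : L * t = 2 * (16 * T * 2 ^ (j + M + 1)) := by
      rw [hL, ht, pow_add, pow_add]; ring
    omega
  have htr : r ≤ t := hrT.trans (Nat.le_mul_of_pos_right _ (by positivity))
  have ht1R : 16 * (t : ℝ) ≤ n := by exact_mod_cast ht1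
  have ht2R : 2 * (n : ℝ) ≤ L * t := by exact_mod_cast ht2
  have ht0 : (0 : ℝ) ≤ t := Nat.cast_nonneg t
  have hn0 : (0 : ℝ) ≤ n := Nat.cast_nonneg n
  have hLt : -((L : ℝ) * t) ≤ 0 := by
    have : (0 : ℝ) ≤ L * t := by positivity
    linarith
  set m := n / 2 with hm
  have h6 : 6 * (t : ℝ) ≤ m := by
    have : 6 * t ≤ m := by omega
    exact_mod_cast this
  have c1 : b ≤ pr G q x (Cross 0 n 0 m) := hK.pr_cross_ge hG hq hx hk htr hg.le hj L (3 * t) hn0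
    hLt (by linarith) (by push_cast; linarith) (by push_cast; linarith)
  have c2 : b ≤ pr G q x (Cross 0 (2 * n) 0 n) := hK.pr_cross_ge hG hq hx hk htr hg.le hj L (3 * t)
    (by linarith) hLt (by linarith) (by push_cast; linarith) (by push_cast; linarith)
  have c3 : c ≤ pr G q x (VertexCross V m) := (hvert m (by omega)).trans
    (mu_vert_le hq hx (by omega))
  have hs : c * b ≤ pr G q x (Side V m n) := by
    refine pr_and_ge hq hx (monotone_image (vertexCross_mono m) _)
      (monotone_image (cross_mono 0 n 0 m) _) hc.le hb0.le ?_ ?_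
    · rw [pr_image hG.isSym_swap (VertexCross V m)]; exact c3
    · rw [pr_image hG.isSym_swap (Cross 0 n 0 m)]; exact c1
  have hs' : c * b ≤ pr G q x (fun X => Side V m n (mirror (2 * n) '' X)) := by
    rw [pr_image (hG.isSym_mirror (2 * n)) (Side V m n)]; exact hs
  have hsm := side_mono (V := V) m n
  have hsm' := monotone_image hsm (mirror (2 * n))
  have hcm := cross_mono 0 (2 * n) 0 n
  have f1 := pr_and_ge hq hx hsm' hcm (by positivity) hb0.le hs' c2
  have f2 := pr_and_ge hq hx hsm (fun _ _ h hX => ⟨hsm' h hX.1, hcm h hX.2⟩) (by positivity)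
    (by positivity) hs f1
  refine f2.trans (mu_mono hq hx ?_)
  rintro S ⟨g1, g2, g3⟩
  exact hG.linked_of_sides (by omega) g1 g2 g3

end Crossings

end

end RandomCluster

end

theorem proposition4p1 {V : Set (ℝ × ℝ)} (G : SimpleGraph V) (hG : RandomCluster.IsLattice G)
    (q : ℝ) (hq : 1 ≤ q) (p : ℝ) (hp : p ∈ Set.Ioo (0 : ℝ) 1)
    (hcross : ∃ φ : MeasureTheory.Measure (RandomCluster.Config G),
      RandomCluster.IsInfiniteVolume p q φ ∧
        0 < Filter.liminf
          (fun n : ℕ => φ (RandomCluster.crossV G 0 (2 * (n : ℝ)) 0 (n : ℝ))) Filter.atTop)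
    (p₀ : ℝ) (hp₀ : p < p₀) (hp₀' : p₀ ≤ 1)
    (φ₀ : MeasureTheory.Measure (RandomCluster.Config G))
    (hφ₀ : RandomCluster.IsInfiniteVolume p₀ q φ₀) :
    0 < Filter.liminf
      (fun n : ℕ => φ₀ (RandomCluster.crossH G 0 (2 * (n : ℝ)) 0 (n : ℝ))) Filter.atTop := by
  obtain ⟨φ, hφ, hlim⟩ := hcross
  obtain ⟨hp0, hp1⟩ := hp
  have hx : 0 < p / (1 - p) := div_pos hp0 (by linarith)
  obtain ⟨y, hxy, hy⟩ : ∃ y, p / (1 - p) < y ∧ (p₀ < 1 → y ≤ p₀ / (1 - p₀)) := by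
    rcases lt_or_eq_of_le hp₀' with h | h
    · refine ⟨p₀ / (1 - p₀), ?_, fun _ => le_rfl⟩
      rw [div_lt_div_iff₀ (by linarith) (by linarith)]
      nlinarith
    · exact ⟨p / (1 - p) + 1, by linarith, fun h' => absurd h h'.ne⟩
  -- The three gaps serve sharpness (`x` to `x₁`), sprinkling of annuli (`x₁` to `x₂`) and the
  -- passage from wired to free measures (`x₂` to `y`).
  obtain ⟨x₁, h01, h1y⟩ := exists_between hxy
  obtain ⟨x₂, h12, h2y⟩ := exists_between h1y
  have hx₁ := hx.trans h01
  have hx₂ := hx₁.trans h12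
  obtain ⟨c, n₀, hc, hvert⟩ := hφ.exists_mu_vert_ge hG hq hp0 hp1 hlim
  obtain ⟨θ, hθ, harm⟩ := hG.exists_theta_ge hq hx h01 hc hvert
  obtain ⟨K, r, hK⟩ := hG.exists_core
  obtain ⟨k, hk⟩ := hK.nonempty
  obtain ⟨a, ha, hfoot⟩ := hK.exists_foot_ge hG hq hx₁ hθ harm
  obtain ⟨T, g, M, N₀, hrT, hT, hg, hgood⟩ := hK.exists_good hG hq hx₁ h12 hk ha hfoot
  obtain ⟨c', n₁, hc', hlink⟩ := hK.exists_mu_linked_ge hG hq hx₂ hk hrT hT hg hgood hc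
    fun n hn => (hvert n hn).trans
      (RandomCluster.mu_mono_param hq hx (h01.trans h12).le (RandomCluster.isUpperSet_linked _ _ _))
  refine lt_of_lt_of_le (ENNReal.ofReal_pos.2 hc') (Filter.le_liminf_of_le (by isBoundedDefault) ?_)
  filter_upwards [Filter.eventually_ge_atTop n₁] with n hn
  rw [RandomCluster.crossH_eq]
  have hfin := hG.finite_edgesIn (RandomCluster.isBounded_rect 0 (2 * (n : ℝ)) 0 n)
  exact (ENNReal.ofReal_le_ofReal (hlink n hn)).trans
    (hφ₀.mu_le_measure hG hq (hp0.trans hp₀) hp₀' hx₂ h2y hy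
      (RandomCluster.isUpperSet_linked _ _ _)
      (RandomCluster.localOn_linked (E := hfin.toFinset) (by simp)))
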